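/- Let $k$ be a field of characteristic zero and $S$ a reductive affine algebraic group over $k$ (every finite dimensional representation is completely reducible) which is split (every irreducible representation is absolutely irreducible). Let $\mathcal O$ be its coordinate ring, a Hopf algebra with comultiplication $\Delta$ and counit $u$; for a right comodule $(M,\Delta^r_M)$ and a left comodule $(N,\Delta^l_N)$ put $M\otimes_{\mathcal O}N=\ker(\Delta^r_M\otimes 1-1\otimes\Delta^l_N: M\otimes_k N\to M\otimes_k\mathcal O\otimes_k N)$. **Relative DGAs.** A relative DGA $A$ over $\mathcal O$ is a complex $(A^\bullet,d)$ of $k$-vector spaces with commuting left and right coactions $\Delta^l:A\to\mathcal O\otimes A$, $\Delta^r:A\to A\otimes\mathcal O$ by chain maps, a bicomodule chain map $i:\mathcal O\to A$ ($\mathcal O$ in degree $0$ with zero differential), and an associative multiplication $\mu:A\otimes_{\mathcal O}A\to A$ that is a chain map of bicomodules and has $i$ as two-sided unit: $\mu(i\otimes1)\Delta^l=1_A=\mu(1\otimes i)\Delta^r$. It is *rigid* if $A^n=0$ for $n<0$, $i:\mathcal O\to A^0$ is an isomorphism and $d$ vanishes on $A^0$. A homomorphism of relative DGAs over $\mathcal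 O$ is a $k$-linear map preserving all this structure. **Relative augmentations.** Write $\mathcal O=\bigoplus_\alpha V^\alpha\otimes(V^\alpha)^\vee$ over the irreducible representations of $S$. Let $E=\bigoplus_{\alpha,\beta}V^\alpha\otimes \mathrm{Hom}_k(V^\alpha,V^\beta)\otimes(V^\beta)^\vee\cong\mathcal O\otimes\mathcal O$, in degree $0$, with the multiplication $E\otimes_{\mathcal O}E\to E$ given by $x\otimes y\mapsto y\circ x$ on $\mathrm{Hom}_k(V^\alpha,V^\beta)\otimes \mathrm{Hom}_k(V^\beta,V^\gamma)$ and the unit $\Delta:\mathcal O\to\mathcal O\otimes\mathcal O\cong E$, which corresponds to the identities of the $V^\alpha$. A relative augmentation of $A$ is a chain map of bicomodules $\varepsilon:A\to E$ that is compatible with the multiplications and the units. It induces $\varepsilon^l=(1\otimes u)\varepsilon$ and $\varepsilon^r=(u\otimes1)\varepsilon: A\to\mathcal O$. **Bar complex.** Let $\mathrm{Bar}_0=\mathcal O$ and $\mathrm{Bar}_n=A\otimes_{\mathcal O}\cdots\otimes_{\mathcal O}A$ ($n$ factors), with the differential of a tensor product of complexes as inner differential $\delta$, and with the outer differential $\partial:\mathrm{Bar}_n\to\mathrm{Bar}_{n-1}$,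 $$\partial(x_1\otimes\cdots\otimes x_n)=\varepsilon^r(x_1)\otimes x_2\otimes\cdots\otimes x_n+\sum_{i=1}^{n-1}(-1)^ix_1\otimes\cdots\otimes x_ix_{i+1}\otimes\cdots\otimes x_n+(-1)^nx_1\otimes\cdots\otimes x_{n-1}\otimes\varepsilon^l(x_n),$$ where $\mathcal O\otimes_{\mathcal O}M=M=M\otimes_{\mathcal O}\mathcal O$. Then $\mathrm{Bar}(A/\mathcal O,\varepsilon)$ is the associated simple complex: elements of $\mathrm{Bar}_n$ of inner degree $p$ have degree $p-n$, and the differential on them is $\delta+(-1)^p\partial$. It carries the comultiplication $$x_1\otimes\cdots\otimes x_n\mapsto\Delta^l(x_1)\otimes x_2\otimes\cdots\otimes x_n+\sum_{0<i<n}(-1)^{iq_i}[x_1\otimes\cdots\otimes x_i]\otimes[x_{i+1}\otimes\cdots\otimes x_n]+x_1\otimes\cdots\otimes x_{n-1}\otimes\Delta^r(x_n)$$ for $n\geq1$ ($q_i$ is the inner degree of $x_{i+1}\otimes\cdots\otimes x_n$) and $\Delta$ on $\mathrm{Bar}_0$, and the counit that is $u$ on $\mathrm{Bar}_0$ and zero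 on $\mathrm{Bar}_n$, $n\ge1$. Through the Künneth isomorphism $H^0(\mathrm{Bar}\otimes\mathrm{Bar})=\bigoplus_iH^i(\mathrm{Bar})\otimes H^{-i}(\mathrm{Bar})$ and the projection to the summand $i=0$ they induce a comultiplication and a counit on $H^0(\mathrm{Bar}(A/\mathcal O,\varepsilon))$. **Integrable connections.** For finite dimensional left $\mathcal O$-comodules $V,W$ let $\underline{\mathrm{Hom}}^n(V,W)=\mathrm{Hom}_{\mathcal O}(V,A^n\otimes_{\mathcal O}W)$ (left comodule homomorphisms), with differential $\partial f=(d\otimes1)f$ and composition $g\circ f=(-1)^{pq}(\mu\otimes1)(1\otimes g)f$ for $g$ of degree $p$ and $f$ of degree $q$. An object of the category $IC(A/\mathcal O)$ of integrable $(A/\mathcal O)$-connections is a finite family $(V^i)_{i\in\mathbb Z}$ of finite dimensional left $\mathcal O$-comodules (all put in degree zero) with $\nabla_{ji}\in\underline{\mathrm{Hom}}^1(V^i,V^j)$ for $i<j$ such that $\partial\nabla_{ki}+\sum_{i<j<k}\nabla_{kj}\circ\nabla_{ji}=0$ for all $i<k$. Its morphisms from $(V^i,\nabla^V)$ to $(W^j,\nabla^W)$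 are the elements of $H^0$ of the complex $\bigoplus_{i,j}\underline{\mathrm{Hom}}^\bullet(V^i,W^j)$ with differential $f\mapsto\partial f+\nabla^W\circ f-(-1)^{\deg f}f\circ\nabla^V$. **Proposition.** Let $A$ be a relative DGA over $\mathcal O$ and $\varepsilon$ a relative augmentation of $A$. Suppose that $A$ has a rigid sub-DGA quasi-isomorphic to it, that is, there are a rigid relative DGA $A_{rig}$ over $\mathcal O$ and an injective homomorphism $A_{rig}\to A$ of relative DGAs over $\mathcal O$ that is a quasi-isomorphism. Then $H^0(\mathrm{Bar}(A/\mathcal O,\varepsilon))$, with the induced comultiplication and counit, is a coalgebra, and the category $IC(A/\mathcal O)$ is equivalent to the category of finite dimensional left $H^0(\mathrm{Bar}(A/\mathcal O,\varepsilon))$-comodules. -/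

import Mathlib

open TensorProduct

universe u

noncomputable section

namespace RelativeDGA

section Comodules

/-- `ρ : M → C ⊗ M` is a coassociative and counitary left coaction of the coalgebra `C`. -/
structure IsLeftCoaction {k C M : Type u} [Field k] [AddCommGroup C] [Module k C]
    [Coalgebra k C] [AddCommGroup M] [Module k M] (ρ : M →ₗ[k] C ⊗[k] M) : Prop where
  coassoc : (TensorProduct.assoc k C C M).toLinearMap ∘ₗ
      LinearMap.rTensor M (Coalgebra.comul (R := k) (A := C)) ∘ₗ ρ = LinearMap.lTensor C ρ ∘ₗ ρ
  counit : (TensorProduct.lid k M).toLinearMap ∘ₗ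
      LinearMap.rTensor M (Coalgebra.counit (R := k) (A := C)) ∘ₗ ρ = LinearMap.id

/-- `ρ : M → M ⊗ C` is a coassociative and counitary right coaction of the coalgebra `C`. -/
structure IsRightCoaction {k C M : Type u} [Field k] [AddCommGroup C] [Module k C]
    [Coalgebra k C] [AddCommGroup M] [Module k M] (ρ : M →ₗ[k] M ⊗[k] C) : Prop where
  coassoc : (TensorProduct.assoc k M C C).toLinearMap ∘ₗ LinearMap.rTensor C ρ ∘ₗ ρ =
      LinearMap.lTensor M (Coalgebra.comul (R := k) (A := C)) ∘ₗ ρ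
  counit : (TensorProduct.rid k M).toLinearMap ∘ₗ
      LinearMap.lTensor M (Coalgebra.counit (R := k) (A := C)) ∘ₗ ρ = LinearMap.id

/-- Finite dimensional left comodules over a coalgebra `C`. -/
structure FDComod (k C : Type u) [Field k] [AddCommGroup C] [Module k C] [Coalgebra k C] where
  carrier : Type u
  [grp : AddCommGroup carrier]
  [mod : Module k carrier]
  [fin : FiniteDimensional k carrier]
  coact : carrier →ₗ[k] C ⊗[k] carrier
  isCoaction : IsLeftCoaction coact

attribute [instance] FDComod.grp FDComod.mod FDComod.fin

instance FDComod.coeSort {k C : Type u} [Field k] [AddCommGroup C] [Module k C]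
    [Coalgebra k C] : CoeSort (FDComod k C) (Type u) := ⟨FDComod.carrier⟩

/-- Homomorphisms of left comodules. -/
@[ext]
structure FDComod.Hom {k C : Type u} [Field k] [AddCommGroup C] [Module k C] [Coalgebra k C]
    (V W : FDComod k C) where
  toLin : V →ₗ[k] W
  colinear : W.coact ∘ₗ toLin = LinearMap.lTensor C toLin ∘ₗ V.coact

/-- The category of finite dimensional left `C`-comodules. -/
instance FDComod.category {k C : Type u} [Field k] [AddCommGroup C] [Module k C]
    [Coalgebra k C] : CategoryTheory.Category (FDComod k C) where
  Hom := FDComod.Hom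
  id V := ⟨LinearMap.id, by simp⟩
  comp f g := ⟨g.toLin ∘ₗ f.toLin, by
    rw [← LinearMap.comp_assoc, g.colinear, LinearMap.comp_assoc, f.colinear,
      LinearMap.lTensor_comp, LinearMap.comp_assoc]⟩

/-- The span of all `x ⊗ y` with `x ∈ P`, `y ∈ Q`, that is, `P ⊗ Q` as a subspace of `M ⊗ N`. -/
def subTensor {k M N : Type u} [Field k] [AddCommGroup M] [Module k M] [AddCommGroup N]
    [Module k N] (P : Submodule k M) (Q : Submodule k N) : Submodule k (M ⊗[k] N) :=
  Submodule.map₂ (TensorProduct.mk k M N) P Q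

/-- `U` is a subcomodule of `V`. -/
def FDComod.IsSubcomodule {k C : Type u} [Field k] [AddCommGroup C] [Module k C] [Coalgebra k C]
    (V : FDComod k C) (U : Submodule k V) : Prop :=
  ∀ v ∈ U, V.coact v ∈ subTensor ⊤ U

/-- `V` is an irreducible comodule. -/
def FDComod.IsIrreducible {k C : Type u} [Field k] [AddCommGroup C] [Module k C] [Coalgebra k C]
    (V : FDComod k C) : Prop :=
  Nontrivial V ∧ ∀ U : Submodule k V, V.IsSubcomodule U → U = ⊥ ∨ U = ⊤

/-- `V` is absolutely irreducible: for every field extension `K` of `k` the comodule `K ⊗ V` over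
`K ⊗ C` is irreducible.  The coaction of `K ⊗ C` on `K ⊗ V` is
`K ⊗ V → K ⊗ (C ⊗ V) = C ⊗ (K ⊗ V) = (K ⊗ C) ⊗_K (K ⊗ V)`. -/
def FDComod.IsAbsolutelyIrreducible {k C : Type u} [Field k] [AddCommGroup C] [Module k C]
    [Coalgebra k C] (V : FDComod k C) : Prop :=
  Nontrivial V ∧ ∀ (K : Type u) [Field K] [Algebra k K] (U : Submodule K (K ⊗[k] V)),
    (∀ v ∈ U, TensorProduct.leftComm k K C V (LinearMap.lTensor K V.coact v) ∈
      subTensor ⊤ (U.restrictScalars k)) → U = ⊥ ∨ U = ⊤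

/-- The affine algebraic group `S = Spec O` over the field `k` of characteristic zero is reductive:
every finite dimensional algebraic representation, i.e. `O`-comodule, is completely reducible. -/
def IsReductive (k O : Type u) [Field k] [CommRing O] [HopfAlgebra k O] : Prop :=
  ∀ (V : FDComod k O) (U : Submodule k V), V.IsSubcomodule U →
    ∃ U' : Submodule k V, V.IsSubcomodule U' ∧ IsCompl U U'

/-- `S = Spec O` is split: every irreducible representation is absolutely irreducible. -/
def IsSplit (k O : Type u) [Field k] [CommRing O] [HopfAlgebra k O] : Prop :=
  ∀ V : FDComod k O, V.IsIrreducible → V.IsAbsolutelyIrreducible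

end Comodules

section Cotensor

variable {k C M N : Type u} [Field k] [AddCommGroup C] [Module k C] [AddCommGroup M]
  [Module k M] [AddCommGroup N] [Module k N]

/-- The coaction on `M ⊗ N` through the left coaction on `M`. -/
def coactLeft (lam : M →ₗ[k] C ⊗[k] M) (N : Type u) [AddCommGroup N] [Module k N] :
    M ⊗[k] N →ₗ[k] C ⊗[k] (M ⊗[k] N) :=
  (TensorProduct.assoc k C M N).toLinearMap ∘ₗ LinearMap.rTensor N lam

/-- The right coaction on `M` as a map `M ⊗ N → M ⊗ C ⊗ N`. -/
def coactMid (ρ : M →ₗ[k] M ⊗[k] C) (N : Type u) [AddCommGroup N] [Module k N] :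
    M ⊗[k] N →ₗ[k] M ⊗[k] (C ⊗[k] N) :=
  (TensorProduct.assoc k M C N).toLinearMap ∘ₗ LinearMap.rTensor N ρ

/-- The cotensor product of a right comodule `M` and a left comodule `N`, the kernel of
`ρ ⊗ 1 - 1 ⊗ lam : M ⊗ N → M ⊗ C ⊗ N`. -/
def cotensor (ρ : M →ₗ[k] M ⊗[k] C) (lam : N →ₗ[k] C ⊗[k] N) : Submodule k (M ⊗[k] N) :=
  LinearMap.ker (coactMid ρ N - LinearMap.lTensor M lam)

/-- A linear extension to `M ⊗ N` of a map defined on a subspace.  It will only be evaluated on the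
subspace. -/
def extend {P : Submodule k M} (f : P →ₗ[k] N) : M →ₗ[k] N :=
  (LinearMap.exists_extend f).choose

theorem extend_apply {P : Submodule k M} (f : P →ₗ[k] N) (x : P) : extend f x = f x :=
  LinearMap.congr_fun (LinearMap.exists_extend f).choose_spec x

/-- The operator `x ↦ (-1) ^ n x` for `x` of degree `n`. -/
def signOp (deg : ℤ → Submodule k M) (h : DirectSum.IsInternal deg) : M →ₗ[k] M :=
  DirectSum.toModule k ℤ M (fun n => ((n.negOnePow : ℤˣ) : ℤ) • (deg n).subtype) ∘ₗ
    (LinearEquiv.ofBijective (DirectSum.coeLinearMap deg) h).symm.toLinearMap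

theorem signOp_apply (deg : ℤ → Submodule k M) (h : DirectSum.IsInternal deg) (n : ℤ) (x : M)
    (hx : x ∈ deg n) : signOp deg h x = ((n.negOnePow : ℤˣ) : ℤ) • x := by
  have : (LinearEquiv.ofBijective (DirectSum.coeLinearMap deg) h).symm x =
      DirectSum.lof k ℤ (fun i => deg i) n ⟨x, hx⟩ := by
    rw [LinearEquiv.symm_apply_eq]
    exact (DirectSum.coeLinearMap_lof deg n ⟨x, hx⟩).symm
  simp [signOp, this]

end Cotensor

section RelDGA

/-- Complexes of bi-comodules over the coalgebra `O`. The complex is given by its total space, the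
subspaces `deg n` of homogeneous elements, and the differential. -/
structure DGBicomod (k O : Type u) [Field k] [AddCommGroup O] [Module k O] [Coalgebra k O] where
  carrier : Type u
  [grp : AddCommGroup carrier]
  [mod : Module k carrier]
  deg : ℤ → Submodule k carrier
  internal : DirectSum.IsInternal deg
  d : carrier →ₗ[k] carrier
  d_deg : ∀ n, ∀ x ∈ deg n, d x ∈ deg (n + 1)
  d_d : d ∘ₗ d = 0
  coactL : carrier →ₗ[k] O ⊗[k] carrier
  coactR : carrier →ₗ[k] carrier ⊗[k] O
  coactL_isCoaction : IsLeftCoaction coactL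
  coactR_isCoaction : IsRightCoaction coactR
  coact_comm : (TensorProduct.assoc k O carrier O).toLinearMap ∘ₗ
    LinearMap.rTensor O coactL ∘ₗ coactR = LinearMap.lTensor O coactR ∘ₗ coactL
  coactL_deg : ∀ n, ∀ x ∈ deg n, coactL x ∈ subTensor ⊤ (deg n)
  coactR_deg : ∀ n, ∀ x ∈ deg n, coactR x ∈ subTensor (deg n) ⊤
  coactL_d : coactL ∘ₗ d = LinearMap.lTensor O d ∘ₗ coactL
  coactR_d : coactR ∘ₗ d = LinearMap.rTensor O d ∘ₗ coactR

attribute [instance] DGBicomod.grp DGBicomod.mod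

instance DGBicomod.coeSort {k O : Type u} [Field k] [AddCommGroup O] [Module k O]
    [Coalgebra k O] : CoeSort (DGBicomod k O) (Type u) := ⟨DGBicomod.carrier⟩

/-- `m ⊗ 1 : A ⊗ A ⊗ Y → A ⊗ Y`. -/
def mulTensor {k A : Type u} [Field k] [AddCommGroup A] [Module k A] (m : A ⊗[k] A →ₗ[k] A)
    (Y : Type u) [AddCommGroup Y] [Module k Y] : A ⊗[k] (A ⊗[k] Y) →ₗ[k] A ⊗[k] Y :=
  LinearMap.rTensor Y m ∘ₗ (TensorProduct.assoc k A A Y).symm.toLinearMap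

/-- Relative DGA's over `O`.  In the axioms the multiplication `mul : A ⊗_O A → A` appears through
`extend mul`, which is evaluated on elements of `A ⊗_O A` only. -/
structure RelDGA (k O : Type u) [Field k] [AddCommGroup O] [Module k O] [Coalgebra k O] extends
    DGBicomod k O where
  unit : O →ₗ[k] carrier
  unit_deg : ∀ x, unit x ∈ deg 0
  unit_d : d ∘ₗ unit = 0
  unit_coactL : coactL ∘ₗ unit = LinearMap.lTensor O unit ∘ₗ Coalgebra.comul
  unit_coactR : coactR ∘ₗ unit = LinearMap.rTensor O unit ∘ₗ Coalgebra.comul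
  mul : cotensor coactR coactL →ₗ[k] carrier
  mul_deg : ∀ p q, ∀ t ∈ cotensor coactR coactL, t ∈ subTensor (deg p) (deg q) →
    extend mul t ∈ deg (p + q)
  mul_d : ∀ t ∈ cotensor coactR coactL, d (extend mul t) =
    extend mul (LinearMap.rTensor carrier d t + TensorProduct.map (signOp deg internal) d t)
  mul_coactL : ∀ t ∈ cotensor coactR coactL, coactL (extend mul t) =
    LinearMap.lTensor O (extend mul) (coactLeft coactL carrier t)
  mul_coactR : ∀ t ∈ cotensor coactR coactL, coactR (extend mul t) =
    LinearMap.rTensor O (extend mul)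
      ((TensorProduct.assoc k carrier carrier O).symm (LinearMap.lTensor carrier coactR t))
  mul_assoc : ∀ t ∈ cotensor coactR (coactLeft coactL carrier),
    LinearMap.lTensor carrier (coactMid coactR carrier - LinearMap.lTensor carrier coactL) t = 0 →
    extend mul (mulTensor (extend mul) carrier t) =
      extend mul (LinearMap.lTensor carrier (extend mul) t)
  unit_mul : extend mul ∘ₗ LinearMap.rTensor carrier unit ∘ₗ coactL = LinearMap.id
  mul_unit : extend mul ∘ₗ LinearMap.lTensor carrier unit ∘ₗ coactR = LinearMap.id

namespace RelDGA

variable {k O : Type u} [Field k] [AddCommGroup O] [Module k O] [Coalgebra k O]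

instance coeSort : CoeSort (RelDGA k O) (Type u) := ⟨fun A => A.carrier⟩

/-- `A ⊗_O A` as a subspace of `A ⊗ A`. -/
def cot (A : RelDGA k O) : Submodule k (A ⊗[k] A) := cotensor A.coactR A.coactL

/-- The multiplication, extended from `A ⊗_O A` to `A ⊗ A` in some way. -/
def m (A : RelDGA k O) : A ⊗[k] A →ₗ[k] A := extend A.mul

/-- The operator `x ↦ (-1) ^ deg x`. -/
def sgn (A : RelDGA k O) : A →ₗ[k] A := signOp A.deg A.internal

/-- Homomorphisms of relative DGA's over `O`. -/
structure Hom (R A : RelDGA k O) where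
  toLin : R →ₗ[k] A
  map_deg : ∀ n, ∀ x ∈ R.deg n, toLin x ∈ A.deg n
  map_d : A.d ∘ₗ toLin = toLin ∘ₗ R.d
  map_coactL : A.coactL ∘ₗ toLin = LinearMap.lTensor O toLin ∘ₗ R.coactL
  map_coactR : A.coactR ∘ₗ toLin = LinearMap.rTensor O toLin ∘ₗ R.coactR
  map_unit : toLin ∘ₗ R.unit = A.unit
  map_mul : ∀ t ∈ R.cot, toLin (R.m t) = A.m (TensorProduct.map toLin toLin t)

/-- A homomorphism is a quasi-isomorphism if it is bijective on cohomology in every degree. -/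
def Hom.IsQuasiIso {R A : RelDGA k O} (j : Hom R A) : Prop :=
  ∀ n : ℤ,
    (∀ x ∈ R.deg n, R.d x = 0 → (∃ y ∈ A.deg (n - 1), A.d y = j.toLin x) →
      ∃ z ∈ R.deg (n - 1), R.d z = x) ∧
    (∀ y ∈ A.deg n, A.d y = 0 → ∃ x ∈ R.deg n, R.d x = 0 ∧
      ∃ z ∈ A.deg (n - 1), A.d z = y - j.toLin x)

/-- Rigid relative DGA's. -/
structure IsRigid (A : RelDGA k O) : Prop where
  neg : ∀ n < 0, A.deg n = ⊥
  unit_injective : Function.Injective A.unit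
  unit_range : LinearMap.range A.unit = A.deg 0
  d_zero : ∀ x ∈ A.deg 0, A.d x = 0

/-- Relative augmentations.  The target `Hom_k(O, O) = Hom_k(O, k) ⊗ O` is written as `O ⊗ O`, by
the isomorphism of the (algebraic) dual `Hom_k(O, k) = ⨁ (V^α)ᵛ ⊗ V^α` with
`O = ⨁ V^α ⊗ (V^α)ᵛ`.  So
`Hom_k(O, O) = O ⊗ O = ⨁ V^α ⊗ Hom_k(V^α, V^β) ⊗ (V^β)ᵛ`, in degree zero, with the
left coaction of the first factor and the right coaction of the second one.  The
multiplication on `(O ⊗ O) ⊗_O (O ⊗ O)` is the composition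
`Hom_k(V^α, V^β) ⊗ Hom_k(V^β, V^γ) → Hom_k(V^α, V^γ)`, `x ⊗ y ↦ y ∘ x`,
that is, it applies the counit of `O` to the two inner factors, and the unit `O → O ⊗ O` is the
comultiplication, corresponding to the identities of the `V^α`. -/
structure Augmentation (A : RelDGA k O) where
  toLin : A →ₗ[k] O ⊗[k] O
  map_deg : ∀ n ≠ 0, ∀ x ∈ A.deg n, toLin x = 0
  map_d : toLin ∘ₗ A.d = 0
  map_coactL : coactLeft Coalgebra.comul O ∘ₗ toLin = LinearMap.lTensor O toLin ∘ₗ A.coactL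
  map_coactR : (TensorProduct.assoc k O O O).symm.toLinearMap ∘ₗ
    LinearMap.lTensor O Coalgebra.comul ∘ₗ toLin = LinearMap.rTensor O toLin ∘ₗ A.coactR
  map_unit : toLin ∘ₗ A.unit = Coalgebra.comul
  map_mul : ∀ t ∈ A.cot, toLin (A.m t) =
    TensorProduct.map
      ((TensorProduct.rid k O).toLinearMap ∘ₗ LinearMap.lTensor O Coalgebra.counit)
      ((TensorProduct.lid k O).toLinearMap ∘ₗ LinearMap.rTensor O Coalgebra.counit)
      (TensorProduct.map toLin toLin t)

namespace Augmentation

variable {A : RelDGA k O}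

/-- The left augmentation `ε^l : A → O`,
`V^α ⊗ A^{αβ} ⊗ (V^β)ᵛ → V^α ⊗ (V^α)ᵛ ⊗ V^β ⊗ (V^β)ᵛ → V^α ⊗ (V^α)ᵛ`. -/
def left (ε : Augmentation A) : A →ₗ[k] O :=
  (TensorProduct.rid k O).toLinearMap ∘ₗ LinearMap.lTensor O Coalgebra.counit ∘ₗ ε.toLin

/-- The right augmentation `ε^r : A → O`. -/
def right (ε : Augmentation A) : A →ₗ[k] O :=
  (TensorProduct.lid k O).toLinearMap ∘ₗ LinearMap.rTensor O Coalgebra.counit ∘ₗ ε.toLin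

end Augmentation

end RelDGA

end RelDGA

section Bar

variable {k O : Type u} [Field k] [AddCommGroup O] [Module k O] [Coalgebra k O]

/-- The space `A ⊗ ⋯ ⊗ A ⊗ O` with `n` factors `A`. -/
def barSp (A : RelDGA k O) : ℕ → ModuleCat.{u} k
  | 0 => ModuleCat.of k O
  | n + 1 => ModuleCat.of k (A ⊗[k] barSp A n)

/-- The left coaction of `O` on `A ⊗ ⋯ ⊗ A ⊗ O`, through the first factor. -/
def barCoact (A : RelDGA k O) : (n : ℕ) → (barSp A n →ₗ[k] O ⊗[k] barSp A n)
  | 0 => (Coalgebra.comul : O →ₗ[k] O ⊗[k] O)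
  | n + 1 => coactLeft A.coactL (barSp A n)

/-- `Bar_n = A ⊗_O ⋯ ⊗_O A` (`n` factors; `Bar_0 = O`), written as `A ⊗_O ⋯ ⊗_O A ⊗_O O` and
regarded as a subspace of `A ⊗ ⋯ ⊗ A ⊗ O`. -/
def barSub (A : RelDGA k O) : (n : ℕ) → Submodule k (barSp A n)
  | 0 => ⊤
  | n + 1 => subTensor ⊤ (barSub A n) ⊓ cotensor A.coactR (barCoact A n)

/-- The elements of inner degree `p` in `A ⊗ ⋯ ⊗ A ⊗ O`; here `O` has degree zero. -/
def barDeg (A : RelDGA k O) : (n : ℕ) → ℤ → Submodule k (barSp A n)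
  | 0, p => if p = 0 then ⊤ else ⊥
  | n + 1, p => ⨆ q : ℤ, subTensor (A.deg q) (barDeg A n (p - q))

/-- The operator `x ↦ (-1) ^ p x` for `x` of inner degree `p`. -/
def barSgn (A : RelDGA k O) : (n : ℕ) → (barSp A n →ₗ[k] barSp A n)
  | 0 => LinearMap.id
  | n + 1 => TensorProduct.map A.sgn (barSgn A n)

/-- The inner differential, that of the tensor product of complexes. -/
def barInner (A : RelDGA k O) : (n : ℕ) → (barSp A n →ₗ[k] barSp A n)
  | 0 => 0
  | n + 1 => LinearMap.rTensor (barSp A n) A.d + TensorProduct.map A.sgn (barInner A n)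

/-- The recursion step of the next definition: `x ⊗ t ↦ -x t - x ⊗ D t`, where `x t` is the
multiplication of `x` with the first factor of `t`. -/
def barOuterStep (A : RelDGA k O) (T : Type u) [AddCommGroup T] [Module k T]
    (D : A ⊗[k] T →ₗ[k] T) : A ⊗[k] (A ⊗[k] T) →ₗ[k] A ⊗[k] T :=
  -mulTensor A.m T - LinearMap.lTensor A D

/-- The part
`∑_{1 ≤ i ≤ n} (-1)^i x_1 ⊗ ⋯ ⊗ x_i x_{i+1} ⊗ ⋯ ⊗ x_{n+1} + (-1)^(n+1) x_1 ⊗ ⋯ ⊗ ε^l(x_{n+1})`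
of the outer differential `Bar_{n+1} → Bar_n`. -/
def barOuterTail (A : RelDGA k O) (ε : A.Augmentation) :
    (n : ℕ) → (barSp A (n + 1) →ₗ[k] barSp A n)
  | 0 => -((TensorProduct.rid k O).toLinearMap ∘ₗ TensorProduct.map ε.left Coalgebra.counit :
      A ⊗[k] O →ₗ[k] O)
  | n + 1 => barOuterStep A (barSp A n) (barOuterTail A ε n)

/-- The part `ε^r(x_1) ⊗ x_2 ⊗ ⋯ ⊗ x_{n+1}` of the outer differential, in
`O ⊗_O Bar_n`, which is identified with `Bar_n` by the counit of `O`. -/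
def barOuterHead (A : RelDGA k O) (ε : A.Augmentation) (n : ℕ) :
    barSp A (n + 1) →ₗ[k] barSp A n :=
  ((TensorProduct.lid k (barSp A n)).toLinearMap ∘ₗ
    LinearMap.rTensor (barSp A n) (Coalgebra.counit ∘ₗ ε.right) :
      A ⊗[k] barSp A n →ₗ[k] barSp A n)

/-- The outer differential `Bar_{n+1} → Bar_n`. -/
def barOuter (A : RelDGA k O) (ε : A.Augmentation) (n : ℕ) :
    barSp A (n + 1) →ₗ[k] barSp A n :=
  barOuterHead A ε n + barOuterTail A ε n

/-- The direct sum of all `A ⊗ ⋯ ⊗ A ⊗ O`, which contains the bar complex. -/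
abbrev BarTot (A : RelDGA k O) : Type u := DirectSum ℕ (fun n => barSp A n)

/-- The inclusion of the `n`-th summand. -/
def barIncl (A : RelDGA k O) (n : ℕ) : barSp A n →ₗ[k] BarTot A :=
  DirectSum.lof k ℕ (fun n => barSp A n) n

/-- The differential of the associate simple complex: `x ↦ δ x + (-1)^p ∂ x` for `x` of
inner degree `p`, with the inner differential `δ` and the outer differential `∂`. -/
def barD (A : RelDGA k O) (ε : A.Augmentation) : BarTot A →ₗ[k] BarTot A :=
  DirectSum.toModule k ℕ (BarTot A) fun n =>
    match n with
    | 0 => barIncl A 0 ∘ₗ barInner A 0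
    | n + 1 => barIncl A (n + 1) ∘ₗ barInner A (n + 1) +
        barIncl A n ∘ₗ barOuter A ε n ∘ₗ barSgn A (n + 1)

/-- The degree `i` part of the relative bar complex `Bar(A/O, ε)`: elements of `Bar_n` of inner
degree `p` have degree `p - n`. -/
def barPart (A : RelDGA k O) (i : ℤ) : Submodule k (BarTot A) :=
  ⨆ n : ℕ, (barSub A n ⊓ barDeg A n (i + n)).map (barIncl A n)

/-- The cocycles of degree `i` of the bar complex. -/
def barZ (A : RelDGA k O) (ε : A.Augmentation) (i : ℤ) : Submodule k (BarTot A) :=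
  barPart A i ⊓ LinearMap.ker (barD A ε)

/-- The coboundaries of degree `i` of the bar complex. -/
def barB (A : RelDGA k O) (ε : A.Augmentation) (i : ℤ) : Submodule k (BarTot A) :=
  (barPart A (i - 1)).map (barD A ε)

/-- `H^0(Bar(A/O, ε))`. -/
abbrev barH0 (A : RelDGA k O) (ε : A.Augmentation) : Type u :=
  barZ A ε 0 ⧸ (barB A ε 0).comap (barZ A ε 0).subtype

/-- The map `x ⊗ y ↦ x ⊗ y`, from `A ⊗ Bar_n` to `Bar_{n+1}`, for all `n`. -/
def barCons (A : RelDGA k O) : A ⊗[k] BarTot A →ₗ[k] BarTot A :=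
  TensorProduct.lift (LinearMap.flip (DirectSum.toModule k ℕ (A →ₗ[k] BarTot A) fun n =>
    LinearMap.flip (LinearMap.compr₂ (TensorProduct.mk k A (barSp A n)) (barIncl A (n + 1)))))

/-- The operator `x ↦ (-1) ^ p x` for `x` of inner degree `p`. -/
def barSgnTot (A : RelDGA k O) : BarTot A →ₗ[k] BarTot A :=
  DirectSum.toModule k ℕ (BarTot A) fun n => barIncl A n ∘ₗ barSgn A n

/-- The recursion step of the next definition:
`x ⊗ t ↦ Δ^l(x) ⊗ t + ∑ ± (x ⊗ t') ⊗ t''` if `D t = ∑ t' ⊗ t''`,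
where the sign is `(-1) ^ q` for `t''` of inner degree `q`. -/
def barComulStep (A : RelDGA k O) (T : Type u) [AddCommGroup T] [Module k T]
    (j : A ⊗[k] T →ₗ[k] BarTot A) (D : T →ₗ[k] BarTot A ⊗[k] BarTot A) :
    A ⊗[k] T →ₗ[k] BarTot A ⊗[k] BarTot A :=
  TensorProduct.map (barIncl A 0 : O →ₗ[k] BarTot A) j ∘ₗ coactLeft A.coactL T +
    TensorProduct.map (barCons A) (barSgnTot A) ∘ₗ
    (TensorProduct.assoc k A (BarTot A) (BarTot A)).symm.toLinearMap ∘ₗ LinearMap.lTensor A D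

/-- The comultiplication
`x_1 ⊗ ⋯ ⊗ x_n ↦ Δ^l(x_1) ⊗ ⋯ ⊗ x_n + ∑_{0<i<n} ± [x_1 ⊗ ⋯ ⊗ x_i] ⊗ [x_{i+1} ⊗ ⋯ ⊗ x_n]
+ x_1 ⊗ ⋯ ⊗ Δ^r(x_n)` on `Bar_n`, by recursion on `n`.  The sign is the one of the isomorphism
`s(K ⊗ L) = s(K) ⊗ s(L)` of associate simple complexes, that is `(-1)^(i q)` with `q` the inner
degree of `x_{i+1} ⊗ ⋯ ⊗ x_n`. -/
def barComulAux (A : RelDGA k O) : (n : ℕ) → (barSp A n →ₗ[k] BarTot A ⊗[k] BarTot A)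
  | 0 => TensorProduct.map (barIncl A 0) (barIncl A 0) ∘ₗ barCoact A 0
  | n + 1 => barComulStep A (barSp A n) (barIncl A (n + 1)) (barComulAux A n)

/-- The comultiplication of the bar complex. -/
def barComul (A : RelDGA k O) : BarTot A →ₗ[k] BarTot A ⊗[k] BarTot A :=
  DirectSum.toModule k ℕ _ (barComulAux A)

/-- The counit of the bar complex, the counit of `O` on `Bar_0 = O`. -/
def barCounit (A : RelDGA k O) : BarTot A →ₗ[k] k :=
  (Coalgebra.counit : O →ₗ[k] k) ∘ₗ DirectSum.component k ℕ (fun n => barSp A n) 0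

/-- The degree zero coboundaries of `Bar ⊗ Bar`. -/
def barBB (A : RelDGA k O) (ε : A.Augmentation) : Submodule k (BarTot A ⊗[k] BarTot A) :=
  Submodule.span k {t | ∃ i : ℤ, ∃ x ∈ barPart A i, ∃ y ∈ barPart A (-1 - i),
    t = barD A ε x ⊗ₜ[k] y + ((i.negOnePow : ℤˣ) : ℤ) • (x ⊗ₜ[k] barD A ε y)}

/-- The coalgebra structure `C` on `H^0(Bar)` is the one induced by the comultiplication and the
counit of `Bar`: under the Künneth isomorphism `H^0(Bar ⊗ Bar) = ⨁ H^i(Bar) ⊗ H^{-i}(Bar)`, the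
comultiplication of the class of `z` is the component in `H^0(Bar) ⊗ H^0(Bar)` of the class
of `Δ z`. -/
def IsInducedCoalgebra (A : RelDGA k O) (ε : A.Augmentation) (C : Coalgebra k (barH0 A ε)) : Prop :=
  ∀ z : barZ A ε 0,
    (∃ w : barZ A ε 0 ⊗[k] barZ A ε 0,
      C.comul (Submodule.Quotient.mk z) = TensorProduct.map (Submodule.mkQ _) (Submodule.mkQ _) w ∧
      barComul A z - TensorProduct.map (barZ A ε 0).subtype (barZ A ε 0).subtype w ∈
        barBB A ε ⊔ ⨆ i : {i : ℤ // i ≠ 0}, subTensor (barZ A ε i) (barZ A ε (-i))) ∧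
    C.counit (Submodule.Quotient.mk z) = barCounit A z

end Bar

section Slices

variable {k C L M N N' Y : Type u} [Field k] [AddCommGroup C] [Module k C] [AddCommGroup L]
  [Module k L] [AddCommGroup M] [Module k M] [AddCommGroup N] [Module k N] [AddCommGroup N']
  [Module k N'] [AddCommGroup Y] [Module k Y]

/-- `1 ⊗ φ : M ⊗ Y → M` for a functional `φ` on `Y`. -/
def slice (M : Type u) [AddCommGroup M] [Module k M] (φ : Y →ₗ[k] k) : M ⊗[k] Y →ₗ[k] M :=
  (TensorProduct.rid k M).toLinearMap ∘ₗ LinearMap.lTensor M φ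

theorem slice_tmul (φ : Y →ₗ[k] k) (x : M) (y : Y) : slice M φ (x ⊗ₜ[k] y) = φ y • x := by
  simp [slice]

theorem slice_sep {x y : M ⊗[k] Y} (h : ∀ φ : Y →ₗ[k] k, slice M φ x = slice M φ y) : x = y := by
  classical
  let b := Module.Basis.ofVectorSpace k Y
  apply (TensorProduct.equivFinsuppOfBasisRight (M := M) b).injective
  ext i
  have key : ∀ z : M ⊗[k] Y, TensorProduct.equivFinsuppOfBasisRight b z i
      = slice M (b.coord i) z := by
    intro z
    induction z with
    | zero => simp
    | tmul a c => simp [slice_tmul]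
    | add a c ha hc => simp [ha, hc]
  rw [key, key, h]

theorem slice_assoc_symm (φ : Y →ₗ[k] k) (x : M ⊗[k] (N ⊗[k] Y)) :
    slice (M ⊗[k] N) φ ((TensorProduct.assoc k M N Y).symm x) =
      LinearMap.lTensor M (slice N φ) x := by
  induction x with
  | zero => simp
  | add a c ha hc => simp [ha, hc]
  | tmul a c =>
    induction c with
    | zero => simp
    | add c c' h h' => simp only [TensorProduct.tmul_add, map_add, h, h']
    | tmul c y => simp [slice_tmul]

theorem slice_sep₂ {x y : M ⊗[k] (N ⊗[k] Y)}
    (h : ∀ φ : Y →ₗ[k] k, LinearMap.lTensor M (slice N φ) x = LinearMap.lTensor M (slice N φ) y) :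
    x = y := by
  apply (TensorProduct.assoc k M N Y).symm.injective
  apply slice_sep
  intro φ
  rw [slice_assoc_symm, slice_assoc_symm, h]

theorem coactLeft_tmul (lam : M →ₗ[k] C ⊗[k] M) (x : M) (y : N) :
    coactLeft lam N (x ⊗ₜ[k] y) =
      LinearMap.lTensor C ((TensorProduct.mk k M N).flip y) (lam x) := by
  simp only [coactLeft, LinearMap.comp_apply, LinearMap.rTensor_tmul]
  generalize lam x = z
  induction z with
  | zero => simp
  | add a c ha hc => simp only [TensorProduct.add_tmul, map_add, ha, hc]
  | tmul a c => simp

theorem coactMid_tmul (ρ : M →ₗ[k] M ⊗[k] C) (x : M) (y : N) :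
    coactMid ρ N (x ⊗ₜ[k] y) =
      LinearMap.lTensor M ((TensorProduct.mk k C N).flip y) (ρ x) := by
  simp only [coactMid, LinearMap.comp_apply, LinearMap.rTensor_tmul]
  generalize ρ x = z
  induction z with
  | zero => simp
  | add a c ha hc => simp only [TensorProduct.add_tmul, map_add, ha, hc]
  | tmul a c => simp

theorem coactLeft_lTensor (lam : M →ₗ[k] C ⊗[k] M) (f : N →ₗ[k] N') (x : M ⊗[k] N) :
    coactLeft lam N' (LinearMap.lTensor M f x) =
      LinearMap.lTensor C (LinearMap.lTensor M f) (coactLeft lam N x) := by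
  induction x with
  | zero => simp
  | add a c ha hc => simp only [map_add, ha, hc]
  | tmul a c =>
    rw [LinearMap.lTensor_tmul, coactLeft_tmul, coactLeft_tmul, ← LinearMap.lTensor_comp_apply]
    congr 2

theorem coactMid_lTensor (ρ : M →ₗ[k] M ⊗[k] C) (f : N →ₗ[k] N') (x : M ⊗[k] N) :
    coactMid ρ N' (LinearMap.lTensor M f x) =
      LinearMap.lTensor M (LinearMap.lTensor C f) (coactMid ρ N x) := by
  induction x with
  | zero => simp
  | add a c ha hc => simp only [map_add, ha, hc]
  | tmul a c =>
    rw [LinearMap.lTensor_tmul, coactMid_tmul, coactMid_tmul, ← LinearMap.lTensor_comp_apply]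
    congr 2

theorem slice_coactLeft (lam : M →ₗ[k] C ⊗[k] M) (φ : Y →ₗ[k] k) (x : M ⊗[k] Y) :
    LinearMap.lTensor C (slice M φ) (coactLeft lam Y x) = lam (slice M φ x) := by
  induction x with
  | zero => simp
  | add a c ha hc => simp only [map_add, ha, hc]
  | tmul a c =>
    have : slice M φ ∘ₗ (TensorProduct.mk k M Y).flip c = φ c • LinearMap.id := by
      ext; simp [slice_tmul]
    rw [coactLeft_tmul, ← LinearMap.lTensor_comp_apply, this, slice_tmul]
    simp

theorem slice_coactMid (ρ : M →ₗ[k] M ⊗[k] C) (φ : Y →ₗ[k] k) (x : M ⊗[k] Y) :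
    LinearMap.lTensor M (slice C φ) (coactMid ρ Y x) = ρ (slice M φ x) := by
  induction x with
  | zero => simp
  | add a c ha hc => simp only [map_add, ha, hc]
  | tmul a c =>
    have : slice C φ ∘ₗ (TensorProduct.mk k C Y).flip c = φ c • LinearMap.id := by
      ext; simp [slice_tmul]
    rw [coactMid_tmul, ← LinearMap.lTensor_comp_apply, this, slice_tmul]
    simp

theorem mem_cotensor {ρ : M →ₗ[k] M ⊗[k] C} {lam : N →ₗ[k] C ⊗[k] N} {x : M ⊗[k] N} :
    x ∈ cotensor ρ lam ↔ coactMid ρ N x = LinearMap.lTensor M lam x := by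
  simp [cotensor, sub_eq_zero]

theorem mem_cotensor_map {ρ : M →ₗ[k] M ⊗[k] C} {lam : N →ₗ[k] C ⊗[k] N}
    {lam' : N' →ₗ[k] C ⊗[k] N'} {f : N →ₗ[k] N'}
    (hf : ∀ y, lam' (f y) = LinearMap.lTensor C f (lam y)) {x : M ⊗[k] N}
    (hx : x ∈ cotensor ρ lam) : LinearMap.lTensor M f x ∈ cotensor ρ lam' := by
  rw [mem_cotensor] at *
  rw [coactMid_lTensor, hx, ← LinearMap.lTensor_comp_apply, ← LinearMap.lTensor_comp_apply]
  congr 2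
  ext y
  simp [hf]

theorem subTensor_map {P : Submodule k M} {Q : Submodule k N} {P' : Submodule k L}
    {Q' : Submodule k N'} {f : M →ₗ[k] L} {g : N →ₗ[k] N'} (hf : ∀ x ∈ P, f x ∈ P')
    (hg : ∀ x ∈ Q, g x ∈ Q') {t : M ⊗[k] N} (ht : t ∈ subTensor P Q) :
    TensorProduct.map f g t ∈ subTensor P' Q' := by
  have : subTensor P Q ≤ (subTensor P' Q').comap (TensorProduct.map f g) := by
    refine Submodule.map₂_le.2 fun x hx y hy => ?_
    exact Submodule.apply_mem_map₂ _ (hf x hx) (hg y hy)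
  exact this ht

theorem slice_mem {P : Submodule k M} {Q : Submodule k Y} {t : M ⊗[k] Y}
    (ht : t ∈ subTensor P Q) (φ : Y →ₗ[k] k) : slice M φ t ∈ P := by
  have : subTensor P Q ≤ P.comap (slice M φ) := by
    refine Submodule.map₂_le.2 fun x hx y hy => ?_
    simpa [slice_tmul] using P.smul_mem _ hx
  exact this ht

theorem mem_subTensor_of_slice {P : Submodule k M} {t : M ⊗[k] Y}
    (h : ∀ φ : Y →ₗ[k] k, slice M φ t ∈ P) : t ∈ subTensor P (⊤ : Submodule k Y) := by
  classical
  let b := Module.Basis.ofVectorSpace k Y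
  have key : ∀ z : M ⊗[k] Y, ∀ i, TensorProduct.equivFinsuppOfBasisRight b z i
      = slice M (b.coord i) z := by
    intro z i
    induction z with
    | zero => simp
    | tmul a c => simp [slice_tmul]
    | add a c ha hc => simp [ha, hc]
  rw [← (TensorProduct.equivFinsuppOfBasisRight (M := M) b).symm_apply_apply t,
    TensorProduct.equivFinsuppOfBasisRight_symm_apply]
  refine Submodule.sum_mem _ fun i _ => Submodule.apply_mem_map₂ _ ?_ trivial
  rw [key]
  exact h _

end Slices

section Connections

variable {k O : Type u} [Field k] [AddCommGroup O] [Module k O] [Coalgebra k O]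

theorem slice_mulTensor {A Y : Type u} [AddCommGroup A] [Module k A] [AddCommGroup Y] [Module k Y]
    (m : A ⊗[k] A →ₗ[k] A) (φ : Y →ₗ[k] k) (T : A ⊗[k] (A ⊗[k] Y)) :
    slice A φ (mulTensor m Y T) = m (LinearMap.lTensor A (slice A φ) T) := by
  induction T with
  | zero => simp
  | add a c ha hc => simp only [map_add, ha, hc]
  | tmul a c =>
    induction c with
    | zero => simp
    | add c c' h h' => simp only [TensorProduct.tmul_add, map_add, h, h']
    | tmul c y => simp [mulTensor, slice_tmul]

theorem mulTensor_lTensor {A X Y : Type u} [AddCommGroup A] [Module k A] [AddCommGroup X]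
    [Module k X] [AddCommGroup Y] [Module k Y] (m : A ⊗[k] A →ₗ[k] A) (f : X →ₗ[k] Y)
    (T : A ⊗[k] (A ⊗[k] X)) : mulTensor m Y (LinearMap.lTensor A (LinearMap.lTensor A f) T) =
      LinearMap.lTensor A f (mulTensor m X T) := by
  induction T with
  | zero => simp
  | add a c ha hc => simp only [map_add, ha, hc]
  | tmul a c =>
    induction c with
    | zero => simp
    | add c c' h h' => simp only [TensorProduct.tmul_add, map_add, h, h']
    | tmul c y => simp [mulTensor]

theorem rTensor_lTensor {M M' N N' : Type u} [AddCommGroup M] [Module k M] [AddCommGroup N]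
    [Module k N] [AddCommGroup M'] [Module k M'] [AddCommGroup N'] [Module k N']
    (f : M →ₗ[k] M') (g : N →ₗ[k] N') (x : M ⊗[k] N) :
    LinearMap.rTensor N' f (LinearMap.lTensor M g x) =
      LinearMap.lTensor M' g (LinearMap.rTensor N f x) := by
  rw [← LinearMap.comp_apply, ← LinearMap.comp_apply, LinearMap.rTensor_comp_lTensor,
    LinearMap.lTensor_comp_rTensor]

theorem slice_rTensor {M N Y : Type u} [AddCommGroup M] [Module k M] [AddCommGroup N]
    [Module k N] [AddCommGroup Y] [Module k Y] (f : M →ₗ[k] N) (φ : Y →ₗ[k] k) (x : M ⊗[k] Y) :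
    slice N φ (LinearMap.rTensor Y f x) = f (slice M φ x) := by
  induction x with
  | zero => simp
  | add a c ha hc => simp only [map_add, ha, hc]
  | tmul a c => simp [slice_tmul]

variable (A : RelDGA k O) (Y : Type u) [AddCommGroup Y] [Module k Y]

theorem slice_mem_cot {T : A ⊗[k] (A ⊗[k] Y)} (hT : T ∈ cotensor A.coactR (coactLeft A.coactL Y))
    (φ : Y →ₗ[k] k) :
    LinearMap.lTensor A (slice A φ) T ∈ cotensor A.coactR A.coactL :=
  mem_cotensor_map (fun y => (slice_coactLeft A.coactL φ y).symm) hT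

theorem mulTensor_coactLeft {T : A ⊗[k] (A ⊗[k] Y)}
    (hT : T ∈ cotensor A.coactR (coactLeft A.coactL Y)) :
    coactLeft A.coactL Y (mulTensor A.m Y T) =
      LinearMap.lTensor O (mulTensor A.m Y) (coactLeft A.coactL (A ⊗[k] Y) T) := by
  apply slice_sep₂
  intro φ
  rw [slice_coactLeft, slice_mulTensor]
  refine (A.mul_coactL _ (slice_mem_cot A Y hT φ)).trans ?_
  rw [coactLeft_lTensor, ← LinearMap.lTensor_comp_apply, ← LinearMap.lTensor_comp_apply]
  congr 2
  refine LinearMap.ext fun z => ?_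
  exact (slice_mulTensor A.m φ z).symm

theorem mulTensor_coactMid {T : A ⊗[k] (A ⊗[k] Y)}
    (hT : T ∈ cotensor A.coactR (coactLeft A.coactL Y)) :
    coactMid A.coactR Y (mulTensor A.m Y T) =
      mulTensor A.m (O ⊗[k] Y) (LinearMap.lTensor A (coactMid A.coactR Y) T) := by
  apply slice_sep₂
  intro φ
  rw [slice_coactMid, slice_mulTensor]
  refine (A.mul_coactR _ (slice_mem_cot A Y hT φ)).trans ?_
  rw [← mulTensor_lTensor, ← LinearMap.lTensor_comp_apply, ← LinearMap.lTensor_comp_apply]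
  have : LinearMap.lTensor A (slice O φ) ∘ₗ coactMid A.coactR Y = A.coactR ∘ₗ slice A φ := by
    refine LinearMap.ext fun z => ?_
    exact slice_coactMid _ _ _
  rw [this]
  rfl

theorem mulTensor_d {T : A ⊗[k] (A ⊗[k] Y)}
    (hT : T ∈ cotensor A.coactR (coactLeft A.coactL Y)) :
    LinearMap.rTensor Y A.d (mulTensor A.m Y T) = mulTensor A.m Y
      (LinearMap.rTensor (A ⊗[k] Y) A.d T +
        TensorProduct.map A.sgn (LinearMap.rTensor Y A.d) T) := by
  apply slice_sep
  intro φ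
  rw [slice_rTensor, slice_mulTensor, slice_mulTensor]
  refine (A.mul_d _ (slice_mem_cot A Y hT φ)).trans ?_
  rw [map_add]
  have h1 : LinearMap.rTensor A.carrier A.d (LinearMap.lTensor A (slice A φ) T) =
      LinearMap.lTensor A (slice A φ) (LinearMap.rTensor (A ⊗[k] Y) A.d T) := by
    exact rTensor_lTensor _ _ _
  have h2 : TensorProduct.map (signOp A.deg A.internal) A.d (LinearMap.lTensor A (slice A φ) T) =
      LinearMap.lTensor A (slice A φ) (TensorProduct.map A.sgn (LinearMap.rTensor Y A.d) T) := by
    have e : slice A φ ∘ₗ LinearMap.rTensor Y A.d = A.d ∘ₗ slice A φ := by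
      refine LinearMap.ext fun z => ?_
      exact slice_rTensor _ _ _
    rw [← LinearMap.comp_apply, ← LinearMap.comp_apply, LinearMap.map_comp_lTensor,
      LinearMap.lTensor_comp_map, e]
    rfl
  rw [h1, h2, map_add (LinearMap.lTensor A (slice A φ))]
  exact (map_add A.m _ _).symm

theorem mulTensor_assoc {T : A ⊗[k] (A ⊗[k] (A ⊗[k] Y))}
    (hT : T ∈ cotensor A.coactR (coactLeft A.coactL (A ⊗[k] Y)))
    (hT' : LinearMap.lTensor A (coactMid A.coactR (A ⊗[k] Y) -
      LinearMap.lTensor A (coactLeft A.coactL Y)) T = 0) :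
    mulTensor A.m Y (mulTensor A.m (A ⊗[k] Y) T) =
      mulTensor A.m Y (LinearMap.lTensor A (mulTensor A.m Y) T) := by
  apply slice_sep
  intro φ
  have h1 : LinearMap.lTensor A (LinearMap.lTensor A (slice A φ)) T ∈
      cotensor A.coactR (coactLeft A.coactL A) :=
    mem_cotensor_map (fun y => coactLeft_lTensor A.coactL (slice A φ) y) hT
  have h2 : LinearMap.lTensor A (coactMid A.coactR A - LinearMap.lTensor A A.coactL)
      (LinearMap.lTensor A (LinearMap.lTensor A (slice A φ)) T) = 0 := by
    have e : (coactMid A.coactR A - LinearMap.lTensor A A.coactL) ∘ₗ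
        LinearMap.lTensor A (slice A φ) = LinearMap.lTensor A (LinearMap.lTensor O (slice A φ)) ∘ₗ
        (coactMid A.coactR (A ⊗[k] Y) - LinearMap.lTensor A (coactLeft A.coactL Y)) := by
      refine LinearMap.ext fun z => ?_
      simp only [LinearMap.comp_apply, LinearMap.sub_apply, map_sub, coactMid_lTensor]
      rw [← LinearMap.lTensor_comp_apply, ← LinearMap.lTensor_comp_apply]
      congr 3
      refine LinearMap.ext fun y => ?_
      exact (slice_coactLeft _ _ _).symm
    have e' := congrArg (fun F => LinearMap.lTensor A F T) e
    simp only [LinearMap.lTensor_comp_apply] at e'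
    rw [e', hT', map_zero]
  have h3 := A.mul_assoc _ h1 h2
  have e1 : mulTensor A.m A (LinearMap.lTensor A (LinearMap.lTensor A (slice A φ)) T) =
    LinearMap.lTensor A (slice A φ) (mulTensor A.m (A ⊗[k] Y) T) := mulTensor_lTensor _ _ _
  rw [slice_mulTensor, slice_mulTensor, ← e1]
  refine h3.trans ?_
  rw [← LinearMap.lTensor_comp_apply, ← LinearMap.lTensor_comp_apply]
  have e2 : slice A φ ∘ₗ mulTensor A.m Y = A.m ∘ₗ LinearMap.lTensor A (slice A φ) := by
    refine LinearMap.ext fun z => ?_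
    exact slice_mulTensor A.m φ z
  rw [e2, LinearMap.lTensor_comp_apply, LinearMap.lTensor_comp_apply]
  rfl

theorem mulTensor_deg {p q : ℤ} {T : A ⊗[k] (A ⊗[k] Y)}
    (hT : T ∈ cotensor A.coactR (coactLeft A.coactL Y))
    (hd : T ∈ subTensor (A.deg p) (subTensor (A.deg q) (⊤ : Submodule k Y))) :
    mulTensor A.m Y T ∈ subTensor (A.deg (p + q)) (⊤ : Submodule k Y) := by
  apply mem_subTensor_of_slice
  intro φ
  rw [slice_mulTensor]
  refine A.mul_deg p q _ (slice_mem_cot A Y hT φ) ?_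
  exact subTensor_map (f := LinearMap.id) (fun _ h => h) (fun _ h => slice_mem h φ) hd

theorem mulTensor_unit_left (x : A ⊗[k] Y) : mulTensor A.m Y
    (LinearMap.rTensor (A ⊗[k] Y) A.unit (coactLeft A.coactL Y x)) = x := by
  apply slice_sep
  intro φ
  rw [slice_mulTensor, ← rTensor_lTensor, slice_coactLeft]
  exact LinearMap.congr_fun A.unit_mul (slice A φ x)

theorem mulTensor_unit_right (x : A ⊗[k] Y) : mulTensor A.m Y
    (LinearMap.lTensor A (LinearMap.rTensor Y A.unit) (coactMid A.coactR Y x)) = x := by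
  apply slice_sep
  intro φ
  have e : slice A φ ∘ₗ LinearMap.rTensor Y A.unit = A.unit ∘ₗ slice O φ := by
    refine LinearMap.ext fun z => ?_
    exact slice_rTensor _ _ _
  rw [slice_mulTensor, ← LinearMap.lTensor_comp_apply, e, LinearMap.lTensor_comp_apply,
    slice_coactMid]
  exact LinearMap.congr_fun A.mul_unit (slice A φ x)

variable {A}

/-- `Hom^n(V, W) = Hom_O(V, A^n ⊗_O W)`, the homomorphisms of degree `n` from `V` to `W` in the
DG category `C(A/O)`, for `O`-comodules `V` and `W` placed in degree zero. -/
def homC (A : RelDGA k O) (n : ℤ) (V W : FDComod k O) : Submodule k (V →ₗ[k] A ⊗[k] W) where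
  carrier := {f | coactLeft A.coactL W ∘ₗ f = LinearMap.lTensor O f ∘ₗ V.coact ∧
    ∀ v, f v ∈ cotensor A.coactR W.coact ∧ f v ∈ subTensor (A.deg n) ⊤}
  add_mem' {f g} hf hg := ⟨by
    rw [LinearMap.comp_add, hf.1, hg.1, LinearMap.lTensor_add, LinearMap.add_comp],
    fun v => ⟨add_mem (hf.2 v).1 (hg.2 v).1, add_mem (hf.2 v).2 (hg.2 v).2⟩⟩
  zero_mem' := ⟨by simp, fun v => ⟨zero_mem _, zero_mem _⟩⟩
  smul_mem' c f hf := ⟨by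
    rw [LinearMap.comp_smul, hf.1, LinearMap.lTensor_smul, LinearMap.smul_comp],
    fun v => ⟨Submodule.smul_mem _ c (hf.2 v).1, Submodule.smul_mem _ c (hf.2 v).2⟩⟩

/-- The composite `V → A ⊗_O W → A ⊗_O A ⊗_O X → A ⊗_O X`. -/
def star {V W X : FDComod k O} (g : W →ₗ[k] A ⊗[k] X) (f : V →ₗ[k] A ⊗[k] W) :
    V →ₗ[k] A ⊗[k] X :=
  mulTensor A.m X ∘ₗ LinearMap.lTensor A g ∘ₗ f

/-- The composite `g ∘ f` in `C(A/O)` of `g` of degree `p` and `f` of degree `q`, which is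
`(μ ⊗ 1) (1 ⊗ g) f`.  The sign is that of `(1 ⊗ g) (a ⊗ w) = (-1)^(p q) a ⊗ g w`
for `a` of degree `q`. -/
def compC {V W X : FDComod k O} (p q : ℤ) (g : W →ₗ[k] A ⊗[k] X) (f : V →ₗ[k] A ⊗[k] W) :
    V →ₗ[k] A ⊗[k] X :=
  (((p * q).negOnePow : ℤˣ) : ℤ) • star g f

/-- The differential `∂` of the complex of homomorphisms in `C(A/O)`. -/
def dC {V W : FDComod k O} (f : V →ₗ[k] A ⊗[k] W) : V →ₗ[k] A ⊗[k] W :=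
  LinearMap.rTensor W A.d ∘ₗ f

/-- The identity `V = O ⊗_O V → A ⊗_O V` in `C(A/O)`. -/
def idC (A : RelDGA k O) (V : FDComod k O) : V →ₗ[k] A ⊗[k] V :=
  LinearMap.rTensor V A.unit ∘ₗ V.coact

section star

variable {U V W X : FDComod k O}

theorem star_add_left (g g' : W →ₗ[k] A ⊗[k] X) (f : V →ₗ[k] A ⊗[k] W) :
    star (g + g') f = star g f + star g' f := by
  ext v; simp [star, LinearMap.lTensor_add]

theorem star_sub_left (g g' : W →ₗ[k] A ⊗[k] X) (f : V →ₗ[k] A ⊗[k] W) :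
    star (g - g') f = star g f - star g' f := by
  ext v; simp [star, LinearMap.lTensor_sub]

theorem star_add_right (g : W →ₗ[k] A ⊗[k] X) (f f' : V →ₗ[k] A ⊗[k] W) :
    star g (f + f') = star g f + star g f' := by
  ext v; simp [star]

theorem star_sub_right (g : W →ₗ[k] A ⊗[k] X) (f f' : V →ₗ[k] A ⊗[k] W) :
    star g (f - f') = star g f - star g f' := by
  ext v; simp [star]

theorem star_zero_left (f : V →ₗ[k] A ⊗[k] W) :
    star (0 : W →ₗ[k] A ⊗[k] X) f = 0 := by
  ext v; simp [star]

theorem star_zero_right (g : W →ₗ[k] A ⊗[k] X) :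
    star g (0 : V →ₗ[k] A ⊗[k] W) = 0 := by
  ext v; simp [star]

theorem lTensor_mem_cotensor {p q : ℤ} {g : W →ₗ[k] A ⊗[k] X} {f : V →ₗ[k] A ⊗[k] W}
    (hg : g ∈ homC A p W X) (hf : f ∈ homC A q V W) (v : V) :
    LinearMap.lTensor A g (f v) ∈ cotensor A.coactR (coactLeft A.coactL X) :=
  mem_cotensor_map (fun y => LinearMap.congr_fun hg.1 y) (hf.2 v).1

theorem star_mem {p q : ℤ} {g : W →ₗ[k] A ⊗[k] X} {f : V →ₗ[k] A ⊗[k] W}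
    (hg : g ∈ homC A p W X) (hf : f ∈ homC A q V W) : star g f ∈ homC A (q + p) V X := by
  refine ⟨?_, fun v => ⟨?_, ?_⟩⟩
  · ext1 v
    have h1 : coactLeft A.coactL X (star g f v) = _ :=
      mulTensor_coactLeft A X (T := LinearMap.lTensor A g (f v)) (lTensor_mem_cotensor hg hf v)
    have h2 : coactLeft A.coactL W (f v) = LinearMap.lTensor O f (V.coact v) :=
      LinearMap.congr_fun hf.1 v
    rw [coactLeft_lTensor, h2, ← LinearMap.lTensor_comp_apply, ← LinearMap.lTensor_comp_apply] at h1
    exact h1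
  · have h1 : coactMid A.coactR X (star g f v) = _ :=
      mulTensor_coactMid A X (T := LinearMap.lTensor A g (f v)) (lTensor_mem_cotensor hg hf v)
    have h2 : coactMid A.coactR X ∘ₗ g = LinearMap.lTensor A X.coact ∘ₗ g := by
      refine LinearMap.ext fun w => ?_
      exact mem_cotensor.1 (hg.2 w).1
    rw [← LinearMap.lTensor_comp_apply, h2, LinearMap.lTensor_comp_apply, mulTensor_lTensor] at h1
    exact mem_cotensor.2 h1
  · refine mulTensor_deg A X (lTensor_mem_cotensor hg hf v) ?_
    exact subTensor_map (f := LinearMap.id) (fun _ h => h) (fun w _ => (hg.2 w).2) (hf.2 v).2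

theorem star_assoc {p q r : ℤ} {h : W →ₗ[k] A ⊗[k] X} {g : V →ₗ[k] A ⊗[k] W}
    {f : U →ₗ[k] A ⊗[k] V} (hh : h ∈ homC A p W X) (hg : g ∈ homC A q V W)
    (hf : f ∈ homC A r U V) : star (star h g) f = star h (star g f) := by
  refine LinearMap.ext fun v => ?_
  have h1 : LinearMap.lTensor A (LinearMap.lTensor A h) (LinearMap.lTensor A g (f v)) ∈
      cotensor A.coactR (coactLeft A.coactL (A ⊗[k] X)) :=
    mem_cotensor_map (fun y => coactLeft_lTensor A.coactL h y) (lTensor_mem_cotensor hg hf v)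
  have h2 : LinearMap.lTensor A (coactMid A.coactR (A ⊗[k] X) -
      LinearMap.lTensor A (coactLeft A.coactL X))
      (LinearMap.lTensor A (LinearMap.lTensor A h) (LinearMap.lTensor A g (f v))) = 0 := by
    rw [← LinearMap.lTensor_comp_apply, ← LinearMap.lTensor_comp_apply]
    have : ((coactMid A.coactR (A ⊗[k] X) - LinearMap.lTensor A (coactLeft A.coactL X)) ∘ₗ
        LinearMap.lTensor A h) ∘ₗ g = 0 := by
      refine LinearMap.ext fun w => ?_
      exact lTensor_mem_cotensor hh hg w
    rw [this]
    simp
  have h3 := mulTensor_assoc A X h1 h2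
  rw [mulTensor_lTensor, ← LinearMap.lTensor_comp_apply, ← LinearMap.lTensor_comp_apply] at h3
  exact h3.symm

theorem idC_mem (V : FDComod k O) : idC A V ∈ homC A 0 V V := by
  have hco : ∀ v, coactLeft Coalgebra.comul V (V.coact v) =
      LinearMap.lTensor O V.coact (V.coact v) :=
    fun v => LinearMap.congr_fun V.isCoaction.coassoc v
  refine ⟨?_, fun v => ⟨?_, ?_⟩⟩
  · have h : coactLeft A.coactL V ∘ₗ LinearMap.rTensor V A.unit =
        LinearMap.lTensor O (LinearMap.rTensor V A.unit) ∘ₗ coactLeft Coalgebra.comul V := by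
      apply TensorProduct.ext'
      intro x y
      have hx : A.coactL (A.unit x) = LinearMap.lTensor O A.unit (Coalgebra.comul x) :=
        LinearMap.congr_fun A.unit_coactL x
      simp only [LinearMap.comp_apply, LinearMap.rTensor_tmul, coactLeft_tmul, hx]
      rw [← LinearMap.lTensor_comp_apply, ← LinearMap.lTensor_comp_apply]
      congr 2
    refine LinearMap.ext fun v => ?_
    have := LinearMap.congr_fun h (V.coact v)
    simp only [LinearMap.comp_apply, hco] at this
    rw [← LinearMap.lTensor_comp_apply] at this
    exact this
  · have h : coactMid A.coactR V ∘ₗ LinearMap.rTensor V A.unit =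
        LinearMap.rTensor (O ⊗[k] V) A.unit ∘ₗ coactLeft Coalgebra.comul V := by
      apply TensorProduct.ext'
      intro x y
      have hx : A.coactR (A.unit x) = LinearMap.rTensor O A.unit (Coalgebra.comul x) :=
        LinearMap.congr_fun A.unit_coactR x
      simp only [LinearMap.comp_apply, LinearMap.rTensor_tmul, coactLeft_tmul, coactMid_tmul, hx]
      exact (rTensor_lTensor _ _ _).symm
    have := LinearMap.congr_fun h (V.coact v)
    simp only [LinearMap.comp_apply, hco] at this
    rw [rTensor_lTensor] at this
    exact mem_cotensor.2 this
  · apply mem_subTensor_of_slice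
    intro φ
    have : slice A φ (idC A V v) = A.unit (slice O φ (V.coact v)) := slice_rTensor _ _ _
    rw [this]
    exact A.unit_deg _

theorem star_idC {p : ℤ} {f : V →ₗ[k] A ⊗[k] W} (hf : f ∈ homC A p V W) :
    star f (idC A V) = f := by
  refine LinearMap.ext fun v => ?_
  have h : coactLeft A.coactL W (f v) = LinearMap.lTensor O f (V.coact v) :=
    LinearMap.congr_fun hf.1 v
  have h1 := mulTensor_unit_left A W (f v)
  rw [h, rTensor_lTensor] at h1
  exact h1

theorem idC_star {p : ℤ} {f : V →ₗ[k] A ⊗[k] W} (hf : f ∈ homC A p V W) :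
    star (idC A W) f = f := by
  refine LinearMap.ext fun v => ?_
  have h1 := mulTensor_unit_right A W (f v)
  rw [mem_cotensor.1 (hf.2 v).1, ← LinearMap.lTensor_comp_apply] at h1
  exact h1

theorem dC_idC (V : FDComod k O) : dC (idC A V) = 0 := by
  have : A.d ∘ₗ A.unit = 0 := A.unit_d
  rw [dC, idC, ← LinearMap.comp_assoc, ← LinearMap.rTensor_comp, this]
  simp

theorem dC_star {p q : ℤ} {g : W →ₗ[k] A ⊗[k] X} {f : V →ₗ[k] A ⊗[k] W}
    (hg : g ∈ homC A p W X) (hf : f ∈ homC A q V W) :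
    dC (star g f) = star g (dC f) + ((q.negOnePow : ℤˣ) : ℤ) • star (dC g) f := by
  refine LinearMap.ext fun v => ?_
  have h1 : dC (star g f) v = _ :=
    mulTensor_d A X (T := LinearMap.lTensor A g (f v)) (lTensor_mem_cotensor hg hf v)
  rw [map_add] at h1
  have h2 : LinearMap.rTensor (A ⊗[k] X) A.d (LinearMap.lTensor A g (f v)) =
      LinearMap.lTensor A g (dC f v) := by
    rw [rTensor_lTensor]
    rfl
  have h3 : ∀ x ∈ subTensor (A.deg q) (⊤ : Submodule k W),
      TensorProduct.map A.sgn (LinearMap.rTensor X A.d) (LinearMap.lTensor A g x) =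
      ((q.negOnePow : ℤˣ) : ℤ) • LinearMap.lTensor A (dC g) x := by
    intro x hx
    have : subTensor (A.deg q) (⊤ : Submodule k W) ≤ LinearMap.ker
        (TensorProduct.map A.sgn (LinearMap.rTensor X A.d) ∘ₗ LinearMap.lTensor A g -
        ((q.negOnePow : ℤˣ) : ℤ) • LinearMap.lTensor A (dC g)) := by
      refine Submodule.map₂_le.2 fun a ha w _ => ?_
      have hs : A.sgn a = ((q.negOnePow : ℤˣ) : ℤ) • a := signOp_apply _ _ _ _ ha
      simp only [LinearMap.mem_ker, LinearMap.sub_apply, LinearMap.comp_apply,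
        TensorProduct.mk_apply, LinearMap.lTensor_tmul, TensorProduct.map_tmul, hs,
        LinearMap.smul_apply, dC]
      rw [TensorProduct.smul_tmul', sub_self]
    have h := this hx
    rw [LinearMap.mem_ker, LinearMap.sub_apply, sub_eq_zero] at h
    exact h
  rw [h2, h3 _ (hf.2 v).2, map_zsmul] at h1
  exact h1

end star

/-- Integrable `(A/O)`-connections: the finite DG complexes `(V^i, d_{ji})` in `C(A/O)` whose
`V^i` are `O`-comodules placed in degree zero.  Here `V = ⨁ V^i` is given with its direct sum
decomposition, and `∇ = ∑_{i < j} d_{ji}` with `d_{ji} ∈ Hom^1(V^i, V^j)`.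
The last axiom is `∂ d_{li} + ∑_{i < j < l} d_{lj} ∘ d_{ji} = 0`. -/
structure Connection (A : RelDGA k O) where
  V : FDComod k O
  piece : ℤ → Submodule k V
  internal : DirectSum.IsInternal piece
  piece_subcomodule : ∀ i, V.IsSubcomodule (piece i)
  nabla : V →ₗ[k] A ⊗[k] V
  nabla_mem : nabla ∈ homC A 1 V V
  nabla_strict : ∀ i, ∀ v ∈ piece i, nabla v ∈ subTensor ⊤ (⨆ j : {j : ℤ // i < j}, piece j)
  flat : dC nabla + compC 1 1 nabla nabla = 0

/-- The differential `f ↦ ∂ f + ∇ ∘ f - (-1)^n f ∘ ∇` on homomorphisms of degree `n`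
of DG complexes. -/
def homD (V W : Connection A) (n : ℤ) : (V.V →ₗ[k] A ⊗[k] W.V) →ₗ[k] (V.V →ₗ[k] A ⊗[k] W.V) where
  toFun f := dC f + compC 1 n W.nabla f - ((n.negOnePow : ℤˣ) : ℤ) • compC n 1 f V.nabla
  map_add' f g := by
    simp only [dC, compC, star_add_left, star_add_right, LinearMap.comp_add, smul_add]
    abel
  map_smul' c f := by
    have h1 : dC (c • f) = c • dC f := by simp [dC, LinearMap.comp_smul]
    have h2 : star W.nabla (c • f) = c • star W.nabla f := by ext v; simp [star]
    have h3 : star (c • f) V.nabla = c • star f V.nabla := by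
      ext v; simp [star, LinearMap.lTensor_smul]
    simp only [compC, h1, h2, h3, smul_sub, smul_add, RingHom.id_apply, smul_comm c]

/-- The closed homomorphisms of degree zero. -/
def homZ (V W : Connection A) : Submodule k (V.V →ₗ[k] A ⊗[k] W.V) :=
  homC A 0 V.V W.V ⊓ LinearMap.ker (homD V W 0)

/-- The exact homomorphisms of degree zero. -/
def homB (V W : Connection A) : Submodule k (V.V →ₗ[k] A ⊗[k] W.V) :=
  (homC A (-1) V.V W.V).map (homD V W (-1))

theorem homD_zero_apply (V W : Connection A) (f : V.V →ₗ[k] A ⊗[k] W.V) :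
    homD V W 0 f = dC f + star W.nabla f - star f V.nabla := by
  simp [homD, compC]

theorem homD_neg_one_apply (V W : Connection A) (f : V.V →ₗ[k] A ⊗[k] W.V) :
    homD V W (-1) f = dC f - star W.nabla f - star f V.nabla := by
  simp [homD, compC, sub_eq_add_neg]

theorem mem_homZ {V W : Connection A} {f : V.V →ₗ[k] A ⊗[k] W.V} : f ∈ homZ V W ↔
    f ∈ homC A 0 V.V W.V ∧ dC f + star W.nabla f - star f V.nabla = 0 := by
  rw [homZ, Submodule.mem_inf, LinearMap.mem_ker, homD_zero_apply]

theorem idC_mem_homZ (V : Connection A) : idC A V.V ∈ homZ V V := by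
  refine mem_homZ.2 ⟨idC_mem V.V, ?_⟩
  rw [dC_idC, star_idC V.nabla_mem, idC_star V.nabla_mem]
  simp

theorem compC_zero_zero {V W X : FDComod k O} (g : W →ₗ[k] A ⊗[k] X) (f : V →ₗ[k] A ⊗[k] W) :
    compC 0 0 g f = star g f := by
  simp [compC]

theorem compC_mem_homZ {V W X : Connection A} {g : W.V →ₗ[k] A ⊗[k] X.V}
    {f : V.V →ₗ[k] A ⊗[k] W.V} (hg : g ∈ homZ W X) (hf : f ∈ homZ V W) :
    compC 0 0 g f ∈ homZ V X := by
  rw [compC_zero_zero]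
  refine mem_homZ.2 ⟨by simpa using star_mem hg.1 hf.1, ?_⟩
  have eg : dC g + star X.nabla g - star g W.nabla = 0 := (mem_homZ.1 hg).2
  have ef : dC f + star W.nabla f - star f V.nabla = 0 := (mem_homZ.1 hf).2
  have eg' := congrArg (fun x => star x f) eg
  have ef' := congrArg (fun x => star g x) ef
  simp only [star_sub_left, star_add_left, star_sub_right, star_add_right, star_zero_left,
    star_zero_right] at eg' ef'
  rw [dC_star hg.1 hf.1,
    star_assoc hg.1 hf.1 V.nabla_mem, ← star_assoc X.nabla_mem hg.1 hf.1]
  rw [star_assoc hg.1 W.nabla_mem hf.1] at eg'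
  simp only [Int.negOnePow_zero, Units.val_one, one_smul]
  have h := congrArg₂ (fun x y => x + y) eg' ef'
  simp only [add_zero] at h
  rw [← h]
  abel

theorem star_homB_right {V W X : Connection A} {g : W.V →ₗ[k] A ⊗[k] X.V}
    {f : V.V →ₗ[k] A ⊗[k] W.V} (hg : g ∈ homZ W X) (hf : f ∈ homB V W) :
    star g f ∈ homB V X := by
  obtain ⟨h, hh, rfl⟩ := hf
  refine ⟨star g h, by simpa using star_mem hg.1 hh, ?_⟩
  have eg : dC g + star X.nabla g - star g W.nabla = 0 := (mem_homZ.1 hg).2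
  have eg' := congrArg (fun x => star x h) eg
  simp only [star_sub_left, star_add_left, star_zero_left] at eg'
  rw [star_assoc hg.1 W.nabla_mem hh] at eg'
  rw [homD_neg_one_apply, homD_neg_one_apply, dC_star hg.1 hh, star_sub_right, star_sub_right,
    star_assoc hg.1 hh V.nabla_mem, ← star_assoc X.nabla_mem hg.1 hh]
  simp only [Int.negOnePow_neg, Int.negOnePow_one, Units.val_neg, Units.val_one, neg_smul, one_smul]
  rw [← sub_eq_zero, ← neg_eq_zero, ← eg']
  abel

theorem star_homB_left {V W X : Connection A} {g : W.V →ₗ[k] A ⊗[k] X.V}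
    {f : V.V →ₗ[k] A ⊗[k] W.V} (hg : g ∈ homB W X) (hf : f ∈ homZ V W) :
    star g f ∈ homB V X := by
  obtain ⟨h, hh, rfl⟩ := hg
  refine ⟨star h f, by simpa using star_mem hh hf.1, ?_⟩
  have ef : dC f + star W.nabla f - star f V.nabla = 0 := (mem_homZ.1 hf).2
  have ef' := congrArg (fun x => star h x) ef
  simp only [star_sub_right, star_add_right, star_zero_right] at ef'
  rw [homD_neg_one_apply, homD_neg_one_apply, dC_star hh hf.1, star_sub_left, star_sub_left,
    star_assoc hh hf.1 V.nabla_mem, ← star_assoc X.nabla_mem hh hf.1,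
    star_assoc hh W.nabla_mem hf.1]
  simp only [Int.negOnePow_zero, Units.val_one, one_smul]
  rw [← sub_eq_zero, ← ef']
  abel

/-- Two closed homomorphisms of degree zero are homotopic if their difference is exact. -/
def homotopic (V W : Connection A) : Setoid (homZ V W) where
  r f g := f.1 - g.1 ∈ homB V W
  iseqv := ⟨fun f => by rw [sub_self]; exact zero_mem _,
    fun {f g} h => by rw [← neg_sub]; exact neg_mem h,
    fun {f g h} h₁ h₂ => by rw [← sub_add_sub_cancel f.1 g.1 h.1]; exact add_mem h₁ h₂⟩

/-- Homomorphisms in the homotopy category: `H^0` of the complex of homomorphisms. -/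
def Connection.Hom (V W : Connection A) : Type u := Quotient (homotopic V W)

/-- The composition of homotopy classes. -/
def Connection.comp {V W X : Connection A} : Connection.Hom V W → Connection.Hom W X →
    Connection.Hom V X :=
  Quotient.map₂ (fun f g => ⟨compC 0 0 g.1 f.1, compC_mem_homZ g.2 f.2⟩) (by
    intro f f' hf g g' hg
    have h1 := star_homB_right g.2 hf
    have h2 := star_homB_left hg f'.2
    rw [star_sub_right] at h1
    rw [star_sub_left] at h2
    have h3 := add_mem h1 h2
    rw [sub_add_sub_cancel] at h3
    change compC 0 0 g.1 f.1 - compC 0 0 g'.1 f'.1 ∈ homB V X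
    rw [compC_zero_zero, compC_zero_zero]
    exact h3)

/-- The category `IC(A/O)` of integrable `(A/O)`-connections, the homotopy category of the
DG category of DG complexes in `C(A/O)` concentrated in degree zero. -/
instance Connection.category (A : RelDGA k O) : CategoryTheory.Category (Connection A) where
  Hom := Connection.Hom
  id V := Quotient.mk _ ⟨idC A V.V, idC_mem_homZ V⟩
  comp := Connection.comp
  id_comp f := by
    induction f using Quotient.inductionOn with | _ f =>
    refine congrArg (Quotient.mk _) (Subtype.ext ?_)
    exact (compC_zero_zero _ _).trans (star_idC f.2.1)
  comp_id f := by
    induction f using Quotient.inductionOn with | _ f =>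
    refine congrArg (Quotient.mk _) (Subtype.ext ?_)
    exact (compC_zero_zero _ _).trans (idC_star f.2.1)
  assoc f g h := by
    induction f using Quotient.inductionOn with | _ f =>
    induction g using Quotient.inductionOn with | _ g =>
    induction h using Quotient.inductionOn with | _ h =>
    refine congrArg (Quotient.mk _) (Subtype.ext ?_)
    simp only [compC_zero_zero]
    exact (star_assoc h.2.1 g.2.1 f.2.1).symm

end Connections
--END

end RelativeDGA

end

/-!
The cohomology coalgebra and the connections are both computed by the rigid subalgebra, and over it
a connection and a comodule are given by the same data: an `O`-comodule together with a
Maurer–Cartan form. The difficulty is to reduce to the rigid subalgebra by bicomodule maps, because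
only these act on cotensor products.

*The retraction.* Complete reducibility yields a Haar integral `Λ` (`exists_haar`), hence the form
`β(b, c) = Λ(b S(c))` on `O`, which makes `O` a coseparable coalgebra (`exists_coseparating`). With
`β` a linear map between comodules can be averaged to a colinear one. Over the field `k` a
subcomplex `B` with acyclic quotient is a deformation retract by linear maps, and after averaging
over both coactions by bicomodule maps (`RelDGA.exists_retract`). Everything below is formulated
for such a `RelDGA.Retract` `R`, with projection `p` and homotopy `h`.

*The bar complex.* All operators on bar words are defined by recursion on the first letter
(`barRec`), on the sum of all `A ⊗ ⋯ ⊗ A ⊗ O`; the bar complex is the subspace of words satisfying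
the cotensor conditions. The differential is the sum of a derivation, of `barTail` and of `barHead`
(`barD_eq`). In characteristic zero the total degree can be read off from the eigenvalues of
`barWt A 2`, the operator `x ↦ 2 ^ deg x` (`mem_barPart`), so that graded statements become
statements about commuting operators.

*The coalgebra.* The homotopy `h` contracts the inner differential onto words with letters in `B`,
and the outer differential shortens words, so that every class is represented by letters in `B`
(`exists_reduction`). In `B` the letters of degree zero are those in the image of `O`, and doubling
them is a contraction onto the words with letters of positive degree (`split_homotopy`). Such words
have degree at least zero, and degree zero only if all letters have degree one. Hence `H^0` is the
space `Retract.core` of closed words with letters of degree one in `B`, and this is a subcoalgebra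
(`comul_core`, `exists_coalgebra`).

*Comodules.* A comodule over this coalgebra is a coaction `ρ` of the bar complex with values in
`Retract.core`. Its component of length zero is a coaction of `O`, the one of length one is a form
`ω` with values in `B^1`; they determine `ρ` (`recursion`), and closedness is the equation
`dω + ω * ω = 0` (`letterPart_maurerCartan`). So `∇ = -ω` is a flat connection. The grading
required of a connection is a splitting of the filtration by iterated socles of `ω`, which exists
by complete reducibility (`exists_pieces`). Conversely a flat connection with values in `B` comes
from the coaction found by solving the recursion (`exists_barCoaction`).

*Connections.* Every connection is gauge equivalent to one with values in `B`, by successive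
approximation along its filtration (`exists_gauge`, `exists_iso_valued`). Between such connections
a closed homomorphism of degree zero is homotopic to one with values in `B^0`, which is a colinear
map commuting with the forms (`exists_strict`), and it is unique because `B` has no elements of
degree `-1` (`eq_zero_of_mem_homB`). These maps are the homomorphisms of comodules over
`Retract.core`, and the functor from comodules to connections is an equivalence
(`IsCoreEmbedding.nonempty_equivalence`).
-/

noncomputable section

namespace RelativeDGA

set_option linter.unusedSectionVars false

open LinearMap (lTensor rTensor comp_apply lTensor_comp_apply rTensor_comp_apply lTensor_tmul
  rTensor_tmul comp_assoc mem_ker eqLocus)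
open Submodule (mem_comap mem_bot mem_inf mem_sup mem_iSup_of_mem)
open Coalgebra (comul counit)

/-! ### Tensor products of subspaces, and graded operators -/

section TensorToolkit

variable {k M M' N N' L : Type u} [Field k] [AddCommGroup M] [Module k M] [AddCommGroup N]
  [Module k N] [AddCommGroup M'] [Module k M'] [AddCommGroup N'] [Module k N']
  [AddCommGroup L] [Module k L]

theorem tmul_mem_subTensor {P : Submodule k M} {Q : Submodule k N} {x : M} {y : N}
    (hx : x ∈ P) (hy : y ∈ Q) : x ⊗ₜ[k] y ∈ subTensor P Q :=
  Submodule.apply_mem_map₂ _ hx hy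

theorem subTensor_mono {P P' : Submodule k M} {Q Q' : Submodule k N} (hP : P ≤ P')
    (hQ : Q ≤ Q') : subTensor P Q ≤ subTensor P' Q' :=
  Submodule.map₂_le_map₂ hP hQ

theorem subTensor_induction {P : Submodule k M} {Q : Submodule k N} (K : Submodule k (M ⊗[k] N))
    (h : ∀ x ∈ P, ∀ y ∈ Q, x ⊗ₜ[k] y ∈ K) {t : M ⊗[k] N} (ht : t ∈ subTensor P Q) : t ∈ K :=
  (Submodule.map₂_le.2 h : subTensor P Q ≤ K) ht

theorem mem_subTensor_top (t : M ⊗[k] N) :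
    t ∈ subTensor (⊤ : Submodule k M) (⊤ : Submodule k N) := by
  induction t with
  | zero => exact zero_mem _
  | tmul x y => exact tmul_mem_subTensor trivial trivial
  | add x y hx hy => exact add_mem hx hy

theorem eq_on_subTensor {P : Submodule k M} {Q : Submodule k N} {F G : M ⊗[k] N →ₗ[k] L}
    (h : ∀ x ∈ P, ∀ y ∈ Q, F (x ⊗ₜ[k] y) = G (x ⊗ₜ[k] y)) {t : M ⊗[k] N}
    (ht : t ∈ subTensor P Q) : F t = G t :=
  subTensor_induction (eqLocus F G) h ht

theorem map_eq_on_subTensor {P : Submodule k M} {Q : Submodule k N} {f f' : M →ₗ[k] M'}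
    {g g' : N →ₗ[k] N'} (hf : ∀ x ∈ P, f x = f' x) (hg : ∀ y ∈ Q, g y = g' y) {t : M ⊗[k] N}
    (ht : t ∈ subTensor P Q) : map f g t = map f' g' t :=
  eq_on_subTensor (fun x hx y hy => by simp [hf x hx, hg y hy]) ht

theorem map_mem_subTensor (f : M →ₗ[k] M') (g : N →ₗ[k] N') (t : M ⊗[k] N) :
    map f g t ∈ subTensor (LinearMap.range f) (LinearMap.range g) :=
  subTensor_map (fun x _ => LinearMap.mem_range_self f x)
    (fun x _ => LinearMap.mem_range_self g x) (mem_subTensor_top t)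

theorem exists_projection (P : Submodule k M) :
    ∃ e : M →ₗ[k] M, (∀ x, e x ∈ P) ∧ ∀ x ∈ P, e x = x := by
  obtain ⟨f, hf⟩ := LinearMap.exists_extend (LinearMap.id : P →ₗ[k] P)
  exact ⟨P.subtype ∘ₗ f, fun x => (f x).2,
    fun x hx => congrArg Subtype.val (LinearMap.congr_fun hf ⟨x, hx⟩)⟩

theorem exists_pseudoinverse (f : M →ₗ[k] N) : ∃ g : N →ₗ[k] M, ∀ x, f (g (f x)) = f x := by
  obtain ⟨s, hs⟩ := f.rangeRestrict.exists_rightInverse_of_surjective f.range_rangeRestrict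
  obtain ⟨g, hg⟩ := LinearMap.exists_extend s
  refine ⟨g, fun x => ?_⟩
  have h1 : g (f x) = s (f.rangeRestrict x) := LinearMap.congr_fun hg (f.rangeRestrict x)
  have h2 := LinearMap.congr_fun hs (f.rangeRestrict x)
  rw [h1]
  exact congrArg Subtype.val h2

/-- Over a field `(P ⊗ N) ∩ (M ⊗ Q) = P ⊗ Q`. -/
theorem subTensor_inf {P : Submodule k M} {Q : Submodule k N} {t : M ⊗[k] N}
    (h1 : t ∈ subTensor P ⊤) (h2 : t ∈ subTensor ⊤ Q) : t ∈ subTensor P Q := by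
  obtain ⟨e, he, he'⟩ := exists_projection P
  obtain ⟨f, hf, hf'⟩ := exists_projection Q
  have e1 : rTensor N e t = t := by
    have := map_eq_on_subTensor (f := e) (f' := LinearMap.id) (g := LinearMap.id)
      (g' := LinearMap.id) he' (fun _ _ => rfl) h1
    rwa [TensorProduct.map_id] at this
  have e2 : lTensor M f t = t := by
    have := map_eq_on_subTensor (f := LinearMap.id) (f' := LinearMap.id) (g := f)
      (g' := LinearMap.id) (fun _ _ => rfl) hf' h2
    rwa [TensorProduct.map_id] at this
  have : map e f t = t := by
    rw [← LinearMap.rTensor_comp_lTensor, comp_apply, e2, e1]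
  rw [← this]
  exact subTensor_mono (by rintro _ ⟨x, rfl⟩; exact he x) (by rintro _ ⟨x, rfl⟩; exact hf x)
    (map_mem_subTensor e f t)

/-- Tensoring over a field is exact: the kernel of `f ⊗ 1` is `ker f ⊗ N`. -/
theorem mem_subTensor_ker_left {f : M →ₗ[k] M'} {t : M ⊗[k] N}
    (h : rTensor N f t = 0) : t ∈ subTensor (LinearMap.ker f) ⊤ := by
  obtain ⟨g, hg⟩ := exists_pseudoinverse f
  have : rTensor N (LinearMap.id - g ∘ₗ f) t = t := by
    rw [LinearMap.rTensor_sub, LinearMap.rTensor_comp, LinearMap.sub_apply, comp_apply, h]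
    simp
  rw [← this]
  exact subTensor_map (P := ⊤) (Q := ⊤) (g := LinearMap.id)
    (fun x _ => by simp [hg]) (fun _ h => h) (mem_subTensor_top t)

theorem mem_subTensor_ker_right {f : N →ₗ[k] N'} {t : M ⊗[k] N}
    (h : lTensor M f t = 0) : t ∈ subTensor ⊤ (LinearMap.ker f) := by
  obtain ⟨g, hg⟩ := exists_pseudoinverse f
  have : lTensor M (LinearMap.id - g ∘ₗ f) t = t := by
    rw [LinearMap.lTensor_sub, LinearMap.lTensor_comp, LinearMap.sub_apply, comp_apply, h]
    simp
  rw [← this]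
  exact subTensor_map (P := ⊤) (Q := ⊤) (f := LinearMap.id)
    (fun _ h => h) (fun x _ => by simp [hg]) (mem_subTensor_top t)

theorem lTensor_injective {f : N →ₗ[k] N'} (hf : Function.Injective f) :
    Function.Injective (lTensor M f) :=
  Module.Flat.lTensor_preserves_injective_linearMap f hf

theorem rTensor_injective {f : N →ₗ[k] N'} (hf : Function.Injective f) :
    Function.Injective (rTensor M f) :=
  Module.Flat.rTensor_preserves_injective_linearMap f hf

theorem map_injective {f : M →ₗ[k] M'} {g : N →ₗ[k] N'} (hf : Function.Injective f)
    (hg : Function.Injective g) : Function.Injective (map f g) := by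
  rw [← LinearMap.rTensor_comp_lTensor]
  exact (rTensor_injective hf).comp (lTensor_injective hg)

/-- Membership in `P ⊗ Q` transported along the injection `P ⊗ Q → M ⊗ N`. -/
theorem exists_map_subtype {P : Submodule k M} {Q : Submodule k N} {t : M ⊗[k] N}
    (ht : t ∈ subTensor P Q) : ∃ w : P ⊗[k] Q, map P.subtype Q.subtype w = t :=
  subTensor_induction (LinearMap.range (map P.subtype Q.subtype))
    (fun x hx y hy => ⟨⟨x, hx⟩ ⊗ₜ ⟨y, hy⟩, by simp⟩) ht

/-- `ψ ⊗ 1 : M ⊗ N → N` for a functional `ψ` on `M`. -/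
def sliceL (N : Type u) [AddCommGroup N] [Module k N] (ψ : M →ₗ[k] k) : M ⊗[k] N →ₗ[k] N :=
  (TensorProduct.lid k N).toLinearMap ∘ₗ rTensor N ψ

@[simp] theorem sliceL_tmul (ψ : M →ₗ[k] k) (x : M) (y : N) :
    sliceL N ψ (x ⊗ₜ[k] y) = ψ x • y := by
  simp [sliceL]

theorem slice_comm (ψ : M →ₗ[k] k) (t : M ⊗[k] N) :
    slice N ψ (TensorProduct.comm k M N t) = sliceL N ψ t := by
  induction t with
  | zero => simp
  | add a c ha hc => simp only [map_add, ha, hc]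
  | tmul a c => simp [slice_tmul]

/-- The functionals on `M` separate the elements of `M ⊗ N`. -/
theorem sliceL_sep {x y : M ⊗[k] N} (h : ∀ ψ : M →ₗ[k] k, sliceL N ψ x = sliceL N ψ y) :
    x = y := by
  apply (TensorProduct.comm k M N).injective
  apply slice_sep
  intro ψ
  rw [slice_comm, slice_comm, h]

theorem comm_mem_subTensor {P : Submodule k M} {Q : Submodule k N} {t : M ⊗[k] N}
    (ht : t ∈ subTensor P Q) : TensorProduct.comm k M N t ∈ subTensor Q P :=
  subTensor_induction ((subTensor Q P).comap (TensorProduct.comm k M N).toLinearMap)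
    (fun _ hx _ hy => tmul_mem_subTensor hy hx) ht

theorem mem_subTensor_of_sliceL {Q : Submodule k N} {t : M ⊗[k] N}
    (h : ∀ ψ : M →ₗ[k] k, sliceL N ψ t ∈ Q) : t ∈ subTensor (⊤ : Submodule k M) Q := by
  have h1 : TensorProduct.comm k M N t ∈ subTensor Q ⊤ :=
    mem_subTensor_of_slice fun ψ => by rw [slice_comm]; exact h ψ
  simpa using comm_mem_subTensor h1

theorem sliceL_mem {P : Submodule k M} {Q : Submodule k N} {t : M ⊗[k] N}
    (ht : t ∈ subTensor P Q) (ψ : M →ₗ[k] k) : sliceL N ψ t ∈ Q :=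
  subTensor_induction (Q.comap (sliceL N ψ))
    (fun x _ y hy => by simpa using Q.smul_mem _ hy) ht

theorem sliceL_lTensor (f : N →ₗ[k] N') (ψ : M →ₗ[k] k) (t : M ⊗[k] N) :
    sliceL N' ψ (lTensor M f t) = f (sliceL N ψ t) := by
  induction t with
  | zero => simp
  | add a c ha hc => simp only [map_add, ha, hc]
  | tmul a c => simp

theorem assoc_map_apply {M₁ M₂ M₃ N₁ N₂ N₃ : Type u} [AddCommGroup M₁] [Module k M₁]
    [AddCommGroup M₂] [Module k M₂] [AddCommGroup M₃] [Module k M₃] [AddCommGroup N₁]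
    [Module k N₁] [AddCommGroup N₂] [Module k N₂] [AddCommGroup N₃] [Module k N₃]
    (f : M₁ →ₗ[k] N₁) (g : M₂ →ₗ[k] N₂) (h : M₃ →ₗ[k] N₃) (t : (M₁ ⊗[k] M₂) ⊗[k] M₃) :
    TensorProduct.assoc k N₁ N₂ N₃ (map (map f g) h t) =
      map f (map g h) (TensorProduct.assoc k M₁ M₂ M₃ t) :=
  LinearMap.congr_fun (TensorProduct.map_map_comp_assoc_eq f g h).symm t

end TensorToolkit

section Eigen

variable {k M : Type u} [Field k] [AddCommGroup M] [Module k M]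

theorem two_zpow_injective [CharZero k] : Function.Injective fun n : ℤ => (2 : k) ^ n := by
  intro m n h
  have h' : ((2 : ℚ) ^ m : ℚ) = (2 : ℚ) ^ n := by
    apply Rat.cast_injective (α := k)
    simpa using h
  exact zpow_right_injective₀ (by norm_num) (by norm_num) h'

/-- If `T` acts on the subspace `V i` by the scalar `μ i`, and these scalars are distinct, then
an eigenvector for `μ j` in the sum of the `V i` lies in `V j`. -/
theorem mem_of_eigenvector {ι : Type*} (T : M →ₗ[k] M) (V : ι → Submodule k M) (μ : ι → k)
    (hμ : Function.Injective μ) (hV : ∀ i, ∀ x ∈ V i, T x = μ i • x) {x : M} (hx : x ∈ ⨆ i, V i)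
    {j : ι} (hj : T x = μ j • x) : x ∈ V j := by
  have hind := (Module.End.eigenspaces_iSupIndep (R := k) (M := M) T).comp hμ
  have hle : (⨆ i, V i) ≤ V j ⊔ ⨆ (i) (_ : i ≠ j), V i := by
    refine iSup_le fun i => ?_
    by_cases h : i = j
    · subst h; exact le_sup_left
    · exact (le_iSup₂_of_le i h le_rfl : V i ≤ ⨆ (i) (_ : i ≠ j), V i).trans le_sup_right
  obtain ⟨u, hu, w, hw, rfl⟩ := Submodule.mem_sup.1 (hle hx)
  have hw1 : w ∈ Module.End.eigenspace T (μ j) := by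
    rw [Module.End.mem_eigenspace_iff]
    have := hV j u hu
    rw [map_add, this, smul_add] at hj
    exact add_left_cancel hj
  have hw2 : w ∈ ⨆ (i) (_ : i ≠ j), Module.End.eigenspace T (μ i) :=
    (iSup₂_mono fun i _ x hx => Module.End.mem_eigenspace_iff.2 (hV i x hx) :
      (⨆ (i) (_ : i ≠ j), V i) ≤ ⨆ (i) (_ : i ≠ j), Module.End.eigenspace T (μ i)) hw
  have : w = 0 := (Submodule.disjoint_def.1 (hind j)) w hw1 hw2
  rw [this, add_zero]
  exact hu

end Eigen

section Graded

variable {k M N : Type u} [Field k] [AddCommGroup M] [Module k M] [AddCommGroup N] [Module k N]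

/-- The linear map which is given by `φ n` on the elements of degree `n`. -/
def gradedLift (deg : ℤ → Submodule k M) (h : DirectSum.IsInternal deg) (φ : ℤ → M →ₗ[k] N) :
    M →ₗ[k] N :=
  DirectSum.toModule k ℤ N (fun n => φ n ∘ₗ (deg n).subtype) ∘ₗ
    (LinearEquiv.ofBijective (DirectSum.coeLinearMap deg) h).symm.toLinearMap

theorem gradedLift_apply (deg : ℤ → Submodule k M) (h : DirectSum.IsInternal deg)
    (φ : ℤ → M →ₗ[k] N) {n : ℤ} {x : M} (hx : x ∈ deg n) : gradedLift deg h φ x = φ n x := by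
  have : (LinearEquiv.ofBijective (DirectSum.coeLinearMap deg) h).symm x =
      DirectSum.lof k ℤ (fun i => deg i) n ⟨x, hx⟩ := by
    rw [LinearEquiv.symm_apply_eq]
    exact (DirectSum.coeLinearMap_lof deg n ⟨x, hx⟩).symm
  simp [gradedLift, this]

/-- The operator which multiplies the elements of degree `n` by the scalar `a n`. -/
def degOp (deg : ℤ → Submodule k M) (h : DirectSum.IsInternal deg) (a : ℤ → k) : M →ₗ[k] M :=
  gradedLift deg h fun n => a n • LinearMap.id

theorem degOp_apply (deg : ℤ → Submodule k M) (h : DirectSum.IsInternal deg) (a : ℤ → k) {n : ℤ}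
    {x : M} (hx : x ∈ deg n) : degOp deg h a x = a n • x := by
  rw [degOp, gradedLift_apply deg h _ hx]
  rfl

theorem graded_induction {deg : ℤ → Submodule k M} (h : DirectSum.IsInternal deg)
    (K : Submodule k M) (hK : ∀ n, deg n ≤ K) (x : M) : x ∈ K := by
  have : (⊤ : Submodule k M) ≤ K := by
    rw [← h.submodule_iSup_eq_top]
    exact iSup_le hK
  exact this trivial

theorem graded_ext {deg : ℤ → Submodule k M} (h : DirectSum.IsInternal deg) {f g : M →ₗ[k] N}
    (H : ∀ n, ∀ x ∈ deg n, f x = g x) : f = g :=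
  LinearMap.ext fun x => graded_induction h (eqLocus f g) H x

theorem signOp_eq_degOp (deg : ℤ → Submodule k M) (h : DirectSum.IsInternal deg) :
    signOp deg h = degOp deg h fun n => (-1) ^ n := by
  refine graded_ext h fun n x hx => ?_
  rw [signOp_apply deg h n x hx, degOp_apply deg h _ hx]
  rcases Int.even_or_odd n with hn | hn
  · simp [Int.negOnePow_even n hn, hn.neg_one_zpow]
  · simp [Int.negOnePow_odd n hn, hn.neg_one_zpow]

theorem degOp_mem (deg : ℤ → Submodule k M) (h : DirectSum.IsInternal deg) (j : ℤ) (x : M) :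
    degOp deg h (Pi.single j 1) x ∈ deg j := by
  refine graded_induction h ((deg j).comap (degOp deg h (Pi.single j 1))) (fun n x hx => ?_) x
  rw [mem_comap, degOp_apply deg h _ hx]
  by_cases hn : n = j
  · subst hn; exact Submodule.smul_mem _ _ hx
  · simp [Pi.single_eq_of_ne hn]

theorem mem_of_degOp_mem {deg : ℤ → Submodule k M} (h : DirectSum.IsInternal deg)
    (K : Submodule k M) {x : M} (hx : ∀ n, degOp deg h (Pi.single n 1) x ∈ K) : x ∈ K := by
  obtain ⟨f, hf, rfl⟩ := (Submodule.mem_iSup_iff_exists_finsupp deg x).1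
    (by rw [h.submodule_iSup_eq_top]; trivial)
  refine Submodule.sum_mem _ fun n hn => ?_
  have := hx n
  rw [Finsupp.sum, map_sum, Finset.sum_eq_single n] at this
  · rwa [degOp_apply deg h _ (hf n), Pi.single_eq_same, one_smul] at this
  · intro m _ hm
    rw [degOp_apply deg h _ (hf m), Pi.single_eq_of_ne hm, zero_smul]
  · intro h'
    rw [Finsupp.notMem_support_iff.1 h', map_zero]

end Graded

/-! ### The Haar integral and a coseparating form -/

section LocalFiniteness

variable {k C M : Type u} [Field k] [AddCommGroup C] [Module k C] [Coalgebra k C]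
  [AddCommGroup M] [Module k M] {ρ : M →ₗ[k] C ⊗[k] M}

theorem IsLeftCoaction.coassoc_apply (hρ : IsLeftCoaction ρ) (x : M) :
    TensorProduct.assoc k C C M (rTensor M Coalgebra.comul (ρ x)) =
      lTensor C ρ (ρ x) :=
  LinearMap.congr_fun hρ.coassoc x

theorem IsLeftCoaction.counit_apply (hρ : IsLeftCoaction ρ) (x : M) :
    sliceL M Coalgebra.counit (ρ x) = x :=
  LinearMap.congr_fun hρ.counit x

/-- The coaction turns `M` into a module over the convolution algebra of functionals on `C`. -/
theorem IsLeftCoaction.sliceL_sliceL (hρ : IsLeftCoaction ρ) (χ ψ : C →ₗ[k] k) (x : M) :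
    sliceL M χ (ρ (sliceL M ψ (ρ x))) =
      sliceL M (χ ∘ₗ sliceL C ψ ∘ₗ Coalgebra.comul) (ρ x) := by
  rw [← sliceL_lTensor, ← hρ.coassoc_apply]
  generalize ρ x = t
  induction t with
  | zero => simp
  | add a c ha hc => simp only [map_add, ha, hc]
  | tmul c m =>
    simp only [rTensor_tmul, sliceL_tmul, comp_apply]
    generalize (Coalgebra.comul (R := k) c) = d
    induction d with
    | zero => simp
    | add a c ha hc => simp only [add_tmul, map_add, ha, hc, add_smul]
    | tmul a b => simp [mul_smul]

/-- Every element of a comodule lies in a finite dimensional subcomodule. -/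
theorem IsLeftCoaction.exists_finite (hρ : IsLeftCoaction ρ) (x : M) :
    ∃ U : Submodule k M, x ∈ U ∧ FiniteDimensional k U ∧ ∀ y ∈ U, ρ y ∈ subTensor ⊤ U := by
  obtain ⟨S, hS⟩ := TensorProduct.exists_finset (ρ x)
  let U : Submodule k M := Submodule.span k (Set.range fun ψ : C →ₗ[k] k => sliceL M ψ (ρ x))
  refine ⟨U, ?_, ?_, ?_⟩
  · exact Submodule.subset_span ⟨Coalgebra.counit, hρ.counit_apply x⟩
  · classical
    have hle : U ≤ Submodule.span k (S.image Prod.snd : Finset M) := by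
      refine Submodule.span_le.2 ?_
      rintro _ ⟨ψ, rfl⟩
      simp only [hS, map_sum, sliceL_tmul]
      refine Submodule.sum_mem _ fun i hi => Submodule.smul_mem _ _ (Submodule.subset_span ?_)
      exact Finset.mem_coe.2 (Finset.mem_image.2 ⟨i, hi, rfl⟩)
    exact Submodule.finiteDimensional_of_le hle
  · intro y hy
    refine mem_subTensor_of_sliceL fun χ => ?_
    refine (Submodule.span_le.2 ?_ : U ≤ U.comap (sliceL M χ ∘ₗ ρ)) hy
    rintro _ ⟨ψ, rfl⟩
    exact Submodule.subset_span ⟨_, (hρ.sliceL_sliceL χ ψ x).symm⟩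

/-- A finite dimensional stable subspace of a comodule is a comodule. -/
theorem IsLeftCoaction.exists_restrict (hρ : IsLeftCoaction ρ) (U : Submodule k M)
    [FiniteDimensional k U] (hU : ∀ y ∈ U, ρ y ∈ subTensor ⊤ U) :
    ∃ (V : FDComod k C) (e : V →ₗ[k] M), Function.Injective e ∧ LinearMap.range e = U ∧
      ρ ∘ₗ e = lTensor C e ∘ₗ V.coact := by
  obtain ⟨r, hr⟩ := LinearMap.exists_extend (LinearMap.id : U →ₗ[k] U)
  have hr' : ∀ x ∈ U, (U.subtype ∘ₗ r) x = (LinearMap.id : M →ₗ[k] M) x := fun x hx =>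
    congrArg Subtype.val (LinearMap.congr_fun hr ⟨x, hx⟩)
  let ρU : U →ₗ[k] C ⊗[k] U := lTensor C r ∘ₗ ρ ∘ₗ U.subtype
  have key : ρ ∘ₗ U.subtype = lTensor C U.subtype ∘ₗ ρU := by
    refine LinearMap.ext fun x => ?_
    have h := map_eq_on_subTensor (f := LinearMap.id (R := k) (M := C)) (f' := LinearMap.id)
      (fun _ _ => rfl) hr' (hU x x.2)
    rw [TensorProduct.map_id] at h
    simp only [ρU, comp_apply, ← lTensor_comp_apply]
    exact h.symm
  have key' : ∀ x : U, ρ x = lTensor C U.subtype (ρU x) := fun x =>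
    LinearMap.congr_fun key x
  refine ⟨{ carrier := U, coact := ρU, isCoaction := ⟨?_, ?_⟩ }, U.subtype,
    U.injective_subtype, U.range_subtype, key⟩
  · refine LinearMap.ext fun x => ?_
    apply lTensor_injective (M := C) (lTensor_injective (M := C) U.injective_subtype)
    simp only [comp_apply]
    rw [← lTensor_comp_apply C, ← key, lTensor_comp_apply, ← key',
      ← hρ.coassoc_apply, key', rTensor_lTensor]
    exact (assoc_map_apply LinearMap.id LinearMap.id U.subtype _).symm.trans (by
      rw [TensorProduct.map_id]; rfl)
  · refine LinearMap.ext fun x => U.injective_subtype ?_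
    have h := hρ.counit_apply (x : M)
    rw [key', sliceL, comp_apply, rTensor_lTensor] at h
    refine Eq.trans ?_ h
    simp only [comp_apply]
    generalize rTensor U Coalgebra.counit (ρU x) = t
    induction t with
    | zero => simp
    | add a c ha hc => simp only [map_add, ha, hc]
    | tmul a c => simp

end LocalFiniteness

section Haar

variable {k O : Type u} [Field k] [CommRing O] [HopfAlgebra k O]

theorem comul_isLeftCoaction (k C : Type u) [Field k] [AddCommGroup C] [Module k C]
    [Coalgebra k C] : IsLeftCoaction (comul : C →ₗ[k] C ⊗[k] C) where
  coassoc := Coalgebra.coassoc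
  counit := by
    rw [Coalgebra.rTensor_counit_comp_comul]
    ext; simp

/-- On a finite dimensional subcomodule of `O` which contains `1`, the projection to `k 1` along an
invariant complement is an invariant functional. -/
theorem exists_invariant_functional (hred : IsReductive k O) (U : Submodule k O)
    [FiniteDimensional k U] (h1 : (1 : O) ∈ U)
    (hU : ∀ y ∈ U, comul (R := k) y ∈ subTensor ⊤ U) :
    ∃ l : O →ₗ[k] k, l 1 = 1 ∧ ∀ y ∈ U, slice O l (comul y) = l y • (1 : O) := by
  obtain ⟨V, e, he, hr, hc⟩ := (comul_isLeftCoaction k O).exists_restrict U hU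
  have hc' : ∀ v, comul (e v) = lTensor O e (V.coact v) := fun v =>
    LinearMap.congr_fun hc v
  obtain ⟨v₁, hv₁⟩ : (1 : O) ∈ LinearMap.range e := hr ▸ h1
  have hv₁c : V.coact v₁ = (1 : O) ⊗ₜ[k] v₁ := by
    apply lTensor_injective (M := O) he
    rw [← hc', hv₁, Bialgebra.comul_one, lTensor_tmul, hv₁]
    rfl
  obtain ⟨W, hW, hcompl⟩ := hred V (Submodule.span k {v₁}) (by
    intro v hv
    obtain ⟨c, rfl⟩ := Submodule.mem_span_singleton.1 hv
    rw [map_smul, hv₁c]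
    exact Submodule.smul_mem _ _
      (tmul_mem_subTensor trivial (Submodule.mem_span_singleton_self v₁)))
  obtain h10 | h10 := eq_or_ne v₁ 0
  · have : (1 : O) = 0 := by rw [← hv₁, h10, map_zero]
    have h0 : (1 : k) = 0 := by
      have h := congrArg (counit (R := k)) this
      rwa [Bialgebra.counit_one, map_zero] at h
    exact absurd h0 one_ne_zero
  have hv₁W : v₁ ∉ W := fun h =>
    h10 (Submodule.disjoint_def.1 hcompl.disjoint v₁ (Submodule.mem_span_singleton_self v₁) h)
  obtain ⟨f, hf⟩ := Submodule.exists_le_ker_of_notMem hv₁W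
  obtain ⟨g, hg⟩ := LinearMap.exists_leftInverse_of_injective e (LinearMap.ker_eq_bot.2 he)
  have hg' : ∀ v, g (e v) = v := fun v => LinearMap.congr_fun hg v
  let l : O →ₗ[k] k := (f v₁)⁻¹ • f ∘ₗ g
  have hl : ∀ v, l (e v) = (f v₁)⁻¹ * f v := fun v => by simp [l, hg']
  have hl1 : l (e v₁) = 1 := by rw [hl]; exact inv_mul_cancel₀ hf.1
  refine ⟨l, by rw [← hv₁]; exact hl1, fun y hy => ?_⟩
  obtain ⟨v, rfl⟩ : y ∈ LinearMap.range e := hr ▸ hy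
  have hsl : ∀ t : O ⊗[k] V, slice O l (lTensor O e t) = slice O (l ∘ₗ e) t := by
    intro t
    rw [slice, slice, LinearMap.lTensor_comp]
    rfl
  rw [hc', hsl]
  obtain ⟨a, ha, w, hw, rfl⟩ := Submodule.mem_sup.1
    (show v ∈ Submodule.span k {v₁} ⊔ W by rw [hcompl.sup_eq_top]; trivial)
  obtain ⟨c, rfl⟩ := Submodule.mem_span_singleton.1 ha
  have hw0 : ∀ w ∈ W, (l ∘ₗ e) w = 0 := fun w hw => by
    rw [comp_apply, hl, show f w = 0 from hf.2 hw, mul_zero]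
  have hW0 : slice O (l ∘ₗ e) (V.coact w) = 0 := by
    have := eq_on_subTensor (F := slice O (l ∘ₗ e)) (G := 0)
      (fun x _ y hy => by rw [slice_tmul, hw0 y hy]; simp) (hW w hw)
    simpa using this
  have hw0' : l (e w) = 0 := hw0 w hw
  simp only [map_add, map_smul, hv₁c, hW0, slice_tmul, comp_apply, hl1, hw0']
  simp

/-- The Haar integral: an invariant functional `Λ` on `O` with `Λ 1 = 1`. Invariance means that
`Λ` kills a certain subspace `J`, and by local finiteness `1 ∈ J` would contradict
the existence of `Λ` on finite dimensional subcomodules. -/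
theorem exists_haar (hred : IsReductive k O) :
    ∃ Λ : O →ₗ[k] k, Λ 1 = 1 ∧ ∀ y, slice O Λ (comul y) = Λ y • (1 : O) := by
  have hsl : ∀ (l ψ : O →ₗ[k] k) (t : O ⊗[k] O), l (sliceL O ψ t) = ψ (slice O l t) := by
    intro l ψ t
    induction t with
    | zero => simp
    | add a c ha hc => simp only [map_add, ha, hc]
    | tmul a c => simp [slice_tmul, mul_comm]
  let J : Submodule k O := Submodule.span k
    {z | ∃ (ψ : O →ₗ[k] k) (f : O), z = sliceL O ψ (comul f) - ψ 1 • f}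
  have hJ : ∀ z ∈ J, ∃ U : Submodule k O, FiniteDimensional k U ∧
      (∀ y ∈ U, comul (R := k) y ∈ subTensor ⊤ U) ∧ ∀ l : O →ₗ[k] k,
      (∀ y ∈ U, slice O l (comul y) = l y • (1 : O)) → l z = 0 := by
    intro z hz
    induction hz using Submodule.span_induction with
    | mem z hz =>
      obtain ⟨ψ, f, rfl⟩ := hz
      obtain ⟨U, hf, hfin, hU⟩ := (comul_isLeftCoaction k O).exists_finite f
      refine ⟨U, hfin, hU, fun l hl => ?_⟩
      rw [map_sub, hsl, hl f hf, map_smul, map_smul, smul_eq_mul, smul_eq_mul, mul_comm, sub_self]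
    | zero => exact ⟨⊥, inferInstance, fun y hy => by simp [(mem_bot k).1 hy],
        fun l _ => map_zero l⟩
    | add x y _ _ hx hy =>
      obtain ⟨U, hfin, hU, h⟩ := hx
      obtain ⟨U', hfin', hU', h'⟩ := hy
      refine ⟨U ⊔ U', inferInstance, fun y hy => ?_, fun l hl => ?_⟩
      · obtain ⟨a, ha, b, hb, rfl⟩ := Submodule.mem_sup.1 hy
        rw [map_add]
        exact add_mem (subTensor_mono le_rfl le_sup_left (hU a ha))
          (subTensor_mono le_rfl le_sup_right (hU' b hb))
      · rw [map_add, h l fun y hy => hl y (Submodule.mem_sup_left hy),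
          h' l fun y hy => hl y (Submodule.mem_sup_right hy), add_zero]
    | smul c x _ hx =>
      obtain ⟨U, hfin, hU, h⟩ := hx
      exact ⟨U, hfin, hU, fun l hl => by rw [map_smul, h l hl, smul_zero]⟩
  have h1 : (1 : O) ∉ J := by
    intro h
    obtain ⟨U, hfin, hU, hl⟩ := hJ 1 h
    obtain ⟨U', h1', hfin', hU'⟩ := (comul_isLeftCoaction k O).exists_finite (1 : O)
    obtain ⟨l, hl1, hl'⟩ := exists_invariant_functional hred (U ⊔ U')
      (Submodule.mem_sup_right h1') (fun y hy => by
        obtain ⟨a, ha, b, hb, rfl⟩ := Submodule.mem_sup.1 hy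
        rw [map_add]
        exact add_mem (subTensor_mono le_rfl le_sup_left (hU a ha))
          (subTensor_mono le_rfl le_sup_right (hU' b hb)))
    have := hl l fun y hy => hl' y (Submodule.mem_sup_left hy)
    rw [hl1] at this
    exact one_ne_zero this
  obtain ⟨f, hf, hfJ⟩ := Submodule.exists_le_ker_of_notMem h1
  refine ⟨(f 1)⁻¹ • f, by simp [hf], fun y => ?_⟩
  have hinv : slice O f (comul y) = f y • (1 : O) := by
    rw [← sub_eq_zero, ← Module.forall_dual_apply_eq_zero_iff k]
    intro ψ
    have : f (sliceL O ψ (comul y) - ψ 1 • y) = 0 :=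
      hfJ (Submodule.subset_span ⟨ψ, y, rfl⟩)
    rw [map_sub, hsl, map_smul, smul_eq_mul] at this
    rw [map_sub, map_smul, smul_eq_mul, mul_comm]
    exact this
  have : slice O ((f 1)⁻¹ • f) = (f 1)⁻¹ • slice O f := by
    ext; simp [slice_tmul, mul_smul]
  rw [this, LinearMap.smul_apply, hinv, LinearMap.smul_apply, smul_smul, smul_eq_mul]

/-- A bilinear form `β` on a coalgebra with `β(b, c₁) c₂ = b₁ β(b₂, c)` and `β(b₁, b₂) = u(b)`.
Such a form exhibits the coalgebra as coseparable. -/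
structure IsCoseparating {k C : Type u} [Field k] [AddCommGroup C] [Module k C] [Coalgebra k C]
    (β : C →ₗ[k] C →ₗ[k] k) : Prop where
  balanced : ∀ b c, sliceL C (β b) (comul c) = slice C (β.flip c) (comul b)
  normalized : ∀ b, TensorProduct.lift β (comul b) = counit (R := k) b

/-- `β(b, c) = Λ(b S(c))` with the Haar integral `Λ`. To prove that it is balanced, `b ⊗ c` is
replaced by `b c₁ ⊗ c₂`; the map `b ⊗ c ↦ b c₁ ⊗ c₂` is surjective because of the antipode. -/
theorem exists_coseparating (hred : IsReductive k O) :
    ∃ β : O →ₗ[k] O →ₗ[k] k, IsCoseparating β := by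
  obtain ⟨Λ, hΛ1, hΛ⟩ := exists_haar hred
  let S : O →ₗ[k] O := HopfAlgebra.antipode k
  let β : O →ₗ[k] O →ₗ[k] k := (LinearMap.mul k O).compr₂ Λ |>.compl₂ S
  have hβ : ∀ b c, β b c = Λ (b * S c) := fun b c => rfl
  have hS1 : ∀ c : O, LinearMap.mul' k O (rTensor O S (comul c)) =
      algebraMap k O (counit c) := HopfAlgebra.mul_antipode_rTensor_comul_apply
  have hS2 : ∀ c : O, LinearMap.mul' k O (lTensor O S (comul c)) =
      algebraMap k O (counit c) := HopfAlgebra.mul_antipode_lTensor_comul_apply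
  let L : O ⊗[k] O →ₗ[k] O := (TensorProduct.lid k O).toLinearMap ∘ₗ
    rTensor O (TensorProduct.lift β) ∘ₗ (TensorProduct.assoc k O O O).symm.toLinearMap ∘ₗ
    lTensor O comul
  let R : O ⊗[k] O →ₗ[k] O := (TensorProduct.rid k O).toLinearMap ∘ₗ
    lTensor O (TensorProduct.lift β) ∘ₗ (TensorProduct.assoc k O O O).toLinearMap ∘ₗ
    rTensor O comul
  have hL : ∀ b c, L (b ⊗ₜ c) = sliceL O (β b) (comul c) := by
    intro b c
    simp only [L, comp_apply, lTensor_tmul]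
    generalize comul (R := k) c = t
    induction t with
    | zero => simp
    | add a c ha hc => simp only [tmul_add, map_add, ha, hc]
    | tmul x y => simp
  have hR : ∀ b c, R (b ⊗ₜ c) = slice O (β.flip c) (comul b) := by
    intro b c
    simp only [R, comp_apply, rTensor_tmul]
    generalize comul (R := k) b = t
    induction t with
    | zero => simp
    | add a c ha hc => simp only [add_tmul, map_add, ha, hc]
    | tmul x y => simp [slice_tmul]
  have hLG : ∀ b c, L (rTensor O (LinearMap.mulLeft k b) (comul c)) =
      Λ b • c := by
    intro b c
    let Ψ : O ⊗[k] (O ⊗[k] O) →ₗ[k] O := (TensorProduct.lid k O).toLinearMap ∘ₗ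
      rTensor O (Λ ∘ₗ LinearMap.mulLeft k b ∘ₗ LinearMap.mul' k O ∘ₗ
        lTensor O S) ∘ₗ (TensorProduct.assoc k O O O).symm.toLinearMap
    have e1 : L ∘ₗ rTensor O (LinearMap.mulLeft k b) =
        Ψ ∘ₗ lTensor O comul := by
      apply TensorProduct.ext'
      intro x y
      simp only [L, Ψ, comp_apply, rTensor_tmul, lTensor_tmul]
      generalize comul (R := k) y = t
      induction t with
      | zero => simp
      | add a c ha hc => simp only [tmul_add, map_add, ha, hc]
      | tmul x y => simp [hβ, mul_assoc]
    have e2 : L (rTensor O (LinearMap.mulLeft k b) (comul c)) =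
        Ψ (lTensor O comul (comul c)) :=
      LinearMap.congr_fun e1 (comul c)
    rw [e2, ← Coalgebra.coassoc_apply]
    simp only [Ψ, comp_apply, LinearEquiv.coe_coe, LinearEquiv.symm_apply_apply]
    rw [← rTensor_comp_apply]
    have e3 : (Λ ∘ₗ LinearMap.mulLeft k b ∘ₗ LinearMap.mul' k O ∘ₗ lTensor O S) ∘ₗ
        comul = Λ b • counit := by
      refine LinearMap.ext fun y => ?_
      simp only [comp_apply, hS2, LinearMap.mulLeft_apply, LinearMap.smul_apply]
      rw [Algebra.algebraMap_eq_smul_one, mul_smul_comm, mul_one, map_smul, smul_eq_mul,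
        smul_eq_mul, mul_comm]
    rw [e3, LinearMap.rTensor_smul, LinearMap.smul_apply, map_smul,
      Coalgebra.rTensor_counit_comul]
    simp
  have hRG : ∀ b c, R (rTensor O (LinearMap.mulLeft k b) (comul c)) =
      Λ b • c := by
    intro b c
    have e1 : R ∘ₗ rTensor O (LinearMap.mulLeft k b) =
        slice O Λ ∘ₗ LinearMap.mulLeft k (comul b) ∘ₗ
        lTensor O (LinearMap.mul' k O ∘ₗ lTensor O S) ∘ₗ
        (TensorProduct.assoc k O O O).toLinearMap ∘ₗ rTensor O comul := by
      apply TensorProduct.ext'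
      intro x y
      simp only [comp_apply, rTensor_tmul, LinearMap.mulLeft_apply, hR,
        Bialgebra.comul_mul]
      generalize comul (R := k) b = s
      generalize comul (R := k) x = t
      induction t with
      | zero => simp
      | add a c ha hc => simp only [add_tmul, mul_add, map_add, ha, hc]
      | tmul p q =>
        induction s with
        | zero => simp
        | add a c ha hc => simp only [add_mul, map_add, ha, hc]
        | tmul p' q' => simp [slice_tmul, hβ, mul_assoc]
    have e2 := LinearMap.congr_fun e1 (comul c)
    simp only [comp_apply] at e2
    rw [LinearEquiv.coe_coe, Coalgebra.coassoc_apply, ← lTensor_comp_apply] at e2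
    have e3 : (LinearMap.mul' k O ∘ₗ lTensor O S) ∘ₗ comul =
        Algebra.linearMap k O ∘ₗ counit := by
      refine LinearMap.ext fun y => ?_
      simp only [comp_apply, hS2, Algebra.linearMap_apply]
    have e4 : lTensor O (Algebra.linearMap k O ∘ₗ counit)
        (comul c) = c ⊗ₜ[k] (1 : O) := by
      rw [lTensor_comp_apply, Coalgebra.lTensor_counit_comul]
      simp
    have e5 : ∀ s : O ⊗[k] O, slice O Λ (s * c ⊗ₜ[k] (1 : O)) = slice O Λ s * c := by
      intro s
      induction s with
      | zero => simp
      | add a c ha hc => simp only [add_mul, map_add, ha, hc]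
      | tmul p' q' => simp [slice_tmul]
    rw [e2, e3, e4, LinearMap.mulLeft_apply, e5, hΛ, smul_mul_assoc, one_mul]
  -- `b ⊗ c ↦ b c₁ ⊗ c₂`, which is surjective because of the antipode
  let gal : O ⊗[k] O →ₗ[k] O ⊗[k] O := rTensor O (LinearMap.mul' k O) ∘ₗ
    (TensorProduct.assoc k O O O).symm.toLinearMap ∘ₗ lTensor O comul
  have hgal : ∀ b c, gal (b ⊗ₜ c) =
      rTensor O (LinearMap.mulLeft k b) (comul c) := by
    intro b c
    simp only [gal, comp_apply, lTensor_tmul]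
    generalize comul (R := k) c = t
    induction t with
    | zero => simp
    | add a c ha hc => simp only [tmul_add, map_add, ha, hc]
    | tmul x y => simp
  have hGsurj : ∀ b c, ∃ t : O ⊗[k] O, b ⊗ₜ[k] c = gal t := by
    intro b c
    refine ⟨rTensor O (LinearMap.mulLeft k b ∘ₗ S) (comul c), ?_⟩
    let Ψ : O ⊗[k] (O ⊗[k] O) →ₗ[k] O ⊗[k] O :=
      rTensor O (LinearMap.mulLeft k b ∘ₗ LinearMap.mul' k O ∘ₗ
        rTensor O S) ∘ₗ (TensorProduct.assoc k O O O).symm.toLinearMap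
    have e1 : ∀ s : O ⊗[k] O, gal
        (rTensor O (LinearMap.mulLeft k b ∘ₗ S) s) =
        Ψ (lTensor O comul s) := by
      intro s
      induction s with
      | zero => simp
      | add a c ha hc => simp only [map_add, ha, hc]
      | tmul x y =>
        simp only [Ψ, hgal, comp_apply, rTensor_tmul, lTensor_tmul]
        generalize comul (R := k) y = t
        induction t with
        | zero => simp
        | add a c ha hc => simp only [tmul_add, map_add, ha, hc]
        | tmul x y => simp
    rw [e1, ← Coalgebra.coassoc_apply]
    simp only [Ψ, comp_apply, LinearEquiv.coe_coe, LinearEquiv.symm_apply_apply]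
    rw [← rTensor_comp_apply]
    have e3 : (LinearMap.mulLeft k b ∘ₗ LinearMap.mul' k O ∘ₗ rTensor O S) ∘ₗ
        comul = (LinearMap.toSpanSingleton k O b) ∘ₗ counit := by
      refine LinearMap.ext fun y => ?_
      simp only [comp_apply, hS1, LinearMap.mulLeft_apply,
        LinearMap.toSpanSingleton_apply]
      rw [Algebra.algebraMap_eq_smul_one, mul_smul_comm, mul_one]
    rw [e3, rTensor_comp_apply, Coalgebra.rTensor_counit_comul]
    simp
  refine ⟨β, fun b c => ?_, fun b => ?_⟩
  · rw [← hL, ← hR]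
    obtain ⟨t, ht⟩ := hGsurj b c
    rw [ht]
    clear ht
    induction t with
    | zero => simp
    | add x y hx hy => simp only [map_add, hx, hy]
    | tmul x y => rw [hgal, hLG, hRG]
  · have : TensorProduct.lift β = Λ ∘ₗ LinearMap.mul' k O ∘ₗ lTensor O S := by
      ext; simp [hβ]
    rw [this, comp_apply, comp_apply, hS2, Algebra.algebraMap_eq_smul_one,
      map_smul, hΛ1, smul_eq_mul, mul_one]

end Haar

/-! ### Averages of linear maps between comodules -/


section Averaging

variable {k C M N N' : Type u} [Field k] [AddCommGroup C] [Module k C] [Coalgebra k C]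
  [AddCommGroup M] [Module k M] [AddCommGroup N] [Module k N] [AddCommGroup N'] [Module k N']

/-- `c ⊗ c' ⊗ n ↦ β(c, c') n`. -/
def contractL (β : C →ₗ[k] C →ₗ[k] k) (N : Type u) [AddCommGroup N] [Module k N] :
    C ⊗[k] (C ⊗[k] N) →ₗ[k] N :=
  (TensorProduct.lid k N).toLinearMap ∘ₗ rTensor N (TensorProduct.lift β) ∘ₗ
    (TensorProduct.assoc k C C N).symm.toLinearMap

/-- `n ⊗ c ⊗ c' ↦ β(c, c') n`. -/
def contractR (β : C →ₗ[k] C →ₗ[k] k) (N : Type u) [AddCommGroup N] [Module k N] :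
    (N ⊗[k] C) ⊗[k] C →ₗ[k] N :=
  (TensorProduct.rid k N).toLinearMap ∘ₗ lTensor N (TensorProduct.lift β) ∘ₗ
    (TensorProduct.assoc k N C C).toLinearMap

variable (β : C →ₗ[k] C →ₗ[k] k)

theorem contractL_tmul (c : C) (t : C ⊗[k] N) : contractL β N (c ⊗ₜ t) = sliceL N (β c) t := by
  induction t with
  | zero => simp
  | add a c ha hc => simp only [tmul_add, map_add, ha, hc]
  | tmul x y => simp [contractL]

theorem contractR_tmul (t : N ⊗[k] C) (c : C) :
    contractR β N (t ⊗ₜ c) = slice N (β.flip c) t := by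
  induction t with
  | zero => simp
  | add a c ha hc => simp only [add_tmul, map_add, ha, hc]
  | tmul x y => simp [contractR, slice_tmul]

theorem contractL_natural (g : N →ₗ[k] N') (t : C ⊗[k] (C ⊗[k] N)) :
    contractL β N' (lTensor C (lTensor C g) t) = g (contractL β N t) := by
  induction t with
  | zero => simp
  | add a c ha hc => simp only [map_add, ha, hc]
  | tmul x y => rw [lTensor_tmul, contractL_tmul, contractL_tmul, sliceL_lTensor]

theorem contractR_natural (g : N →ₗ[k] N') (t : (N ⊗[k] C) ⊗[k] C) :
    contractR β N' (rTensor C (rTensor C g) t) = g (contractR β N t) := by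
  induction t with
  | zero => simp
  | add a c ha hc => simp only [map_add, ha, hc]
  | tmul x y => rw [rTensor_tmul, contractR_tmul, contractR_tmul, slice_rTensor]

/-- The average `m ↦ β(m₋₁, f(m₀)₋₁) f(m₀)₀` of a linear map between left comodules. -/
def avgL (ρ : M →ₗ[k] C ⊗[k] M) (σ : N →ₗ[k] C ⊗[k] N) (f : M →ₗ[k] N) : M →ₗ[k] N :=
  contractL β N ∘ₗ lTensor C (σ ∘ₗ f) ∘ₗ ρ

/-- The average `m ↦ f(m₀)₀ β(f(m₀)₁, m₁)` of a linear map between right comodules. -/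
def avgR (ρ : M →ₗ[k] M ⊗[k] C) (σ : N →ₗ[k] N ⊗[k] C) (f : M →ₗ[k] N) : M →ₗ[k] N :=
  contractR β N ∘ₗ rTensor C (σ ∘ₗ f) ∘ₗ ρ

variable {β}

section left

variable {ρ : M →ₗ[k] C ⊗[k] M} {σ : N →ₗ[k] C ⊗[k] N} {σ' : N' →ₗ[k] C ⊗[k] N'}

/-- Balancedness of the form makes the average colinear. -/
theorem avgL_colinear (hβ : IsCoseparating β) (hρ : IsLeftCoaction ρ)
    (hσ : IsLeftCoaction σ) (f : M →ₗ[k] N) (x : M) :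
    σ (avgL β ρ σ f x) = lTensor C (avgL β ρ σ f) (ρ x) := by
  have key : ∀ (c : C) (t : C ⊗[k] N), sliceL (C ⊗[k] N) (β c)
      (TensorProduct.assoc k C C N (rTensor N comul t)) =
      lTensor C (contractL β N)
        (TensorProduct.assoc k C C (C ⊗[k] N) (comul c ⊗ₜ t)) := by
    intro c t
    induction t with
    | zero => simp
    | add a c ha hc => simp only [tmul_add, map_add, ha, hc]
    | tmul x y =>
      have e1 : ∀ s : C ⊗[k] C, sliceL (C ⊗[k] N) (β c) (TensorProduct.assoc k C C N (s ⊗ₜ y)) =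
          sliceL C (β c) s ⊗ₜ y := by
        intro s
        induction s with
        | zero => simp
        | add a c ha hc => simp only [add_tmul, map_add, ha, hc]
        | tmul a b => simp [smul_tmul']
      have e2 : ∀ s : C ⊗[k] C, lTensor C (contractL β N)
          (TensorProduct.assoc k C C (C ⊗[k] N) (s ⊗ₜ (x ⊗ₜ y))) =
          slice C (β.flip x) s ⊗ₜ y := by
        intro s
        induction s with
        | zero => simp
        | add a c ha hc => simp only [add_tmul, map_add, ha, hc]
        | tmul a b => simp [contractL_tmul, slice_tmul, smul_tmul']
      rw [rTensor_tmul, e1, e2, hβ.balanced]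
  have key2 : σ ∘ₗ contractL β N ∘ₗ lTensor C σ = lTensor C (contractL β N) ∘ₗ
      lTensor C (lTensor C σ) ∘ₗ (TensorProduct.assoc k C C N).toLinearMap ∘ₗ
      rTensor N comul := by
    apply TensorProduct.ext'
    intro c y
    have h1 : σ (sliceL N (β c) (σ y)) = sliceL (C ⊗[k] N) (β c) (lTensor C σ (σ y)) :=
      (sliceL_lTensor _ _ _).symm
    simp only [comp_apply, lTensor_tmul, rTensor_tmul,
      contractL_tmul]
    rw [h1, ← hσ.coassoc_apply, key]
    congr 1
    generalize comul (R := k) c = s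
    induction s with
    | zero => simp
    | add a c ha hc => simp only [add_tmul, map_add, ha, hc]
    | tmul a b => simp
  have h1 : σ (avgL β ρ σ f x) = (σ ∘ₗ contractL β N ∘ₗ lTensor C σ)
      (lTensor C f (ρ x)) := by
    simp only [avgL, comp_apply, LinearMap.lTensor_comp]
  have h2 : lTensor C (avgL β ρ σ f) (ρ x) = lTensor C (contractL β N)
      (lTensor C (lTensor C σ) (lTensor C (lTensor C f)
        (lTensor C ρ (ρ x)))) := by
    simp only [avgL, LinearMap.lTensor_comp, comp_apply]
  have h3 : lTensor C (lTensor C f) (TensorProduct.assoc k C C M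
      (rTensor M comul (ρ x))) = TensorProduct.assoc k C C N
      (rTensor N comul (lTensor C f (ρ x))) := by
    rw [rTensor_lTensor]
    refine (assoc_map_apply LinearMap.id LinearMap.id f _).symm.trans ?_
    rw [TensorProduct.map_id]
    rfl
  rw [h1, key2, h2, ← hρ.coassoc_apply, h3]
  rfl

/-- The normalization of the form makes averaging a projection to the colinear maps. -/
theorem avgL_eq_self (hβ : IsCoseparating β) (hρ : IsLeftCoaction ρ) {f : M →ₗ[k] N}
    (hf : σ ∘ₗ f = lTensor C f ∘ₗ ρ) : avgL β ρ σ f = f := by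
  refine LinearMap.ext fun x => ?_
  have : avgL β ρ σ f x = contractL β N (lTensor C (lTensor C f)
      (lTensor C ρ (ρ x))) := by
    rw [avgL, hf]; simp only [comp_apply, LinearMap.lTensor_comp]
  rw [this, contractL_natural, ← hρ.coassoc_apply]
  simp only [contractL, comp_apply, LinearEquiv.coe_coe, LinearEquiv.symm_apply_apply]
  rw [← rTensor_comp_apply,
    show TensorProduct.lift β ∘ₗ comul = counit from LinearMap.ext hβ.normalized]
  exact congrArg f (hρ.counit_apply x)

theorem avgL_comp_left {g : N →ₗ[k] N'} (hg : σ' ∘ₗ g = lTensor C g ∘ₗ σ)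
    (f : M →ₗ[k] N) : avgL β ρ σ' (g ∘ₗ f) = g ∘ₗ avgL β ρ σ f := by
  refine LinearMap.ext fun x => ?_
  rw [avgL, ← comp_assoc f, hg]
  simp only [comp_apply, LinearMap.lTensor_comp, contractL_natural, avgL]

theorem avgL_comp_right {ρ' : N' →ₗ[k] C ⊗[k] N'} {e : N' →ₗ[k] M}
    (he : ρ ∘ₗ e = lTensor C e ∘ₗ ρ') (f : M →ₗ[k] N) :
    avgL β ρ' σ (f ∘ₗ e) = avgL β ρ σ f ∘ₗ e := by
  rw [avgL, avgL, comp_assoc, comp_assoc, he,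
    ← comp_assoc e f, LinearMap.lTensor_comp, comp_assoc]

theorem avgL_add (f g : M →ₗ[k] N) : avgL β ρ σ (f + g) = avgL β ρ σ f + avgL β ρ σ g := by
  simp only [avgL, LinearMap.comp_add, LinearMap.lTensor_add, LinearMap.add_comp]

theorem avgL_mem {P : Submodule k M} {Q : Submodule k N} (hP : ∀ x ∈ P, ρ x ∈ subTensor ⊤ P)
    (hQ : ∀ y ∈ Q, σ y ∈ subTensor ⊤ Q) {f : M →ₗ[k] N} (hf : ∀ x ∈ P, f x ∈ Q) {x : M}
    (hx : x ∈ P) : avgL β ρ σ f x ∈ Q := by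
  refine subTensor_induction (Q.comap (contractL β N ∘ₗ lTensor C (σ ∘ₗ f)))
    (fun a _ b hb => ?_) (hP x hx)
  rw [mem_comap, comp_apply, lTensor_tmul, contractL_tmul]
  exact sliceL_mem (hQ _ (hf b hb)) _

end left

section right

variable {ρ : M →ₗ[k] M ⊗[k] C} {σ : N →ₗ[k] N ⊗[k] C} {σ' : N' →ₗ[k] N' ⊗[k] C}

theorem IsRightCoaction.coassoc_apply (hρ : IsRightCoaction ρ) (x : M) :
    (TensorProduct.assoc k M C C).symm (lTensor M Coalgebra.comul (ρ x)) =
      rTensor C ρ (ρ x) := by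
  rw [LinearEquiv.symm_apply_eq]
  exact (LinearMap.congr_fun hρ.coassoc x).symm

theorem IsRightCoaction.counit_apply (hρ : IsRightCoaction ρ) (x : M) :
    slice M Coalgebra.counit (ρ x) = x :=
  LinearMap.congr_fun hρ.counit x

/-- Balancedness of the form makes the average colinear. -/
theorem avgR_colinear (hβ : IsCoseparating β) (hρ : IsRightCoaction ρ)
    (hσ : IsRightCoaction σ) (f : M →ₗ[k] N) (x : M) :
    σ (avgR β ρ σ f x) = rTensor C (avgR β ρ σ f) (ρ x) := by
  have key : ∀ (c : C) (t : N ⊗[k] C), slice (N ⊗[k] C) (β.flip c)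
      ((TensorProduct.assoc k N C C).symm (lTensor N comul t)) =
      rTensor C (contractR β N)
        ((TensorProduct.assoc k (N ⊗[k] C) C C).symm (t ⊗ₜ comul c)) := by
    intro c t
    induction t with
    | zero => simp
    | add a c ha hc => simp only [add_tmul, map_add, ha, hc]
    | tmul y x =>
      have e1 : ∀ s : C ⊗[k] C, slice (N ⊗[k] C) (β.flip c)
          ((TensorProduct.assoc k N C C).symm (y ⊗ₜ s)) = y ⊗ₜ slice C (β.flip c) s := by
        intro s
        induction s with
        | zero => simp
        | add a c ha hc => simp only [tmul_add, map_add, ha, hc]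
        | tmul a b => simp [slice_tmul]
      have e2 : ∀ s : C ⊗[k] C, rTensor C (contractR β N)
          ((TensorProduct.assoc k (N ⊗[k] C) C C).symm ((y ⊗ₜ x) ⊗ₜ s)) =
          y ⊗ₜ sliceL C (β x) s := by
        intro s
        induction s with
        | zero => simp
        | add a c ha hc => simp only [tmul_add, map_add, ha, hc]
        | tmul a b =>
          simp [contractR_tmul, slice_tmul, TensorProduct.smul_tmul]
      rw [lTensor_tmul, e1, e2, hβ.balanced]
  have key2 : σ ∘ₗ contractR β N ∘ₗ rTensor C σ = rTensor C (contractR β N) ∘ₗ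
      rTensor C (rTensor C σ) ∘ₗ
      (TensorProduct.assoc k N C C).symm.toLinearMap ∘ₗ lTensor N comul := by
    apply TensorProduct.ext'
    intro y c
    have h1 : σ (slice N (β.flip c) (σ y)) =
        slice (N ⊗[k] C) (β.flip c) (rTensor C σ (σ y)) := (slice_rTensor _ _ _).symm
    simp only [comp_apply, lTensor_tmul, rTensor_tmul,
      contractR_tmul]
    rw [h1, ← hσ.coassoc_apply, key]
    congr 1
    generalize comul (R := k) c = s
    induction s with
    | zero => simp
    | add a c ha hc => simp only [tmul_add, map_add, ha, hc]
    | tmul a b => simp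
  have h1 : σ (avgR β ρ σ f x) = (σ ∘ₗ contractR β N ∘ₗ rTensor C σ)
      (rTensor C f (ρ x)) := by
    simp only [avgR, comp_apply, LinearMap.rTensor_comp]
  have h2 : rTensor C (avgR β ρ σ f) (ρ x) = rTensor C (contractR β N)
      (rTensor C (rTensor C σ) (rTensor C (rTensor C f)
        (rTensor C ρ (ρ x)))) := by
    simp only [avgR, LinearMap.rTensor_comp, comp_apply]
  have h3 : ∀ t : M ⊗[k] C, rTensor C (rTensor C f)
      ((TensorProduct.assoc k M C C).symm (lTensor M comul t)) =
      (TensorProduct.assoc k N C C).symm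
      (lTensor N comul (rTensor C f t)) := by
    intro t
    induction t with
    | zero => simp
    | add a c ha hc => simp only [map_add, ha, hc]
    | tmul y c =>
      simp only [lTensor_tmul, rTensor_tmul]
      generalize comul (R := k) c = s
      induction s with
      | zero => simp
      | add a c ha hc => simp only [tmul_add, map_add, ha, hc]
      | tmul a b => simp
  rw [h1, key2, h2, ← hρ.coassoc_apply, h3]
  rfl

/-- The normalization of the form makes averaging a projection to the colinear maps. -/
theorem avgR_eq_self (hβ : IsCoseparating β) (hρ : IsRightCoaction ρ) {f : M →ₗ[k] N}
    (hf : σ ∘ₗ f = rTensor C f ∘ₗ ρ) : avgR β ρ σ f = f := by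
  refine LinearMap.ext fun x => ?_
  have : avgR β ρ σ f x = contractR β N (rTensor C (rTensor C f)
      (rTensor C ρ (ρ x))) := by
    rw [avgR, hf]; simp only [comp_apply, LinearMap.rTensor_comp]
  rw [this, contractR_natural, ← hρ.coassoc_apply]
  simp only [contractR, comp_apply, LinearEquiv.coe_coe, LinearEquiv.apply_symm_apply]
  rw [← lTensor_comp_apply,
    show TensorProduct.lift β ∘ₗ comul = counit from LinearMap.ext hβ.normalized]
  exact congrArg f (hρ.counit_apply x)

theorem avgR_comp_left {g : N →ₗ[k] N'} (hg : σ' ∘ₗ g = rTensor C g ∘ₗ σ)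
    (f : M →ₗ[k] N) : avgR β ρ σ' (g ∘ₗ f) = g ∘ₗ avgR β ρ σ f := by
  refine LinearMap.ext fun x => ?_
  rw [avgR, ← comp_assoc f, hg]
  simp only [comp_apply, LinearMap.rTensor_comp, contractR_natural, avgR]

theorem avgR_comp_right {ρ' : N' →ₗ[k] N' ⊗[k] C} {e : N' →ₗ[k] M}
    (he : ρ ∘ₗ e = rTensor C e ∘ₗ ρ') (f : M →ₗ[k] N) :
    avgR β ρ' σ (f ∘ₗ e) = avgR β ρ σ f ∘ₗ e := by
  rw [avgR, avgR, comp_assoc, comp_assoc, he,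
    ← comp_assoc e f, LinearMap.rTensor_comp, comp_assoc]

theorem avgR_add (f g : M →ₗ[k] N) : avgR β ρ σ (f + g) = avgR β ρ σ f + avgR β ρ σ g := by
  simp only [avgR, LinearMap.comp_add, LinearMap.rTensor_add, LinearMap.add_comp]

theorem avgR_mem {P : Submodule k M} {Q : Submodule k N} (hP : ∀ x ∈ P, ρ x ∈ subTensor P ⊤)
    (hQ : ∀ y ∈ Q, σ y ∈ subTensor Q ⊤) {f : M →ₗ[k] N} (hf : ∀ x ∈ P, f x ∈ Q) {x : M}
    (hx : x ∈ P) : avgR β ρ σ f x ∈ Q := by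
  refine subTensor_induction (Q.comap (contractR β N ∘ₗ rTensor C (σ ∘ₗ f)))
    (fun a ha b _ => ?_) (hP x hx)
  rw [mem_comap, comp_apply, rTensor_tmul, contractR_tmul]
  exact slice_mem (hQ _ (hf a ha)) _

end right

end Averaging

/-! ### The rigid subalgebra as a deformation retract -/

section Bicolinear

variable {k O : Type u} [Field k] [AddCommGroup O] [Module k O] [Coalgebra k O]

namespace RelDGA

/-- Endomorphisms of `A` as a bicomodule. -/
structure Bicolinear (A : RelDGA k O) (α : A →ₗ[k] A) : Prop where
  left : ∀ x, A.coactL (α x) = lTensor O α (A.coactL x)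
  right : ∀ x, A.coactR (α x) = rTensor O α (A.coactR x)

variable {A : RelDGA k O}

namespace Bicolinear

theorem id : A.Bicolinear LinearMap.id := ⟨fun x => by simp, fun x => by simp⟩

theorem comp {α β : A →ₗ[k] A} (hα : A.Bicolinear α) (hβ : A.Bicolinear β) :
    A.Bicolinear (α ∘ₗ β) :=
  ⟨fun x => by rw [comp_apply, hα.left, hβ.left, lTensor_comp_apply],
    fun x => by rw [comp_apply, hα.right, hβ.right, rTensor_comp_apply]⟩

theorem sub {α β : A →ₗ[k] A} (hα : A.Bicolinear α) (hβ : A.Bicolinear β) :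
    A.Bicolinear (α - β) :=
  ⟨fun x => by rw [LinearMap.sub_apply, map_sub, hα.left, hβ.left, LinearMap.lTensor_sub,
      LinearMap.sub_apply],
    fun x => by rw [LinearMap.sub_apply, map_sub, hα.right, hβ.right, LinearMap.rTensor_sub,
      LinearMap.sub_apply]⟩

theorem smul {α : A →ₗ[k] A} (hα : A.Bicolinear α) (c : k) : A.Bicolinear (c • α) :=
  ⟨fun x => by rw [LinearMap.smul_apply, map_smul, hα.left, LinearMap.lTensor_smul,
      LinearMap.smul_apply],
    fun x => by rw [LinearMap.smul_apply, map_smul, hα.right, LinearMap.rTensor_smul,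
      LinearMap.smul_apply]⟩

theorem d : A.Bicolinear A.d :=
  ⟨fun x => LinearMap.congr_fun A.coactL_d x, fun x => LinearMap.congr_fun A.coactR_d x⟩

end Bicolinear

variable (A)

/-- The operator which multiplies the elements of degree `n` by `a n`. -/
def dOp (a : ℤ → k) : A →ₗ[k] A := degOp A.deg A.internal a

/-- The operator `x ↦ c ^ deg x`. -/
def wt (c : k) : A →ₗ[k] A := A.dOp fun n => c ^ n

/-- The projection to the elements of degree `n`. -/
def proj (n : ℤ) : A →ₗ[k] A := A.dOp (Pi.single n 1)

variable {A}

theorem dOp_apply (a : ℤ → k) {n : ℤ} {x : A} (hx : x ∈ A.deg n) : A.dOp a x = a n • x :=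
  degOp_apply _ _ _ hx

theorem wt_apply (c : k) {n : ℤ} {x : A} (hx : x ∈ A.deg n) : A.wt c x = c ^ n • x :=
  degOp_apply _ _ _ hx

theorem proj_of_mem {n : ℤ} {x : A} (hx : x ∈ A.deg n) : A.proj n x = x := by
  rw [proj, dOp_apply _ hx, Pi.single_eq_same, one_smul]

theorem proj_of_ne {m n : ℤ} (h : n ≠ m) {x : A} (hx : x ∈ A.deg n) : A.proj m x = 0 := by
  rw [proj, dOp_apply _ hx, Pi.single_eq_of_ne h, zero_smul]

theorem proj_mem (n : ℤ) (x : A) : A.proj n x ∈ A.deg n := degOp_mem _ _ _ _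

theorem sgn_eq_wt : A.sgn = A.wt (-1) := signOp_eq_degOp _ _

theorem dOp_bicolinear (a : ℤ → k) : A.Bicolinear (A.dOp a) := by
  constructor
  · refine fun x => LinearMap.congr_fun (graded_ext A.internal (f := A.coactL ∘ₗ A.dOp a)
      (g := lTensor O (A.dOp a) ∘ₗ A.coactL) fun n x hx => ?_) x
    have h := map_eq_on_subTensor (f := LinearMap.id (R := k) (M := O)) (f' := LinearMap.id)
      (g' := a n • LinearMap.id) (fun _ _ => rfl) (fun y hy => dOp_apply a hy)
      (A.coactL_deg n x hx)
    refine Eq.trans ?_ h.symm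
    rw [comp_apply, dOp_apply a hx, map_smul, TensorProduct.map_smul_right,
      TensorProduct.map_id]
    rfl
  · refine fun x => LinearMap.congr_fun (graded_ext A.internal (f := A.coactR ∘ₗ A.dOp a)
      (g := rTensor O (A.dOp a) ∘ₗ A.coactR) fun n x hx => ?_) x
    have h := map_eq_on_subTensor (g := LinearMap.id (R := k) (M := O)) (g' := LinearMap.id)
      (f' := a n • LinearMap.id) (fun y hy => dOp_apply a hy) (fun _ _ => rfl)
      (A.coactR_deg n x hx)
    refine Eq.trans ?_ h.symm
    rw [comp_apply, dOp_apply a hx, map_smul, TensorProduct.map_smul_left,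
      TensorProduct.map_id]
    rfl

theorem wt_bicolinear (c : k) : A.Bicolinear (A.wt c) := dOp_bicolinear _

theorem sgn_bicolinear : A.Bicolinear A.sgn := sgn_eq_wt (A := A) ▸ wt_bicolinear _

theorem dOp_comm_of_deg {α : A →ₗ[k] A} (hα : ∀ n, ∀ x ∈ A.deg n, α x ∈ A.deg n) (a : ℤ → k)
    (x : A) : A.dOp a (α x) = α (A.dOp a x) := by
  refine LinearMap.congr_fun (graded_ext A.internal (f := A.dOp a ∘ₗ α) (g := α ∘ₗ A.dOp a)
    fun n x hx => ?_) x
  rw [comp_apply, comp_apply, dOp_apply a hx, dOp_apply a (hα n x hx), map_smul]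

theorem dOp_comp (a b : ℤ → k) (x : A) : A.dOp a (A.dOp b x) = A.dOp (a * b) x := by
  refine LinearMap.congr_fun (graded_ext A.internal (f := A.dOp a ∘ₗ A.dOp b) (g := A.dOp (a * b))
    fun n x hx => ?_) x
  rw [comp_apply, dOp_apply b hx, map_smul, dOp_apply a hx, dOp_apply _ hx, smul_smul,
    mul_comm]
  rfl

theorem wt_of_deg_shift {α : A →ₗ[k] A} {j : ℤ} (hα : ∀ n, ∀ x ∈ A.deg n, α x ∈ A.deg (n + j))
    {c : k} (hc : c ≠ 0) (x : A) : A.wt c (α x) = c ^ j • α (A.wt c x) := by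
  refine LinearMap.congr_fun (graded_ext A.internal (f := A.wt c ∘ₗ α)
    (g := c ^ j • α ∘ₗ A.wt c) fun n x hx => ?_) x
  rw [comp_apply, LinearMap.smul_apply, comp_apply, wt_apply c hx,
    wt_apply c (hα n x hx), map_smul, smul_smul, zpow_add₀ hc, mul_comm]

theorem sgn_sgn (x : A) : A.sgn (A.sgn x) = x := by
  rw [sgn_eq_wt, wt, dOp_comp]
  refine LinearMap.congr_fun (graded_ext A.internal (g := LinearMap.id) fun n x hx => ?_) x
  rw [dOp_apply _ hx, Pi.mul_apply, ← mul_zpow]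
  simp

theorem sgn_apply {n : ℤ} {x : A} (hx : x ∈ A.deg n) : A.sgn x = ((-1) ^ n : k) • x := by
  rw [sgn_eq_wt, wt_apply _ hx]

theorem wt_sgn (c : k) (x : A) : A.wt c (A.sgn x) = A.sgn (A.wt c x) := by
  rw [sgn_eq_wt, wt, wt, dOp_comp, dOp_comp, mul_comm]

theorem sgn_of_deg_shift {α : A →ₗ[k] A} {j : ℤ} (hα : ∀ n, ∀ x ∈ A.deg n, α x ∈ A.deg (n + j))
    (x : A) : A.sgn (α x) = ((-1) ^ j : k) • α (A.sgn x) := by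
  rw [sgn_eq_wt, wt_of_deg_shift hα (by simp)]

theorem sgn_d (x : A) : A.sgn (A.d x) = -A.d (A.sgn x) := by
  rw [sgn_of_deg_shift A.d_deg]; simp

theorem wt_d {c : k} (hc : c ≠ 0) (x : A) : A.wt c (A.d x) = c • A.d (A.wt c x) := by
  rw [wt_of_deg_shift A.d_deg hc, zpow_one]

theorem d_d_apply (x : A) : A.d (A.d x) = 0 := LinearMap.congr_fun A.d_d x

theorem wt_unit (c : k) (f : O) : A.wt c (A.unit f) = A.unit f := by
  rw [wt_apply c (A.unit_deg f), zpow_zero, one_smul]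

theorem sgn_unit (f : O) : A.sgn (A.unit f) = A.unit f := by rw [sgn_eq_wt, wt_unit]

/-- A graded sub-bicomodule `B` of `A`, which is a rigid relative DGA with the structure of `A`,
together with a deformation retraction of `A` to `B` by bicomodule maps. -/
structure Retract (A : RelDGA k O) where
  B : Submodule k A
  h : A →ₗ[k] A
  p : A →ₗ[k] A
  h_bicolinear : A.Bicolinear h
  p_bicolinear : A.Bicolinear p
  p_mem : ∀ x, p x ∈ B
  p_eq : ∀ x ∈ B, p x = x
  h_eq : ∀ x ∈ B, h x = 0
  homotopy : ∀ x, A.d (h x) + h (A.d x) = x - p x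
  h_deg : ∀ n, ∀ x ∈ A.deg n, h x ∈ A.deg (n + -1)
  dOp_mem : ∀ a, ∀ x ∈ B, A.dOp a x ∈ B
  eq_zero : ∀ n < 0, ∀ x ∈ B, x ∈ A.deg n → x = 0
  exists_unit : ∀ x ∈ B, x ∈ A.deg 0 → ∃ f, A.unit f = x
  unit_mem : ∀ f, A.unit f ∈ B
  unit_injective : Function.Injective A.unit
  mul_mem : ∀ t ∈ A.cot, t ∈ subTensor B B → A.m t ∈ B
  d_mem : ∀ x ∈ B, A.d x ∈ B

/-- A sub-DGA quasi-isomorphic to `A` is a deformation retract by linear algebra over `k`, and the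
homotopy is made bicolinear by averaging. -/
theorem exists_retract {β : O →ₗ[k] O →ₗ[k] k} (hβ : IsCoseparating β) {R : RelDGA k O}
    (j : Hom R A) (hj : Function.Injective j.toLin) (hR : R.IsRigid) (hq : j.IsQuasiIso) :
    Nonempty (Retract A) := by
  have jd : ∀ x, A.d (j.toLin x) = j.toLin (R.d x) := fun x => LinearMap.congr_fun j.map_d x
  let B : Submodule k A := LinearMap.range j.toLin
  have hB : ∀ x ∈ B, ∃ r, j.toLin r = x := fun x hx => hx
  have B_d : ∀ x ∈ B, A.d x ∈ B := by
    rintro _ ⟨r, rfl⟩; exact ⟨R.d r, (jd r).symm⟩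
  have j_dOp : ∀ a r, A.dOp a (j.toLin r) = j.toLin (R.dOp a r) := fun a r =>
    LinearMap.congr_fun (graded_ext R.internal (f := A.dOp a ∘ₗ j.toLin)
      (g := j.toLin ∘ₗ R.dOp a) fun n x hx => by
        rw [comp_apply, comp_apply, dOp_apply a hx,
          dOp_apply a (j.map_deg n x hx), map_smul]) r
  have B_dOp : ∀ a, ∀ x ∈ B, A.dOp a x ∈ B := by
    rintro a _ ⟨r, rfl⟩; exact ⟨R.dOp a r, (j_dOp a r).symm⟩
  have j_deg : ∀ n r, j.toLin r ∈ A.deg n → r ∈ R.deg n := by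
    intro n r hr
    have : R.proj n r = r := hj (by rw [proj, ← j_dOp]; exact proj_of_mem hr)
    rw [← this]
    exact proj_mem n r
  have B_L : ∀ x ∈ B, A.coactL x ∈ subTensor ⊤ B := by
    rintro _ ⟨r, rfl⟩
    rw [show A.coactL (j.toLin r) = _ from LinearMap.congr_fun j.map_coactL r]
    exact subTensor_mono le_top le_rfl (map_mem_subTensor _ _ _)
  have B_R : ∀ x ∈ B, A.coactR x ∈ subTensor B ⊤ := by
    rintro _ ⟨r, rfl⟩
    rw [show A.coactR (j.toLin r) = _ from LinearMap.congr_fun j.map_coactR r]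
    exact subTensor_mono le_rfl le_top (map_mem_subTensor _ _ _)
  have proj_d : ∀ n x, A.proj n (A.d x) = A.d (A.proj (n - 1) x) := fun n x =>
    LinearMap.congr_fun (graded_ext A.internal (f := A.proj n ∘ₗ A.d)
      (g := A.d ∘ₗ A.proj (n - 1)) fun m x hx => by
        simp only [comp_apply]
        by_cases h : m + 1 = n
        · subst h
          rw [proj_of_mem (A.d_deg m x hx), add_sub_cancel_right, proj_of_mem hx]
        · rw [proj_of_ne h (A.d_deg m x hx), proj_of_ne (by omega) hx, map_zero]) x
  -- the quotient complex `A / B` is acyclic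
  have acyclic : ∀ x, A.d x ∈ B → x ∈ B ⊔ LinearMap.range A.d := by
    intro x hx
    refine mem_of_degOp_mem A.internal _ fun n => ?_
    change A.proj n x ∈ _
    have h1 : A.d (A.proj n x) ∈ B := by
      have := B_dOp (Pi.single (n + 1) 1) _ hx
      rw [← proj, proj_d, add_sub_cancel_right] at this
      exact this
    have hxn := proj_mem (A := A) n x
    generalize A.proj n x = y at h1 hxn
    obtain ⟨r, hr⟩ := h1
    have hrn : r ∈ R.deg (n + 1) := j_deg _ _ (by rw [hr]; exact A.d_deg n y hxn)
    obtain ⟨z, hz, hzr⟩ := (hq (n + 1)).1 r hrn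
      (hj (by rw [← jd, hr, map_zero, d_d_apply])) ⟨y, by simpa using hxn, hr.symm⟩
    rw [add_sub_cancel_right] at hz
    obtain ⟨r', hr', -, w, -, hw⟩ := (hq n).2 (y - j.toLin z)
      (sub_mem hxn (j.map_deg n z hz)) (by rw [map_sub, jd, hzr, hr, sub_self])
    refine Submodule.mem_sup.2 ⟨j.toLin (z + r'), ⟨_, rfl⟩, A.d w, ⟨w, rfl⟩, ?_⟩
    rw [hw, map_add]
    abel
  -- `σ x` is a primitive of `x` modulo `B` if there is one, and `σ` vanishes on `B`
  let D : A →ₗ[k] A ⧸ B := B.mkQ ∘ₗ A.d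
  obtain ⟨g, hg⟩ := exists_pseudoinverse D
  let σ : A →ₗ[k] A := g ∘ₗ B.mkQ
  have hσB : ∀ x ∈ B, σ x = 0 := fun x hx => by
    simp only [σ, comp_apply, (Submodule.Quotient.mk_eq_zero B).2 hx, Submodule.mkQ_apply,
      map_zero]
  have hσ : ∀ x, A.d x ∈ B → x - A.d (σ x) ∈ B := by
    intro x hx
    obtain ⟨b, hb, _, ⟨y, rfl⟩, rfl⟩ := Submodule.mem_sup.1 (acyclic x hx)
    rw [map_add, hσB b hb, zero_add, add_sub_assoc]
    refine add_mem hb ?_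
    rw [← Submodule.Quotient.mk_eq_zero, Submodule.Quotient.mk_sub, sub_eq_zero]
    exact (hg y).symm
  let h₀ : A →ₗ[k] A := σ - σ ∘ₗ σ ∘ₗ A.d
  have h₀B : ∀ x ∈ B, h₀ x = 0 := fun x hx => by
    simp [h₀, hσB x hx, hσB _ (B_d x hx)]
  have h₀h : ∀ x, x - (A.d (h₀ x) + h₀ (A.d x)) ∈ B := by
    intro x
    have h1 : A.d (x - σ (A.d x)) ∈ B := by
      rw [map_sub]
      exact hσ _ (by rw [d_d_apply]; exact zero_mem _)
    have h2 := hσ _ h1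
    have h3 : A.d (h₀ x) + h₀ (A.d x) = A.d (σ (x - σ (A.d x))) + σ (A.d x) := by
      simp [h₀, d_d_apply]
    rw [h3]
    convert h2 using 1
    abel
  -- the component of `h₀` of degree `-1`
  let h₁ : A →ₗ[k] A := gradedLift A.deg A.internal fun n => A.proj (n + -1) ∘ₗ h₀
  have h₁_apply : ∀ n, ∀ x ∈ A.deg n, h₁ x = A.proj (n + -1) (h₀ x) := fun n x hx =>
    gradedLift_apply _ _ _ hx
  have h₁B : ∀ x ∈ B, h₁ x = 0 := by
    intro x hx
    refine mem_of_degOp_mem A.internal (LinearMap.ker h₁) fun n => ?_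
    change h₁ (A.proj n x) = 0
    rw [h₁_apply n _ (proj_mem n x), h₀B (A.proj n x) (B_dOp _ x hx), map_zero]
  have h₁h : ∀ x, x - (A.d (h₁ x) + h₁ (A.d x)) ∈ B := by
    intro x
    refine graded_induction A.internal
      (B.comap (LinearMap.id - (A.d ∘ₗ h₁ + h₁ ∘ₗ A.d))) (fun n x hx => ?_) x
    have h1 : A.proj n (x - (A.d (h₀ x) + h₀ (A.d x))) ∈ B := B_dOp _ _ (h₀h x)
    rw [map_sub, map_add, proj_d, proj_of_mem hx] at h1
    change x - (A.d (h₁ x) + h₁ (A.d x)) ∈ B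
    rw [h₁_apply n x hx, h₁_apply _ _ (A.d_deg n x hx), add_neg_cancel_right]
    exact h1
  -- averages over both coactions commute with `d`, as `d` is bicolinear
  let avg : (A →ₗ[k] A) → (A →ₗ[k] A) := fun f =>
    avgR β A.coactR A.coactR (avgL β A.coactL A.coactL f)
  have avg_bi : ∀ f, A.Bicolinear (avg f) := by
    intro f
    refine ⟨fun x => ?_, avgR_colinear hβ A.coactR_isCoaction A.coactR_isCoaction _⟩
    apply sliceL_sep
    intro ψ
    -- `e` is right colinear because the coactions commute, so the right average is natural for it
    let e : A →ₗ[k] A := sliceL A ψ ∘ₗ A.coactL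
    have he : A.coactR ∘ₗ e = rTensor O e ∘ₗ A.coactR := by
      refine LinearMap.ext fun y => ?_
      have h1 : rTensor O e (A.coactR y) = sliceL (A ⊗[k] O) ψ
          (TensorProduct.assoc k O A O (rTensor O A.coactL (A.coactR y))) := by
        generalize A.coactR y = t
        induction t with
        | zero => simp
        | add a c ha hc => simp only [map_add, ha, hc]
        | tmul a f =>
          simp only [e, rTensor_tmul, comp_apply]
          generalize A.coactL a = s
          induction s with
          | zero => simp
          | add a c ha hc => simp only [add_tmul, map_add, ha, hc]
          | tmul a b => simp [smul_tmul']
      have h2 := LinearMap.congr_fun A.coact_comm y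
      simp only [comp_apply, LinearEquiv.coe_coe] at h2
      refine Eq.trans ?_ h1.symm
      rw [h2, sliceL_lTensor]
      rfl
    have hf : e ∘ₗ avgL β A.coactL A.coactL f = avgL β A.coactL A.coactL f ∘ₗ e := by
      refine LinearMap.ext fun y => ?_
      simp only [e, comp_apply]
      rw [avgL_colinear hβ A.coactL_isCoaction A.coactL_isCoaction, sliceL_lTensor]
    have h3 : e ∘ₗ avg f = avg f ∘ₗ e := by
      simp only [avg]
      rw [← avgR_comp_left he, hf, avgR_comp_right he]
    have h4 := LinearMap.congr_fun h3 x
    simp only [e, comp_apply] at h4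
    rw [h4, sliceL_lTensor]
  have avg_mem : ∀ {P Q : Submodule k A}, (∀ x ∈ P, A.coactL x ∈ subTensor ⊤ P) →
      (∀ x ∈ P, A.coactR x ∈ subTensor P ⊤) → (∀ x ∈ Q, A.coactL x ∈ subTensor ⊤ Q) →
      (∀ x ∈ Q, A.coactR x ∈ subTensor Q ⊤) → ∀ f : A →ₗ[k] A, (∀ x ∈ P, f x ∈ Q) →
      ∀ x ∈ P, avg f x ∈ Q := by
    intro P Q h1 h2 h3 h4 f hf x hx
    exact avgR_mem h2 h4 (fun y hy => avgL_mem h1 h3 hf hy) hx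
  have hh : ∀ x, A.d (avg h₁ x) + avg h₁ (A.d x) =
      x - avg (LinearMap.id - (A.d ∘ₗ h₁ + h₁ ∘ₗ A.d)) x := by
    intro x
    have hLd : A.coactL ∘ₗ A.d = lTensor O A.d ∘ₗ A.coactL := A.coactL_d
    have hRd : A.coactR ∘ₗ A.d = rTensor O A.d ∘ₗ A.coactR := A.coactR_d
    have h1 : avg (A.d ∘ₗ h₁) = A.d ∘ₗ avg h₁ := by
      simp only [avg]; rw [avgL_comp_left hLd, avgR_comp_left hRd]
    have h2 : avg (h₁ ∘ₗ A.d) = avg h₁ ∘ₗ A.d := by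
      simp only [avg]; rw [avgL_comp_right hLd, avgR_comp_right hRd]
    have h3 : avg LinearMap.id = LinearMap.id := by
      simp only [avg]
      rw [avgL_eq_self hβ A.coactL_isCoaction (by simp),
        avgR_eq_self hβ A.coactR_isCoaction (by simp)]
    have h4 : ∀ f g, avg (f + g) = avg f + avg g := fun f g => by
      simp only [avg]; rw [avgL_add, avgR_add]
    have h5 : avg (LinearMap.id - (A.d ∘ₗ h₁ + h₁ ∘ₗ A.d)) + (A.d ∘ₗ avg h₁ + avg h₁ ∘ₗ A.d) =
        LinearMap.id := by
      rw [← h1, ← h2, ← h4, ← h4, sub_add_cancel, h3]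
    have h6 := LinearMap.congr_fun h5 x
    simp only [LinearMap.add_apply, comp_apply, LinearMap.id_apply] at h6
    exact (sub_eq_of_eq_add' h6.symm).symm
  have top_L : ∀ x ∈ (⊤ : Submodule k A), A.coactL x ∈ subTensor ⊤ (⊤ : Submodule k A) :=
    fun x _ => mem_subTensor_top _
  have top_R : ∀ x ∈ (⊤ : Submodule k A), A.coactR x ∈ subTensor (⊤ : Submodule k A) ⊤ :=
    fun x _ => mem_subTensor_top _
  have havgB : ∀ x ∈ B, avg h₁ x = 0 := fun x hx => avg_mem (Q := ⊥) B_L B_R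
    (fun y hy => by simp [(mem_bot k).1 hy])
    (fun y hy => by simp [(mem_bot k).1 hy]) h₁ h₁B x hx
  have hp_eq : ∀ x ∈ B, avg (LinearMap.id - (A.d ∘ₗ h₁ + h₁ ∘ₗ A.d)) x = x := by
    intro x hx
    have := hh x
    rw [havgB x hx, havgB _ (B_d x hx), map_zero, add_zero] at this
    exact (sub_eq_zero.1 this.symm).symm
  refine ⟨⟨B, avg h₁, avg (LinearMap.id - (A.d ∘ₗ h₁ + h₁ ∘ₗ A.d)), avg_bi _, avg_bi _,
    fun x => avg_mem top_L top_R B_L B_R _ (fun x _ => h₁h x) x trivial, hp_eq, havgB, hh,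
    fun n => avg_mem (A.coactL_deg n) (A.coactR_deg n) (A.coactL_deg _) (A.coactR_deg _) h₁
      (fun x hx => by rw [h₁_apply n x hx]; exact proj_mem _ _),
    B_dOp, ?_, ?_, ?_, ?_, ?_, B_d⟩⟩
  · rintro n hn _ ⟨r, rfl⟩ hr
    have := j_deg _ _ hr
    rw [hR.neg n hn, mem_bot] at this
    rw [this, map_zero]
  · rintro _ ⟨r, rfl⟩ hr
    have := j_deg _ _ hr
    rw [← hR.unit_range] at this
    obtain ⟨f, hf⟩ := this
    exact ⟨f, by rw [← hf, ← j.map_unit]; rfl⟩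
  · intro f
    rw [← j.map_unit]
    exact ⟨_, rfl⟩
  · rw [← j.map_unit]
    exact hj.comp hR.unit_injective
  · intro t ht htB
    have : ∃ t', map j.toLin j.toLin t' = t := by
      refine subTensor_induction (LinearMap.range (map j.toLin j.toLin)) ?_ htB
      rintro _ ⟨x, rfl⟩ _ ⟨y, rfl⟩
      exact ⟨x ⊗ₜ y, by simp⟩
    obtain ⟨t', rfl⟩ := this
    have h1 : ∀ s : R ⊗[k] R, coactMid A.coactR A (map j.toLin j.toLin s) =
        map j.toLin (lTensor O j.toLin)
          (coactMid R.coactR R s) := by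
      intro s
      induction s with
      | zero => simp
      | add a c ha hc => simp only [map_add, ha, hc]
      | tmul a b =>
        have hja : A.coactR (j.toLin a) = rTensor O j.toLin (R.coactR a) :=
          LinearMap.congr_fun j.map_coactR a
        rw [map_tmul, coactMid_tmul, coactMid_tmul, hja]
        generalize R.coactR a = q
        induction q with
        | zero => simp
        | add a c ha hc => simp only [map_add, ha, hc]
        | tmul a b => simp
    have h2 : ∀ s : R ⊗[k] R, lTensor A A.coactL (map j.toLin j.toLin s) =
        map j.toLin (lTensor O j.toLin)
          (lTensor R R.coactL s) := by
      intro s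
      induction s with
      | zero => simp
      | add a c ha hc => simp only [map_add, ha, hc]
      | tmul a b =>
        have hjb : A.coactL (j.toLin b) = lTensor O j.toLin (R.coactL b) :=
          LinearMap.congr_fun j.map_coactL b
        simp only [map_tmul, lTensor_tmul, hjb]
    have ht' : t' ∈ R.cot := by
      refine mem_cotensor.2 (map_injective hj (lTensor_injective (M := O) hj) ?_)
      have := mem_cotensor.1 ht
      rw [h1, h2] at this
      exact this
    exact ⟨_, j.map_mul t' ht'⟩

end RelDGA

end Bicolinear

/-! ### Bar words and operators defined by recursion on the first letter -/

section BarTotal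

variable {k O : Type u} [Field k] [AddCommGroup O] [Module k O] [Coalgebra k O]

section decomposition

variable (A : RelDGA k O)

/-- The inclusion of `Bar_0 = O`. -/
def barZero : O →ₗ[k] BarTot A := barIncl A 0

/-- The projection to `A ⊗ ⋯ ⊗ A ⊗ O` with `n` factors `A`. -/
def barComp (n : ℕ) : BarTot A →ₗ[k] barSp A n := DirectSum.component k ℕ (fun n => barSp A n) n

/-- The projection to `Bar_0 = O`. -/
def barPrZero : BarTot A →ₗ[k] O := barComp A 0

/-- The partial inverse `x₁ ⊗ ⋯ ⊗ xₙ ↦ x₁ ⊗ (x₂ ⊗ ⋯ ⊗ xₙ)` of `barCons`, zero on `Bar_0`. -/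
def barUncons : BarTot A →ₗ[k] A ⊗[k] BarTot A :=
  DirectSum.toModule k ℕ _ fun n =>
    match n with
    | 0 => 0
    | n + 1 => (lTensor A (barIncl A n) : A ⊗[k] barSp A n →ₗ[k] A ⊗[k] BarTot A)

variable {A}

theorem barCons_incl (a : A) (n : ℕ) (t : barSp A n) :
    barCons A (a ⊗ₜ[k] barIncl A n t) = barIncl A (n + 1) (a ⊗ₜ[k] t : A ⊗[k] barSp A n) := by
  simp only [barCons, TensorProduct.lift.tmul, LinearMap.flip_apply, barIncl]
  rw [DirectSum.toModule_lof]
  rfl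

theorem barCons_lTensor_incl (n : ℕ) (t : A ⊗[k] barSp A n) :
    barCons A (lTensor A (barIncl A n) t) = barIncl A (n + 1) t := by
  induction t with
  | zero => simp only [map_zero]; exact (map_zero (barIncl A (n + 1))).symm
  | add x y hx hy =>
    rw [map_add, map_add, hx, hy]; exact (map_add (barIncl A (n + 1)) x y).symm
  | tmul a t => rw [lTensor_tmul, barCons_incl]

theorem toModule_barIncl {Y : Type u} [AddCommGroup Y] [Module k Y]
    (f : (n : ℕ) → (barSp A n →ₗ[k] Y)) (n : ℕ) (t : barSp A n) :
    DirectSum.toModule k ℕ Y f (barIncl A n t) = f n t :=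
  DirectSum.toModule_lof k (M := fun n => barSp A n) (φ := f) n t

theorem barUncons_incl (n : ℕ) (t : A ⊗[k] barSp A n) :
    barUncons A (barIncl A (n + 1) t) = lTensor A (barIncl A n) t :=
  toModule_barIncl _ _ _

@[simp] theorem barUncons_zero (f : O) : barUncons A (barZero A f) = 0 :=
  (toModule_barIncl _ _ _).trans rfl

theorem barComp_incl (n : ℕ) (t : barSp A n) : barComp A n (barIncl A n t) = t :=
  DirectSum.component.lof_self k (M := fun n => barSp A n) n t

theorem barComp_incl_ne {m n : ℕ} (h : m ≠ n) (t : barSp A m) :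
    barComp A n (barIncl A m t) = 0 := by
  exact (DirectSum.component.of k (M := fun n => barSp A n) n m t).trans (dif_neg h)

@[simp] theorem barPrZero_zero (f : O) : barPrZero A (barZero A f) = f := barComp_incl 0 _

theorem barTot_induction (K : Submodule k (BarTot A)) (h0 : ∀ f, barZero A f ∈ K)
    (h1 : ∀ a, ∀ t ∈ K, barCons A (a ⊗ₜ[k] t) ∈ K) (x : BarTot A) : x ∈ K := by
  have : ∀ n, ∀ t : barSp A n, barIncl A n t ∈ K := by
    intro n
    induction n with
    | zero => exact h0
    | succ n ih =>
      intro (t : A ⊗[k] barSp A n)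
      rw [← barCons_lTensor_incl]
      induction t with
      | zero => simp
      | add x y hx hy => simp only [map_add]; exact add_mem hx hy
      | tmul a t => exact h1 a _ (ih t)
  induction x using DirectSum.induction_on with
  | zero => exact zero_mem K
  | of n t => exact this n t
  | add x y hx hy => exact add_mem hx hy

theorem barTot_ext {Y : Type u} [AddCommGroup Y] [Module k Y] {F G : BarTot A →ₗ[k] Y}
    (h0 : ∀ f, F (barZero A f) = G (barZero A f))
    (h1 : ∀ a t, F t = G t → F (barCons A (a ⊗ₜ[k] t)) = G (barCons A (a ⊗ₜ[k] t))) : F = G :=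
  LinearMap.ext fun x => barTot_induction (eqLocus F G) h0 h1 x

theorem eq_of_incl {Y : Type u} [AddCommGroup Y] [Module k Y] {F G : BarTot A →ₗ[k] Y}
    (h : ∀ n t, F (barIncl A n t) = G (barIncl A n t)) : F = G :=
  DirectSum.linearMap_ext k fun n => LinearMap.ext (h n)

@[simp] theorem barUncons_cons (x : A ⊗[k] BarTot A) : barUncons A (barCons A x) = x := by
  induction x with
  | zero => simp
  | add x y hx hy => simp only [map_add, hx, hy]
  | tmul a t =>
    induction t using DirectSum.induction_on with
    | zero => simp
    | add x y hx hy => simp only [tmul_add, map_add, hx, hy]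
    | of n t =>
      change barUncons A (barCons A (a ⊗ₜ barIncl A n t)) = a ⊗ₜ barIncl A n t
      rw [barCons_incl, barUncons_incl, lTensor_tmul]

theorem barComp_succ_cons (n : ℕ) (x : A ⊗[k] BarTot A) :
    barComp A (n + 1) (barCons A x) = lTensor A (barComp A n) x := by
  induction x with
  | zero => simp only [map_zero]; rfl
  | add x y hx hy => simp only [map_add, hx, hy]; rfl
  | tmul a t =>
    induction t using DirectSum.induction_on with
    | zero => simp only [tmul_zero, map_zero]; rfl
    | add x y hx hy => simp only [tmul_add, map_add, hx, hy]; rfl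
    | of m t =>
      change barComp A (n + 1) (barCons A (a ⊗ₜ barIncl A m t)) =
        lTensor A (barComp A n) (a ⊗ₜ barIncl A m t)
      rw [barCons_incl, lTensor_tmul]
      by_cases h : m = n
      · subst h; rw [barComp_incl]; exact barComp_incl (m + 1) _
      · rw [barComp_incl_ne h, tmul_zero]
        exact barComp_incl_ne (by omega) _

@[simp] theorem barPrZero_cons (x : A ⊗[k] BarTot A) : barPrZero A (barCons A x) = 0 := by
  induction x with
  | zero => simp only [map_zero]
  | add x y hx hy => rw [map_add, map_add, hx, hy, add_zero]
  | tmul a t =>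
    induction t using DirectSum.induction_on with
    | zero => simp only [tmul_zero, map_zero]
    | add x y hx hy => rw [tmul_add, map_add, map_add, hx, hy, add_zero]
    | of m t =>
      change barPrZero A (barCons A (a ⊗ₜ barIncl A m t)) = 0
      rw [barCons_incl]
      exact barComp_incl_ne (Nat.succ_ne_zero m) _

/-- Every bar word is a word of length zero plus a word with a first letter. -/
theorem bar_decomp (x : BarTot A) :
    barZero A (barPrZero A x) + barCons A (barUncons A x) = x := by
  refine LinearMap.congr_fun (barTot_ext (F := barZero A ∘ₗ barPrZero A + barCons A ∘ₗ barUncons A)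
    (G := LinearMap.id) (fun f => ?_) (fun a t _ => ?_)) x
  · simp
  · simp

theorem barComp_sep {x y : BarTot A} (h : ∀ n, barComp A n x = barComp A n y) : x = y :=
  DFinsupp.ext h

/-- The `n`-th part of the recursion `barRec`. -/
def barRecAux {Y : Type u} [AddCommGroup Y] [Module k Y] (f : O →ₗ[k] Y) (g₁ : A ⊗[k] Y →ₗ[k] Y)
    (g₂ : A ⊗[k] BarTot A →ₗ[k] Y) : (n : ℕ) → (barSp A n →ₗ[k] Y)
  | 0 => f
  | n + 1 => (g₁ ∘ₗ lTensor A (barRecAux f g₁ g₂ n) +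
      g₂ ∘ₗ lTensor A (barIncl A n) : A ⊗[k] barSp A n →ₗ[k] Y)

/-- The linear map `F` with `F = f` on `Bar_0` and `F (a ⊗ t) = g₁ (a ⊗ F t) + g₂ (a ⊗ t)`. -/
def barRec {Y : Type u} [AddCommGroup Y] [Module k Y] (f : O →ₗ[k] Y) (g₁ : A ⊗[k] Y →ₗ[k] Y)
    (g₂ : A ⊗[k] BarTot A →ₗ[k] Y) : BarTot A →ₗ[k] Y :=
  DirectSum.toModule k ℕ Y (barRecAux f g₁ g₂)

section barRec

variable {Y : Type u} [AddCommGroup Y] [Module k Y] (f : O →ₗ[k] Y) (g₁ : A ⊗[k] Y →ₗ[k] Y)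
    (g₂ : A ⊗[k] BarTot A →ₗ[k] Y)

theorem barRec_zero (x : O) : barRec f g₁ g₂ (barZero A x) = f x :=
  toModule_barIncl _ _ _

theorem barRec_cons (x : A ⊗[k] BarTot A) : barRec f g₁ g₂ (barCons A x) =
    g₁ (lTensor A (barRec f g₁ g₂) x) + g₂ x := by
  induction x with
  | zero => simp
  | add x y hx hy => simp only [map_add, hx, hy]; abel
  | tmul a t =>
    induction t using DirectSum.induction_on with
    | zero => simp
    | add x y hx hy => simp only [tmul_add, map_add, hx, hy]; abel
    | of n t =>
      change barRec f g₁ g₂ (barCons A (a ⊗ₜ barIncl A n t)) =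
        g₁ (lTensor A (barRec f g₁ g₂) (a ⊗ₜ barIncl A n t)) + g₂ (a ⊗ₜ barIncl A n t)
      rw [barCons_incl, lTensor_tmul, barRec, toModule_barIncl]
      exact toModule_barIncl (barRecAux f g₁ g₂) (n + 1) _

end barRec

end decomposition

section operators

variable (A : RelDGA k O)

/-- `x₁ ⊗ ⋯ ⊗ xₙ ⊗ f ↦ α x₁ ⊗ ⋯ ⊗ α xₙ ⊗ f`. -/
def barWord (α : A →ₗ[k] A) : BarTot A →ₗ[k] BarTot A :=
  barRec (barZero A) (barCons A ∘ₗ rTensor (BarTot A) α) 0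

/-- `x₁ ⊗ ⋯ ⊗ xₙ ⊗ f ↦ ∑ᵢ β x₁ ⊗ ⋯ ⊗ β xᵢ₋₁ ⊗ α xᵢ ⊗ xᵢ₊₁ ⊗ ⋯ ⊗ xₙ ⊗ f`. -/
def barDer (α β : A →ₗ[k] A) : BarTot A →ₗ[k] BarTot A :=
  barRec 0 (barCons A ∘ₗ rTensor (BarTot A) β)
    (barCons A ∘ₗ rTensor (BarTot A) α)

/-- The left coaction of `O` on the direct sum of all `A ⊗ ⋯ ⊗ A ⊗ O`. -/
def barLam : BarTot A →ₗ[k] O ⊗[k] BarTot A :=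
  lTensor O (barZero A) ∘ₗ comul ∘ₗ barPrZero A +
    lTensor O (barCons A) ∘ₗ coactLeft A.coactL (BarTot A) ∘ₗ barUncons A

variable {A}

theorem barWord_zero (α : A →ₗ[k] A) (f : O) : barWord A α (barZero A f) = barZero A f :=
  barRec_zero _ _ _ _

theorem barWord_cons (α : A →ₗ[k] A) (x : A ⊗[k] BarTot A) :
    barWord A α (barCons A x) = barCons A (map α (barWord A α) x) := by
  rw [barWord, barRec_cons, LinearMap.zero_apply, add_zero, ← barWord, comp_apply,
    ← LinearMap.rTensor_comp_lTensor, comp_apply]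

theorem barDer_zero (α β : A →ₗ[k] A) (f : O) : barDer A α β (barZero A f) = 0 :=
  barRec_zero _ _ _ _

theorem barDer_cons (α β : A →ₗ[k] A) (x : A ⊗[k] BarTot A) : barDer A α β (barCons A x) =
    barCons A (rTensor (BarTot A) α x) +
      barCons A (map β (barDer A α β) x) := by
  rw [barDer, barRec_cons, ← barDer, comp_apply, comp_apply,
    ← LinearMap.rTensor_comp_lTensor, comp_apply, add_comm]

theorem barLam_zero (f : O) :
    barLam A (barZero A f) = lTensor O (barZero A) (comul f) := by
  simp [barLam]

theorem barLam_cons (x : A ⊗[k] BarTot A) : barLam A (barCons A x) =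
    lTensor O (barCons A) (coactLeft A.coactL (BarTot A) x) := by
  simp [barLam]

theorem coactLeft_map {M N N' P : Type u} [AddCommGroup M] [Module k M] [AddCommGroup N]
    [Module k N] [AddCommGroup N'] [Module k N'] [AddCommGroup P] [Module k P]
    {lam : M →ₗ[k] O ⊗[k] M} {lam' : P →ₗ[k] O ⊗[k] P} {α : M →ₗ[k] P}
    (hα : ∀ x, lam' (α x) = lTensor O α (lam x)) (f : N →ₗ[k] N') (t : M ⊗[k] N) :
    coactLeft lam' N' (map α f t) =
      lTensor O (map α f) (coactLeft lam N t) := by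
  induction t with
  | zero => simp
  | add x y hx hy => simp only [map_add, hx, hy]
  | tmul a t =>
    rw [map_tmul, coactLeft_tmul, coactLeft_tmul, hα,
      ← lTensor_comp_apply, ← lTensor_comp_apply]
    congr 2

theorem coactMid_map {M N N' P : Type u} [AddCommGroup M] [Module k M] [AddCommGroup N]
    [Module k N] [AddCommGroup N'] [Module k N'] [AddCommGroup P] [Module k P]
    {ρ : M →ₗ[k] M ⊗[k] O} {ρ' : P →ₗ[k] P ⊗[k] O} {α : M →ₗ[k] P}
    (hα : ∀ x, ρ' (α x) = rTensor O α (ρ x)) (f : N →ₗ[k] N') (t : M ⊗[k] N) :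
    coactMid ρ' N' (map α f t) =
      map α (lTensor O f) (coactMid ρ N t) := by
  induction t with
  | zero => simp
  | add x y hx hy => simp only [map_add, hx, hy]
  | tmul a t =>
    rw [map_tmul, coactMid_tmul, coactMid_tmul, hα]
    generalize ρ a = s
    induction s with
    | zero => simp
    | add x y hx hy => simp only [map_add, hx, hy]
    | tmul x y => simp

/-- `α ⊗ f` maps a cotensor product to a cotensor product if `α` is right colinear and `f` is
left colinear on a subspace `Q` which contains the second factors. -/
theorem map_mem_cotensor {M N N' : Type u} [AddCommGroup M] [Module k M] [AddCommGroup N]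
    [Module k N] [AddCommGroup N'] [Module k N'] {ρ : M →ₗ[k] M ⊗[k] O} {lam : N →ₗ[k] O ⊗[k] N}
    {lam' : N' →ₗ[k] O ⊗[k] N'} {α : M →ₗ[k] M} (hα : ∀ x, ρ (α x) = rTensor O α (ρ x))
    {f : N →ₗ[k] N'} {Q : Submodule k N} (hf : ∀ y ∈ Q, lam' (f y) = lTensor O f (lam y))
    {x : M ⊗[k] N} (hx : x ∈ cotensor ρ lam) (hxQ : x ∈ subTensor ⊤ Q) :
    map α f x ∈ cotensor ρ lam' := by
  rw [mem_cotensor] at *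
  rw [coactMid_map hα, hx]
  have h := map_eq_on_subTensor (f := α) (f' := α) (g := lam' ∘ₗ f)
    (g' := lTensor O f ∘ₗ lam) (fun _ _ => rfl) hf hxQ
  have e1 : map α (lam' ∘ₗ f) x = lTensor M lam'
      (map α f x) := by
    rw [← LinearMap.lTensor_comp_map, comp_apply]
  have e2 : map α (lTensor O f ∘ₗ lam) x =
      map α (lTensor O f) (lTensor M lam x) := by
    rw [← LinearMap.map_comp_lTensor, comp_apply]
  rw [← e1, h, e2]

theorem barLam_word {α : A →ₗ[k] A} (hα : A.Bicolinear α) (x : BarTot A) :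
    barLam A (barWord A α x) = lTensor O (barWord A α) (barLam A x) := by
  refine LinearMap.congr_fun (barTot_ext (F := barLam A ∘ₗ barWord A α)
    (G := lTensor O (barWord A α) ∘ₗ barLam A) (fun f => ?_) (fun a t _ => ?_)) x
  · rw [comp_apply, comp_apply, barWord_zero, barLam_zero,
      ← lTensor_comp_apply]
    congr 2
    exact LinearMap.ext fun f => (barWord_zero α f).symm
  · rw [comp_apply, comp_apply, barWord_cons, barLam_cons, barLam_cons,
      coactLeft_map hα.left, ← lTensor_comp_apply, ← lTensor_comp_apply]
    congr 2
    exact LinearMap.ext fun y => (barWord_cons α y).symm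

theorem barLam_der {α β : A →ₗ[k] A} (hα : A.Bicolinear α) (hβ : A.Bicolinear β) (x : BarTot A) :
    barLam A (barDer A α β x) = lTensor O (barDer A α β) (barLam A x) := by
  refine LinearMap.congr_fun (barTot_ext (F := barLam A ∘ₗ barDer A α β)
    (G := lTensor O (barDer A α β) ∘ₗ barLam A) (fun f => ?_) (fun a t _ => ?_)) x
  · rw [comp_apply, comp_apply, barDer_zero, barLam_zero,
      ← lTensor_comp_apply, show barDer A α β ∘ₗ barZero A = 0 from
        LinearMap.ext fun f => barDer_zero α β f]
    simp
  · have h1 : barDer A α β ∘ₗ barCons A = barCons A ∘ₗ rTensor (BarTot A) α +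
        barCons A ∘ₗ map β (barDer A α β) :=
      LinearMap.ext fun y => barDer_cons α β y
    have h2 := coactLeft_map (f := LinearMap.id (R := k) (M := BarTot A)) hα.left (a ⊗ₜ t)
    rw [comp_apply, comp_apply, barDer_cons, map_add, barLam_cons, barLam_cons,
      barLam_cons, coactLeft_map hβ.left, ← lTensor_comp_apply O (barDer A α β), h1,
      LinearMap.lTensor_add, LinearMap.add_apply, ← lTensor_comp_apply O (barCons A),
      lTensor_comp_apply O (barCons A), rTensor, h2,
      lTensor_comp_apply O (barCons A)]

theorem barWord_comp (α β : A →ₗ[k] A) (x : BarTot A) :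
    barWord A α (barWord A β x) = barWord A (α ∘ₗ β) x := by
  refine LinearMap.congr_fun (barTot_ext (F := barWord A α ∘ₗ barWord A β)
    (G := barWord A (α ∘ₗ β)) (fun f => ?_) (fun a t h => ?_)) x
  · simp only [comp_apply, barWord_zero]
  · simp only [comp_apply] at h
    simp only [comp_apply, barWord_cons, map_tmul, h]

theorem barWord_id (x : BarTot A) : barWord A LinearMap.id x = x := by
  refine LinearMap.congr_fun (barTot_ext (F := barWord A LinearMap.id)
    (G := LinearMap.id) (fun f => ?_) (fun a t h => ?_)) x
  · rw [barWord_zero]; rfl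
  · rw [barWord_cons, map_tmul, h]; rfl

/-- A derivation-like operator commutes with the action of `γ` on all letters up to the scalar by
which its single special letter does. -/
theorem barWord_der {α β γ : A →ₗ[k] A} {c : k} (hα : ∀ x, γ (α x) = c • α (γ x))
    (hβ : ∀ x, γ (β x) = β (γ x)) (x : BarTot A) :
    barWord A γ (barDer A α β x) = c • barDer A α β (barWord A γ x) := by
  refine LinearMap.congr_fun (barTot_ext (F := barWord A γ ∘ₗ barDer A α β)
    (G := c • barDer A α β ∘ₗ barWord A γ) (fun f => ?_) (fun a t h => ?_)) x
  · simp only [comp_apply, LinearMap.smul_apply, barWord_zero, barDer_zero, map_zero,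
      smul_zero]
  · simp only [comp_apply, LinearMap.smul_apply] at h
    simp only [comp_apply, LinearMap.smul_apply, barWord_cons, barDer_cons, map_add,
      rTensor_tmul, map_tmul, h, hα, hβ, smul_add, TensorProduct.tmul_smul,
      map_smul, ← smul_tmul']

variable (A) in
/-- The bar complex `⨁ A ⊗_O ⋯ ⊗_O A`, as a subspace of the sum of all `A ⊗ ⋯ ⊗ A ⊗ O`. -/
def barTotSub : Submodule k (BarTot A) := ⨅ n, (barSub A n).comap (barComp A n)

theorem mem_barTotSub {x : BarTot A} : x ∈ barTotSub A ↔ ∀ n, barComp A n x ∈ barSub A n := by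
  simp [barTotSub]

theorem barZero_mem (f : O) : barZero A f ∈ barTotSub A := by
  refine mem_barTotSub.2 fun n => ?_
  by_cases h : 0 = n
  · subst h; trivial
  · have : barComp A n (barZero A f) = 0 := barComp_incl_ne h f
    rw [this]; exact zero_mem _

theorem barIncl_mem {n : ℕ} {t : barSp A n} (ht : t ∈ barSub A n) :
    barIncl A n t ∈ barTotSub A := by
  refine mem_barTotSub.2 fun m => ?_
  by_cases h : n = m
  · subst h; rwa [barComp_incl]
  · rw [barComp_incl_ne h]; exact zero_mem _

theorem barCoact_comp (n : ℕ) (x : BarTot A) :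
    barCoact A n (barComp A n x) = lTensor O (barComp A n) (barLam A x) := by
  refine LinearMap.congr_fun (barTot_ext (F := barCoact A n ∘ₗ barComp A n)
    (G := lTensor O (barComp A n) ∘ₗ barLam A) (fun f => ?_) (fun a t _ => ?_)) x
  · rw [comp_apply, comp_apply, barLam_zero]
    refine Eq.trans ?_ (lTensor_comp_apply O (barComp A n) (barZero A) _)
    by_cases h : 0 = n
    · subst h
      have h1 : barPrZero A ∘ₗ barZero A = LinearMap.id := LinearMap.ext fun f =>
        barPrZero_zero (A := A) f
      change comul (R := k) (barPrZero A (barZero A f)) =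
        lTensor O (barPrZero A ∘ₗ barZero A) (comul f)
      rw [h1, barPrZero_zero, LinearMap.lTensor_id]
      rfl
    · have : barComp A n ∘ₗ barZero A = 0 := LinearMap.ext fun f => barComp_incl_ne h f
      rw [this, show barComp A n (barZero A f) = 0 from barComp_incl_ne h f]
      simp
  · rw [comp_apply, comp_apply, barLam_cons, ← lTensor_comp_apply]
    cases n with
    | zero =>
      have h1 : barPrZero A ∘ₗ barCons A = 0 := LinearMap.ext fun y => barPrZero_cons y
      change comul (R := k) (barPrZero A (barCons A (a ⊗ₜ t))) =
        lTensor O (barPrZero A ∘ₗ barCons A) (coactLeft A.coactL (BarTot A) (a ⊗ₜ t))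
      rw [h1, barPrZero_cons]
      simp
    | succ n =>
      have : barComp A (n + 1) ∘ₗ barCons A = lTensor A (barComp A n) :=
        LinearMap.ext fun y => barComp_succ_cons n y
      rw [this, barComp_succ_cons]
      exact coactLeft_lTensor A.coactL (barComp A n) (a ⊗ₜ t)

theorem mem_barSub_succ {n : ℕ} {t : A ⊗[k] barSp A n} :
    (show barSp A (n + 1) from t) ∈ barSub A (n + 1) ↔
      t ∈ (subTensor ⊤ (barSub A n) : Submodule k (A ⊗[k] barSp A n)) ∧
        t ∈ cotensor A.coactR (barCoact A n) :=
  Iff.rfl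

variable (A) in
/-- `A ⊗_O X` for the sum `X` of all `A ⊗ ⋯ ⊗ A ⊗ O`. -/
def barCot : Submodule k (A ⊗[k] BarTot A) := cotensor A.coactR (barLam A)

/-- The recursive description of the bar complex: prepending a letter is `A ⊗_O Bar_n → Bar_(n+1)`.
-/
theorem barCons_mem_iff {x : A ⊗[k] BarTot A} :
    barCons A x ∈ barTotSub A ↔ x ∈ barCot A ∧ x ∈ subTensor ⊤ (barTotSub A) := by
  rw [mem_barTotSub]
  have key : ∀ n, lTensor A (barComp A n) x ∈ cotensor A.coactR (barCoact A n) ↔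
      lTensor A (lTensor O (barComp A n)) (coactMid A.coactR (BarTot A) x) =
      lTensor A (lTensor O (barComp A n))
        (lTensor A (barLam A) x) := by
    intro n
    rw [mem_cotensor, coactMid_lTensor, ← lTensor_comp_apply A (barCoact A n),
      ← lTensor_comp_apply A _ (barLam A)]
    have : barCoact A n ∘ₗ barComp A n = lTensor O (barComp A n) ∘ₗ barLam A :=
      LinearMap.ext fun y => barCoact_comp n y
    rw [this]
  constructor
  · intro h
    have h' : ∀ n, lTensor A (barComp A n) x ∈ subTensor ⊤ (barSub A n) ∧
        lTensor A (barComp A n) x ∈ cotensor A.coactR (barCoact A n) := by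
      intro n
      have := h (n + 1)
      rw [barComp_succ_cons] at this
      exact Submodule.mem_inf.1 this
    constructor
    · refine mem_cotensor.2 (sliceL_sep fun ψ => sliceL_sep fun χ => barComp_sep fun n => ?_)
      have := congrArg (fun t => sliceL (barSp A n) χ (sliceL (O ⊗[k] barSp A n) ψ t))
        ((key n).1 (h' n).2)
      simpa only [sliceL_lTensor] using this
    · refine mem_subTensor_of_sliceL fun ψ => mem_barTotSub.2 fun n => ?_
      rw [← sliceL_lTensor]
      exact sliceL_mem (h' n).1 ψ
  · rintro ⟨h1, h2⟩ n
    cases n with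
    | zero => trivial
    | succ n =>
      rw [barComp_succ_cons]
      refine mem_barSub_succ.2 ⟨?_, ?_⟩
      · have h3 : lTensor A (barComp A n) x ∈
            (subTensor ⊤ (barSub A n) : Submodule k (A ⊗[k] barSp A n)) :=
          subTensor_map (f := LinearMap.id) (fun _ h => h)
            (fun y hy => mem_barTotSub.1 hy n) h2
        exact h3
      · exact (key n).2 (by rw [mem_cotensor.1 h1])

/-- The induction principle for the bar complex. -/
theorem barTotSub_induction (K : Submodule k (BarTot A)) (h0 : ∀ f, barZero A f ∈ K)
    (h1 : ∀ x ∈ barCot A, x ∈ subTensor ⊤ (K ⊓ barTotSub A) → barCons A x ∈ K)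
    {x : BarTot A} (hx : x ∈ barTotSub A) : x ∈ K := by
  classical
  have : ∀ n, ∀ t ∈ barSub A n, barIncl A n t ∈ K := by
    intro n
    induction n with
    | zero => exact fun t _ => h0 t
    | succ n ih =>
      intro t ht
      have h2 := barIncl_mem ht
      change A ⊗[k] barSp A n at t
      rw [← barCons_lTensor_incl] at h2 ⊢
      refine h1 _ (barCons_mem_iff.1 h2).1 ?_
      have h3 : t ∈ (subTensor ⊤ (barSub A n) : Submodule k (A ⊗[k] barSp A n)) :=
        (mem_barSub_succ.1 ht).1
      exact subTensor_map (Q' := K ⊓ barTotSub A) (f := LinearMap.id) (fun _ h => h)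
        (fun y hy => ⟨ih y hy, barIncl_mem hy⟩) h3
  rw [← DirectSum.sum_support_of x]
  exact Submodule.sum_mem _ fun n _ => this n _ (mem_barTotSub.1 hx n)

theorem barUncons_mem {x : BarTot A} (hx : x ∈ barTotSub A) :
    barUncons A x ∈ barCot A ∧ barUncons A x ∈ subTensor ⊤ (barTotSub A) := by
  rw [← barCons_mem_iff]
  have := bar_decomp x
  rw [← eq_sub_iff_add_eq'] at this
  rw [this]
  exact sub_mem hx (barZero_mem _)

theorem barWord_mem {α : A →ₗ[k] A} (hα : A.Bicolinear α) {x : BarTot A}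
    (hx : x ∈ barTotSub A) : barWord A α x ∈ barTotSub A := by
  refine barTotSub_induction ((barTotSub A).comap (barWord A α)) (fun f => ?_) (fun x h1 h2 => ?_) hx
  · rw [mem_comap, barWord_zero]; exact barZero_mem f
  · rw [mem_comap, barWord_cons, barCons_mem_iff]
    exact ⟨map_mem_cotensor hα.right (fun y _ => barLam_word hα y) h1 h2,
      subTensor_map (P' := ⊤) (Q' := barTotSub A) (fun _ _ => trivial) (fun y hy => (Submodule.mem_inf.1 hy).1) h2⟩

theorem barDer_mem {α β : A →ₗ[k] A} (hα : A.Bicolinear α) (hβ : A.Bicolinear β) {x : BarTot A}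
    (hx : x ∈ barTotSub A) : barDer A α β x ∈ barTotSub A := by
  refine barTotSub_induction ((barTotSub A).comap (barDer A α β)) (fun f => ?_)
    (fun x h1 h2 => ?_) hx
  · rw [mem_comap, barDer_zero]; exact zero_mem _
  · rw [mem_comap, barDer_cons]
    refine add_mem (barCons_mem_iff.2 ⟨?_, ?_⟩) (barCons_mem_iff.2 ⟨?_, ?_⟩)
    · exact map_mem_cotensor hα.right (f := LinearMap.id) (fun y _ => by simp) h1 h2
    · exact subTensor_map (P' := ⊤) (Q' := barTotSub A) (g := LinearMap.id) (fun _ _ => trivial) (fun y hy => (Submodule.mem_inf.1 hy).2) h2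
    · exact map_mem_cotensor hβ.right (fun y _ => barLam_der hα hβ y) h1 h2
    · exact subTensor_map (P' := ⊤) (Q' := barTotSub A) (fun _ _ => trivial) (fun y hy => (Submodule.mem_inf.1 hy).1) h2

end operators

end BarTotal

/-! ### Weights, and the character of an augmentation -/

section Operators

variable {k O : Type u} [Field k] [AddCommGroup O] [Module k O] [Coalgebra k O] {A : RelDGA k O}

/-- Only finitely many degrees occur in the first factor of an element of `A ⊗ Y`. -/
theorem RelDGA.exists_sum_proj {Y : Type u} [AddCommGroup Y] [Module k Y] (t : A ⊗[k] Y) :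
    ∃ S : Finset ℤ, ∀ S', S ⊆ S' → ∑ p ∈ S', rTensor Y (A.proj p) t = t := by
  classical
  have h0 : ∀ x : A, ∃ S : Finset ℤ, ∀ S', S ⊆ S' → ∑ p ∈ S', A.proj p x = x := by
    intro x
    have hx : x ∈ ⨆ n, A.deg n := by rw [A.internal.submodule_iSup_eq_top]; trivial
    induction hx using Submodule.iSup_induction' with
    | mem n x hx =>
      refine ⟨{n}, fun S' h => ?_⟩
      rw [Finset.sum_eq_single_of_mem n (h (Finset.mem_singleton_self n))
        (fun m _ hm => RelDGA.proj_of_ne hm.symm hx), RelDGA.proj_of_mem hx]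
    | zero => exact ⟨∅, fun S' _ => by simp⟩
    | add x y _ _ hx hy =>
      obtain ⟨S, hS⟩ := hx
      obtain ⟨S', hS'⟩ := hy
      refine ⟨S ∪ S', fun S'' h => ?_⟩
      simp only [map_add, Finset.sum_add_distrib]
      rw [hS _ (Finset.union_subset_left h), hS' _ (Finset.union_subset_right h)]
  induction t with
  | zero => exact ⟨∅, fun S' _ => by simp⟩
  | tmul a y =>
    obtain ⟨S, hS⟩ := h0 a
    refine ⟨S, fun S' h => ?_⟩
    simp only [rTensor_tmul]
    rw [← TensorProduct.sum_tmul, hS S' h]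
  | add x y hx hy =>
    obtain ⟨S, hS⟩ := hx
    obtain ⟨S', hS'⟩ := hy
    refine ⟨S ∪ S', fun S'' h => ?_⟩
    simp only [map_add, Finset.sum_add_distrib]
    rw [hS _ (Finset.union_subset_left h), hS' _ (Finset.union_subset_right h)]

theorem RelDGA.cot_map {α β : A →ₗ[k] A} (hα : A.Bicolinear α) (hβ : A.Bicolinear β)
    {t : A ⊗[k] A} (ht : t ∈ A.cot) : map α β t ∈ A.cot :=
  map_mem_cotensor hα.right (Q := ⊤) (fun y _ => hβ.left y) ht (mem_subTensor_top t)

/-- The multiplication preserves degrees. It is defined on the cotensor product alone, so the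
homogeneous components have to be taken inside it. -/
theorem RelDGA.wt_mul {c : k} (hc : c ≠ 0) {t : A ⊗[k] A} (ht : t ∈ A.cot) :
    A.wt c (A.m t) = A.m (map (A.wt c) (A.wt c) t) := by
  have key : ∀ p q, A.wt c (A.m (map (A.proj p) (A.proj q) t)) =
      A.m (map (A.wt c) (A.wt c) (map (A.proj p) (A.proj q) t)) := by
    intro p q
    have h1 : map (A.proj p) (A.proj q) t ∈ subTensor (A.deg p) (A.deg q) :=
      subTensor_map (P := ⊤) (Q := ⊤) (fun x _ => RelDGA.proj_mem p x)
        (fun x _ => RelDGA.proj_mem q x) (mem_subTensor_top t)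
    have h2 := A.mul_deg p q _
      (RelDGA.cot_map (RelDGA.dOp_bicolinear _) (RelDGA.dOp_bicolinear _) ht) h1
    have h3 := map_eq_on_subTensor (f := A.wt c) (f' := c ^ p • LinearMap.id) (g := A.wt c)
      (g' := c ^ q • LinearMap.id) (fun x hx => RelDGA.wt_apply c hx)
      (fun x hx => RelDGA.wt_apply c hx) h1
    rw [h3, TensorProduct.map_smul_left, TensorProduct.map_smul_right, TensorProduct.map_id,
      smul_smul, ← zpow_add₀ hc, LinearMap.smul_apply, LinearMap.id_apply, map_smul]
    exact RelDGA.wt_apply c h2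
  have key2 : ∀ q, A.wt c (A.m (lTensor A (A.proj q) t)) =
      A.m (map (A.wt c) (A.wt c) (lTensor A (A.proj q) t)) := by
    intro q
    obtain ⟨S, hS⟩ := RelDGA.exists_sum_proj (lTensor A (A.proj q) t)
    rw [← hS S subset_rfl]
    simp only [map_sum]
    refine Finset.sum_congr rfl fun p _ => ?_
    rw [← comp_apply (rTensor _ _), LinearMap.rTensor_comp_lTensor]
    exact key p q
  obtain ⟨S, hS⟩ := RelDGA.exists_sum_proj (TensorProduct.comm k A A t)
  have hS' := congrArg (TensorProduct.comm k A A).symm (hS S subset_rfl)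
  have h4 : ∀ q (x : A ⊗[k] A), (TensorProduct.comm k A A).symm (rTensor A (A.proj q)
      (TensorProduct.comm k A A x)) = lTensor A (A.proj q) x := by
    intro q x
    induction x with
    | zero => simp
    | add x y hx hy => simp only [map_add, hx, hy]
    | tmul x y => simp
  rw [map_sum, LinearEquiv.symm_apply_apply] at hS'
  simp only [h4] at hS'
  rw [← hS']
  simp only [map_sum]
  exact Finset.sum_congr rfl fun q _ => key2 q

theorem RelDGA.sgn_mul {t : A ⊗[k] A} (ht : t ∈ A.cot) :
    A.sgn (A.m t) = A.m (map A.sgn A.sgn t) := by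
  rw [RelDGA.sgn_eq_wt]; exact RelDGA.wt_mul (by simp) ht

theorem slice_map {M M' Y Z : Type u} [AddCommGroup M] [Module k M] [AddCommGroup M'] [Module k M']
    [AddCommGroup Y] [Module k Y] [AddCommGroup Z] [Module k Z] (α : M →ₗ[k] M') (f : Y →ₗ[k] Z)
    (φ : Z →ₗ[k] k) (w : M ⊗[k] Y) :
    slice M' φ (map α f w) = α (slice M (φ ∘ₗ f) w) := by
  induction w with
  | zero => simp
  | add x y hx hy => simp only [map_add, hx, hy]
  | tmul a y => simp [slice_tmul]

theorem mulTensor_map {α : A →ₗ[k] A} {c : k}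
    (hm : ∀ t ∈ A.cot, α (A.m t) = c • A.m (map α α t)) {Y Z : Type u}
    [AddCommGroup Y] [Module k Y] [AddCommGroup Z] [Module k Z] (f : Y →ₗ[k] Z)
    {z : A ⊗[k] (A ⊗[k] Y)} (hz : z ∈ cotensor A.coactR (coactLeft A.coactL Y)) :
    map α f (mulTensor A.m Y z) =
      c • mulTensor A.m Z (map α (map α f) z) := by
  apply slice_sep
  intro φ
  rw [slice_map, slice_mulTensor, hm _ (slice_mem_cot A Y hz _), map_smul, slice_mulTensor]
  congr 2
  rw [← comp_apply, ← comp_apply, LinearMap.map_comp_lTensor,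
    LinearMap.lTensor_comp_map]
  congr 2
  exact LinearMap.ext fun w => (slice_map α f φ w).symm

namespace RelDGA.Augmentation

variable (ε : A.Augmentation)

/-- The functional `u ε^r = u ε^l` on `A`. -/
def char : A →ₗ[k] k := counit ∘ₗ ε.right

theorem char_eq_left (x : A) : ε.char x = counit (R := k) (ε.left x) := by
  simp only [char, right, left, comp_apply]
  generalize ε.toLin x = w
  induction w with
  | zero => simp
  | add x y hx hy => simp only [map_add, hx, hy]
  | tmul f g => simp [mul_comm]

/-- The augmentation vanishes in all degrees but zero, where the weight operator is the identity. -/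
theorem toLin_wt (c : k) (x : A) : ε.toLin (A.wt c x) = ε.toLin x := by
  refine LinearMap.congr_fun (graded_ext A.internal (f := ε.toLin ∘ₗ A.wt c) (g := ε.toLin)
    fun n x hx => ?_) x
  rw [comp_apply, RelDGA.wt_apply c hx, map_smul]
  by_cases h : n = 0
  · simp [h]
  · rw [ε.map_deg n h x hx, smul_zero]

theorem left_wt (c : k) (x : A) : ε.left (A.wt c x) = ε.left x := by
  simp only [left, comp_apply, toLin_wt]

theorem char_wt (c : k) (x : A) : ε.char (A.wt c x) = ε.char x := by
  rw [char_eq_left, char_eq_left, left_wt]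

theorem left_sgn (x : A) : ε.left (A.sgn x) = ε.left x := by
  rw [RelDGA.sgn_eq_wt, left_wt]

theorem char_sgn (x : A) : ε.char (A.sgn x) = ε.char x := by
  rw [RelDGA.sgn_eq_wt, char_wt]

theorem left_d (x : A) : ε.left (A.d x) = 0 := by
  have : ε.toLin (A.d x) = 0 := LinearMap.congr_fun ε.map_d x
  simp only [left, comp_apply, this, map_zero]

theorem char_d (x : A) : ε.char (A.d x) = 0 := by
  rw [char_eq_left, left_d, map_zero]

theorem left_unit (f : O) : ε.left (A.unit f) = f := by
  have : ε.toLin (A.unit f) = comul f := LinearMap.congr_fun ε.map_unit f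
  simp [left, this]

theorem char_unit (f : O) : ε.char (A.unit f) = counit (R := k) f := by
  rw [char_eq_left, left_unit]

theorem left_colinear (x : A) :
    comul (R := k) (ε.left x) = lTensor O ε.left (A.coactL x) := by
  have h : coactLeft comul O (ε.toLin x) = lTensor O ε.toLin (A.coactL x) :=
    LinearMap.congr_fun ε.map_coactL x
  have h2 := slice_coactLeft (C := O) (Y := O) (k := k) comul counit (ε.toLin x)
  rw [h, ← lTensor_comp_apply] at h2
  exact h2.symm

/-- The functional `u ε^r` on the second factor of the left coaction gives `ε^l`. -/
theorem slice_char (x : A) : slice O ε.char (A.coactL x) = ε.left x := by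
  have h : coactLeft comul O (ε.toLin x) = lTensor O ε.toLin (A.coactL x) :=
    LinearMap.congr_fun ε.map_coactL x
  have h1 : ∀ w : O ⊗[k] O, slice O (counit ∘ₗ (TensorProduct.lid k O).toLinearMap ∘ₗ
      rTensor O counit) (coactLeft comul O w) =
      slice O counit w := by
    intro w
    induction w with
    | zero => simp
    | add x y hx hy => simp only [map_add, hx, hy]
    | tmul f g =>
      rw [coactLeft_tmul, slice_tmul]
      have h3 : ∀ w : O ⊗[k] O, slice O (counit ∘ₗ
          (TensorProduct.lid k O).toLinearMap ∘ₗ rTensor O counit)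
          (lTensor O ((TensorProduct.mk k O O).flip g) w) =
          counit (R := k) g • slice O counit w := by
        intro w
        induction w with
        | zero => simp
        | add x y hx hy => simp only [map_add, hx, hy, smul_add]
        | tmul x y => simp [slice_tmul, smul_smul, mul_comm]
      rw [h3]
      congr 1
      have := Coalgebra.lTensor_counit_comul (R := k) f
      simp [slice, this]
  have h2 := h1 (ε.toLin x)
  rw [h] at h2
  refine Eq.trans ?_ h2
  generalize A.coactL x = w
  induction w with
  | zero => simp
  | add x y hx hy => simp only [map_add, hx, hy]
  | tmul f g => rfl

/-- The multiplicativity of `ε`, after the counit has been applied to the second factor of `E = O ⊗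
O`. -/
theorem left_mul {t : A ⊗[k] A} (ht : t ∈ A.cot) :
    ε.left (A.m t) = ε.left (slice A ε.char t) := by
  simp only [left, comp_apply]
  rw [ε.map_mul t ht]
  clear ht
  induction t with
  | zero => simp
  | add x y hx hy => simp only [map_add, hx, hy]
  | tmul a b =>
    rw [slice_tmul, map_smul]
    simp only [map_tmul, comp_apply, lTensor_tmul, char, right,
      LinearEquiv.coe_coe, TensorProduct.rid_tmul, map_smul]

/-- The functional `u ε^r` is multiplicative on the cotensor product. -/
theorem char_mul {t : A ⊗[k] A} (ht : t ∈ A.cot) :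
    ε.char (A.m t) = ε.char (slice A ε.char t) := by
  rw [char_eq_left, left_mul ε ht, ← char_eq_left]

end RelDGA.Augmentation
end Operators

/-! ### The differential of the bar complex -/

section BarDifferential

variable {k O : Type u} [Field k] [AddCommGroup O] [Module k O] [Coalgebra k O] {A : RelDGA k O}

theorem bar_cases (y : BarTot A) : ∃ f x, y = barZero A f + barCons A x :=
  ⟨_, _, (bar_decomp y).symm⟩

theorem barCounit_zero (f : O) : barCounit A (barZero A f) = counit (R := k) f :=
  congrArg (counit (R := k) (A := O)) (barPrZero_zero (A := A) f)

theorem barCounit_cons (x : A ⊗[k] BarTot A) : barCounit A (barCons A x) = 0 :=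
  (congrArg (counit (R := k) (A := O)) (barPrZero_cons (A := A) x)).trans (map_zero _)

theorem barUncons_colinear (y : BarTot A) : coactLeft A.coactL (BarTot A) (barUncons A y) =
    lTensor O (barUncons A) (barLam A y) := by
  obtain ⟨f, x, rfl⟩ := bar_cases y
  have h1 : barUncons A ∘ₗ barZero A = 0 := LinearMap.ext fun f => barUncons_zero f
  have h2 : barUncons A ∘ₗ barCons A = LinearMap.id := LinearMap.ext fun f => barUncons_cons f
  rw [map_add, map_add, map_add, map_add, barUncons_zero, barUncons_cons, barLam_zero, barLam_cons,
    ← lTensor_comp_apply, ← lTensor_comp_apply, h1, h2]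
  simp

theorem barUncons_word (α : A →ₗ[k] A) (y : BarTot A) :
    barUncons A (barWord A α y) = map α (barWord A α) (barUncons A y) := by
  obtain ⟨f, x, rfl⟩ := bar_cases y
  simp [barWord_zero, barWord_cons]

theorem barCounit_word (α : A →ₗ[k] A) (y : BarTot A) :
    barCounit A (barWord A α y) = barCounit A y := by
  obtain ⟨f, x, rfl⟩ := bar_cases y
  simp [barWord_zero, barWord_cons, barCounit_cons]

theorem barUncons_der (α β : A →ₗ[k] A) (y : BarTot A) : barUncons A (barDer A α β y) =
    rTensor (BarTot A) α (barUncons A y) +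
      map β (barDer A α β) (barUncons A y) := by
  obtain ⟨f, x, rfl⟩ := bar_cases y
  simp [barDer_zero, barDer_cons]

theorem barCounit_der (α β : A →ₗ[k] A) (y : BarTot A) : barCounit A (barDer A α β y) = 0 := by
  obtain ⟨f, x, rfl⟩ := bar_cases y
  simp [barDer_zero, barDer_cons, barCounit_cons]

theorem map_mem_barCot {α : A →ₗ[k] A} (hα : A.Bicolinear α) {f : BarTot A →ₗ[k] BarTot A}
    (hf : ∀ y ∈ barTotSub A, barLam A (f y) = lTensor O f (barLam A y))
    {x : A ⊗[k] BarTot A} (hx : x ∈ barCot A) (hx' : x ∈ subTensor ⊤ (barTotSub A)) :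
    map α f x ∈ barCot A :=
  map_mem_cotensor hα.right hf hx hx'

theorem map_mem_top_sub {α : A →ₗ[k] A} {f : BarTot A →ₗ[k] BarTot A}
    (hf : ∀ y ∈ barTotSub A, f y ∈ barTotSub A)
    {x : A ⊗[k] BarTot A} (hx' : x ∈ subTensor ⊤ (barTotSub A)) :
    map α f x ∈ subTensor ⊤ (barTotSub A) :=
  subTensor_map (P' := ⊤) (fun _ _ => trivial) hf hx'

theorem map_word_mem_barCot {α β : A →ₗ[k] A} (hα : A.Bicolinear α) (hβ : A.Bicolinear β)
    {x : A ⊗[k] BarTot A} (hx : x ∈ barCot A) : map α (barWord A β) x ∈ barCot A :=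
  map_mem_cotensor hα.right (Q := ⊤) (fun y _ => barLam_word hβ y) hx (mem_subTensor_top x)

theorem lTensor_uncons_mem {y : A ⊗[k] BarTot A} (hy : y ∈ barCot A) :
    lTensor A (barUncons A) y ∈ cotensor A.coactR (coactLeft A.coactL (BarTot A)) :=
  mem_cotensor_map barUncons_colinear hy

section action

variable (ε : A.Augmentation)

/-- The action `a ⊗ (x₁ ⊗ ⋯ ⊗ xₙ ⊗ f) ↦ a x₁ ⊗ ⋯ ⊗ xₙ ⊗ f` for `n ≥ 1`, and
`a ⊗ f ↦ u(f) ε^l(a)` on `Bar_0`. -/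
def barAct : A ⊗[k] BarTot A →ₗ[k] BarTot A :=
  barZero A ∘ₗ ε.left ∘ₗ slice A (barCounit A) +
    barCons A ∘ₗ mulTensor A.m (BarTot A) ∘ₗ lTensor A (barUncons A)

theorem barAct_apply (y : A ⊗[k] BarTot A) : barAct ε y =
    barZero A (ε.left (slice A (barCounit A) y)) +
      barCons A (mulTensor A.m (BarTot A) (lTensor A (barUncons A) y)) := rfl

theorem barUncons_act (y : A ⊗[k] BarTot A) : barUncons A (barAct ε y) =
    mulTensor A.m (BarTot A) (lTensor A (barUncons A) y) := by
  simp [barAct_apply]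

theorem barCounit_act (y : A ⊗[k] BarTot A) : barCounit A (barAct ε y) =
    ε.char (slice A (barCounit A) y) := by
  rw [barAct_apply, map_add, barCounit_zero, barCounit_cons, add_zero, ε.char_eq_left]

theorem barAct_zero (a : A) (f : O) : barAct ε (a ⊗ₜ barZero A f) =
    barZero A (counit (R := k) f • ε.left a) := by
  simp [barAct_apply, slice_tmul, barCounit_zero]

theorem barAct_lTensor_cons (x : A ⊗[k] (A ⊗[k] BarTot A)) :
    barAct ε (lTensor A (barCons A) x) = barCons A (mulTensor A.m (BarTot A) x) := by
  have h1 : barUncons A ∘ₗ barCons A = LinearMap.id := LinearMap.ext fun f => barUncons_cons f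
  have h2 : ∀ x, slice A (barCounit A) (lTensor A (barCons A) x) = 0 := by
    intro x
    induction x with
    | zero => simp
    | add x y hx hy => simp only [map_add, hx, hy, add_zero]
    | tmul a y => simp [slice_tmul, barCounit_cons]
  rw [barAct_apply, h2, ← lTensor_comp_apply, h1]
  simp

variable {ε}

/-- The scalar `c` lets the signs and the weight operators be treated together: it is `1` for the
former, and for the latter the power lost by a multiplication of two letters. -/
theorem barWord_act {α : A →ₗ[k] A} {c : k}
    (hm : ∀ t ∈ A.cot, α (A.m t) = c • A.m (map α α t))
    (hl : ∀ x, ε.left x = c • ε.left (α x)) {y : A ⊗[k] BarTot A} (hy : y ∈ barCot A) :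
    barWord A α (barAct ε y) = c • barAct ε (map α (barWord A α) y) := by
  have h1 : barCounit A ∘ₗ barWord A α = barCounit A := LinearMap.ext fun f => barCounit_word α f
  have h2 : barUncons A ∘ₗ barWord A α = map α (barWord A α) ∘ₗ barUncons A :=
    LinearMap.ext fun f => barUncons_word α f
  have h3 : lTensor A (barUncons A) (map α (barWord A α) y) =
      map α (map α (barWord A α))
        (lTensor A (barUncons A) y) := by
    rw [← comp_apply, LinearMap.lTensor_comp_map, h2, ← LinearMap.map_comp_lTensor]
    rfl
  rw [barAct_apply, barAct_apply, map_add, barWord_zero, barWord_cons,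
    mulTensor_map hm (barWord A α) (lTensor_uncons_mem hy), h3, slice_map, h1,
    hl (slice A (barCounit A) y)]
  simp only [map_smul, smul_add]

theorem barAct_colinear {y : A ⊗[k] BarTot A} (hy : y ∈ barCot A) : barLam A (barAct ε y) =
    lTensor O (barAct ε) (coactLeft A.coactL (BarTot A) y) := by
  have e : barAct ε = barZero A ∘ₗ ε.left ∘ₗ slice A (barCounit A) +
    barCons A ∘ₗ mulTensor A.m (BarTot A) ∘ₗ lTensor A (barUncons A) := rfl
  rw [barAct_apply, map_add, barLam_zero, barLam_cons, ε.left_colinear,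
    mulTensor_coactLeft A (BarTot A) (lTensor_uncons_mem hy), coactLeft_lTensor, e,
    LinearMap.lTensor_add, LinearMap.add_apply, ← slice_coactLeft]
  simp only [lTensor_comp_apply]

theorem mulTensor_mem_barCot {z : A ⊗[k] (A ⊗[k] BarTot A)}
    (hz : z ∈ cotensor A.coactR (coactLeft A.coactL (BarTot A)))
    (hz' : z ∈ subTensor ⊤ (barCot A)) : mulTensor A.m (BarTot A) z ∈ barCot A := by
  refine mem_cotensor.2 ?_
  rw [mulTensor_coactMid A (BarTot A) hz, ← mulTensor_lTensor]
  congr 1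
  exact eq_on_subTensor (F := lTensor A (coactMid A.coactR (BarTot A)))
    (G := lTensor A (lTensor A (barLam A)))
    (fun a _ w hw => by simp only [lTensor_tmul]; rw [mem_cotensor.1 hw]) hz'

theorem mulTensor_mem_top {m : A ⊗[k] A →ₗ[k] A} {Y : Type u} [AddCommGroup Y] [Module k Y]
    {Q : Submodule k Y} {z : A ⊗[k] (A ⊗[k] Y)}
    (hz : z ∈ subTensor ⊤ (subTensor ⊤ Q)) : mulTensor m Y z ∈ subTensor ⊤ Q := by
  refine subTensor_induction ((subTensor ⊤ Q).comap (mulTensor m Y)) (fun a _ w hw => ?_) hz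
  refine subTensor_induction ((subTensor ⊤ Q).comap (mulTensor m Y ∘ₗ TensorProduct.mk k A _ a))
    (fun b _ y hy => ?_) hw
  simpa [mulTensor] using tmul_mem_subTensor (P := ⊤) trivial hy

theorem lTensor_uncons_mem_top {y : A ⊗[k] BarTot A} (hy : y ∈ subTensor ⊤ (barTotSub A)) :
    lTensor A (barUncons A) y ∈ subTensor ⊤ (barCot A) ∧
      lTensor A (barUncons A) y ∈ subTensor ⊤ (subTensor ⊤ (barTotSub A)) :=
  ⟨subTensor_map (P' := ⊤) (f := LinearMap.id) (fun _ _ => trivial)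
      (fun _ h => (barUncons_mem h).1) hy,
    subTensor_map (P' := ⊤) (f := LinearMap.id) (fun _ _ => trivial)
      (fun _ h => (barUncons_mem h).2) hy⟩

theorem barAct_mem {y : A ⊗[k] BarTot A} (hy : y ∈ barCot A)
    (hy' : y ∈ subTensor ⊤ (barTotSub A)) : barAct ε y ∈ barTotSub A := by
  rw [barAct_apply]
  refine add_mem (barZero_mem _) (barCons_mem_iff.2 ⟨?_, ?_⟩)
  · exact mulTensor_mem_barCot (lTensor_uncons_mem hy) (lTensor_uncons_mem_top hy').1
  · exact mulTensor_mem_top (lTensor_uncons_mem_top hy').2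

theorem barAct_assoc {z : A ⊗[k] (A ⊗[k] BarTot A)}
    (hz : z ∈ cotensor A.coactR (coactLeft A.coactL (BarTot A)))
    (hz' : z ∈ subTensor ⊤ (barCot A)) :
    barAct ε (mulTensor A.m (BarTot A) z) = barAct ε (lTensor A (barAct ε) z) := by
  have h1 : barUncons A ∘ₗ barAct ε =
      mulTensor A.m (BarTot A) ∘ₗ lTensor A (barUncons A) :=
    LinearMap.ext fun y => barUncons_act ε y
  have h2 : barCounit A ∘ₗ barAct ε = ε.char ∘ₗ slice A (barCounit A) :=
    LinearMap.ext fun y => barCounit_act ε y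
  rw [barAct_apply, barAct_apply]
  refine congrArg₂ (· + ·) (congrArg _ ?_) (congrArg _ ?_)
  · have h3 := ε.left_mul (slice_mem_cot A (BarTot A) hz (barCounit A))
    have h6 : slice A (barCounit A) (lTensor A (barAct ε) z) =
        slice A (ε.char ∘ₗ slice A (barCounit A)) z := by
      rw [lTensor, slice_map, h2]; rfl
    have h7 : slice A ε.char (lTensor A (slice A (barCounit A)) z) =
        slice A (ε.char ∘ₗ slice A (barCounit A)) z := by
      rw [lTensor, slice_map]; rfl
    rw [slice_mulTensor, h3, h7, h6]
  · rw [← mulTensor_lTensor, ← lTensor_comp_apply, h1, lTensor_comp_apply]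
    refine mulTensor_assoc A (BarTot A)
      (mem_cotensor_map (fun y => coactLeft_lTensor A.coactL (barUncons A) y) hz) ?_
    refine eq_on_subTensor (F := lTensor A (coactMid A.coactR (A ⊗[k] BarTot A) -
      lTensor A (coactLeft A.coactL (BarTot A))) ∘ₗ
        lTensor A (lTensor A (barUncons A))) (G := 0) (fun a _ w hw => ?_) hz'
    have h4 : coactLeft A.coactL (BarTot A) ∘ₗ barUncons A =
      lTensor O (barUncons A) ∘ₗ barLam A := LinearMap.ext barUncons_colinear
    have h5 : coactMid A.coactR (A ⊗[k] BarTot A) (lTensor A (barUncons A) w) =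
        lTensor A (coactLeft A.coactL (BarTot A))
          (lTensor A (barUncons A) w) := by
      rw [coactMid_lTensor, mem_cotensor.1 hw, ← lTensor_comp_apply,
        ← lTensor_comp_apply, h4]
    simp only [comp_apply, lTensor_tmul, LinearMap.sub_apply, h5, sub_self,
      tmul_zero, LinearMap.zero_apply]

end action

section tail

variable (ε : A.Augmentation)

/-- The part of the differential of the bar complex which comes from the multiplication of
adjacent factors and from `ε^l`. -/
def barTail : BarTot A →ₗ[k] BarTot A :=
  barRec 0 (-(barCons A ∘ₗ rTensor (BarTot A) A.sgn))
    (-(barAct ε ∘ₗ map A.sgn (barWord A A.sgn)))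

/-- The part of the differential of the bar complex which comes from `ε^r`. -/
def barHead : BarTot A →ₗ[k] BarTot A :=
  barWord A A.sgn ∘ₗ sliceL (BarTot A) ε.char ∘ₗ barUncons A

theorem barTail_zero (f : O) : barTail ε (barZero A f) = 0 := barRec_zero _ _ _ _

theorem barTail_cons (x : A ⊗[k] BarTot A) : barTail ε (barCons A x) =
    -barAct ε (map A.sgn (barWord A A.sgn) x) -
      barCons A (map A.sgn (barTail ε) x) := by
  rw [barTail, barRec_cons, ← barTail, LinearMap.neg_apply, LinearMap.neg_apply,
    comp_apply, comp_apply, ← comp_apply (rTensor _ _),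
    LinearMap.rTensor_comp_lTensor]
  abel

theorem barHead_zero (f : O) : barHead ε (barZero A f) = 0 := by simp [barHead]

theorem barHead_cons (x : A ⊗[k] BarTot A) : barHead ε (barCons A x) =
    barWord A A.sgn (sliceL (BarTot A) ε.char x) := by simp [barHead]

variable {ε}

theorem barWord_sgn_sgn (x : BarTot A) : barWord A A.sgn (barWord A A.sgn x) = x := by
  rw [barWord_comp, show A.sgn ∘ₗ A.sgn = LinearMap.id from LinearMap.ext RelDGA.sgn_sgn,
    barWord_id]

theorem barWord_comm {α β : A →ₗ[k] A} (h : ∀ x, α (β x) = β (α x)) (x : BarTot A) :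
    barWord A α (barWord A β x) = barWord A β (barWord A α x) := by
  rw [barWord_comp, barWord_comp, show α ∘ₗ β = β ∘ₗ α from LinearMap.ext h]

theorem barTail_colinear {x : BarTot A} (hx : x ∈ barTotSub A) :
    barLam A (barTail ε x) = lTensor O (barTail ε) (barLam A x) := by
  have h := (barUncons_mem hx).1
  rw [← bar_decomp x]
  generalize barUncons A x = y at h
  have h1 : barTail ε ∘ₗ barZero A = 0 := LinearMap.ext fun f => barTail_zero ε f
  have h2 : barTail ε ∘ₗ barCons A =
      -(barAct ε ∘ₗ map A.sgn (barWord A A.sgn)) -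
      barCons A ∘ₗ map A.sgn (barTail ε) :=
    LinearMap.ext fun f => barTail_cons ε f
  rw [map_add, map_add, map_add, map_add, barTail_zero, map_zero, barLam_zero, barTail_cons,
    map_sub, map_neg, barAct_colinear
      (map_word_mem_barCot RelDGA.sgn_bicolinear RelDGA.sgn_bicolinear h),
    barLam_cons, barLam_cons, coactLeft_map RelDGA.sgn_bicolinear.left,
    coactLeft_map RelDGA.sgn_bicolinear.left, ← lTensor_comp_apply O (barTail ε),
    ← lTensor_comp_apply O (barTail ε), h1, h2, LinearMap.lTensor_sub,
    LinearMap.lTensor_neg]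
  simp only [LinearMap.lTensor_zero, LinearMap.zero_apply, LinearMap.sub_apply,
    LinearMap.neg_apply, lTensor_comp_apply]

theorem barTail_mem {x : BarTot A} (hx : x ∈ barTotSub A) : barTail ε x ∈ barTotSub A := by
  refine barTotSub_induction ((barTotSub A).comap (barTail ε)) (fun f => ?_) (fun x h1 h2 => ?_) hx
  · rw [mem_comap, barTail_zero]; exact zero_mem _
  · have h3 : x ∈ subTensor ⊤ (barTotSub A) := subTensor_mono le_rfl inf_le_right h2
    rw [mem_comap, barTail_cons]
    refine sub_mem (neg_mem (barAct_mem ?_ ?_)) (barCons_mem_iff.2 ⟨?_, ?_⟩)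
    · exact map_word_mem_barCot RelDGA.sgn_bicolinear RelDGA.sgn_bicolinear h1
    · exact map_mem_top_sub (fun y hy => barWord_mem RelDGA.sgn_bicolinear hy) h3
    · exact map_mem_barCot RelDGA.sgn_bicolinear (fun y hy => barTail_colinear hy) h1 h3
    · exact subTensor_map (P' := ⊤) (fun _ _ => trivial) (fun y hy => (Submodule.mem_inf.1 hy).1) h2

theorem barHead_mem {x : BarTot A} (hx : x ∈ barTotSub A) : barHead ε x ∈ barTotSub A :=
  barWord_mem RelDGA.sgn_bicolinear (sliceL_mem (barUncons_mem hx).2 _)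

theorem barWord_tail {α : A →ₗ[k] A} {c : k}
    (hm : ∀ t ∈ A.cot, α (A.m t) = c • A.m (map α α t))
    (hl : ∀ x, ε.left x = c • ε.left (α x)) (hs : ∀ x, α (A.sgn x) = A.sgn (α x))
    {x : BarTot A} (hx : x ∈ barTotSub A) :
    barWord A α (barTail ε x) = c • barTail ε (barWord A α x) := by
  refine barTotSub_induction (eqLocus (barWord A α ∘ₗ barTail ε)
    (c • barTail ε ∘ₗ barWord A α)) (fun f => ?_) (fun x h1 h2 => ?_) hx
  · simp [LinearMap.mem_eqLocus, barTail_zero, barWord_zero]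
  · have h3 : map α (barWord A α) (map A.sgn (barWord A A.sgn) x) =
        map A.sgn (barWord A A.sgn) (map α (barWord A α) x) := by
      refine eq_on_subTensor (F := map α (barWord A α) ∘ₗ
        map A.sgn (barWord A A.sgn)) (G := map A.sgn (barWord A A.sgn)
          ∘ₗ map α (barWord A α)) (fun a _ y _ => ?_) (mem_subTensor_top x)
      simp only [comp_apply, map_tmul, hs, barWord_comm hs]
    have h4 : map α (barWord A α) (map A.sgn (barTail ε) x) =
        c • map A.sgn (barTail ε) (map α (barWord A α) x) := by
      refine eq_on_subTensor (F := map α (barWord A α) ∘ₗ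
        map A.sgn (barTail ε)) (G := c • map A.sgn (barTail ε)
          ∘ₗ map α (barWord A α)) (fun a _ y hy => ?_) h2
      have h5 : barWord A α (barTail ε y) = c • barTail ε (barWord A α y) := hy.1
      simp only [comp_apply, map_tmul, hs, h5, LinearMap.smul_apply,
        TensorProduct.tmul_smul]
    change barWord A α (barTail ε (barCons A x)) = c • barTail ε (barWord A α (barCons A x))
    rw [barTail_cons, map_sub, map_neg, barWord_act hm hl
      (map_word_mem_barCot RelDGA.sgn_bicolinear RelDGA.sgn_bicolinear h1), barWord_cons,
      barWord_cons, barTail_cons, h3, h4, map_smul, smul_sub, smul_neg]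

theorem barWord_head {α : A →ₗ[k] A} {c : k} (hl : ∀ x, ε.char x = c • ε.char (α x))
    (hs : ∀ x, α (A.sgn x) = A.sgn (α x)) (x : BarTot A) :
    barWord A α (barHead ε x) = c • barHead ε (barWord A α x) := by
  have key : ∀ w : A ⊗[k] BarTot A, barWord A α (sliceL (BarTot A) ε.char w) =
      c • sliceL (BarTot A) ε.char (map α (barWord A α) w) := by
    intro w
    induction w with
    | zero => simp
    | add x y hx hy => simp only [map_add, hx, hy, smul_add]
    | tmul a y =>
      rw [sliceL_tmul, map_tmul, sliceL_tmul, map_smul, hl a, smul_assoc]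
  simp only [barHead, comp_apply]
  rw [barWord_comm hs, key, barUncons_word, map_smul]

theorem barTail_sgn {x : BarTot A} (hx : x ∈ barTotSub A) :
    barTail ε (barWord A A.sgn x) = barWord A A.sgn (barTail ε x) := by
  rw [barWord_tail (c := 1) (fun t ht => by rw [RelDGA.sgn_mul ht, one_smul])
    (fun x => by rw [ε.left_sgn, one_smul]) (fun _ => rfl) hx, one_smul]

theorem barHead_sgn (x : BarTot A) :
    barHead ε (barWord A A.sgn x) = barWord A A.sgn (barHead ε x) := by
  rw [barWord_head (c := 1) (fun x => by rw [ε.char_sgn, one_smul]) (fun _ => rfl) x, one_smul]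

/-- Recursion step for the square of `barTail`: the associativity of the action of `A` cancels the
products of three adjacent letters. -/
theorem barTail_act {y : A ⊗[k] BarTot A} (hy : y ∈ barCot A)
    (hy' : y ∈ subTensor ⊤ (barTotSub A)) :
    barTail ε (barAct ε y) = barAct ε (map A.sgn (barTail ε) y) := by
  have hm : ∀ t ∈ A.cot, A.sgn (A.m t) = (1 : k) • A.m (map A.sgn A.sgn t) :=
    fun t ht => by rw [RelDGA.sgn_mul ht, one_smul]
  set z := lTensor A (barUncons A) y with hz
  have z1 : z ∈ cotensor A.coactR (coactLeft A.coactL (BarTot A)) := lTensor_uncons_mem hy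
  have z2 := (lTensor_uncons_mem_top hy').1
  have e1 : map A.sgn (barTail ε) y =
      -lTensor A (barAct ε) (map A.sgn (map A.sgn
        (barWord A A.sgn)) z) - lTensor A (barCons A)
          (map A.sgn (map A.sgn (barTail ε)) z) := by
    rw [hz]
    clear_value z
    clear hz z1 z2 hy hy'
    induction y with
    | zero => simp
    | add x y hx hy => simp only [map_add, hx, hy]; abel
    | tmul a t =>
      obtain ⟨f, x, rfl⟩ := bar_cases t
      simp only [lTensor_tmul, map_tmul, map_add, barTail_zero,
        barTail_cons, barUncons_zero, barUncons_cons, zero_add, TensorProduct.tmul_sub,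
        TensorProduct.tmul_neg]
  have e2 : map A.sgn (map A.sgn (barWord A A.sgn)) z ∈
      cotensor A.coactR (coactLeft A.coactL (BarTot A)) :=
    map_mem_cotensor RelDGA.sgn_bicolinear.right (Q := ⊤)
      (fun w _ => coactLeft_map RelDGA.sgn_bicolinear.left _ w) z1 (mem_subTensor_top z)
  have e3 : map A.sgn (map A.sgn (barWord A A.sgn)) z ∈
      subTensor ⊤ (barCot A) :=
    subTensor_map (P' := ⊤) (fun _ _ => trivial)
      (fun w hw => map_word_mem_barCot RelDGA.sgn_bicolinear RelDGA.sgn_bicolinear hw) z2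
  rw [barAct_apply, map_add, barTail_zero, zero_add, barTail_cons, mulTensor_map hm _ z1,
    mulTensor_map hm _ z1, one_smul, one_smul, barAct_assoc e2 e3, e1, map_sub, map_neg,
    barAct_lTensor_cons]

/-- The part of the differential given by products and `ε^l` squares to zero, as for the bar
resolution. -/
theorem barTail_tail {x : BarTot A} (hx : x ∈ barTotSub A) : barTail ε (barTail ε x) = 0 := by
  refine barTotSub_induction (LinearMap.ker (barTail ε ∘ₗ barTail ε)) (fun f => ?_)
    (fun x h1 h2 => ?_) hx
  · simp [barTail_zero]
  · have h3 : x ∈ subTensor ⊤ (barTotSub A) := subTensor_mono le_rfl inf_le_right h2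
    have e1 : map A.sgn (barTail ε) (map A.sgn (barWord A A.sgn) x) =
        map A.sgn (barWord A A.sgn) (map A.sgn (barTail ε) x) := by
      refine eq_on_subTensor (F := map A.sgn (barTail ε) ∘ₗ
        map A.sgn (barWord A A.sgn)) (G := map A.sgn (barWord A A.sgn)
          ∘ₗ map A.sgn (barTail ε)) (fun a _ y hy => ?_) h3
      simp only [comp_apply, map_tmul, barTail_sgn hy]
    have e2 : map A.sgn (barTail ε) (map A.sgn (barTail ε) x) = 0 := by
      refine eq_on_subTensor (F := map A.sgn (barTail ε) ∘ₗ
        map A.sgn (barTail ε)) (G := 0) (fun a _ y hy => ?_) h2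
      have h5 : barTail ε (barTail ε y) = 0 := hy.1
      simp only [comp_apply, map_tmul, h5, tmul_zero,
        LinearMap.zero_apply]
    rw [mem_ker, comp_apply, barTail_cons, map_sub, map_neg, barTail_act
      (map_word_mem_barCot RelDGA.sgn_bicolinear RelDGA.sgn_bicolinear h1)
      (map_mem_top_sub (fun y hy => barWord_mem RelDGA.sgn_bicolinear hy) h3), barTail_cons, e1,
      e2, map_zero]
    abel

theorem sliceL_char_mulTensor {Y : Type u} [AddCommGroup Y] [Module k Y]
    {z : A ⊗[k] (A ⊗[k] Y)} (hz : z ∈ cotensor A.coactR (coactLeft A.coactL Y)) :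
    sliceL Y ε.char (mulTensor A.m Y z) =
      sliceL Y ε.char (lTensor A (sliceL Y ε.char) z) := by
  have key : ∀ (φ : Y →ₗ[k] k) (χ : A →ₗ[k] k) (w : A ⊗[k] Y),
      φ (sliceL Y χ w) = χ (slice A φ w) := by
    intro φ χ w
    induction w with
    | zero => simp
    | add x y hx hy => simp only [map_add, hx, hy]
    | tmul a y => simp [slice_tmul, mul_comm]
  have h : ∀ φ : Y →ₗ[k] k, φ (sliceL Y ε.char (mulTensor A.m Y z)) =
      φ (sliceL Y ε.char (lTensor A (sliceL Y ε.char) z)) := by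
    intro φ
    rw [key, slice_mulTensor, ε.char_mul (slice_mem_cot A Y hz φ), key, lTensor,
      lTensor, slice_map, slice_map]
    have e : ε.char ∘ₗ slice A φ = φ ∘ₗ sliceL Y ε.char :=
      LinearMap.ext fun w => (key φ ε.char w).symm
    rw [e]
  rw [← sub_eq_zero]
  refine (Module.forall_dual_apply_eq_zero_iff k _).1 fun φ => ?_
  rw [map_sub, h, sub_self]

theorem sliceL_map {M M' Y Z : Type u} [AddCommGroup M] [Module k M] [AddCommGroup M'] [Module k M']
    [AddCommGroup Y] [Module k Y] [AddCommGroup Z] [Module k Z] (α : M →ₗ[k] M') (f : Y →ₗ[k] Z)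
    (ψ : M' →ₗ[k] k) (w : M ⊗[k] Y) :
    sliceL Z ψ (map α f w) = f (sliceL Y (ψ ∘ₗ α) w) := by
  induction w with
  | zero => simp
  | add x y hx hy => simp only [map_add, hx, hy]
  | tmul a y => simp

theorem char_comp_sgn : ε.char ∘ₗ A.sgn = ε.char := LinearMap.ext ε.char_sgn

/-- The remaining terms of the square of the outer differential, all of which involve `ε^r`, cancel
because `u ε^r` is multiplicative. -/
theorem barHead_tail {x : BarTot A} (hx : x ∈ barTotSub A) :
    barHead ε (barTail ε x) + barTail ε (barHead ε x) + barHead ε (barHead ε x) = 0 := by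
  have h := barUncons_mem hx
  rw [← bar_decomp x]
  generalize barUncons A x = y at h
  generalize barPrZero A x = f
  have e1 := lTensor_uncons_mem
    (map_word_mem_barCot RelDGA.sgn_bicolinear RelDGA.sgn_bicolinear h.1)
  have e2 : sliceL (BarTot A) ε.char y ∈ barTotSub A := sliceL_mem h.2 _
  have e3 : barHead ε = (barWord A A.sgn ∘ₗ sliceL (BarTot A) ε.char) ∘ₗ barUncons A := rfl
  have e4 : barHead ε (barAct ε (map A.sgn (barWord A A.sgn) y)) =
      barHead ε (barWord A A.sgn (sliceL (BarTot A) ε.char y)) := by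
    rw [e3, comp_apply, barUncons_act, comp_apply, sliceL_char_mulTensor e1,
      ← sliceL_lTensor, ← lTensor_comp_apply, ← lTensor_comp_apply, ← e3,
      sliceL_lTensor, sliceL_map, char_comp_sgn]
  simp only [map_add, barTail_zero, barHead_zero, zero_add, barTail_cons, map_sub,
    map_neg, barHead_cons, e4, barTail_sgn e2, sliceL_map, char_comp_sgn]
  abel

/-- The Leibniz rule of `A`, and the vanishing of `ε d`. -/
theorem barDer_act {y : A ⊗[k] BarTot A} (hy : y ∈ barCot A) :
    barDer A A.d A.sgn (barAct ε y) = barAct ε (rTensor (BarTot A) A.d y) +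
      barAct ε (map A.sgn (barDer A A.d A.sgn) y) := by
  have hm : ∀ t ∈ A.cot, A.sgn (A.m t) = (1 : k) • A.m (map A.sgn A.sgn t) :=
    fun t ht => by rw [RelDGA.sgn_mul ht, one_smul]
  have z1 := lTensor_uncons_mem hy
  have h1 : barCounit A ∘ₗ barDer A A.d A.sgn = 0 := LinearMap.ext fun f => barCounit_der _ _ f
  have h2 : lTensor A (barUncons A) (map A.sgn (barDer A A.d A.sgn) y) =
      map A.sgn (rTensor (BarTot A) A.d)
        (lTensor A (barUncons A) y) + map A.sgn (map A.sgn
          (barDer A A.d A.sgn)) (lTensor A (barUncons A) y) := by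
    clear z1 hy
    induction y with
    | zero => simp
    | add x y hx hy => simp only [map_add, hx, hy]; abel
    | tmul a t => simp only [lTensor_tmul, map_tmul, barUncons_der,
        tmul_add]
  have h3 : slice A (barCounit A ∘ₗ barDer A A.d A.sgn) y = 0 := by
    rw [h1]; simp [slice]
  rw [barAct_apply, barAct_apply, barAct_apply, map_add, barDer_zero, zero_add, barDer_cons,
    mulTensor_d A (BarTot A) z1, mulTensor_map hm _ z1, one_smul, slice_rTensor, ε.left_d,
    slice_map, h3, h2, rTensor_lTensor]
  simp only [map_add, map_zero, zero_add]
  abel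

theorem barDer_tail {x : BarTot A} (hx : x ∈ barTotSub A) :
    barDer A A.d A.sgn (barTail ε x) + barTail ε (barDer A A.d A.sgn x) = 0 := by
  refine barTotSub_induction (LinearMap.ker (barDer A A.d A.sgn ∘ₗ barTail ε +
    barTail ε ∘ₗ barDer A A.d A.sgn)) (fun f => ?_) (fun x h1 h2 => ?_) hx
  · simp [barTail_zero, barDer_zero]
  · have h3 : x ∈ subTensor ⊤ (barTotSub A) := subTensor_mono le_rfl inf_le_right h2
    have sd : ∀ y : BarTot A, barWord A A.sgn (barDer A A.d A.sgn y) =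
        -barDer A A.d A.sgn (barWord A A.sgn y) := by
      intro y
      rw [barWord_der (c := -1) (fun x => by rw [RelDGA.sgn_d, neg_one_smul]) (fun _ => rfl),
        neg_one_smul]
    have e1 : rTensor (BarTot A) A.d (map A.sgn (barWord A A.sgn) x) +
        map A.sgn (barWord A A.sgn) (rTensor (BarTot A) A.d x) = 0 := by
      clear h1 h2 h3
      induction x with
      | zero => simp
      | add x y hx hy =>
        simp only [map_add]; rw [add_add_add_comm, hx, hy, add_zero]
      | tmul a t => simp [RelDGA.sgn_d, neg_tmul]
    have e2 : map A.sgn (barDer A A.d A.sgn)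
        (map A.sgn (barWord A A.sgn) x) + map A.sgn (barWord A A.sgn)
          (map A.sgn (barDer A A.d A.sgn) x) = 0 := by
      clear h1 h2 h3 e1
      induction x with
      | zero => simp
      | add x y hx hy =>
        simp only [map_add]; rw [add_add_add_comm, hx, hy, add_zero]
      | tmul a t => simp [sd, TensorProduct.tmul_neg]
    have e3 : rTensor (BarTot A) A.d (map A.sgn (barTail ε) x) +
        map A.sgn (barTail ε) (rTensor (BarTot A) A.d x) = 0 := by
      clear h1 h2 h3 e1 e2
      induction x with
      | zero => simp
      | add x y hx hy =>
        simp only [map_add]; rw [add_add_add_comm, hx, hy, add_zero]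
      | tmul a t => simp [RelDGA.sgn_d, neg_tmul]
    have e4 : map A.sgn (barDer A A.d A.sgn)
        (map A.sgn (barTail ε) x) + map A.sgn (barTail ε)
          (map A.sgn (barDer A A.d A.sgn) x) = 0 := by
      refine eq_on_subTensor (F := map A.sgn (barDer A A.d A.sgn) ∘ₗ
        (map A.sgn (barTail ε)) + map A.sgn (barTail ε) ∘ₗ
          (map A.sgn (barDer A A.d A.sgn))) (G := 0) (fun a _ y hy => ?_) h2
      have h5 : barDer A A.d A.sgn (barTail ε y) + barTail ε (barDer A A.d A.sgn y) = 0 := hy.1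
      simp only [comp_apply, LinearMap.add_apply, map_tmul,
        ← tmul_add, h5, tmul_zero, LinearMap.zero_apply]
    change barDer A A.d A.sgn (barTail ε (barCons A x)) +
      barTail ε (barDer A A.d A.sgn (barCons A x)) = 0
    rw [barTail_cons, barDer_cons, map_add, map_sub, map_neg, barTail_cons, barTail_cons,
      barDer_act (map_word_mem_barCot RelDGA.sgn_bicolinear RelDGA.sgn_bicolinear h1),
      barDer_cons, eq_neg_of_add_eq_zero_right e1, eq_neg_of_add_eq_zero_right e2,
      eq_neg_of_add_eq_zero_right e3, eq_neg_of_add_eq_zero_right e4]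
    simp only [map_neg]
    abel

theorem barDer_head (x : BarTot A) :
    barDer A A.d A.sgn (barHead ε x) + barHead ε (barDer A A.d A.sgn x) = 0 := by
  obtain ⟨f, y, rfl⟩ := bar_cases x
  have sd : ∀ y : BarTot A, barWord A A.sgn (barDer A A.d A.sgn y) =
      -barDer A A.d A.sgn (barWord A A.sgn y) := by
    intro y
    rw [barWord_der (c := -1) (fun x => by rw [RelDGA.sgn_d, neg_one_smul]) (fun _ => rfl),
      neg_one_smul]
  have h : ε.char ∘ₗ A.d = 0 := LinearMap.ext ε.char_d
  have h' : ∀ w, sliceL (BarTot A) (0 : A →ₗ[k] k) w = 0 := fun w => by simp [sliceL]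
  simp only [map_add, barHead_zero, barDer_zero, map_zero, zero_add, barHead_cons, barDer_cons,
    rTensor, sliceL_map, h, char_comp_sgn, sd, h']
  abel

theorem barDer_der (x : BarTot A) : barDer A A.d A.sgn (barDer A A.d A.sgn x) = 0 := by
  refine LinearMap.congr_fun (barTot_ext (F := barDer A A.d A.sgn ∘ₗ barDer A A.d A.sgn)
    (G := 0) (fun f => ?_) (fun a t h => ?_)) x
  · simp [barDer_zero]
  · have h' : barDer A A.d A.sgn (barDer A A.d A.sgn t) = 0 := h
    simp [barDer_cons, RelDGA.d_d_apply, h', RelDGA.sgn_d, neg_tmul]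

end tail

section comparison

variable (ε : A.Augmentation)

theorem barWord_sgn_incl (n : ℕ) (t : barSp A n) :
    barWord A A.sgn (barIncl A n t) = barIncl A n (barSgn A n t) := by
  induction n with
  | zero => exact barWord_zero (A := A) _ t
  | succ n ih =>
    have h : barWord A A.sgn ∘ₗ barIncl A n = barIncl A n ∘ₗ barSgn A n := LinearMap.ext ih
    have key : ∀ t : A ⊗[k] barSp A n, barWord A A.sgn (barIncl A (n + 1) t) =
        barIncl A (n + 1) (map A.sgn (barSgn A n) t) := by
      intro t
      rw [← barCons_lTensor_incl, barWord_cons, ← comp_apply (map _ _),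
        LinearMap.map_comp_lTensor, h, ← LinearMap.lTensor_comp_map, comp_apply,
        barCons_lTensor_incl]
    exact key t

theorem barSgnTot_eq : barSgnTot A = barWord A A.sgn :=
  eq_of_incl fun n t => (toModule_barIncl _ n t).trans (barWord_sgn_incl n t).symm

theorem barDer_incl (n : ℕ) (t : barSp A n) :
    barDer A A.d A.sgn (barIncl A n t) = barIncl A n (barInner A n t) := by
  induction n with
  | zero => exact (barDer_zero (A := A) _ _ t).trans (map_zero (barIncl A 0)).symm
  | succ n ih =>
    have h : barDer A A.d A.sgn ∘ₗ barIncl A n = barIncl A n ∘ₗ barInner A n := LinearMap.ext ih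
    have key : ∀ t : A ⊗[k] barSp A n, barDer A A.d A.sgn (barIncl A (n + 1) t) =
        barIncl A (n + 1) (rTensor (barSp A n) A.d t) +
        barIncl A (n + 1) (map A.sgn (barInner A n) t) := by
      intro t
      rw [← barCons_lTensor_incl, barDer_cons, ← comp_apply (map _ _),
        LinearMap.map_comp_lTensor, h, ← LinearMap.lTensor_comp_map, comp_apply,
        barCons_lTensor_incl, rTensor_lTensor, barCons_lTensor_incl]
    exact (key t).trans (map_add (barIncl A (n + 1)) _ _).symm

theorem barTail_incl (n : ℕ) (t : barSp A (n + 1)) :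
    barTail ε (barIncl A (n + 1) t) = barIncl A n (barOuterTail A ε n (barSgn A (n + 1) t)) := by
  induction n with
  | zero =>
    have key : ∀ t : A ⊗[k] O, barTail ε (barCons A (lTensor A (barZero A) t)) =
        barZero A (-TensorProduct.rid k O (map ε.left counit
          (map A.sgn LinearMap.id t))) := by
      intro t
      rw [barTail_cons]
      induction t with
      | zero => simp
      | add x y hx hy =>
        simp only [map_add, neg_add] at hx hy ⊢
        rw [← hx, ← hy]; abel
      | tmul a f =>
        simp only [lTensor_tmul, map_tmul, barWord_zero, barTail_zero,
          barAct_zero, tmul_zero, map_zero, sub_zero, TensorProduct.rid_tmul,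
          LinearMap.id_apply, map_neg]
    exact (congrArg (barTail ε) (barCons_lTensor_incl 0 t).symm).trans (key t)
  | succ n ih =>
    have h : barWord A A.sgn ∘ₗ barIncl A (n + 1) = barIncl A (n + 1) ∘ₗ barSgn A (n + 1) :=
      LinearMap.ext (barWord_sgn_incl (n + 1))
    have h1 : barTail ε ∘ₗ barIncl A (n + 1) =
        barIncl A n ∘ₗ (barOuterTail A ε n ∘ₗ barSgn A (n + 1)) := LinearMap.ext ih
    have hg : ∀ g : A ⊗[k] barSp A n →ₗ[k] BarTot A,
        g = barCons A ∘ₗ lTensor A (barIncl A n) → ∀ w : A ⊗[k] (A ⊗[k] barSp A n),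
        barAct ε (lTensor A g w) = g (mulTensor A.m (barSp A n) w) := by
      rintro _ rfl w
      rw [lTensor_comp_apply, barAct_lTensor_cons, comp_apply,
        mulTensor_lTensor]
    have h2 := hg (barIncl A (n + 1)) (LinearMap.ext fun y => (barCons_lTensor_incl n y).symm)
    have key : ∀ t : A ⊗[k] barSp A (n + 1),
        barTail ε (barCons A (lTensor A (barIncl A (n + 1)) t)) =
        -barAct ε (lTensor A (barIncl A (n + 1))
          (map A.sgn (barSgn A (n + 1)) t)) -
        barCons A (lTensor A (barIncl A n) (lTensor A (barOuterTail A ε n)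
          (map A.sgn (barSgn A (n + 1)) t))) := by
      intro t
      rw [barTail_cons, ← comp_apply (map _ _),
        ← comp_apply (map _ _), LinearMap.map_comp_lTensor,
        LinearMap.map_comp_lTensor, h, h1, ← LinearMap.lTensor_comp_map,
        ← LinearMap.lTensor_comp_map, ← LinearMap.lTensor_comp_map]
      rfl
    refine (congrArg (barTail ε) (barCons_lTensor_incl (n + 1) t).symm).trans
      ((key t).trans ?_)
    have h3 := h2 (map A.sgn (barSgn A (n + 1)) t)
    have h4 := barCons_lTensor_incl n (lTensor A (barOuterTail A ε n)
          (map A.sgn (barSgn A (n + 1)) t))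
    refine (congrArg₂ (fun a b => -a - b) h3 h4).trans ?_
    have e : ∀ (F : barSp A (n + 1) →ₗ[k] BarTot A) (a b), -F a - F b = F (-a - b) := by
      intro F a b
      rw [map_sub, map_neg]
    exact e (barIncl A (n + 1)) _ _

theorem barHead_incl (n : ℕ) (t : barSp A (n + 1)) :
    barHead ε (barIncl A (n + 1) t) = barIncl A n (barOuterHead A ε n (barSgn A (n + 1) t)) := by
  have h : barWord A A.sgn ∘ₗ barIncl A n = barIncl A n ∘ₗ barSgn A n :=
    LinearMap.ext (barWord_sgn_incl n)
  have key : ∀ t : A ⊗[k] barSp A n, barHead ε (barCons A (lTensor A (barIncl A n) t)) =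
      barIncl A n (sliceL (barSp A n) ε.char (map A.sgn (barSgn A n) t)) := by
    intro t
    rw [barHead_cons, sliceL_lTensor, sliceL_map, char_comp_sgn]
    exact LinearMap.congr_fun h _
  exact (congrArg (barHead ε) (barCons_lTensor_incl n t).symm).trans (key t)

/-- The differential as a sum of three operators which are defined by recursion. -/
theorem barD_eq (x : BarTot A) :
    barD A ε x = barDer A A.d A.sgn x + barTail ε x + barHead ε x := by
  refine LinearMap.congr_fun (eq_of_incl (F := barD A ε)
    (G := barDer A A.d A.sgn + barTail ε + barHead ε) fun n t => ?_) x
  refine (toModule_barIncl _ n t).trans ?_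
  rw [LinearMap.add_apply, LinearMap.add_apply, barDer_incl]
  cases n with
  | zero =>
    have h1 : barTail ε (barIncl A 0 t) = 0 := barTail_zero ε t
    have h2 : barHead ε (barIncl A 0 t) = 0 := barHead_zero ε t
    rw [h1, h2, add_zero, add_zero]
    rfl
  | succ n =>
    rw [barTail_incl, barHead_incl, add_assoc, ← map_add, add_comm (barOuterTail A ε n _)]
    rfl

end comparison

section differential

variable {ε : A.Augmentation}

theorem barD_mem {x : BarTot A} (hx : x ∈ barTotSub A) : barD A ε x ∈ barTotSub A := by
  rw [barD_eq]
  exact add_mem (add_mem (barDer_mem .d RelDGA.sgn_bicolinear hx) (barTail_mem hx)) (barHead_mem hx)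

theorem barD_barD {x : BarTot A} (hx : x ∈ barTotSub A) : barD A ε (barD A ε x) = 0 := by
  have h1 := barDer_der (A := A) x
  have h2 := barDer_tail (ε := ε) hx
  have h3 := barDer_head (ε := ε) x
  have h4 := barHead_tail (ε := ε) hx
  have h5 := barTail_tail (ε := ε) hx
  simp only [barD_eq, map_add]
  rw [h1, h5]
  calc _ = (barDer A A.d A.sgn (barTail ε x) + barTail ε (barDer A A.d A.sgn x)) +
        (barDer A A.d A.sgn (barHead ε x) + barHead ε (barDer A A.d A.sgn x)) +
        (barHead ε (barTail ε x) + barTail ε (barHead ε x) + barHead ε (barHead ε x)) := by abel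
    _ = 0 := by rw [h2, h3, h4]; simp

variable (A) in
/-- The operator `x ↦ c ^ (p - n) x` for `x` in `Bar_n` of inner degree `p`. -/
def barWt (c : k) : BarTot A →ₗ[k] BarTot A := barWord A (c⁻¹ • A.wt c)

theorem smul_wt_bicolinear (c : k) : A.Bicolinear (c⁻¹ • A.wt c) :=
  (RelDGA.wt_bicolinear c).smul _

theorem barWt_mem (c : k) {x : BarTot A} (hx : x ∈ barTotSub A) : barWt A c x ∈ barTotSub A :=
  barWord_mem (smul_wt_bicolinear c) hx

theorem barWt_barD {c : k} (hc : c ≠ 0) {x : BarTot A} (hx : x ∈ barTotSub A) :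
    barWt A c (barD A ε x) = c • barD A ε (barWt A c x) := by
  have hs : ∀ x, (c⁻¹ • A.wt c) (A.sgn x) = A.sgn ((c⁻¹ • A.wt c) x) := by
    intro x
    simp only [LinearMap.smul_apply, RelDGA.wt_sgn, map_smul]
  rw [barD_eq, barD_eq, map_add, map_add, barWt,
    barWord_der (c := c) (fun x => by
      simp only [LinearMap.smul_apply, RelDGA.wt_d hc, map_smul, smul_comm c⁻¹ c]) hs,
    barWord_tail (c := c) (fun t ht => by
      rw [LinearMap.smul_apply, RelDGA.wt_mul hc ht, TensorProduct.map_smul_left,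
        TensorProduct.map_smul_right, LinearMap.smul_apply, LinearMap.smul_apply, map_smul,
        map_smul, smul_smul c c⁻¹, mul_inv_cancel₀ hc, one_smul])
      (fun x => by
        rw [LinearMap.smul_apply, map_smul, ε.left_wt, smul_smul, mul_inv_cancel₀ hc, one_smul])
      hs hx,
    barWord_head (c := c) (fun x => by
        rw [LinearMap.smul_apply, map_smul, ε.char_wt, smul_smul, mul_inv_cancel₀ hc, one_smul])
      hs, smul_add, smul_add]

end differential

end BarDifferential

/-! ### The comultiplication of the bar complex -/

section BarCoproduct

variable {k O : Type u} [Field k] [AddCommGroup O] [Module k O] [Coalgebra k O] {A : RelDGA k O}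

theorem map_map_eq {M₁ M₂ M₃ N₁ N₂ N₃ : Type u} [AddCommGroup M₁] [Module k M₁] [AddCommGroup M₂]
    [Module k M₂] [AddCommGroup M₃] [Module k M₃] [AddCommGroup N₁] [Module k N₁] [AddCommGroup N₂]
    [Module k N₂] [AddCommGroup N₃] [Module k N₃] (f : M₂ →ₗ[k] M₃) (g : N₂ →ₗ[k] N₃)
    (f' : M₁ →ₗ[k] M₂) (g' : N₁ →ₗ[k] N₂) (t : M₁ ⊗[k] N₁) :
    map f g (map f' g' t) = map (f ∘ₗ f') (g ∘ₗ g') t :=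
  LinearMap.congr_fun (TensorProduct.map_comp f g f' g').symm t

theorem map_lTensor_eq {M₁ M₂ N₁ N₂ N₃ : Type u} [AddCommGroup M₁] [Module k M₁] [AddCommGroup M₂]
    [Module k M₂] [AddCommGroup N₁] [Module k N₁] [AddCommGroup N₂]
    [Module k N₂] [AddCommGroup N₃] [Module k N₃] (f : M₁ →ₗ[k] M₂) (g : N₂ →ₗ[k] N₃)
    (g' : N₁ →ₗ[k] N₂) (t : M₁ ⊗[k] N₁) :
    map f g (lTensor M₁ g' t) = map f (g ∘ₗ g') t :=
  map_map_eq f g LinearMap.id g' t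

theorem coactLeft_map₂ {C C' M N N' P : Type u} [AddCommGroup C] [Module k C] [AddCommGroup C']
    [Module k C'] [AddCommGroup M] [Module k M] [AddCommGroup N]
    [Module k N] [AddCommGroup N'] [Module k N'] [AddCommGroup P] [Module k P]
    {lam : M →ₗ[k] C ⊗[k] M} {lam' : P →ₗ[k] C' ⊗[k] P} {γ : C →ₗ[k] C'} {α : M →ₗ[k] P}
    (hα : ∀ x, lam' (α x) = map γ α (lam x)) (f : N →ₗ[k] N') (t : M ⊗[k] N) :
    coactLeft lam' N' (map α f t) =
      map γ (map α f) (coactLeft lam N t) := by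
  induction t with
  | zero => simp
  | add x y hx hy => simp only [map_add, hx, hy]
  | tmul a t =>
    rw [map_tmul, coactLeft_tmul, coactLeft_tmul, hα, map_lTensor_eq,
      lTensor, map_map_eq]
    congr 2

variable (A) in
/-- `a ⊗ (p ⊗ q) ↦ (a ⊗ p) ⊗ (-1) ^ deg q q`. -/
def barJoin : A ⊗[k] (BarTot A ⊗[k] BarTot A) →ₗ[k] BarTot A ⊗[k] BarTot A :=
  map (barCons A) (barWord A A.sgn) ∘ₗ
    (TensorProduct.assoc k A (BarTot A) (BarTot A)).symm.toLinearMap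

theorem barJoin_tmul (a : A) (p q : BarTot A) :
    barJoin A (a ⊗ₜ (p ⊗ₜ q)) = barCons A (a ⊗ₜ p) ⊗ₜ barWord A A.sgn q := by
  simp [barJoin]

/-- Two linear maps on `A ⊗ (X ⊗ X)` agree if they agree on pure tensors. -/
theorem ext_threefold {M N P Y : Type u} [AddCommGroup M] [Module k M] [AddCommGroup N]
    [Module k N] [AddCommGroup P] [Module k P] [AddCommGroup Y] [Module k Y]
    {F G : M ⊗[k] (N ⊗[k] P) →ₗ[k] Y}
    (h : ∀ a p q, F (a ⊗ₜ (p ⊗ₜ q)) = G (a ⊗ₜ (p ⊗ₜ q))) (w : M ⊗[k] (N ⊗[k] P)) : F w = G w := by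
  induction w with
  | zero => simp
  | add x y hx hy => simp only [map_add, hx, hy]
  | tmul a t =>
    induction t with
    | zero => simp
    | add x y hx hy => simp only [tmul_add, map_add, hx, hy]
    | tmul p q => exact h a p q

theorem barComul_zero (f : O) : barComul A (barZero A f) =
    map (barZero A) (barZero A) (comul f) :=
  toModule_barIncl _ 0 f

theorem barComul_cons (x : A ⊗[k] BarTot A) : barComul A (barCons A x) =
    map (barZero A) (barCons A) (coactLeft A.coactL (BarTot A) x) +
      barJoin A (lTensor A (barComul A) x) := by
  induction x with
  | zero => simp
  | add x y hx hy => simp only [map_add, hx, hy]; abel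
  | tmul a t =>
    induction t using DirectSum.induction_on with
    | zero => simp
    | add x y hx hy => simp only [tmul_add, map_add, hx, hy]; abel
    | of n t =>
      change barComul A (barCons A (a ⊗ₜ barIncl A n t)) = map (barZero A)
        (barCons A) (coactLeft A.coactL (BarTot A) (lTensor A (barIncl A n) (a ⊗ₜ t))) +
          barJoin A (a ⊗ₜ barComul A (barIncl A n t))
      have h1 : (barIncl A (n + 1) : A ⊗[k] barSp A n →ₗ[k] BarTot A) =
        barCons A ∘ₗ lTensor A (barIncl A n) :=
        LinearMap.ext fun y => (barCons_lTensor_incl n y).symm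
      have h2 : barComul A (barIncl A n t) = barComulAux A n t := toModule_barIncl _ n t
      rw [barCons_incl, h2, coactLeft_lTensor, map_lTensor_eq, ← h1, barJoin, ← barSgnTot_eq]
      exact toModule_barIncl (barComulAux A) (n + 1) _

theorem barJoin_word {α : A →ₗ[k] A} (hs : ∀ x, α (A.sgn x) = A.sgn (α x))
    (w : A ⊗[k] (BarTot A ⊗[k] BarTot A)) :
    barJoin A (map α (map (barWord A α) (barWord A α)) w) =
      map (barWord A α) (barWord A α) (barJoin A w) := by
  refine ext_threefold (F := barJoin A ∘ₗ map α (map (barWord A α)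
    (barWord A α))) (G := map (barWord A α) (barWord A α) ∘ₗ barJoin A)
    (fun a p q => ?_) w
  simp only [comp_apply, map_tmul, barJoin_tmul, barWord_cons,
    barWord_comm hs]

theorem barComul_word {α : A →ₗ[k] A} (hα : A.Bicolinear α)
    (hs : ∀ x, α (A.sgn x) = A.sgn (α x)) (x : BarTot A) : barComul A (barWord A α x) =
      map (barWord A α) (barWord A α) (barComul A x) := by
  have e0 : barWord A α ∘ₗ barZero A = barZero A := LinearMap.ext fun f => barWord_zero α f
  have e1 : barWord A α ∘ₗ barCons A = barCons A ∘ₗ map α (barWord A α) :=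
    LinearMap.ext fun y => barWord_cons α y
  refine LinearMap.congr_fun (barTot_ext (F := barComul A ∘ₗ barWord A α)
    (G := map (barWord A α) (barWord A α) ∘ₗ barComul A) (fun f => ?_)
    (fun a t h => ?_)) x
  · rw [comp_apply, comp_apply, barWord_zero, barComul_zero, map_map_eq, e0]
  · have h' : barComul A (barWord A α t) =
      map (barWord A α) (barWord A α) (barComul A t) := h
    rw [comp_apply, comp_apply, barWord_cons, barComul_cons, barComul_cons,
      map_add, map_map_eq, e0, e1, coactLeft_map hα.left, map_lTensor_eq, ← barJoin_word hs,
      map_tmul, lTensor_tmul, lTensor_tmul,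
      map_tmul, h']

theorem coactLeft_coassoc {C M : Type u} [AddCommGroup C] [Module k C] [Coalgebra k C]
    [AddCommGroup M] [Module k M] {lam : M →ₗ[k] C ⊗[k] M} (h : IsLeftCoaction lam)
    {N : Type u} [AddCommGroup N] [Module k N] (x : M ⊗[k] N) :
    coactLeft comul (M ⊗[k] N) (coactLeft lam N x) =
      lTensor C (coactLeft lam N) (coactLeft lam N x) := by
  induction x with
  | zero => simp
  | add x y hx hy => simp only [map_add, hx, hy]
  | tmul a n =>
    have h1 : coactLeft comul M (lam a) = lTensor C lam (lam a) :=
      h.coassoc_apply a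
    have h2 : coactLeft lam N ∘ₗ (TensorProduct.mk k M N).flip n =
        lTensor C ((TensorProduct.mk k M N).flip n) ∘ₗ lam :=
      LinearMap.ext fun m => coactLeft_tmul lam m n
    rw [coactLeft_tmul, coactLeft_lTensor, h1, ← lTensor_comp_apply,
      ← lTensor_comp_apply, h2]

theorem barComul_comp_zero : barComul A ∘ₗ barZero A =
    map (barZero A) (barZero A) ∘ₗ comul :=
  LinearMap.ext fun f => barComul_zero f

theorem barComul_comp_cons : barComul A ∘ₗ barCons A =
    map (barZero A) (barCons A) ∘ₗ coactLeft A.coactL (BarTot A) +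
      barJoin A ∘ₗ lTensor A (barComul A) :=
  LinearMap.ext fun f => barComul_cons f

theorem coactLeft_comul_comul (f : O) : coactLeft comul O (comul (R := k) f) =
    lTensor O comul (comul f) :=
  Coalgebra.coassoc_apply f

theorem barComul_colinear (x : BarTot A) : coactLeft (barLam A) (BarTot A) (barComul A x) =
    lTensor O (barComul A) (barLam A x) := by
  have e2 : ∀ w, coactLeft (barLam A) (BarTot A) (barJoin A w) =
      lTensor O (barJoin A) (coactLeft A.coactL (BarTot A ⊗[k] BarTot A) w) := by
    refine ext_threefold (F := coactLeft (barLam A) (BarTot A) ∘ₗ barJoin A)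
      (G := lTensor O (barJoin A) ∘ₗ coactLeft A.coactL (BarTot A ⊗[k] BarTot A))
      (fun a p q => ?_)
    rw [comp_apply, comp_apply, barJoin_tmul, coactLeft_tmul, coactLeft_tmul,
      barLam_cons, coactLeft_tmul, ← lTensor_comp_apply, ← lTensor_comp_apply,
      ← lTensor_comp_apply]
    congr 2
  obtain ⟨f, x, rfl⟩ := bar_cases x
  rw [map_add, map_add, map_add, map_add, barComul_zero, barLam_zero, barComul_cons, barLam_cons,
    coactLeft_map barLam_zero, coactLeft_comul_comul, map_add, coactLeft_map barLam_zero,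
    coactLeft_coassoc A.coactL_isCoaction, e2, coactLeft_lTensor, ← lTensor_comp_apply,
    ← lTensor_comp_apply, ← lTensor_comp_apply, ← lTensor_comp_apply,
    ← lTensor_comp_apply, barComul_comp_zero, barComul_comp_cons, LinearMap.lTensor_add,
    LinearMap.add_apply]

/-- The comultiplication of the bar complex is coassociative, already on the sum of all
`A ⊗ ⋯ ⊗ A ⊗ O`. -/
theorem barComul_coassoc (x : BarTot A) : coactLeft (barComul A) (BarTot A) (barComul A x) =
    lTensor (BarTot A) (barComul A) (barComul A x) := by
  let J : A ⊗[k] (BarTot A ⊗[k] (BarTot A ⊗[k] BarTot A)) →ₗ[k]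
      BarTot A ⊗[k] (BarTot A ⊗[k] BarTot A) :=
    map (barCons A) (map (barWord A A.sgn) (barWord A A.sgn)) ∘ₗ
      (TensorProduct.assoc k A (BarTot A) (BarTot A ⊗[k] BarTot A)).symm.toLinearMap
  have hJ : ∀ a p r, J (a ⊗ₜ (p ⊗ₜ r)) = barCons A (a ⊗ₜ p) ⊗ₜ
      map (barWord A A.sgn) (barWord A A.sgn) r := fun a p r => by simp [J]
  have e1 : ∀ w, coactLeft (barComul A) (BarTot A) (barJoin A w) =
      map (barZero A) (barJoin A) (coactLeft A.coactL (BarTot A ⊗[k] BarTot A) w) +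
      J (lTensor A (coactLeft (barComul A) (BarTot A)) w) := by
    refine ext_threefold (F := coactLeft (barComul A) (BarTot A) ∘ₗ barJoin A)
      (G := map (barZero A) (barJoin A) ∘ₗ
        coactLeft A.coactL (BarTot A ⊗[k] BarTot A) +
        J ∘ₗ lTensor A (coactLeft (barComul A) (BarTot A))) (fun a p q => ?_)
    simp only [comp_apply, LinearMap.add_apply, barJoin_tmul, coactLeft_tmul,
      lTensor_tmul, barComul_cons, map_add, map_lTensor_eq]
    congr 1
    · generalize A.coactL a = c
      induction c with
      | zero => simp
      | add x y hx hy => simp only [map_add, hx, hy]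
      | tmul f b => simp [barJoin_tmul]
    · generalize barComul A p = c
      induction c with
      | zero => simp
      | add x y hx hy => simp only [tmul_add, map_add, hx, hy]
      | tmul p p' => simp [barJoin_tmul, hJ]
  have e2 : ∀ w, lTensor (BarTot A) (barComul A) (barJoin A w) =
      J (lTensor A (lTensor (BarTot A) (barComul A)) w) := by
    refine ext_threefold (F := lTensor (BarTot A) (barComul A) ∘ₗ barJoin A)
      (G := J ∘ₗ lTensor A (lTensor (BarTot A) (barComul A)))
      (fun a p q => ?_)
    simp only [comp_apply, barJoin_tmul, lTensor_tmul, hJ,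
      barComul_word RelDGA.sgn_bicolinear (fun _ => rfl)]
  refine LinearMap.congr_fun (barTot_ext (F := coactLeft (barComul A) (BarTot A) ∘ₗ barComul A)
    (G := lTensor (BarTot A) (barComul A) ∘ₗ barComul A) (fun f => ?_)
    (fun a t h => ?_)) x
  · rw [comp_apply, comp_apply, barComul_zero, coactLeft_map₂ barComul_zero,
      coactLeft_comul_comul, map_lTensor_eq, lTensor, map_map_eq, barComul_comp_zero]
    rfl
  · have h' : coactLeft (barComul A) (BarTot A) (barComul A t) =
      lTensor (BarTot A) (barComul A) (barComul A t) := h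
    rw [comp_apply, comp_apply, barComul_cons, map_add, map_add,
      coactLeft_map₂ barComul_zero, coactLeft_coassoc A.coactL_isCoaction, e1, e2,
      coactLeft_lTensor, map_lTensor_eq, map_lTensor_eq,
      lTensor_tmul A (barComul A), lTensor_tmul, lTensor_tmul, h',
      ← add_assoc]
    congr 1
    refine Eq.trans ?_ (map_map_eq LinearMap.id (barComul A) (barZero A) (barCons A) _).symm
    rw [barComul_comp_cons, TensorProduct.map_add_right]
    rfl

theorem sliceL_barCounit_comul (x : BarTot A) :
    sliceL (BarTot A) (barCounit A) (barComul A x) = x := by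
  have h0 : barCounit A ∘ₗ barZero A = counit :=
    LinearMap.ext fun f => barCounit_zero f
  have h1 : ∀ w, sliceL (BarTot A) (barCounit A) (barJoin A w) = 0 := by
    refine ext_threefold (F := sliceL (BarTot A) (barCounit A) ∘ₗ barJoin A) (G := 0)
      (fun a p q => ?_)
    simp [barJoin_tmul, barCounit_cons]
  obtain ⟨f, x, rfl⟩ := bar_cases x
  have h2 : sliceL O counit (comul (R := k) f) = f := by
    simp [sliceL]
  have h3 : ∀ x : A ⊗[k] BarTot A,
      sliceL (A ⊗[k] BarTot A) counit (coactLeft A.coactL (BarTot A) x) = x := by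
    intro x
    induction x with
    | zero => simp
    | add x y hx hy => simp only [map_add, hx, hy]
    | tmul a t =>
      rw [coactLeft_tmul, sliceL_lTensor, A.coactL_isCoaction.counit_apply]
      rfl
  rw [map_add, map_add, barComul_zero, barComul_cons, map_add, h1, sliceL_map, sliceL_map, h0, h2,
    h3, add_zero]

theorem slice_barCounit_comul (x : BarTot A) :
    slice (BarTot A) (barCounit A) (barComul A x) = x := by
  have h0 : barCounit A ∘ₗ barZero A = counit :=
    LinearMap.ext fun f => barCounit_zero f
  have h0' : barCounit A ∘ₗ barCons A = 0 := LinearMap.ext fun f => barCounit_cons f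
  have h1 : ∀ w, slice (BarTot A) (barCounit A) (barJoin A w) =
      barCons A (lTensor A (slice (BarTot A) (barCounit A)) w) := by
    refine ext_threefold (F := slice (BarTot A) (barCounit A) ∘ₗ barJoin A)
      (G := barCons A ∘ₗ lTensor A (slice (BarTot A) (barCounit A)))
      (fun a p q => ?_)
    simp [barJoin_tmul, slice_tmul, barCounit_word]
  refine LinearMap.congr_fun (barTot_ext (F := slice (BarTot A) (barCounit A) ∘ₗ barComul A)
    (G := LinearMap.id) (fun f => ?_) (fun a t h => ?_)) x
  · have h2 : slice O counit (comul (R := k) f) = f := by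
      simp [slice]
    rw [comp_apply, barComul_zero, slice_map, h0, h2, LinearMap.id_apply]
  · have h' : slice (BarTot A) (barCounit A) (barComul A t) = t := h
    rw [comp_apply, barComul_cons, map_add, slice_map, h0', h1, lTensor_tmul,
      lTensor_tmul, h', LinearMap.id_apply]
    simp [slice]

section differential

variable (ε : A.Augmentation)

/-- The functional `ε^r` acts on the first letter only, hence on the first part of a
deconcatenation. -/
theorem barComul_head (x : BarTot A) : barComul A (barHead ε x) =
    rTensor (BarTot A) (barHead ε) (barComul A x) := by
  have h0 : barHead ε ∘ₗ barZero A = 0 := LinearMap.ext fun f => barHead_zero ε f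
  have h1 : ∀ w, rTensor (BarTot A) (barHead ε) (barJoin A w) =
      map (barWord A A.sgn) (barWord A A.sgn)
        (sliceL (BarTot A ⊗[k] BarTot A) ε.char w) := by
    refine ext_threefold (F := rTensor (BarTot A) (barHead ε) ∘ₗ barJoin A)
      (G := map (barWord A A.sgn) (barWord A A.sgn) ∘ₗ
        sliceL (BarTot A ⊗[k] BarTot A) ε.char) (fun a p q => ?_)
    simp [barJoin_tmul, barHead_cons, smul_tmul']
  obtain ⟨f, x, rfl⟩ := bar_cases x
  rw [map_add, map_add, map_add, map_add, barComul_zero, barHead_zero, barHead_cons,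
    barComul_word RelDGA.sgn_bicolinear (fun _ => rfl), barComul_cons, map_add, h1,
    sliceL_lTensor, rTensor, map_map_eq, map_map_eq, h0]
  simp

variable (A) in
/-- The operator `x ↦ (-1) ^ (p - n) x` for `x` in `Bar_n` of inner degree `p`. -/
def barTotSgn : BarTot A →ₗ[k] BarTot A := barWord A (-A.sgn)

theorem barSgn_der (x : BarTot A) : barWord A A.sgn (barDer A A.d A.sgn x) =
    -barDer A A.d A.sgn (barWord A A.sgn x) := by
  rw [barWord_der (c := -1) (fun x => by rw [RelDGA.sgn_d, neg_one_smul]) (fun _ => rfl),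
    neg_one_smul]

theorem barTotSgn_cons (a : A) (p : BarTot A) : barTotSgn A (barCons A (a ⊗ₜ p)) =
    -barCons A (A.sgn a ⊗ₜ barTotSgn A p) := by
  simp [barTotSgn, barWord_cons, neg_tmul]

theorem barTotSgn_zero (f : O) : barTotSgn A (barZero A f) = barZero A f := barWord_zero _ _

theorem barComul_der (x : BarTot A) : barComul A (barDer A A.d A.sgn x) =
    rTensor (BarTot A) (barDer A A.d A.sgn) (barComul A x) +
      map (barTotSgn A) (barDer A A.d A.sgn) (barComul A x) := by
  have h0 : barDer A A.d A.sgn ∘ₗ barZero A = 0 := LinearMap.ext fun f => barDer_zero _ _ f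
  have h0' : barTotSgn A ∘ₗ barZero A = barZero A := LinearMap.ext fun f => barTotSgn_zero f
  have h0'' : barDer A A.d A.sgn ∘ₗ barCons A = barCons A ∘ₗ rTensor (BarTot A) A.d +
      barCons A ∘ₗ map A.sgn (barDer A A.d A.sgn) :=
    LinearMap.ext fun f => barDer_cons _ _ f
  have h1 : ∀ w, rTensor (BarTot A) (barDer A A.d A.sgn) (barJoin A w) =
      barJoin A (rTensor _ A.d w) + barJoin A (map A.sgn
        (rTensor (BarTot A) (barDer A A.d A.sgn)) w) := by
    refine ext_threefold (F := rTensor (BarTot A) (barDer A A.d A.sgn) ∘ₗ barJoin A)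
      (G := barJoin A ∘ₗ rTensor _ A.d + barJoin A ∘ₗ map A.sgn
        (rTensor (BarTot A) (barDer A A.d A.sgn))) (fun a p q => ?_)
    simp [barJoin_tmul, barDer_cons, add_tmul]
  have h2 : ∀ w, map (barTotSgn A) (barDer A A.d A.sgn) (barJoin A w) =
      barJoin A (map A.sgn
        (map (barTotSgn A) (barDer A A.d A.sgn)) w) := by
    refine ext_threefold (F := map (barTotSgn A) (barDer A A.d A.sgn) ∘ₗ barJoin A)
      (G := barJoin A ∘ₗ map A.sgn
        (map (barTotSgn A) (barDer A A.d A.sgn))) (fun a p q => ?_)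
    simp [barJoin_tmul, barTotSgn_cons, barSgn_der, neg_tmul, TensorProduct.tmul_neg]
  refine LinearMap.congr_fun (barTot_ext (F := barComul A ∘ₗ barDer A A.d A.sgn)
    (G := rTensor (BarTot A) (barDer A A.d A.sgn) ∘ₗ barComul A +
      map (barTotSgn A) (barDer A A.d A.sgn) ∘ₗ barComul A) (fun f => ?_)
    (fun a t h => ?_)) x
  · rw [LinearMap.add_apply, comp_apply, comp_apply, comp_apply,
      barDer_zero, barComul_zero, rTensor, map_map_eq, map_map_eq, h0]
    simp
  · have h' : barComul A (barDer A A.d A.sgn t) = rTensor (BarTot A)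
      (barDer A A.d A.sgn) (barComul A t) + map (barTotSgn A)
        (barDer A A.d A.sgn) (barComul A t) := h
    have h3 := coactLeft_map (f := LinearMap.id (R := k) (M := BarTot A))
      (RelDGA.Bicolinear.d (A := A)).left (a ⊗ₜ t)
    have h4 : rTensor (BarTot A) (barDer A A.d A.sgn) (map (barZero A)
        (barCons A) (coactLeft A.coactL (BarTot A) (a ⊗ₜ[k] t))) = 0 := by
      rw [rTensor, map_map_eq, h0]; simp
    rw [LinearMap.add_apply, comp_apply, comp_apply, comp_apply,
      barDer_cons, map_add, barComul_cons, barComul_cons, barComul_cons, map_add, map_add, h4,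
      h1, h2, map_map_eq, h0', h0'', coactLeft_map RelDGA.sgn_bicolinear.left, map_lTensor_eq,
      rTensor, h3, map_lTensor_eq, TensorProduct.map_add_right, LinearMap.add_apply]
    simp only [map_tmul, lTensor_tmul, LinearMap.id_apply, h', map_add,
      tmul_add, rTensor]
    abel

variable {ε}

theorem coactLeft_mem_top {x : A ⊗[k] BarTot A} (hx : x ∈ barCot A)
    (hx' : x ∈ subTensor ⊤ (barTotSub A)) :
    coactLeft A.coactL (BarTot A) x ∈ subTensor ⊤ (barCot A ⊓ subTensor ⊤ (barTotSub A)) := by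
  refine mem_subTensor_of_sliceL fun ψ => ?_
  let α : A →ₗ[k] A := sliceL A ψ ∘ₗ A.coactL
  have hα : ∀ a, A.coactR (α a) = rTensor O α (A.coactR a) := by
    intro a
    have h := LinearMap.congr_fun A.coact_comm a
    simp only [comp_apply] at h
    simp only [α, comp_apply]
    rw [← sliceL_lTensor, ← h, rTensor_comp_apply]
    generalize rTensor O A.coactL (A.coactR a) = c
    induction c with
    | zero => simp
    | add x y hx hy => simp only [map_add, hx, hy]
    | tmul z g =>
      induction z with
      | zero => simp
      | add x y hx hy => simp only [add_tmul, map_add, hx, hy]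
      | tmul f b => simp [smul_tmul']
  have h1 : sliceL (A ⊗[k] BarTot A) ψ (coactLeft A.coactL (BarTot A) x) =
      map α LinearMap.id x := by
    clear hx hx'
    induction x with
    | zero => simp
    | add x y hx hy => simp only [map_add, hx, hy]
    | tmul a t => rw [coactLeft_tmul, sliceL_lTensor]; rfl
  rw [h1]
  exact ⟨map_mem_cotensor hα (Q := ⊤) (fun y _ => by simp) hx (mem_subTensor_top x),
    map_mem_top_sub (f := LinearMap.id) (fun y hy => hy) hx'⟩

/-- Deconcatenation maps the bar complex to its tensor square. The coaction on the first letter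
accounts for the first summand, in which the first part is empty. -/
theorem barComul_mem {x : BarTot A} (hx : x ∈ barTotSub A) :
    barComul A x ∈ subTensor (barTotSub A) (barTotSub A) := by
  refine barTotSub_induction ((subTensor (barTotSub A) (barTotSub A)).comap (barComul A))
    (fun f => ?_) (fun x h1 h2 => ?_) hx
  · rw [mem_comap, barComul_zero]
    exact subTensor_map (P := ⊤) (Q := ⊤) (fun f _ => barZero_mem f) (fun f _ => barZero_mem f)
      (mem_subTensor_top _)
  · have h3 : x ∈ subTensor ⊤ (barTotSub A) := subTensor_mono le_rfl inf_le_right h2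
    rw [mem_comap, barComul_cons]
    refine add_mem (subTensor_map (fun f _ => barZero_mem f)
      (fun y hy => barCons_mem_iff.2 (Submodule.mem_inf.1 hy)) (coactLeft_mem_top h1 h3)) ?_
    set w := lTensor A (barComul A) x with hw
    have h4 : w ∈ subTensor ⊤ (subTensor (barTotSub A) (barTotSub A)) :=
      subTensor_map (P' := ⊤) (f := LinearMap.id) (fun _ _ => trivial) 
        (fun y hy => (Submodule.mem_inf.1 hy).1) h2
    have h5 : (TensorProduct.assoc k A (BarTot A) (BarTot A)).symm w ∈
        subTensor (barCot A ⊓ subTensor ⊤ (barTotSub A)) ⊤ := by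
      refine mem_subTensor_of_slice fun φ => ?_
      rw [slice_assoc_symm, hw, ← lTensor_comp_apply]
      refine ⟨mem_cotensor_map (fun y => ?_) h1, subTensor_map (P' := ⊤) (Q' := barTotSub A)
        (f := LinearMap.id) (g := slice (BarTot A) φ ∘ₗ barComul A) (fun _ _ => trivial)
        (fun y hy => slice_mem (Submodule.mem_inf.1 hy).1 φ) h2⟩
      rw [comp_apply, ← slice_coactLeft, barComul_colinear,
        ← lTensor_comp_apply]
    have h6 : (TensorProduct.assoc k A (BarTot A) (BarTot A)).symm w ∈
        subTensor ⊤ (barTotSub A) := by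
      refine subTensor_induction ((subTensor ⊤ (barTotSub A)).comap
        (TensorProduct.assoc k A (BarTot A) (BarTot A)).symm.toLinearMap) (fun a _ c hc => ?_) h4
      refine subTensor_induction ((subTensor ⊤ (barTotSub A)).comap
        ((TensorProduct.assoc k A (BarTot A) (BarTot A)).symm.toLinearMap ∘ₗ
          TensorProduct.mk k A _ a)) (fun p _ q hq => ?_) hc
      exact tmul_mem_subTensor (P := ⊤) trivial hq
    exact subTensor_map (fun y hy => barCons_mem_iff.2 (Submodule.mem_inf.1 hy))
      (fun y hy => barWord_mem RelDGA.sgn_bicolinear hy) (subTensor_inf h5 h6)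

theorem barComul_eq (t : BarTot A) : barComul A t =
    rTensor (BarTot A) (barZero A) (barLam A t) +
      barJoin A (lTensor A (barComul A) (barUncons A t)) := by
  obtain ⟨f, x, rfl⟩ := bar_cases t
  simp only [map_add, barComul_zero, barComul_cons, barLam_zero, barLam_cons, barUncons_zero,
    barUncons_cons, zero_add]
  rw [← comp_apply (rTensor _ _), ← comp_apply (rTensor _ _),
    LinearMap.rTensor_comp_lTensor, LinearMap.rTensor_comp_lTensor, add_assoc]

/-- The comultiplication of `a y` for the action of `A` on the bar complex.  The middle term is due
to the different definition of the action on `Bar_0`. -/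
theorem barComul_act {y : A ⊗[k] BarTot A} (hy : y ∈ barCot A) : barComul A (barAct ε y) =
    map (barZero A) (barAct ε) (coactLeft A.coactL (BarTot A) y) -
      map (barZero A) (sliceL (BarTot A) ε.char)
        (coactLeft A.coactL (BarTot A) y) +
      rTensor (BarTot A) (barAct ε)
        ((TensorProduct.assoc k A (BarTot A) (BarTot A)).symm
          (lTensor A (barComul A) y)) := by
  have z1 := lTensor_uncons_mem hy
  have h1 : rTensor (BarTot A) (barAct ε)
        ((TensorProduct.assoc k A (BarTot A) (BarTot A)).symm (lTensor A
          (rTensor (BarTot A) (barZero A)) (coactMid A.coactR (BarTot A) y))) =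
      map (barZero A) (sliceL (BarTot A) ε.char)
        (coactLeft A.coactL (BarTot A) y) := by
    clear hy z1
    induction y with
    | zero => simp
    | add x y hx hy => simp only [map_add, hx, hy]
    | tmul a t =>
      have e1 : ∀ c : A ⊗[k] O, rTensor (BarTot A) (barAct ε)
          ((TensorProduct.assoc k A (BarTot A) (BarTot A)).symm (lTensor A
          (rTensor (BarTot A) (barZero A)) (lTensor A
          ((TensorProduct.mk k O (BarTot A)).flip t) c))) =
          barZero A (ε.left (slice A counit c)) ⊗ₜ t := by
        intro c
        induction c with
        | zero => simp
        | add x y hx hy => simp only [map_add, hx, hy, add_tmul]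
        | tmul b f => simp [barAct_zero, slice_tmul]
      have e2 : ∀ c : O ⊗[k] A, map (barZero A) (sliceL (BarTot A) ε.char)
          (lTensor O ((TensorProduct.mk k A (BarTot A)).flip t) c) =
          barZero A (slice O ε.char c) ⊗ₜ t := by
        intro c
        induction c with
        | zero => simp
        | add x y hx hy => simp only [map_add, hx, hy, add_tmul]
        | tmul f b => simp [slice_tmul, smul_tmul']
      rw [coactMid_tmul, coactLeft_tmul, e1, e2, A.coactR_isCoaction.counit_apply, ε.slice_char]
  have h2 : ∀ v : A ⊗[k] (A ⊗[k] (BarTot A ⊗[k] BarTot A)),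
      rTensor (BarTot A) (barAct ε) ((TensorProduct.assoc k A (BarTot A) (BarTot A)).symm
        (lTensor A (barJoin A) v)) = barJoin A (mulTensor A.m _ v) := by
    refine ext_threefold (F := rTensor (BarTot A) (barAct ε) ∘ₗ
      (TensorProduct.assoc k A (BarTot A) (BarTot A)).symm.toLinearMap ∘ₗ
        lTensor A (barJoin A)) (G := barJoin A ∘ₗ mulTensor A.m _) (fun a b r => ?_)
    induction r with
    | zero => simp
    | add x y hx hy => simp only [tmul_add, map_add, hx, hy]
    | tmul p q =>
      have := barAct_lTensor_cons ε (a ⊗ₜ[k] (b ⊗ₜ[k] p))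
      rw [lTensor_tmul] at this
      simp [barJoin_tmul, this, mulTensor]
  have h3 : lTensor A (barComul A) y = lTensor A
      (rTensor (BarTot A) (barZero A)) (coactMid A.coactR (BarTot A) y) +
      lTensor A (barJoin A) (lTensor A (lTensor A (barComul A))
        (lTensor A (barUncons A) y)) := by
    have e : barComul A = rTensor (BarTot A) (barZero A) ∘ₗ barLam A +
        barJoin A ∘ₗ lTensor A (barComul A) ∘ₗ barUncons A :=
      LinearMap.ext barComul_eq
    rw [mem_cotensor.1 hy]
    conv_lhs => rw [e]
    rw [LinearMap.lTensor_add, LinearMap.add_apply]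
    simp only [lTensor_comp_apply]
  have h4 : barAct ε = barZero A ∘ₗ ε.left ∘ₗ slice A (barCounit A) +
    barCons A ∘ₗ mulTensor A.m (BarTot A) ∘ₗ lTensor A (barUncons A) := rfl
  have h5 : map (barZero A) (barAct ε) (coactLeft A.coactL (BarTot A) y) =
      map (barZero A) (barZero A) (lTensor O ε.left (lTensor O
        (slice A (barCounit A)) (coactLeft A.coactL (BarTot A) y))) +
      map (barZero A) (barCons A) (lTensor O (mulTensor A.m (BarTot A))
        (lTensor O (lTensor A (barUncons A))
          (coactLeft A.coactL (BarTot A) y))) := by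
    rw [h4, TensorProduct.map_add_right, LinearMap.add_apply]
    simp only [map_lTensor_eq, comp_assoc]
  rw [h3, map_add, map_add, h1, h2, h5, barAct_apply, map_add, barComul_zero, barComul_cons,
    ε.left_colinear, ← slice_coactLeft, mulTensor_coactLeft A (BarTot A) z1, coactLeft_lTensor,
    mulTensor_lTensor]
  abel

/-- Cutting a word at the place of a product is impossible, and what is left of `barTail` acts on
one of the two parts; `ε^l` of the last letter of the first part cancels against `ε^r` of the first
letter of the second. -/
theorem barComul_tail {x : BarTot A} (hx : x ∈ barTotSub A) : barComul A (barTail ε x) =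
    rTensor (BarTot A) (barTail ε) (barComul A x) +
      map (barTotSgn A) (barTail ε + barHead ε) (barComul A x) := by
  have h0 : barTail ε ∘ₗ barZero A = 0 := LinearMap.ext fun f => barTail_zero _ f
  have h0' : barTotSgn A ∘ₗ barZero A = barZero A := LinearMap.ext fun f => barTotSgn_zero f
  refine barTotSub_induction (eqLocus (barComul A ∘ₗ barTail ε)
    (rTensor (BarTot A) (barTail ε) ∘ₗ barComul A +
      map (barTotSgn A) (barTail ε + barHead ε) ∘ₗ barComul A)) (fun f => ?_)
    (fun x h1 h2 => ?_) hx
  · have h3 : (barTail ε + barHead ε) ∘ₗ barZero A = 0 :=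
      LinearMap.ext fun f => by simp [barTail_zero, barHead_zero]
    rw [LinearMap.mem_eqLocus, LinearMap.add_apply, comp_apply, comp_apply,
      comp_apply, barTail_zero, barComul_zero, rTensor, map_map_eq, map_map_eq,
      h0, h3]
    simp
  · have h3 : x ∈ subTensor ⊤ (barTotSub A) := subTensor_mono le_rfl inf_le_right h2
    have e1 : (barTail ε + barHead ε) ∘ₗ barCons A =
        -(barAct ε ∘ₗ map A.sgn (barWord A A.sgn)) -
        barCons A ∘ₗ map A.sgn (barTail ε) +
        sliceL (BarTot A) ε.char ∘ₗ map A.sgn (barWord A A.sgn) := by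
      refine LinearMap.ext fun w => ?_
      simp [barTail_cons, barHead_cons, sliceL_map, char_comp_sgn]
    have e2 : ∀ w, rTensor (BarTot A) (barTail ε) (barJoin A w) =
        -rTensor (BarTot A) (barAct ε)
          ((TensorProduct.assoc k A (BarTot A) (BarTot A)).symm (map A.sgn
            (map (barWord A A.sgn) (barWord A A.sgn)) w)) -
        barJoin A (map A.sgn (rTensor (BarTot A) (barTail ε)) w) := by
      refine ext_threefold (F := rTensor (BarTot A) (barTail ε) ∘ₗ barJoin A)
        (G := -(rTensor (BarTot A) (barAct ε) ∘ₗ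
          (TensorProduct.assoc k A (BarTot A) (BarTot A)).symm.toLinearMap ∘ₗ
            (map A.sgn (map (barWord A A.sgn) (barWord A A.sgn)))) -
          barJoin A ∘ₗ map A.sgn (rTensor (BarTot A) (barTail ε)))
        (fun a p q => ?_)
      simp [barJoin_tmul, barTail_cons, TensorProduct.sub_tmul, neg_tmul]
    have e3 : ∀ w ∈ (subTensor ⊤ (subTensor ⊤ (barTotSub A)) :
        Submodule k (A ⊗[k] (BarTot A ⊗[k] BarTot A))),
        map (barTotSgn A) (barTail ε + barHead ε) (barJoin A w) =
        -barJoin A (map A.sgn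
          (map (barTotSgn A) (barTail ε + barHead ε)) w) := by
      intro w hw
      refine eq_on_subTensor (F := map (barTotSgn A) (barTail ε + barHead ε) ∘ₗ
        barJoin A) (G := -(barJoin A ∘ₗ map A.sgn
          (map (barTotSgn A) (barTail ε + barHead ε)))) (fun a _ c hc => ?_) hw
      refine eq_on_subTensor (F := map (barTotSgn A) (barTail ε + barHead ε) ∘ₗ
        barJoin A ∘ₗ TensorProduct.mk k A _ a) (G := -(barJoin A ∘ₗ map A.sgn
          (map (barTotSgn A) (barTail ε + barHead ε))) ∘ₗ TensorProduct.mk k A _ a)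
          (fun p _ q hq => ?_) hc
      simp only [comp_apply, LinearMap.neg_apply, TensorProduct.mk_apply, barJoin_tmul,
        map_tmul, barTotSgn_cons, LinearMap.add_apply, barTail_sgn hq, barHead_sgn,
        map_add, neg_tmul]
    have e4 : lTensor A (barComul A) (map A.sgn (barTail ε) x) =
        map A.sgn (rTensor (BarTot A) (barTail ε))
          (lTensor A (barComul A) x) + map A.sgn
          (map (barTotSgn A) (barTail ε + barHead ε))
          (lTensor A (barComul A) x) := by
      refine eq_on_subTensor (F := lTensor A (barComul A) ∘ₗ
        map A.sgn (barTail ε)) (G := map A.sgn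
          (rTensor (BarTot A) (barTail ε)) ∘ₗ lTensor A (barComul A) +
          map A.sgn (map (barTotSgn A) (barTail ε + barHead ε)) ∘ₗ
          lTensor A (barComul A)) (fun a _ y hy => ?_) h2
      have h5 : barComul A (barTail ε y) = rTensor (BarTot A) (barTail ε) (barComul A y) +
        map (barTotSgn A) (barTail ε + barHead ε) (barComul A y) := hy.1
      simp only [comp_apply, LinearMap.add_apply, map_tmul,
        lTensor_tmul, h5, tmul_add]
    have e5 : lTensor A (barComul A) (map A.sgn (barWord A A.sgn) x) =
        map A.sgn (map (barWord A A.sgn) (barWord A A.sgn))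
          (lTensor A (barComul A) x) := by
      refine eq_on_subTensor (F := lTensor A (barComul A) ∘ₗ
        map A.sgn (barWord A A.sgn)) (G := map A.sgn
          (map (barWord A A.sgn) (barWord A A.sgn)) ∘ₗ
          lTensor A (barComul A)) (fun a _ y _ => ?_) (mem_subTensor_top x)
      simp only [comp_apply, map_tmul, lTensor_tmul,
        barComul_word RelDGA.sgn_bicolinear (fun _ => rfl)]
    have h6 : lTensor A (barComul A) x ∈ subTensor ⊤ (subTensor ⊤ (barTotSub A)) :=
      subTensor_map (P' := ⊤) (f := LinearMap.id) (fun _ _ => trivial)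
        (fun y hy => subTensor_mono le_top le_rfl (barComul_mem hy)) h3
    have h7 : ∀ c, rTensor (BarTot A) (barTail ε)
        (map (barZero A) (barCons A) c) = 0 := by
      intro c
      rw [rTensor, map_map_eq, h0, TensorProduct.map_zero_left, LinearMap.zero_apply]
    have map_neg_right : ∀ {P Q : Type u} [AddCommGroup P] [Module k P] [AddCommGroup Q]
        [Module k Q] (f : O →ₗ[k] BarTot A) (g : P →ₗ[k] Q),
        map f (-g) = -map f g := by
      intro P Q _ _ _ _ f g
      exact TensorProduct.ext' fun p q => by simp [TensorProduct.tmul_neg]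
    rw [LinearMap.mem_eqLocus, LinearMap.add_apply, comp_apply, comp_apply,
      comp_apply, barTail_cons, map_sub, map_neg, barComul_act
        (map_word_mem_barCot RelDGA.sgn_bicolinear RelDGA.sgn_bicolinear h1), barComul_cons,
      barComul_cons, e4, e5, map_add (barJoin A),
      map_add (rTensor (BarTot A) (barTail ε)),
      map_add (map (barTotSgn A) (barTail ε + barHead ε)), e2, e3 _ h6, h7,
      coactLeft_map RelDGA.sgn_bicolinear.left, coactLeft_map RelDGA.sgn_bicolinear.left,
      map_map_eq, h0', e1]
    generalize lTensor A (barComul A) x = w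
    simp only [map_lTensor_eq, TensorProduct.map_add_right, sub_eq_add_neg, map_neg_right,
      LinearMap.add_apply, LinearMap.neg_apply, map_add]
    abel

/-- The comultiplication of the bar complex is a homomorphism of complexes. -/
theorem barComul_barD {x : BarTot A} (hx : x ∈ barTotSub A) : barComul A (barD A ε x) =
    rTensor (BarTot A) (barD A ε) (barComul A x) +
      map (barTotSgn A) (barD A ε) (barComul A x) := by
  have e : barD A ε = barDer A A.d A.sgn + (barTail ε + barHead ε) :=
    LinearMap.ext fun x => by rw [barD_eq, add_assoc]; rfl
  rw [barD_eq, map_add, map_add, barComul_der, barComul_tail hx, barComul_head, e,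
    LinearMap.rTensor_add, LinearMap.rTensor_add]
  simp only [LinearMap.add_apply, TensorProduct.map_add_right]
  abel

end differential

end BarCoproduct

/-! ### The grading of the bar complex by eigenvalues -/

section Degrees

variable {k O : Type u} [Field k] [AddCommGroup O] [Module k O] [Coalgebra k O] {A : RelDGA k O}

theorem barSp_deg_iSup (n : ℕ) : ⨆ p, barDeg A n p = ⊤ := by
  induction n with
  | zero =>
    refine eq_top_iff.2 ((?_ : (⊤ : Submodule k (barSp A 0)) ≤ barDeg A 0 0).trans (le_iSup _ 0))
    simp [barDeg]
  | succ n ih =>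
    let S : ℤ → Submodule k (A ⊗[k] barSp A n) := fun p => barDeg A (n + 1) p
    have key : ∀ t : A ⊗[k] barSp A n, t ∈ ⨆ p, S p := by
      intro t
      induction t with
      | zero => exact zero_mem _
      | add x y hx hy => exact add_mem hx hy
      | tmul a t =>
        suffices h : ⊤ ≤ (⨆ p, S p).comap (TensorProduct.mk k A (barSp A n) a) from
          h (show t ∈ ⊤ from trivial)
        rw [← ih]
        refine iSup_le fun p s hs => ?_
        refine graded_induction A.internal
          ((⨆ p, S p).comap ((TensorProduct.mk k A (barSp A n)).flip s)) (fun q b hb => ?_) a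
        refine mem_iSup_of_mem (q + p) (mem_iSup_of_mem q ?_)
        refine tmul_mem_subTensor hb ?_
        rw [add_sub_cancel_left]
        exact hs
    exact eq_top_iff.2 fun t _ => key t

theorem barWt_cons (c : k) (x : A ⊗[k] BarTot A) :
    barWt A c (barCons A x) = barCons A (map (c⁻¹ • A.wt c) (barWt A c) x) :=
  barWord_cons _ _

theorem barWt_incl {c : k} (hc : c ≠ 0) {n : ℕ} {p : ℤ} {t : barSp A n} (ht : t ∈ barDeg A n p) :
    barWt A c (barIncl A n t) = c ^ (p - n) • barIncl A n t := by
  induction n generalizing p with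
  | zero =>
    by_cases hp : p = 0
    · subst hp
      have : barWt A c (barIncl A 0 t) = barIncl A 0 t := barWord_zero _ _
      simpa using this
    · have : t = 0 := by
        have h : t ∈ (if p = 0 then ⊤ else ⊥ : Submodule k (barSp A 0)) := ht
        rw [if_neg hp] at h
        exact h
      simp [this]
  | succ n ih =>
    let F : BarTot A →ₗ[k] BarTot A := barWt A c - c ^ (p - (n + 1 : ℕ)) • LinearMap.id
    have key : ∀ q, subTensor (A.deg q) (barDeg A n (p - q)) ≤
        LinearMap.ker (F ∘ₗ barCons A ∘ₗ lTensor A (barIncl A n)) := by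
      intro q
      refine Submodule.map₂_le.2 fun a ha t ht => ?_
      have h1 := ih ht
      rw [mem_ker, comp_apply, comp_apply, TensorProduct.mk_apply,
        lTensor_tmul, LinearMap.sub_apply, barWt_cons, map_tmul, h1,
        LinearMap.smul_apply, A.wt_apply c ha, LinearMap.smul_apply, LinearMap.id_apply,
        sub_eq_zero, TensorProduct.tmul_smul, smul_smul, smul_tmul', smul_smul,
        ← map_smul, smul_tmul']
      congr 3
      rw [← zpow_neg_one, ← zpow_add₀ hc, ← zpow_add₀ hc]
      congr 1
      push_cast
      ring
    have h : t ∈ LinearMap.ker (F ∘ₗ barCons A ∘ₗ lTensor A (barIncl A n)) :=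
      iSup_le key ht
    have h2 := barCons_lTensor_incl n t
    have h3 : F (barIncl A (n + 1) t) = 0 := (congrArg F h2).symm.trans h
    exact sub_eq_zero.1 h3

theorem barTot_mem_of_comp {x : BarTot A} {K : Submodule k (BarTot A)}
    (h : ∀ n, barIncl A n (barComp A n x) ∈ K) : x ∈ K := by
  classical
  have := DirectSum.sum_support_of x
  rw [← this]
  exact Submodule.sum_mem _ fun n _ => h n

theorem barComp_barWt (c : k) (n : ℕ) (x : BarTot A) :
    barComp A n (barWt A c x) = barComp A n (barWt A c (barIncl A n (barComp A n x))) := by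
  let F : BarTot A →ₗ[k] barSp A n := barComp A n ∘ₗ barWt A c
  suffices h : F = F ∘ₗ barIncl A n ∘ₗ barComp A n from LinearMap.congr_fun h x
  refine eq_of_incl fun m t => ?_
  by_cases hmn : m = n
  · subst hmn
    simp only [comp_apply, barComp_incl]
  · rw [comp_apply F, comp_apply (barIncl A n), barComp_incl_ne hmn, map_zero,
      map_zero]
    have key : ∀ m t, ∃ t', barWt A c (barIncl A m t) = barIncl A m t' := by
      intro m
      induction m with
      | zero => exact fun t => ⟨t, barWord_zero _ _⟩
      | succ m ih =>
        have : ∀ t : A ⊗[k] barSp A m, barWt A c (barIncl A (m + 1) t) ∈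
            LinearMap.range (barIncl A (m + 1)) := by
          intro t
          induction t with
          | zero => exact ⟨0, by rw [map_zero]; exact (congrArg _ (map_zero _)).trans (map_zero _) |>.symm⟩
          | add x y hx hy =>
            have e : barWt A c (barIncl A (m + 1) (x + y : A ⊗[k] barSp A m)) =
              barWt A c (barIncl A (m + 1) x) + barWt A c (barIncl A (m + 1) y) :=
                (congrArg _ (map_add _ _ _)).trans (map_add _ _ _)
            rw [e]
            exact add_mem hx hy
          | tmul a t =>
            obtain ⟨t', ht'⟩ := ih t
            rw [← barCons_incl, barWt_cons, map_tmul, ht', barCons_incl]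
            exact ⟨_, rfl⟩
        intro t
        obtain ⟨t', h⟩ := this t
        exact ⟨t', h.symm⟩
    obtain ⟨t', h⟩ := key m t
    change barComp A n (barWt A c (barIncl A m t)) = 0
    rw [h, barComp_incl_ne hmn]

/-- The grading of the bar complex is read off from the operator `barWt A 2`, which is `2 ^ i` in
degree `i`. -/
theorem mem_barPart [CharZero k] {i : ℤ} {x : BarTot A} :
    x ∈ barPart A i ↔ x ∈ barTotSub A ∧ barWt A 2 x = (2 : k) ^ i • x := by
  constructor
  · intro hx
    let K : Submodule k (BarTot A) :=
      barTotSub A ⊓ LinearMap.ker (barWt A (2 : k) - (2 : k) ^ i • LinearMap.id)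
    have : barPart A i ≤ K := by
      refine iSup_le fun n => Submodule.map_le_iff_le_comap.2 fun t ht => ⟨barIncl_mem ht.1, ?_⟩
      have h := barWt_incl (A := A) (c := (2 : k)) two_ne_zero ht.2
      rw [add_sub_cancel_right] at h
      rw [SetLike.mem_coe, mem_ker, LinearMap.sub_apply, h]
      simp
    have h := this hx
    exact ⟨h.1, sub_eq_zero.1 h.2⟩
  · rintro ⟨hx, hw⟩
    refine barTot_mem_of_comp fun n => mem_iSup_of_mem n ?_
    refine Submodule.mem_map_of_mem ⟨mem_barTotSub.1 hx n, ?_⟩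
    let T : barSp A n →ₗ[k] barSp A n := barComp A n ∘ₗ barWt A 2 ∘ₗ barIncl A n
    refine mem_of_eigenvector T (barDeg A n) (fun p => (2 : k) ^ (p - n)) ?_ ?_ ?_ ?_
    · intro p q h
      have := two_zpow_injective (k := k) h
      simpa using this
    · intro p t ht
      change barComp A n (barWt A 2 (barIncl A n t)) = _
      rw [barWt_incl two_ne_zero ht, map_smul, barComp_incl]
    · rw [barSp_deg_iSup]
      trivial
    · change barComp A n (barWt A 2 (barIncl A n (barComp A n x))) = _
      rw [← barComp_barWt, hw, map_smul, add_sub_cancel_right]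

theorem barWt_of_mem_barPart {c : k} (hc : c ≠ 0) {i : ℤ} {x : BarTot A} (hx : x ∈ barPart A i) :
    barWt A c x = c ^ i • x := by
  have : barPart A i ≤ LinearMap.ker (barWt A c - c ^ i • LinearMap.id) := by
    refine iSup_le fun n => Submodule.map_le_iff_le_comap.2 fun t ht => ?_
    have h := barWt_incl (A := A) hc ht.2
    rw [add_sub_cancel_right] at h
    rw [mem_comap, mem_ker, LinearMap.sub_apply, h]
    simp
  exact sub_eq_zero.1 (this hx)

theorem mem_iSup_eigen (x : BarTot A) [CharZero k] :
    x ∈ ⨆ i : ℤ, LinearMap.ker (barWt A (2 : k) - (2 : k) ^ i • LinearMap.id) := by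
  refine barTot_mem_of_comp fun n => ?_
  have h : barComp A n x ∈ ⨆ p, barDeg A n p := by rw [barSp_deg_iSup]; trivial
  have h' : ⨆ p, barDeg A n p ≤ (⨆ i : ℤ, LinearMap.ker
      (barWt A (2 : k) - (2 : k) ^ i • LinearMap.id)).comap (barIncl A n) := by
    refine iSup_le fun p t ht => mem_iSup_of_mem (p - n) ?_
    rw [mem_ker, LinearMap.sub_apply, barWt_incl two_ne_zero ht]
    simp
  exact h' h

/-- The differential raises eigenvalues of `barWt A 2` by the factor `2`. -/
theorem barD_mem_barPart [CharZero k] {ε : A.Augmentation} {i : ℤ} {x : BarTot A}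
    (hx : x ∈ barPart A i) : barD A ε x ∈ barPart A (i + 1) := by
  rw [mem_barPart] at *
  refine ⟨barD_mem hx.1, ?_⟩
  rw [barWt_barD two_ne_zero hx.1, hx.2, map_smul, smul_smul, zpow_add_one₀ two_ne_zero, mul_comm]

end Degrees

/-! ### Reduction of the bar complex to letters in the rigid subalgebra -/

section EigenSum

variable {k M : Type u} [Field k] [AddCommGroup M] [Module k M]

/-- A stable subspace contains the eigenvectors of its elements. -/
theorem mem_of_sum_eigenvectors {ι : Type*} [DecidableEq ι] (T : M →ₗ[k] M) (P : Submodule k M)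
    (hP : ∀ x ∈ P, T x ∈ P) (μ : ι → k) (hμ : Function.Injective μ) (S : Finset ι) (x : ι → M)
    (hx : ∀ i, T (x i) = μ i • x i) (h : ∑ i ∈ S, x i ∈ P) : ∀ i ∈ S, x i ∈ P := by
  induction S using Finset.induction_on generalizing x with
  | empty => simp
  | insert j S hj ih =>
    have h1 : ∑ i ∈ S, (μ i - μ j) • x i ∈ P := by
      have h2 := sub_mem (hP _ h) (P.smul_mem (μ j) h)
      rw [Finset.sum_insert hj, map_add, map_sum, smul_add, Finset.smul_sum, hx j,
        add_sub_add_left_eq_sub, ← Finset.sum_sub_distrib] at h2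
      convert h2 using 2 with i
      rw [hx, sub_smul]
    have h3 : ∀ i ∈ S, x i ∈ P := by
      intro i hi
      have h4 := ih (fun i => (μ i - μ j) • x i)
        (fun i => by rw [map_smul, hx, smul_smul, smul_smul, mul_comm]) h1 i hi
      have h5 : μ i - μ j ≠ 0 := sub_ne_zero.2 fun e => hj (hμ e ▸ hi)
      exact (P.smul_mem_iff h5).1 h4
    intro i hi
    rcases Finset.mem_insert.1 hi with rfl | hi
    · rw [Finset.sum_insert hj] at h
      exact (Submodule.add_mem_iff_left _ (P.sum_mem h3)).1 h
    · exact h3 i hi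

theorem mem_iSup_inf_of_eigen {ι : Type*} (T : M →ₗ[k] M) (P : Submodule k M)
    (hP : ∀ x ∈ P, T x ∈ P) (μ : ι → k) (hμ : Function.Injective μ) {x : M} (hx : x ∈ P)
    (h : x ∈ ⨆ i, LinearMap.ker (T - μ i • LinearMap.id)) :
    x ∈ ⨆ i, P ⊓ LinearMap.ker (T - μ i • LinearMap.id) := by
  classical
  obtain ⟨f, hf, rfl⟩ := (Submodule.mem_iSup_iff_exists_finsupp _ _).1 h
  have key := mem_of_sum_eigenvectors T P hP μ hμ f.support f
    (fun i => sub_eq_zero.1 (hf i)) hx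
  exact Submodule.sum_mem _ fun i hi => mem_iSup_of_mem i ⟨key i hi, hf i⟩

end EigenSum

section Reduction

variable {k O : Type u} [Field k] [AddCommGroup O] [Module k O] [Coalgebra k O] {A : RelDGA k O}

theorem barTotSub_le_iSup [CharZero k] : barTotSub A ≤ ⨆ i, barPart A i := by
  intro x hx
  have h := mem_iSup_inf_of_eigen (barWt A (2 : k)) (barTotSub A) (fun y hy => barWt_mem 2 hy)
    (fun i : ℤ => (2 : k) ^ i) two_zpow_injective hx (mem_iSup_eigen x)
  exact SetLike.le_def.1 (iSup_mono fun i y hy => mem_barPart.2 ⟨hy.1, sub_eq_zero.1 hy.2⟩) h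

section length

variable (A) in
/-- The words of length less than `n`. -/
def barLen : ℕ → Submodule k (BarTot A)
  | 0 => ⊥
  | n + 1 => LinearMap.range (barZero A) ⊔ (subTensor ⊤ (barLen n)).map (barCons A)

theorem barZero_mem_barLen (n : ℕ) (f : O) : barZero A f ∈ barLen A (n + 1) :=
  Submodule.mem_sup_left ⟨f, rfl⟩

theorem barCons_mem_barLen {n : ℕ} {x : A ⊗[k] BarTot A} (hx : x ∈ subTensor ⊤ (barLen A n)) :
    barCons A x ∈ barLen A (n + 1) :=
  Submodule.mem_sup_right (Submodule.mem_map_of_mem hx)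

theorem barLen_succ_le {n : ℕ} {K : Submodule k (BarTot A)} (h0 : ∀ f, barZero A f ∈ K)
    (h1 : ∀ x ∈ subTensor ⊤ (barLen A n), barCons A x ∈ K) : barLen A (n + 1) ≤ K := by
  refine sup_le ?_ ?_
  · rintro _ ⟨f, rfl⟩
    exact h0 f
  · rintro _ ⟨x, hx, rfl⟩
    exact h1 x hx

theorem barLen_mono_succ (n : ℕ) : barLen A n ≤ barLen A (n + 1) := by
  induction n with
  | zero => exact bot_le
  | succ n ih =>
    exact barLen_succ_le (barZero_mem_barLen _)
      fun x hx => barCons_mem_barLen (subTensor_mono le_rfl ih hx)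

theorem exists_mem_barLen (x : BarTot A) : ∃ n, x ∈ barLen A n := by
  have hm : Monotone (barLen A) := monotone_nat_of_le_succ barLen_mono_succ
  refine (Submodule.mem_iSup_of_directed _ hm.directed_le).1 ?_
  refine barTot_induction _ (fun f => mem_iSup_of_mem 1 (barZero_mem_barLen 0 f)) ?_ x
  intro a t ht
  have : ⨆ n, barLen A n ≤ (⨆ n, barLen A n).comap
      (barCons A ∘ₗ TensorProduct.mk k A (BarTot A) a) :=
    iSup_le fun n s hs => mem_iSup_of_mem (n + 1)
      (barCons_mem_barLen (tmul_mem_subTensor trivial hs))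
  exact this ht

theorem map_mem_barLen {α : A →ₗ[k] A} {f : BarTot A →ₗ[k] BarTot A} {m n : ℕ}
    (hf : ∀ y ∈ barLen A m, f y ∈ barLen A n) {x : A ⊗[k] BarTot A}
    (hx : x ∈ subTensor ⊤ (barLen A m)) :
    barCons A (map α f x) ∈ barLen A (n + 1) :=
  barCons_mem_barLen (subTensor_map (P := ⊤) (P' := ⊤) (fun _ _ => trivial) hf hx)

theorem barWord_mem_barLen (α : A →ₗ[k] A) {n : ℕ} {x : BarTot A} (hx : x ∈ barLen A n) :
    barWord A α x ∈ barLen A n := by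
  induction n generalizing x with
  | zero =>
    rw [(mem_bot k).1 hx, map_zero]
    exact zero_mem _
  | succ n ih =>
    refine barLen_succ_le (K := (barLen A (n + 1)).comap (barWord A α)) (fun f => ?_)
      (fun x hx => ?_) hx
    · rw [mem_comap, barWord_zero]
      exact barZero_mem_barLen _ f
    · rw [mem_comap, barWord_cons]
      exact map_mem_barLen (fun y hy => ih hy) hx

theorem barDer_mem_barLen (α β : A →ₗ[k] A) {n : ℕ} {x : BarTot A} (hx : x ∈ barLen A n) :
    barDer A α β x ∈ barLen A n := by
  induction n generalizing x with
  | zero =>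
    rw [(mem_bot k).1 hx, map_zero]
    exact zero_mem _
  | succ n ih =>
    refine barLen_succ_le (K := (barLen A (n + 1)).comap (barDer A α β)) (fun f => ?_)
      (fun x hx => ?_) hx
    · rw [mem_comap, barDer_zero]
      exact zero_mem _
    · rw [mem_comap, barDer_cons]
      exact add_mem (map_mem_barLen (f := LinearMap.id) (fun y hy => hy) hx)
        (map_mem_barLen (fun y hy => ih hy) hx)

variable (ε : A.Augmentation)

theorem barAct_mem_barLen {n : ℕ} {x : A ⊗[k] BarTot A} (hx : x ∈ subTensor ⊤ (barLen A n)) :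
    barAct ε x ∈ barLen A n := by
  refine subTensor_induction ((barLen A n).comap (barAct ε)) (fun a _ t ht => ?_) hx
  cases n with
  | zero =>
    rw [(mem_bot k).1 ht, tmul_zero]
    exact zero_mem _
  | succ n =>
    refine barLen_succ_le (K := ((barLen A (n + 1)).comap (barAct ε)).comap
      (TensorProduct.mk k A (BarTot A) a)) (fun f => ?_) (fun x hx => ?_) ht
    · change barAct ε (a ⊗ₜ barZero A f) ∈ barLen A (n + 1)
      rw [barAct_zero]
      exact barZero_mem_barLen _ _
    · have : barAct ε (a ⊗ₜ barCons A x) = barCons A (mulTensor A.m (BarTot A) (a ⊗ₜ x)) :=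
        barAct_lTensor_cons ε (a ⊗ₜ x)
      change barAct ε (a ⊗ₜ barCons A x) ∈ barLen A (n + 1)
      rw [this]
      exact barCons_mem_barLen (mulTensor_mem_top (tmul_mem_subTensor trivial hx))

theorem barTail_mem_barLen {n : ℕ} {x : BarTot A} (hx : x ∈ barLen A (n + 1)) :
    barTail ε x ∈ barLen A n := by
  induction n generalizing x with
  | zero =>
    refine barLen_succ_le (K := (barLen A 0).comap (barTail ε)) (fun f => ?_)
      (fun x hx => ?_) hx
    · rw [mem_comap, barTail_zero]
      exact zero_mem _
    · have : x = 0 := subTensor_induction (⊥ : Submodule k (A ⊗[k] BarTot A))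
        (fun a _ t ht => by
          rw [(mem_bot k).1 ht, tmul_zero]; exact zero_mem _) hx
      rw [this, map_zero]
      exact zero_mem _
  | succ n ih =>
    refine barLen_succ_le (K := (barLen A (n + 1)).comap (barTail ε)) (fun f => ?_)
      (fun x hx => ?_) hx
    · rw [mem_comap, barTail_zero]
      exact zero_mem _
    · rw [mem_comap, barTail_cons]
      refine sub_mem (neg_mem (barAct_mem_barLen ε ?_)) (map_mem_barLen (fun y hy => ih hy) hx)
      exact subTensor_map (P := ⊤) (P' := ⊤) (fun _ _ => trivial)
        (fun y hy => barWord_mem_barLen _ hy) hx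

theorem barHead_mem_barLen {n : ℕ} {x : BarTot A} (hx : x ∈ barLen A (n + 1)) :
    barHead ε x ∈ barLen A n := by
  refine barLen_succ_le (K := (barLen A n).comap (barHead ε)) (fun f => ?_) (fun x hx => ?_) hx
  · rw [mem_comap, barHead_zero]
    exact zero_mem _
  · rw [mem_comap, barHead_cons]
    exact barWord_mem_barLen _ (sliceL_mem hx _)

end length

namespace RelDGA.Retract

variable (R : A.Retract)

theorem p_p (x : A) : R.p (R.p x) = R.p x := R.p_eq _ (R.p_mem x)

theorem h_p (x : A) : R.h (R.p x) = 0 := R.h_eq _ (R.p_mem x)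

theorem p_d (x : A) : R.p (A.d x) = A.d (R.p x) := by
  have h1 := congrArg A.d (R.homotopy x)
  have h2 := R.homotopy (A.d x)
  rw [map_add, d_d_apply, zero_add, map_sub] at h1
  rw [d_d_apply, map_zero, add_zero, h1] at h2
  exact (sub_right_injective h2).symm

theorem p_deg (n : ℤ) (x : A) (hx : x ∈ A.deg n) : R.p x ∈ A.deg n := by
  have h1 : R.p x = x - (A.d (R.h x) + R.h (A.d x)) := by rw [R.homotopy]; abel
  rw [h1]
  refine sub_mem hx (add_mem ?_ ?_)
  · have := A.d_deg _ _ (R.h_deg n x hx)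
    rwa [neg_add_cancel_right] at this
  · have := R.h_deg _ _ (A.d_deg n x hx)
    rwa [add_neg_cancel_right] at this

theorem p_dOp (a : ℤ → k) (x : A) : A.dOp a (R.p x) = R.p (A.dOp a x) :=
  dOp_comm_of_deg R.p_deg a x

theorem p_sgn (x : A) : A.sgn (R.p x) = R.p (A.sgn x) := by
  rw [sgn_eq_wt]
  exact R.p_dOp _ x

theorem h_sgn (x : A) : A.sgn (R.h x) = -R.h (A.sgn x) := by
  rw [sgn_of_deg_shift R.h_deg]
  norm_num

/-- The bar words of `A ⊗_O ⋯ ⊗_O A` with all letters in the rigid subalgebra. -/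
def sub : Submodule k (BarTot A) :=
  barTotSub A ⊓ LinearMap.ker (barWord A R.p - LinearMap.id)

theorem mem_sub {x : BarTot A} : x ∈ R.sub ↔ x ∈ barTotSub A ∧ barWord A R.p x = x := by
  rw [sub, mem_inf, mem_ker, LinearMap.sub_apply, sub_eq_zero]
  rfl

theorem p_comp_p : R.p ∘ₗ R.p = R.p := LinearMap.ext R.p_p

theorem word_p_mem {x : BarTot A} (hx : x ∈ barTotSub A) : barWord A R.p x ∈ R.sub :=
  R.mem_sub.2 ⟨barWord_mem R.p_bicolinear hx, by rw [barWord_comp, p_comp_p]⟩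

/-- The contraction of the inner differential of the bar complex onto the words in the rigid
subalgebra. -/
def contract : BarTot A →ₗ[k] BarTot A := barDer A R.h (A.sgn ∘ₗ R.p)

/-- The tensor product of the homotopies of all letters. -/
theorem contract_der (x : BarTot A) : barDer A A.d A.sgn (R.contract x) +
    R.contract (barDer A A.d A.sgn x) = x - barWord A R.p x := by
  suffices h : barDer A A.d A.sgn ∘ₗ R.contract + R.contract ∘ₗ barDer A A.d A.sgn =
      LinearMap.id - barWord A R.p from LinearMap.congr_fun h x
  refine barTot_ext (fun f => ?_) (fun a t ih => ?_)
  · simp [contract, barDer_zero, barWord_zero]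
  · simp only [LinearMap.add_apply, comp_apply, LinearMap.sub_apply,
      LinearMap.id_apply, contract] at ih ⊢
    simp only [barDer_cons, barWord_cons, map_add, rTensor_tmul, map_tmul,
      comp_apply]
    have e1 : R.contract (barDer A A.d A.sgn t) = t - barWord A R.p t -
      barDer A A.d A.sgn (R.contract t) := by rw [← ih]; simp [contract]
    simp only [contract] at e1
    rw [e1]
    have e2 : A.sgn (R.p (A.d a)) = -A.d (A.sgn (R.p a)) := by rw [R.p_d, sgn_d]
    have e3 : R.h (A.sgn a) = -A.sgn (R.h a) := by rw [h_sgn, neg_neg]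
    have e4 : R.h (A.d a) = a - R.p a - A.d (R.h a) := by rw [← R.homotopy]; abel
    have e5 : A.sgn (R.p (A.sgn a)) = R.p a := by rw [← R.p_sgn, sgn_sgn]
    rw [e2, e3, e4, e5, sgn_sgn]
    simp only [TensorProduct.sub_tmul, TensorProduct.tmul_sub, neg_tmul, map_sub,
      map_neg]
    abel

theorem contract_word (x : BarTot A) : R.contract (barWord A R.p x) = 0 := by
  suffices h : R.contract ∘ₗ barWord A R.p = 0 from LinearMap.congr_fun h x
  refine barTot_ext (fun f => ?_) (fun a t ih => ?_)
  · simp [contract, barDer_zero, barWord_zero]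
  · simp only [comp_apply, LinearMap.zero_apply, contract] at ih ⊢
    rw [barWord_cons, barDer_cons, map_tmul, map_tmul, ih,
      rTensor_tmul, R.h_p]
    simp

theorem contract_eq_zero {x : BarTot A} (hx : x ∈ R.sub) : R.contract x = 0 := by
  rw [← (R.mem_sub.1 hx).2, contract_word]

theorem sgn_p_bicolinear : A.Bicolinear (A.sgn ∘ₗ R.p) := sgn_bicolinear.comp R.p_bicolinear

theorem contract_mem_barPart [CharZero k] {i : ℤ} {x : BarTot A} (hx : x ∈ barPart A i) :
    R.contract x ∈ barPart A (i - 1) := by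
  rw [mem_barPart] at *
  refine ⟨barDer_mem R.h_bicolinear R.sgn_p_bicolinear hx.1, ?_⟩
  have h2 : (2 : k) ≠ 0 := two_ne_zero
  have := barWord_der (γ := (2 : k)⁻¹ • A.wt 2) (α := R.h) (β := A.sgn ∘ₗ R.p) (c := (2 : k)⁻¹)
    (fun x => by
      rw [LinearMap.smul_apply, LinearMap.smul_apply, wt_of_deg_shift R.h_deg h2, map_smul,
        zpow_neg_one])
    (fun x => by
      simp only [LinearMap.smul_apply, comp_apply, wt_sgn, map_smul]
      rw [wt, R.p_dOp]) x
  refine this.trans ?_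
  change (2 : k)⁻¹ • R.contract (barWt A 2 x) = _
  rw [hx.2, map_smul, smul_smul, zpow_sub_one₀ h2, mul_comm]

theorem word_p_mem_barPart [CharZero k] {i : ℤ} {x : BarTot A} (hx : x ∈ barPart A i) :
    barWord A R.p x ∈ barPart A i := by
  rw [mem_barPart] at *
  refine ⟨barWord_mem R.p_bicolinear hx.1, ?_⟩
  rw [barWt, barWord_comm, ← barWt, hx.2, map_smul]
  intro x
  rw [LinearMap.smul_apply, LinearMap.smul_apply, map_smul, wt, R.p_dOp]

/-- The letters in the rigid subalgebra are preserved by the action, as it is closed under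
multiplication. -/
theorem word_act {ε : A.Augmentation} {y : A ⊗[k] BarTot A} (hy : y ∈ barCot A)
    (hy' : y ∈ subTensor R.B R.sub) : barWord A R.p (barAct ε y) = barAct ε y := by
  rw [barAct_apply, map_add, barWord_zero, barWord_cons]
  congr 2
  have hz := lTensor_uncons_mem hy
  have hp : ∀ t ∈ subTensor R.B R.sub, lTensor A (barUncons A) t ∈
      subTensor R.B (subTensor R.B (⊤ : Submodule k (BarTot A))) := by
    intro t ht
    refine subTensor_map (f := LinearMap.id) (fun _ h => h) (fun c hc => ?_) ht
    rw [← (R.mem_sub.1 hc).2, barUncons_word]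
    exact subTensor_map (P := ⊤) (Q := ⊤) (P' := R.B) (Q' := ⊤) (fun a _ => R.p_mem a)
      (fun _ _ => trivial) (mem_subTensor_top _)
  have hw : lTensor A (lTensor A (barWord A R.p))
      (lTensor A (barUncons A) y) = lTensor A (barUncons A) y := by
    rw [← lTensor_comp_apply]
    refine eq_on_subTensor (F := lTensor A _) (G := lTensor A _)
      (fun a _ c hc => ?_) hy'
    rw [lTensor_tmul, lTensor_tmul, comp_apply]
    congr 1
    have h1 : map R.p (barWord A R.p) (barUncons A c) = barUncons A c := by
      rw [← barUncons_word, (R.mem_sub.1 hc).2]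
    conv_rhs => rw [← h1]
    conv_lhs => rw [← h1]
    rw [lTensor, map_map_eq]
    congr 2
    exact LinearMap.ext fun t => (barWord_comp _ _ _).trans (by rw [p_comp_p])
  apply slice_sep
  intro φ
  rw [slice_map, slice_mulTensor]
  have h2 : lTensor A (slice A (φ ∘ₗ barWord A R.p))
      (lTensor A (barUncons A) y) ∈ subTensor R.B R.B :=
    subTensor_map (f := LinearMap.id) (fun _ h => h) (fun c hc => slice_mem hc _) (hp y hy')
  rw [R.p_eq _ (R.mul_mem _ (slice_mem_cot A _ hz _) h2), slice_mulTensor]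
  have h3 : slice A (φ ∘ₗ barWord A R.p) = slice A φ ∘ₗ lTensor A (barWord A R.p) := by
    refine TensorProduct.ext' fun a t => ?_
    simp [slice_tmul]
  rw [h3, lTensor_comp_apply, hw]

theorem word_tail {ε : A.Augmentation} {x : BarTot A} (hx : x ∈ barTotSub A) :
    barWord A R.p (barTail ε (barWord A R.p x)) = barTail ε (barWord A R.p x) := by
  refine barTotSub_induction (LinearMap.ker (barWord A R.p ∘ₗ barTail ε ∘ₗ barWord A R.p -
    barTail ε ∘ₗ barWord A R.p)) (fun f => ?_) (fun x hx hx' => ?_) hx |> sub_eq_zero.1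
  · simp [barWord_zero, barTail_zero]
  · have h1 : map A.sgn (barWord A A.sgn)
        (map R.p (barWord A R.p) x) ∈ barCot A :=
      map_word_mem_barCot sgn_bicolinear sgn_bicolinear
        (map_word_mem_barCot R.p_bicolinear R.p_bicolinear hx)
    have h2 : map A.sgn (barWord A A.sgn)
        (map R.p (barWord A R.p) x) ∈ subTensor R.B R.sub := by
      rw [map_map_eq]
      refine subTensor_map (P := ⊤) (fun a _ => ?_) (fun c hc => ?_) hx'
      · rw [comp_apply, R.p_sgn]
        exact R.p_mem _
      · rw [comp_apply, barWord_comm R.p_sgn]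
        exact R.word_p_mem (barWord_mem sgn_bicolinear hc.2)
    rw [mem_ker, LinearMap.sub_apply, comp_apply, comp_apply,
      barWord_cons, barTail_cons, map_sub, map_neg, R.word_act h1 h2,
      barWord_cons, sub_eq_zero]
    congr 2
    rw [map_map_eq, map_map_eq, map_map_eq]
    refine map_eq_on_subTensor (P := ⊤) (fun a _ => ?_) (fun c hc => ?_) hx'
    · simp only [comp_apply]
      rw [R.p_sgn, R.p_p]
    · exact sub_eq_zero.1 hc.1

theorem barD_mem_sub {ε : A.Augmentation} {x : BarTot A} (hx : x ∈ R.sub) :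
    barD A ε x ∈ R.sub := by
  obtain ⟨h1, h2⟩ := R.mem_sub.1 hx
  refine R.mem_sub.2 ⟨barD_mem h1, ?_⟩
  rw [barD_eq, map_add, map_add]
  refine congrArg₂ (· + ·) (congrArg₂ (· + ·) ?_ ?_) ?_
  · conv_lhs => rw [← h2]
    have := barWord_der (γ := R.p) (α := A.d) (β := A.sgn) (c := 1)
      (fun x => by rw [R.p_d, one_smul]) (fun x => (R.p_sgn x).symm) (barWord A R.p x)
    rw [this, one_smul, h2, h2]
  · conv_lhs => rw [← h2]
    rw [R.word_tail h1, h2]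
  · obtain ⟨f, y, rfl⟩ := bar_cases x
    have h3 : barHead ε (barZero A f + barCons A y) = barHead ε (barWord A R.p (barZero A f +
      barCons A y)) := by rw [h2]
    rw [h3]
    simp only [map_add, barWord_zero, barWord_cons, barHead_zero, barHead_cons, zero_add]
    rw [sliceL_map, barWord_comm (α := A.sgn) (β := R.p) R.p_sgn, barWord_comp, p_comp_p]

/-- A chain whose differential has letters in the rigid subalgebra is homologous to a chain of
that kind: the contraction of the inner differential makes the error shorter in each step. -/
theorem exists_reduction_of_barLen [CharZero k] {ε : A.Augmentation} {n : ℕ} {i : ℤ} {x : BarTot A}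
    (hn : x ∈ barLen A n) (hx : x ∈ barPart A i) (hD : barD A ε x ∈ R.sub) :
    ∃ y ∈ barPart A (i - 1), x - barD A ε y ∈ R.sub := by
  induction n generalizing x with
  | zero =>
    refine ⟨0, zero_mem _, ?_⟩
    rw [(mem_bot k).1 hn, map_zero, sub_zero]
    exact zero_mem _
  | succ n ih =>
    have hx1 := (mem_barPart.1 hx).1
    have hH := R.contract_mem_barPart hx
    have hp := R.word_p_mem_barPart hx
    have hDH := barD_mem_barPart (ε := ε) hH
    rw [sub_add_cancel] at hDH
    have e1 : R.contract (barD A ε x) = 0 := R.contract_eq_zero hD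
    have e2 : x - barD A ε (R.contract x) - barWord A R.p x =
        -(R.contract (barTail ε x) + R.contract (barHead ε x) + barTail ε (R.contract x) +
          barHead ε (R.contract x)) := by
      rw [barD_eq, map_add, map_add] at e1
      rw [barD_eq]
      have h3 := R.contract_der x
      have h4 : R.contract (barDer A A.d A.sgn x) = -(R.contract (barTail ε x)) -
        R.contract (barHead ε x) := by
        rw [add_assoc] at e1
        rw [eq_neg_of_add_eq_zero_left e1]
        abel
      rw [h4] at h3
      have h5 : barWord A R.p x = x - (barDer A A.d A.sgn (R.contract x) +
        (-(R.contract (barTail ε x)) - R.contract (barHead ε x))) := by rw [h3]; abel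
      rw [h5]
      abel
    -- `barTail` and `barHead` shorten words, and `contract` preserves the length
    have hl : x - barD A ε (R.contract x) - barWord A R.p x ∈ barLen A n := by
      rw [e2]
      exact neg_mem (add_mem (add_mem (add_mem
        (barDer_mem_barLen _ _ (barTail_mem_barLen ε hn))
        (barDer_mem_barLen _ _ (barHead_mem_barLen ε hn)))
        (barTail_mem_barLen ε (barDer_mem_barLen _ _ hn)))
        (barHead_mem_barLen ε (barDer_mem_barLen _ _ hn)))
    obtain ⟨y, hy, hy'⟩ := ih hl (sub_mem (sub_mem hx hDH) hp) (by
      rw [map_sub, map_sub, barD_barD (mem_barPart.1 hH).1, sub_zero]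
      exact sub_mem hD (R.barD_mem_sub (R.word_p_mem hx1)))
    refine ⟨R.contract x + y, add_mem hH hy, ?_⟩
    have h3 := add_mem hy' (R.word_p_mem hx1)
    rw [map_add]
    convert h3 using 1
    abel

theorem exists_reduction [CharZero k] {ε : A.Augmentation} {i : ℤ} {x : BarTot A}
    (hx : x ∈ barPart A i) (hD : barD A ε x ∈ R.sub) :
    ∃ y ∈ barPart A (i - 1), x - barD A ε y ∈ R.sub :=
  (exists_mem_barLen x).elim fun _ hn => R.exists_reduction_of_barLen hn hx hD

end RelDGA.Retract

end Reduction

/-! ### Insertion of the unit, and letters of positive degree -/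

section Insertion

variable {k O : Type u} [Field k] [AddCommGroup O] [Module k O] [Coalgebra k O] {A : RelDGA k O}

theorem sliceL_coactLeft {C M N : Type u} [AddCommGroup C] [Module k C] [Coalgebra k C]
    [AddCommGroup M] [Module k M] [AddCommGroup N] [Module k N] {lam : M →ₗ[k] C ⊗[k] M}
    (h : IsLeftCoaction lam) (x : M ⊗[k] N) :
    sliceL (M ⊗[k] N) counit (coactLeft lam N x) = x := by
  induction x with
  | zero => simp
  | add a c ha hc => simp only [map_add, ha, hc]
  | tmul a c =>
    rw [coactLeft_tmul, sliceL_lTensor, h.counit_apply]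
    rfl

theorem barLam_isLeftCoaction : IsLeftCoaction (barLam A) where
  coassoc := by
    refine barTot_ext (fun f => ?_) (fun a t ih => ?_)
    · change coactLeft comul (BarTot A) (barLam A (barZero A f)) =
        lTensor O (barLam A) (barLam A (barZero A f))
      rw [barLam_zero, coactLeft_lTensor, ← lTensor_comp_apply]
      refine (congrArg _ (coactLeft_comul_comul f)).trans ?_
      rw [← lTensor_comp_apply]
      congr 2
      exact LinearMap.ext fun g => (barLam_zero g).symm
    · change coactLeft comul (BarTot A) (barLam A (barCons A _)) =
        lTensor O (barLam A) (barLam A (barCons A _))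
      rw [barLam_cons, coactLeft_lTensor, ← lTensor_comp_apply,
        coactLeft_coassoc A.coactL_isCoaction, ← lTensor_comp_apply]
      congr 2
      exact LinearMap.ext fun g => (barLam_cons g).symm
  counit := by
    refine barTot_ext (fun f => ?_) (fun a t ih => ?_)
    · change sliceL (BarTot A) counit (barLam A (barZero A f)) = barZero A f
      rw [barLam_zero, sliceL_lTensor, (comul_isLeftCoaction k O).counit_apply]
    · change sliceL (BarTot A) counit (barLam A (barCons A (a ⊗ₜ[k] t))) =
        barCons A (a ⊗ₜ[k] t)
      rw [barLam_cons, sliceL_lTensor, sliceL_coactLeft A.coactL_isCoaction]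

theorem barLam_coassoc (x : BarTot A) : coactLeft comul (BarTot A) (barLam A x) =
    lTensor O (barLam A) (barLam A x) :=
  barLam_isLeftCoaction.coassoc_apply x

theorem barLam_mem {x : BarTot A} (hx : x ∈ barTotSub A) :
    barLam A x ∈ subTensor ⊤ (barTotSub A) := by
  refine barTotSub_induction ((subTensor ⊤ (barTotSub A)).comap (barLam A)) (fun f => ?_)
    (fun x hx hx' => ?_) hx
  · rw [mem_comap, barLam_zero]
    exact subTensor_map (P := ⊤) (Q := ⊤) (f := LinearMap.id) (fun _ h => h)
      (fun g _ => barZero_mem g) (mem_subTensor_top _)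
  · rw [mem_comap, barLam_cons]
    exact subTensor_map (f := LinearMap.id) (fun _ h => h) (fun y hy => barCons_mem_iff.2 hy)
      (coactLeft_mem_top hx (subTensor_mono le_rfl inf_le_right hx'))

theorem rTensor_unit_coactLeft (t : O ⊗[k] BarTot A) :
    coactLeft A.coactL (BarTot A) (rTensor (BarTot A) A.unit t) =
      lTensor O (rTensor (BarTot A) A.unit)
        (coactLeft comul (BarTot A) t) :=
  coactLeft_map (fun x => LinearMap.congr_fun A.unit_coactL x) LinearMap.id t

theorem rTensor_unit_coactMid {Y : Type u} [AddCommGroup Y] [Module k Y] (t : O ⊗[k] Y) :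
    coactMid A.coactR Y (rTensor Y A.unit t) =
      rTensor (O ⊗[k] Y) A.unit (coactLeft comul Y t) := by
  have h := coactMid_map (ρ' := A.coactR) (fun x => LinearMap.congr_fun A.unit_coactR x)
    LinearMap.id t
  refine h.trans ?_
  rw [LinearMap.lTensor_id]
  rfl

variable (A) in
/-- The element `1 ⊗ t` of `O ⊗_O X`, inserted as a letter in the image of the unit. -/
def barIns : BarTot A →ₗ[k] BarTot A :=
  barCons A ∘ₗ rTensor (BarTot A) A.unit ∘ₗ barLam A

theorem barIns_apply (t : BarTot A) :
    barIns A t = barCons A (rTensor (BarTot A) A.unit (barLam A t)) := rfl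

theorem rTensor_unit_lam_mem (t : BarTot A) :
    rTensor (BarTot A) A.unit (barLam A t) ∈ barCot A := by
  refine mem_cotensor.2 ?_
  rw [rTensor_unit_coactMid, barLam_coassoc, rTensor_lTensor]

theorem barIns_mem {t : BarTot A} (ht : t ∈ barTotSub A) : barIns A t ∈ barTotSub A :=
  barCons_mem_iff.2 ⟨rTensor_unit_lam_mem t,
    subTensor_map (P' := ⊤) (g := LinearMap.id) (fun _ _ => trivial) (fun _ h => h)
      (barLam_mem ht)⟩

theorem barIns_colinear (t : BarTot A) :
    barLam A (barIns A t) = lTensor O (barIns A) (barLam A t) := by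
  rw [barIns_apply, barLam_cons, rTensor_unit_coactLeft, barLam_coassoc,
    ← lTensor_comp_apply, ← lTensor_comp_apply]
  rfl

theorem barWord_ins {γ : A →ₗ[k] A} (hγ : A.Bicolinear γ) {c : k}
    (hu : ∀ f, γ (A.unit f) = c • A.unit f) (t : BarTot A) :
    barWord A γ (barIns A t) = c • barIns A (barWord A γ t) := by
  rw [barIns_apply, barWord_cons, barIns_apply, barLam_word hγ, ← map_smul]
  congr 1
  rw [rTensor, lTensor, map_map_eq, map_map_eq]
  have : γ ∘ₗ A.unit = c • A.unit := LinearMap.ext hu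
  rw [this, TensorProduct.map_smul_left]
  rfl

theorem barDer_ins (t : BarTot A) :
    barDer A A.d A.sgn (barIns A t) = barIns A (barDer A A.d A.sgn t) := by
  rw [barIns_apply, barDer_cons, barIns_apply, barLam_der RelDGA.Bicolinear.d RelDGA.sgn_bicolinear,
    rTensor, rTensor, lTensor, map_map_eq, map_map_eq, map_map_eq]
  have h1 : A.d ∘ₗ A.unit = 0 := A.unit_d
  have h2 : A.sgn ∘ₗ A.unit = A.unit := LinearMap.ext RelDGA.sgn_unit
  rw [h1, h2, TensorProduct.map_zero_left]
  simp

theorem barWord_sgn_ins (t : BarTot A) :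
    barWord A A.sgn (barIns A t) = barIns A (barWord A A.sgn t) := by
  rw [barWord_ins RelDGA.sgn_bicolinear (c := 1) (fun f => by rw [RelDGA.sgn_unit, one_smul]), one_smul]

variable (ε : A.Augmentation)

theorem barHead_ins (t : BarTot A) : barHead ε (barIns A t) = barWord A A.sgn t := by
  have h : ε.char ∘ₗ A.unit = counit := LinearMap.ext ε.char_unit
  rw [barIns_apply, barHead_cons]
  congr 1
  refine (sliceL_map A.unit LinearMap.id ε.char (barLam A t)).trans ?_
  rw [h, barLam_isLeftCoaction.counit_apply]
  rfl

theorem barAct_unit (t : BarTot A) :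
    barAct ε (rTensor (BarTot A) A.unit (barLam A t)) = t := by
  obtain ⟨f, x, rfl⟩ := bar_cases t
  rw [map_add, map_add, map_add, barLam_zero, barLam_cons, rTensor_lTensor, rTensor_lTensor,
    barAct_lTensor_cons, mulTensor_unit_left]
  congr 1
  have h : barAct ε ∘ₗ lTensor A (barZero A) ∘ₗ rTensor O A.unit =
      barZero A ∘ₗ slice O counit := by
    refine TensorProduct.ext' fun g g' => ?_
    simp only [comp_apply, rTensor_tmul, lTensor_tmul, barAct_zero,
      slice_tmul, ε.left_unit]
  refine (LinearMap.congr_fun h _).trans ?_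
  have h2 : slice O counit (comul (R := k) f) = f := by
    have := Coalgebra.lTensor_counit_comul (R := k) f
    rw [slice, comp_apply, this]
    simp
  rw [comp_apply, h2]

theorem mulTensor_unit_lam {y : A ⊗[k] BarTot A} (hy : y ∈ barCot A) :
    mulTensor A.m (BarTot A) (lTensor A
      (rTensor (BarTot A) A.unit ∘ₗ barLam A) y) = y := by
  rw [lTensor_comp_apply, ← mem_cotensor.1 hy, mulTensor_unit_right]

/-- The inserted unit is multiplied with the next letter, which gives back the word. -/
theorem barTail_ins {t : BarTot A} (ht : t ∈ barTotSub A) :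
    barTail ε (barIns A t) = -barWord A A.sgn t - barIns A (barTail ε t) := by
  have h2 : A.sgn ∘ₗ A.unit = A.unit := LinearMap.ext RelDGA.sgn_unit
  have h3 : ∀ f : BarTot A →ₗ[k] BarTot A, map A.sgn f
      (rTensor (BarTot A) A.unit (barLam A t)) =
      rTensor (BarTot A) A.unit (lTensor O f (barLam A t)) := by
    intro f
    rw [rTensor, lTensor, map_map_eq, map_map_eq, h2]
    rfl
  rw [barIns_apply, barTail_cons, h3, h3, ← barLam_word RelDGA.sgn_bicolinear, barAct_unit,
    ← barTail_colinear ht]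
  rfl

end Insertion

section Contraction

variable {k O : Type u} [Field k] [AddCommGroup O] [Module k O] [Coalgebra k O] {A : RelDGA k O}

namespace RelDGA

variable (A) in
/-- The projection to the part of nonzero degree. -/
def pos : A →ₗ[k] A := LinearMap.id - A.proj 0

theorem proj_bicolinear (n : ℤ) : A.Bicolinear (A.proj n) := dOp_bicolinear _

theorem pos_bicolinear : A.Bicolinear A.pos := Bicolinear.id.sub (proj_bicolinear 0)

theorem pos_apply (x : A) : A.pos x = x - A.proj 0 x := rfl

theorem dOp_dOp_comm (a b : ℤ → k) (x : A) : A.dOp a (A.dOp b x) = A.dOp b (A.dOp a x) := by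
  rw [dOp_comp, dOp_comp, mul_comm]

theorem dOp_pos (a : ℤ → k) (x : A) : A.dOp a (A.pos x) = A.pos (A.dOp a x) := by
  rw [pos_apply, pos_apply, map_sub, proj, dOp_dOp_comm]

theorem proj_proj (n : ℤ) (x : A) : A.proj n (A.proj n x) = A.proj n x :=
  proj_of_mem (proj_mem n x)

theorem proj_pos (x : A) : A.proj 0 (A.pos x) = 0 := by
  rw [pos_apply, map_sub, proj_proj, sub_self]

theorem proj_sgn (n : ℤ) (x : A) : A.proj n (A.sgn x) = A.sgn (A.proj n x) := by
  rw [sgn_eq_wt]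
  exact dOp_dOp_comm _ _ _

theorem pos_sgn (x : A) : A.sgn (A.pos x) = A.pos (A.sgn x) := by
  rw [sgn_eq_wt]
  exact dOp_pos _ _

theorem sgn_proj_zero (x : A) : A.sgn (A.proj 0 x) = A.proj 0 x := by
  rw [sgn_apply (proj_mem 0 x)]
  simp

theorem proj_unit (f : O) : A.proj 0 (A.unit f) = A.unit f := proj_of_mem (A.unit_deg f)

theorem pos_unit (f : O) : A.pos (A.unit f) = 0 := by rw [pos_apply, proj_unit, sub_self]

theorem proj_d (n : ℤ) (x : A) : A.proj (n + 1) (A.d x) = A.d (A.proj n x) := by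
  suffices h : A.proj (n + 1) ∘ₗ A.d = A.d ∘ₗ A.proj n from LinearMap.congr_fun h x
  refine graded_ext A.internal fun m y hy => ?_
  rw [comp_apply, comp_apply]
  by_cases h : m = n
  · subst h
    rw [proj_of_mem hy, proj_of_mem (A.d_deg m y hy)]
  · rw [proj_of_ne h hy, map_zero, proj_of_ne (fun e => h (by omega)) (A.d_deg m y hy)]

/-- The component of degree `n` of a product `a b`, for `a` of degree `p`. -/
theorem proj_mul (p n : ℤ) {t : A ⊗[k] A} (ht : t ∈ A.cot) :
    A.proj n (A.m (rTensor A (A.proj p) t)) =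
      A.m (map (A.proj p) (A.proj (n - p)) t) := by
  have hs : ∃ S : Finset ℤ, n - p ∈ S ∧ ∑ q ∈ S, lTensor A (A.proj q) t = t := by
    obtain ⟨S, hS⟩ := exists_sum_proj (TensorProduct.comm k A A t)
    refine ⟨insert (n - p) S, Finset.mem_insert_self _ _, ?_⟩
    have h := congrArg (TensorProduct.comm k A A) (hS _ (Finset.subset_insert (n - p) S))
    rw [map_sum] at h
    have e : ∀ z : A ⊗[k] A, TensorProduct.comm k A A (TensorProduct.comm k A A z) = z :=
      fun z => (TensorProduct.comm k A A).symm_apply_apply z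
    rw [e] at h
    refine Eq.trans (Finset.sum_congr rfl fun q _ => ?_) h
    generalize t = z
    induction z with
    | zero => simp
    | add x y hx hy => simp only [map_add, hx, hy]
    | tmul x y => simp
  obtain ⟨S, hn, hS⟩ := hs
  have h1 : ∀ q, A.proj n (A.m (map (A.proj p) (A.proj q) t)) =
      if q = n - p then A.m (map (A.proj p) (A.proj q) t) else 0 := by
    intro q
    have h2 : A.m (map (A.proj p) (A.proj q) t) ∈ A.deg (p + q) :=
      A.mul_deg p q _ (cot_map (proj_bicolinear p) (proj_bicolinear q) ht)
        (subTensor_map (P := ⊤) (Q := ⊤) (fun x _ => proj_mem p x) (fun x _ => proj_mem q x)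
          (mem_subTensor_top t))
    split_ifs with h
    · have : p + q = n := by omega
      rw [this] at h2
      exact proj_of_mem h2
    · exact proj_of_ne (by omega) h2
  conv_lhs => rw [← hS]
  have h3 : ∀ q, rTensor A (A.proj p) (lTensor A (A.proj q) t) =
      map (A.proj p) (A.proj q) t := by
    intro q
    rw [rTensor, lTensor, map_map_eq]
    rfl
  simp only [map_sum, h3, h1]
  rw [Finset.sum_ite_eq' S (n - p), if_pos hn]

theorem Augmentation.char_proj (ε : A.Augmentation) (x : A) : ε.char (A.proj 0 x) = ε.char x := by
  suffices h : ε.char ∘ₗ A.proj 0 = ε.char from LinearMap.congr_fun h x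
  refine graded_ext A.internal fun n y hy => ?_
  rw [comp_apply]
  by_cases h : n = 0
  · subst h
    rw [proj_of_mem hy]
  · have : ε.char y = 0 := by
      simp [Augmentation.char, Augmentation.right, ε.map_deg n h y hy]
    rw [proj_of_ne h hy, map_zero, this]

theorem Augmentation.left_proj (ε : A.Augmentation) (x : A) : ε.left (A.proj 0 x) = ε.left x := by
  suffices h : ε.left ∘ₗ A.proj 0 = ε.left from LinearMap.congr_fun h x
  refine graded_ext A.internal fun n y hy => ?_
  rw [comp_apply]
  by_cases h : n = 0
  · subst h
    rw [proj_of_mem hy]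
  · have : ε.left y = 0 := by
      simp [Augmentation.left, ε.map_deg n h y hy]
    rw [proj_of_ne h hy, map_zero, this]

namespace Retract

variable (R : A.Retract)

theorem proj_eq_zero {n : ℤ} (hn : n < 0) {x : A} (hx : x ∈ R.B) : A.proj n x = 0 :=
  R.eq_zero n hn _ (R.dOp_mem _ _ hx) (proj_mem n x)

theorem exists_unit_proj {x : A} (hx : x ∈ R.B) : ∃ f, A.unit f = A.proj 0 x :=
  R.exists_unit _ (R.dOp_mem _ _ hx) (proj_mem 0 x)

theorem proj_d_eq_zero {x : A} (hx : x ∈ R.B) : A.proj 0 (A.d x) = 0 := by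
  have := proj_d (-1) x
  rw [neg_add_cancel] at this
  rw [this, R.proj_eq_zero (by omega) hx, map_zero]

theorem d_proj_eq_zero {x : A} (hx : x ∈ R.B) : A.d (A.proj 0 x) = 0 := by
  obtain ⟨f, hf⟩ := R.exists_unit_proj hx
  rw [← hf]
  exact LinearMap.congr_fun A.unit_d f

/-- The elements of positive degree of the rigid subalgebra. -/
def Bpos : Submodule k A := R.B ⊓ LinearMap.ker (A.proj 0)

theorem pos_mem {x : A} (hx : x ∈ R.B) : A.pos x ∈ R.Bpos :=
  ⟨sub_mem hx (R.dOp_mem _ _ hx), proj_pos x⟩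

theorem pos_of_mem {x : A} (hx : x ∈ R.Bpos) : A.pos x = x := by
  have h : A.proj 0 x = 0 := hx.2
  rw [pos_apply, h, sub_zero]

theorem char_eq_zero (ε : A.Augmentation) {x : A} (hx : x ∈ R.Bpos) : ε.char x = 0 := by
  have h : A.proj 0 x = 0 := hx.2
  rw [← ε.char_proj, h, map_zero]

theorem left_eq_zero (ε : A.Augmentation) {x : A} (hx : x ∈ R.Bpos) : ε.left x = 0 := by
  have h : A.proj 0 x = 0 := hx.2
  rw [← ε.left_proj, h, map_zero]

theorem sgn_mem_Bpos {x : A} (hx : x ∈ R.Bpos) : A.sgn x ∈ R.Bpos := by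
  have h : A.proj 0 x = 0 := hx.2
  refine ⟨by rw [sgn_eq_wt]; exact R.dOp_mem _ _ hx.1, ?_⟩
  exact (proj_sgn 0 x).trans (by rw [h, map_zero])

/-- A product has degree zero in the rigid subalgebra only if both factors do, as there are no
negative degrees. -/
theorem proj_mul_eq_zero {t : A ⊗[k] A} (ht : t ∈ A.cot) (h : t ∈ subTensor R.Bpos R.B) :
    A.proj 0 (A.m t) = 0 := by
  obtain ⟨S, hS⟩ := exists_sum_proj t
  conv_lhs => rw [← hS S subset_rfl]
  rw [map_sum, map_sum]
  refine Finset.sum_eq_zero fun p _ => ?_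
  rw [proj_mul p 0 ht]
  have : map (A.proj p) (A.proj (0 - p)) t = 0 := by
    refine eq_on_subTensor (G := (0 : A ⊗[k] A →ₗ[k] A ⊗[k] A)) (fun x hx y hy => ?_) h
    rw [map_tmul, LinearMap.zero_apply]
    rcases lt_trichotomy p 0 with hp | hp | hp
    · rw [R.proj_eq_zero hp hx.1, zero_tmul]
    · subst hp
      have h0 : A.proj 0 x = 0 := hx.2
      rw [h0, zero_tmul]
    · rw [R.proj_eq_zero (n := 0 - p) (by omega) hy, tmul_zero]
  rw [this, map_zero]

end Retract

end RelDGA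

end Contraction

/-! ### Contraction onto the words without letters of degree zero -/

section Splitting

variable {k O : Type u} [Field k] [AddCommGroup O] [Module k O] [Coalgebra k O] {A : RelDGA k O}

variable (A) in
/-- The contraction of the bar complex of the rigid subalgebra onto the words without letters of
degree zero: it doubles a letter of degree zero, which is to say one in the image of `O`. -/
def barSplit : BarTot A →ₗ[k] BarTot A :=
  barRec 0 (-(barCons A ∘ₗ rTensor (BarTot A) (A.sgn ∘ₗ A.pos)))
    (barIns A ∘ₗ barCons A ∘ₗ map (A.proj 0) (barWord A A.sgn))

theorem barSplit_zero (f : O) : barSplit A (barZero A f) = 0 := barRec_zero _ _ _ _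

theorem barSplit_cons (x : A ⊗[k] BarTot A) : barSplit A (barCons A x) =
    barIns A (barCons A (map (A.proj 0) (barWord A A.sgn) x)) -
      barCons A (map (A.sgn ∘ₗ A.pos) (barSplit A) x) := by
  have h := barRec_cons (A := A) 0
    (-(barCons A ∘ₗ rTensor (BarTot A) (A.sgn ∘ₗ A.pos)))
    (barIns A ∘ₗ barCons A ∘ₗ map (A.proj 0) (barWord A A.sgn)) x
  refine h.trans ?_
  rw [LinearMap.neg_apply, comp_apply, comp_apply, comp_apply,
    rTensor, lTensor, map_map_eq, neg_add_eq_sub]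
  rfl

theorem barUncons_ins (t : BarTot A) :
    barUncons A (barIns A t) = rTensor (BarTot A) A.unit (barLam A t) :=
  barUncons_cons _

theorem barSplit_ins (t : BarTot A) :
    barSplit A (barIns A t) = barIns A (barIns A (barWord A A.sgn t)) := by
  have h1 : A.proj 0 ∘ₗ A.unit = A.unit := LinearMap.ext RelDGA.proj_unit
  have h2 : (A.sgn ∘ₗ A.pos) ∘ₗ A.unit = 0 :=
    LinearMap.ext fun f => (congrArg A.sgn (RelDGA.pos_unit f)).trans (map_zero _)
  rw [barIns_apply, barSplit_cons, rTensor, map_map_eq, map_map_eq, h1, h2,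
    TensorProduct.map_zero_left, LinearMap.zero_apply, map_zero, sub_zero,
    barIns_apply (barWord A A.sgn t), barLam_word RelDGA.sgn_bicolinear, rTensor,
    lTensor, map_map_eq]
  rfl

theorem barSplit_colinear (y : BarTot A) :
    barLam A (barSplit A y) = lTensor O (barSplit A) (barLam A y) := by
  obtain ⟨f, x, rfl⟩ := bar_cases y
  have h0 : barSplit A ∘ₗ barZero A = 0 := LinearMap.ext barSplit_zero
  have h1 : barSplit A ∘ₗ barCons A =
      barIns A ∘ₗ barCons A ∘ₗ map (A.proj 0) (barWord A A.sgn) -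
      barCons A ∘ₗ map (A.sgn ∘ₗ A.pos) (barSplit A) := LinearMap.ext barSplit_cons
  rw [map_add, map_add, map_add, map_add, barSplit_zero, barLam_zero, barLam_cons,
    ← lTensor_comp_apply, ← lTensor_comp_apply, h0, h1, barSplit_cons, map_sub,
    barIns_colinear, barLam_cons, barLam_cons, coactLeft_map (RelDGA.proj_bicolinear 0).left,
    coactLeft_map (RelDGA.sgn_bicolinear.comp RelDGA.pos_bicolinear).left]
  simp only [LinearMap.lTensor_sub, lTensor_comp_apply, LinearMap.sub_apply,
    LinearMap.lTensor_zero, LinearMap.zero_apply, map_zero]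

theorem barSplit_mem {x : BarTot A} (hx : x ∈ barTotSub A) : barSplit A x ∈ barTotSub A := by
  refine barTotSub_induction ((barTotSub A).comap (barSplit A)) (fun f => ?_)
    (fun x hx hx' => ?_) hx
  · rw [mem_comap, barSplit_zero]
    exact zero_mem _
  · rw [mem_comap, barSplit_cons]
    have hx'' := subTensor_mono le_rfl inf_le_right hx'
    refine sub_mem (barIns_mem (barCons_mem_iff.2
      ⟨map_word_mem_barCot (RelDGA.proj_bicolinear 0) RelDGA.sgn_bicolinear hx,
        map_mem_top_sub (fun y hy => barWord_mem RelDGA.sgn_bicolinear hy) hx''⟩))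
      (barCons_mem_iff.2 ⟨map_mem_barCot (RelDGA.sgn_bicolinear.comp RelDGA.pos_bicolinear)
        (fun y _ => barSplit_colinear y) hx hx'', ?_⟩)
    exact subTensor_map (P := ⊤) (P' := ⊤) (fun _ _ => trivial)
      (fun y hy => (Submodule.mem_inf.1 hy).1) hx'

theorem barWord_split {γ : A →ₗ[k] A} (hγ : A.Bicolinear γ) {c : k}
    (hu : ∀ f, γ (A.unit f) = c • A.unit f) (hp : ∀ x, γ (A.proj 0 x) = A.proj 0 (γ x))
    (hs : ∀ x, γ (A.sgn x) = A.sgn (γ x)) (hc : ∀ x, γ (A.pos x) = A.pos (γ x)) (x : BarTot A) :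
    barWord A γ (barSplit A x) = c • barSplit A (barWord A γ x) := by
  suffices h : barWord A γ ∘ₗ barSplit A = c • (barSplit A ∘ₗ barWord A γ) from
    LinearMap.congr_fun h x
  refine barTot_ext (fun f => ?_) (fun a t ih => ?_)
  · simp [barSplit_zero, barWord_zero]
  · rw [comp_apply, LinearMap.smul_apply, comp_apply] at ih ⊢
    rw [barSplit_cons, barWord_cons, barSplit_cons, map_sub, barWord_ins hγ hu, barWord_cons,
      barWord_cons, smul_sub]
    simp only [map_tmul, comp_apply]
    rw [hp, hs, hc, ih, barWord_comm hs, TensorProduct.tmul_smul, map_smul]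

theorem barSplit_sgn (x : BarTot A) :
    barWord A A.sgn (barSplit A x) = barSplit A (barWord A A.sgn x) := by
  rw [barWord_split RelDGA.sgn_bicolinear (c := 1) (fun f => by rw [RelDGA.sgn_unit, one_smul])
    (fun x => (RelDGA.proj_sgn 0 x).symm) (fun _ => rfl) RelDGA.pos_sgn, one_smul]

theorem barSplit_mem_barPart [CharZero k] {i : ℤ} {x : BarTot A} (hx : x ∈ barPart A i) :
    barSplit A x ∈ barPart A (i - 1) := by
  rw [mem_barPart] at *
  refine ⟨barSplit_mem hx.1, ?_⟩
  have h2 : (2 : k) ≠ 0 := two_ne_zero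
  have := barWord_split (smul_wt_bicolinear (A := A) (2 : k)) (c := (2 : k)⁻¹)
    (fun f => by rw [LinearMap.smul_apply, RelDGA.wt_unit])
    (fun x => by
      rw [LinearMap.smul_apply, LinearMap.smul_apply, map_smul]
      exact congrArg _ (RelDGA.dOp_dOp_comm _ _ x))
    (fun x => by rw [LinearMap.smul_apply, LinearMap.smul_apply, RelDGA.wt_sgn, map_smul])
    (fun x => by
      rw [LinearMap.smul_apply, LinearMap.smul_apply, map_smul]
      exact congrArg _ (RelDGA.dOp_pos _ x)) x
  refine this.trans ?_
  change (2 : k)⁻¹ • barSplit A (barWt A 2 x) = _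
  rw [hx.2, map_smul, smul_smul, zpow_sub_one₀ h2, mul_comm]

namespace RelDGA.Retract

variable (R : A.Retract)

/-- The induction principle for the bar complex of the rigid subalgebra. -/
theorem sub_induction (K : Submodule k (BarTot A)) (h0 : ∀ f, barZero A f ∈ K)
    (h1 : ∀ x ∈ barCot A, x ∈ subTensor R.B (K ⊓ R.sub) → barCons A x ∈ K) {x : BarTot A}
    (hx : x ∈ R.sub) : x ∈ K := by
  have h := barTotSub_induction (K.comap (barWord A R.p)) (fun f => ?_) (fun x hx hx' => ?_)
    (R.mem_sub.1 hx).1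
  · rwa [mem_comap, (R.mem_sub.1 hx).2] at h
  · rw [mem_comap, barWord_zero]
    exact h0 f
  · rw [mem_comap, barWord_cons]
    refine h1 _ (map_word_mem_barCot R.p_bicolinear R.p_bicolinear hx) ?_
    exact subTensor_map (P := ⊤) (fun a _ => R.p_mem a)
      (fun y hy => Submodule.mem_inf.2
        ⟨(Submodule.mem_inf.1 hy).1, R.word_p_mem (Submodule.mem_inf.1 hy).2⟩) hx'

theorem uncons_mem {y : BarTot A} (hy : y ∈ R.sub) :
    barUncons A y ∈ barCot A ∧ barUncons A y ∈ subTensor R.B R.sub := by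
  obtain ⟨h1, h2⟩ := R.mem_sub.1 hy
  refine ⟨(barUncons_mem h1).1, ?_⟩
  rw [← h2, barUncons_word]
  exact subTensor_map (P := ⊤) (fun a _ => R.p_mem a) (fun t ht => R.word_p_mem ht)
    (barUncons_mem h1).2

theorem sub_le : R.sub ≤ barTotSub A := inf_le_left

theorem word_sgn_mem {x : BarTot A} (hx : x ∈ R.sub) : barWord A A.sgn x ∈ R.sub := by
  obtain ⟨h1, h2⟩ := R.mem_sub.1 hx
  refine R.mem_sub.2 ⟨barWord_mem sgn_bicolinear h1, ?_⟩
  rw [← barWord_comm R.p_sgn, h2]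

theorem der_split_word (x : BarTot A) :
    barDer A A.d A.sgn (barSplit A (barWord A R.p x)) +
      barSplit A (barDer A A.d A.sgn (barWord A R.p x)) = 0 := by
  suffices h : barDer A A.d A.sgn ∘ₗ barSplit A ∘ₗ barWord A R.p +
      barSplit A ∘ₗ barDer A A.d A.sgn ∘ₗ barWord A R.p = 0 from LinearMap.congr_fun h x
  refine barTot_ext (fun f => ?_) (fun a t ih => ?_)
  · simp [barSplit_zero, barWord_zero, barDer_zero]
  · simp only [LinearMap.add_apply, comp_apply, LinearMap.zero_apply] at ih ⊢
    have e1 := R.proj_d_eq_zero (R.p_mem a)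
    have e2 := R.d_proj_eq_zero (R.p_mem a)
    have e3 : A.d (A.sgn (A.pos (R.p a))) = -A.sgn (A.pos (A.d (R.p a))) := by
      rw [pos_apply, pos_apply, e1, sub_zero, sgn_d, neg_neg, map_sub, map_sub, sgn_proj_zero, e2,
        sub_zero]
    have e4 := eq_neg_of_add_eq_zero_right ih
    have e5 : A.sgn (A.pos (A.sgn (R.p a))) = A.pos (R.p a) := by rw [← pos_sgn, sgn_sgn]
    simp only [barWord_cons, map_tmul, barDer_cons, barSplit_cons, map_add, map_sub,
      rTensor_tmul, comp_apply, barDer_ins, sgn_proj_zero, e2, e3, e4, e1,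
      proj_sgn, e5, sgn_sgn, barSgn_der, zero_tmul, neg_tmul,
      TensorProduct.tmul_neg, map_neg, map_zero]
    abel

/-- The differential of `A` neither starts nor ends in degree zero on the rigid subalgebra, where
`d` vanishes on `B^0` and `B^(-1) = 0`. Hence the inner differential commutes with doubling a letter
of degree zero up to sign. -/
theorem der_split {x : BarTot A} (hx : x ∈ R.sub) : barDer A A.d A.sgn (barSplit A x) +
    barSplit A (barDer A A.d A.sgn x) = 0 := by
  rw [← (R.mem_sub.1 hx).2, R.der_split_word]

variable {ε : A.Augmentation}

/-- Elements of the cotensor product whose first letter lies in the image of `O`. -/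
theorem rTensor_proj {x : A ⊗[k] BarTot A} (hx : x ∈ barCot A) (hx' : x ∈ subTensor R.B ⊤) :
    rTensor (BarTot A) (A.proj 0) x =
      rTensor (BarTot A) A.unit (barLam A (sliceL (BarTot A) ε.char x)) := by
  obtain ⟨g, hg⟩ := A.unit.exists_leftInverse_of_injective
    (LinearMap.ker_eq_bot.2 R.unit_injective)
  have hg' : ∀ f, g (A.unit f) = f := LinearMap.congr_fun hg
  have hcot : rTensor (BarTot A) (A.proj 0) x ∈ barCot A :=
    map_mem_cotensor (proj_bicolinear 0).right (f := LinearMap.id) (Q := ⊤)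
      (fun y _ => by simp) hx (subTensor_mono le_top le_rfl hx')
  set z : O ⊗[k] BarTot A := rTensor (BarTot A) g
    (rTensor (BarTot A) (A.proj 0) x) with hz
  have h1 : rTensor (BarTot A) A.unit z = rTensor (BarTot A) (A.proj 0) x := by
    rw [hz, ← rTensor_comp_apply, ← rTensor_comp_apply]
    refine eq_on_subTensor (F := rTensor (BarTot A) ((A.unit ∘ₗ g) ∘ₗ A.proj 0))
      (G := rTensor (BarTot A) (A.proj 0)) (fun a ha t _ => ?_) hx'
    obtain ⟨f, hf⟩ := R.exists_unit_proj ha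
    rw [rTensor_tmul, rTensor_tmul, comp_apply,
      comp_apply, ← hf, hg']
  have h2 : coactLeft comul (BarTot A) z = lTensor O (barLam A) z := by
    apply rTensor_injective R.unit_injective
    rw [← rTensor_unit_coactMid, h1, mem_cotensor.1 hcot, ← h1, rTensor_lTensor]
  have h3 := sliceL_coactLeft (comul_isLeftCoaction k O) z
  rw [h2, sliceL_lTensor] at h3
  rw [← h1, ← h3]
  congr 2
  rw [hz, ← rTensor_comp_apply]
  refine (sliceL_map _ LinearMap.id _ x).trans ?_
  rw [LinearMap.id_apply]
  refine eq_on_subTensor (F := sliceL (BarTot A) (counit ∘ₗ g ∘ₗ A.proj 0))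
    (G := sliceL (BarTot A) ε.char) (fun a ha t _ => ?_) hx'
  obtain ⟨f, hf⟩ := R.exists_unit_proj ha
  rw [sliceL_tmul, sliceL_tmul, comp_apply, comp_apply, ← ε.char_proj a, ← hf,
    hg', ε.char_unit]

theorem cons_map_proj {x : A ⊗[k] BarTot A} (hx : x ∈ barCot A) (hx' : x ∈ subTensor R.B ⊤) :
    barCons A (map (A.proj 0) (barWord A A.sgn) x) =
      barIns A (barHead ε (barCons A x)) := by
  have h : map (A.proj 0) (barWord A A.sgn) x = lTensor A
      (barWord A A.sgn) (rTensor (BarTot A) (A.proj 0) x) := by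
    rw [rTensor, lTensor, map_map_eq]
    rfl
  rw [h, R.rTensor_proj (ε := ε) hx hx', barHead_cons, barIns_apply,
    barLam_word sgn_bicolinear, rTensor_lTensor]

theorem split_cons {x : A ⊗[k] BarTot A} (hx : x ∈ barCot A) (hx' : x ∈ subTensor R.B ⊤) :
    barSplit A (barCons A x) = barIns A (barIns A (barHead ε (barCons A x))) -
      barCons A (map (A.sgn ∘ₗ A.pos) (barSplit A) x) := by
  rw [barSplit_cons, R.cons_map_proj (ε := ε) hx hx']

theorem head_split {y : BarTot A} (hy : y ∈ R.sub) :
    barHead ε (barSplit A y) = barIns A (barWord A A.sgn (barHead ε y)) := by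
  obtain ⟨h1, h2⟩ := R.uncons_mem hy
  have h3 : ε.char ∘ₗ A.sgn ∘ₗ A.pos = 0 := by
    refine LinearMap.ext fun a => ?_
    rw [comp_apply, comp_apply, ε.char_sgn, pos_apply, map_sub, ε.char_proj,
      sub_self]
    rfl
  rw [← bar_decomp y, map_add, map_add, map_add, barSplit_zero,
    R.split_cons (ε := ε) h1 (subTensor_mono le_rfl le_top h2), map_zero, zero_add, map_sub,
    barHead_ins, barHead_cons _ (map _ _ _), sliceL_map, h3, barHead_zero, zero_add,
    barWord_sgn_ins]
  simp [sliceL]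

theorem head_colinear {c : BarTot A} (hc : c ∈ R.sub) :
    barLam A (barHead ε c) = lTensor O (barHead ε) (barLam A c) := by
  obtain ⟨h1, h2⟩ := R.uncons_mem hc
  have h3 := R.rTensor_proj (ε := ε) h1 (subTensor_mono le_rfl le_top h2)
  set x := barUncons A c with hx
  set e := sliceL (BarTot A) ε.char x with he
  have h4 : barHead ε ∘ₗ barCons A =
      (barHead ε ∘ₗ barCons A) ∘ₗ rTensor (BarTot A) (A.proj 0) := by
    refine TensorProduct.ext' fun a t => ?_
    simp only [comp_apply, rTensor_tmul, barHead_cons, sliceL_tmul,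
      ε.char_proj]
  have h5 : barHead ε ∘ₗ barZero A = 0 := LinearMap.ext fun f => barHead_zero ε f
  have h6 : barHead ε ∘ₗ barIns A = barWord A A.sgn := LinearMap.ext fun f => barHead_ins ε f
  have h7 : coactLeft A.coactL (BarTot A) (rTensor (BarTot A) (A.proj 0) x) =
      lTensor O (rTensor (BarTot A) (A.proj 0))
        (coactLeft A.coactL (BarTot A) x) := coactLeft_map (proj_bicolinear 0).left LinearMap.id x
  have h8 : barHead ε c = barWord A A.sgn e := by
    conv_lhs => rw [← bar_decomp c, map_add, barHead_zero, zero_add, barHead_cons]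
  have h9 : lTensor O (barHead ε) (barLam A c) =
      lTensor O (barHead ε) (barLam A (barIns A e)) := by
    conv_lhs => rw [← bar_decomp c, map_add, map_add, barLam_zero, barLam_cons, ← hx,
      ← lTensor_comp_apply, ← lTensor_comp_apply, h5, h4,
      lTensor_comp_apply, ← h7, h3, lTensor_comp_apply]
    rw [barIns_apply, barLam_cons]
    simp
  rw [h8, h9, barIns_colinear, ← lTensor_comp_apply, h6, barLam_word sgn_bicolinear]

theorem map_split_uncons {c : BarTot A} (hc : c ∈ R.sub) :
    map A.sgn (barSplit A) (barUncons A c) =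
      rTensor (BarTot A) A.unit (barLam A (barIns A (barHead ε c) +
        barSplit A (barWord A A.sgn (barHead ε c)))) - barUncons A (barSplit A c) := by
  obtain ⟨h1, h2⟩ := R.uncons_mem hc
  have h2' := subTensor_mono (le_refl R.B) (le_top (a := R.sub)) h2
  have hE : barHead ε c = barHead ε (barCons A (barUncons A c)) := by
    conv_lhs => rw [← bar_decomp c, map_add, barHead_zero, zero_add]
  have hQ : barUncons A (barSplit A c) = rTensor (BarTot A) A.unit
      (barLam A (barIns A (barHead ε c))) -
      map (A.sgn ∘ₗ A.pos) (barSplit A) (barUncons A c) := by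
    have h : barSplit A c = barSplit A (barCons A (barUncons A c)) := by
      conv_lhs => rw [← bar_decomp c, map_add, barSplit_zero, zero_add]
    rw [h, R.split_cons (ε := ε) h1 h2', map_sub, barUncons_ins, barUncons_cons, hE]
  have h3 : A.sgn = A.sgn ∘ₗ A.pos + A.proj 0 := by
    refine LinearMap.ext fun a => ?_
    rw [LinearMap.add_apply, comp_apply, pos_apply, map_sub, sgn_proj_zero,
      sub_add_cancel]
  have h4 : map (A.proj 0) (barSplit A) (barUncons A c) =
      rTensor (BarTot A) A.unit
        (barLam A (barSplit A (barWord A A.sgn (barHead ε c)))) := by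
    have h : map (A.proj 0) (barSplit A) (barUncons A c) = lTensor A
        (barSplit A) (rTensor (BarTot A) (A.proj 0) (barUncons A c)) := by
      rw [rTensor, lTensor, map_map_eq]
      rfl
    rw [h, R.rTensor_proj (ε := ε) h1 h2', hE, barHead_cons, barWord_sgn_sgn, barSplit_colinear,
      rTensor_lTensor]
  conv_lhs => rw [h3]
  rw [TensorProduct.map_add_left, LinearMap.add_apply, h4, hQ, map_add, map_add]
  abel

theorem split_cons_pos {y : A ⊗[k] BarTot A} (hy : y ∈ subTensor R.Bpos ⊤) :
    barSplit A (barCons A y) = -barCons A (map A.sgn (barSplit A) y) := by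
  have h1 : map (A.proj 0) (barWord A A.sgn) y = 0 :=
    eq_on_subTensor (G := (0 : A ⊗[k] BarTot A →ₗ[k] A ⊗[k] BarTot A)) (fun a ha t _ => by
      have h : A.proj 0 a = 0 := ha.2
      rw [map_tmul, h, zero_tmul]
      rfl) hy
  have h2 : map (A.sgn ∘ₗ A.pos) (barSplit A) y =
      map A.sgn (barSplit A) y :=
    map_eq_on_subTensor (fun a ha => by rw [comp_apply, R.pos_of_mem ha])
      (fun _ _ => rfl) hy
  rw [barSplit_cons, h1, h2]
  simp

theorem head_cons_pos {y : A ⊗[k] BarTot A} (hy : y ∈ subTensor R.Bpos ⊤) :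
    barHead ε (barCons A y) = 0 := by
  have : sliceL (BarTot A) ε.char y = 0 :=
    eq_on_subTensor (G := (0 : A ⊗[k] BarTot A →ₗ[k] BarTot A)) (fun a ha t _ => by
      rw [sliceL_tmul, R.char_eq_zero ε ha, zero_smul]
      rfl) hy
  rw [barHead_cons, this, map_zero]

theorem act_pos {y : A ⊗[k] BarTot A} (hy : y ∈ subTensor R.Bpos ⊤) :
    barAct ε y = barCons A (mulTensor A.m (BarTot A) (lTensor A (barUncons A) y)) := by
  rw [barAct_apply, R.left_eq_zero ε (slice_mem hy _), map_zero, zero_add]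

theorem rTensor_proj_mulTensor {y : A ⊗[k] BarTot A} (hy : y ∈ barCot A)
    (hy' : y ∈ subTensor R.Bpos R.sub) : rTensor (BarTot A) (A.proj 0)
      (mulTensor A.m (BarTot A) (lTensor A (barUncons A) y)) = 0 := by
  apply slice_sep
  intro φ
  have h : lTensor A (slice A φ) (lTensor A (barUncons A) y) ∈
      subTensor R.Bpos R.B := by
    rw [← lTensor_comp_apply]
    exact subTensor_map (f := LinearMap.id) (fun _ h => h)
      (fun c hc => slice_mem (R.uncons_mem hc).2 φ) hy'
  rw [slice_rTensor, slice_mulTensor,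
    R.proj_mul_eq_zero (slice_mem_cot A _ (lTensor_uncons_mem hy) φ) h, map_zero]

/-- Compatibility of `barSplit` with products whose first factor has positive degree, which cannot
create letters of degree zero. -/
theorem split_act {y : A ⊗[k] BarTot A} (hy : y ∈ barCot A) (hy' : y ∈ subTensor R.Bpos R.sub) :
    barSplit A (barAct ε y) = barAct ε (map A.sgn (barSplit A) y) -
      barCons A (map A.sgn (barIns A ∘ₗ barHead ε +
        barSplit A ∘ₗ barWord A A.sgn ∘ₗ barHead ε) y) := by
  set F : BarTot A →ₗ[k] BarTot A := barIns A ∘ₗ barHead ε +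
    barSplit A ∘ₗ barWord A A.sgn ∘ₗ barHead ε with hF
  have hz := lTensor_uncons_mem hy
  have h0 := R.rTensor_proj_mulTensor hy hy'
  have hy1 := subTensor_mono (le_refl R.Bpos) (le_top (a := R.sub)) hy'
  have hs : ∀ f : BarTot A →ₗ[k] BarTot A,
      map A.sgn f y ∈ subTensor R.Bpos ⊤ := fun f =>
    subTensor_map (Q' := ⊤) (fun a ha => R.sgn_mem_Bpos ha) (fun _ _ => trivial) hy'
  rw [R.act_pos hy1, R.act_pos (hs _), barSplit_cons]
  set w := mulTensor A.m (BarTot A) (lTensor A (barUncons A) y) with hw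
  have h1 : map (A.proj 0) (barWord A A.sgn) w = 0 := by
    have : map (A.proj 0) (barWord A A.sgn) w = lTensor A
        (barWord A A.sgn) (rTensor (BarTot A) (A.proj 0) w) := by
      rw [rTensor, lTensor, map_map_eq]
      rfl
    rw [this, h0, map_zero]
  have h2 : map (A.sgn ∘ₗ A.pos) (barSplit A) w =
      map A.sgn (barSplit A) w := by
    have : map (A.sgn ∘ₗ A.pos) (barSplit A) w = map A.sgn (barSplit A)
        (w - rTensor (BarTot A) (A.proj 0) w) := by
      generalize w = v
      induction v with
      | zero => simp
      | add x y hx hy =>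
        rw [map_add, hx, hy, ← map_add]
        congr 1
        rw [map_add]
        abel
      | tmul x y => simp [pos_apply, TensorProduct.sub_tmul]
    rw [this, h0, sub_zero]
  have h3 : map A.sgn (barSplit A) w =
      map A.sgn F y - mulTensor A.m (BarTot A) (lTensor A (barUncons A)
        (map A.sgn (barSplit A) y)) := by
    have hm := mulTensor_map (α := A.sgn) (c := 1)
      (fun t ht => by rw [one_smul]; exact sgn_mul ht) (barSplit A) hz
    rw [one_smul] at hm
    rw [hw, hm, map_lTensor_eq]
    have h4 : map A.sgn (map A.sgn (barSplit A) ∘ₗ barUncons A) y =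
        map A.sgn ((rTensor (BarTot A) A.unit ∘ₗ barLam A) ∘ₗ F -
          barUncons A ∘ₗ barSplit A) y :=
      map_eq_on_subTensor (fun _ _ => rfl) (fun c hc => R.map_split_uncons (ε := ε) hc) hy'
    have h5 : map A.sgn F y ∈ barCot A :=
      map_mem_cotensor sgn_bicolinear.right (Q := R.sub) (fun c hc => by
        rw [hF, LinearMap.add_apply, map_add, LinearMap.lTensor_add, LinearMap.add_apply]
        simp only [comp_apply, lTensor_comp_apply, barIns_colinear,
          barSplit_colinear, barLam_word sgn_bicolinear, R.head_colinear hc]) hy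
        (subTensor_mono le_top le_rfl hy')
    have h6 : map A.sgn ((rTensor (BarTot A) A.unit ∘ₗ barLam A) ∘ₗ F -
        barUncons A ∘ₗ barSplit A) y =
        lTensor A (rTensor (BarTot A) A.unit ∘ₗ barLam A)
          (map A.sgn F y) -
        lTensor A (barUncons A) (map A.sgn (barSplit A) y) := by
      generalize y = v
      induction v with
      | zero => simp
      | add x y hx hy =>
        simp only [map_add, hx, hy]
        abel
      | tmul x y => simp [TensorProduct.tmul_sub]
    rw [h4, h6, map_sub, mulTensor_unit_lam h5]
  rw [h1, h2, h3]
  simp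

/-- The homotopy formula for a word which begins with an inserted unit. -/
theorem split_homotopy_ins {t : BarTot A} (ht : t ∈ barTotSub A) :
    barTail ε (barSplit A (barIns A t)) + barHead ε (barSplit A (barIns A t)) +
      barSplit A (barTail ε (barIns A t)) + barSplit A (barHead ε (barIns A t)) =
      barIns A t - barWord A A.pos (barIns A t) := by
  have h1 : barWord A A.pos (barIns A t) = 0 := by
    rw [barWord_ins pos_bicolinear (c := 0) (fun f => by rw [pos_unit, zero_smul]), zero_smul]
  have hs := barWord_mem sgn_bicolinear ht
  rw [h1, barSplit_ins, barTail_ins ε (barIns_mem hs), barHead_ins, barTail_ins ε ht, barHead_ins,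
    barTail_ins ε hs, barWord_sgn_ins, barWord_sgn_sgn, map_sub, map_sub, map_neg, map_neg,
    barSplit_ins, barTail_sgn ht]
  abel

/-- The homotopy formula for a word whose first letter has positive degree, from the formula for the
rest. -/
theorem split_homotopy_cons {y : A ⊗[k] BarTot A} (hy : y ∈ barCot A) {K : Submodule k (BarTot A)}
    (hK : ∀ c ∈ K, barTail ε (barSplit A c) + barHead ε (barSplit A c) +
      barSplit A (barTail ε c) + barSplit A (barHead ε c) = c - barWord A A.pos c)
    (hy' : y ∈ subTensor R.Bpos (K ⊓ R.sub)) :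
    barTail ε (barSplit A (barCons A y)) + barHead ε (barSplit A (barCons A y)) +
      barSplit A (barTail ε (barCons A y)) + barSplit A (barHead ε (barCons A y)) =
      barCons A y - barWord A A.pos (barCons A y) := by
  have hy1 := subTensor_mono (le_refl R.Bpos) (inf_le_right (a := K) (b := R.sub)) hy'
  have htop : ∀ f : BarTot A →ₗ[k] BarTot A,
      map A.sgn f y ∈ subTensor R.Bpos ⊤ := fun f =>
    subTensor_map (Q' := ⊤) (fun a ha => R.sgn_mem_Bpos ha) (fun _ _ => trivial) hy'
  have hy2 : map A.sgn (barWord A A.sgn) y ∈ subTensor R.Bpos R.sub :=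
    subTensor_map (fun a ha => R.sgn_mem_Bpos ha) (fun c hc => R.word_sgn_mem hc) hy1
  have hs : A.sgn ∘ₗ A.sgn = LinearMap.id := LinearMap.ext sgn_sgn
  rw [R.head_cons_pos (subTensor_mono le_rfl le_top hy1),
    R.split_cons_pos (subTensor_mono le_rfl le_top hy1), map_neg, map_neg,
    R.head_cons_pos (htop _), barTail_cons, barTail_cons, map_sub, map_neg,
    R.split_act (map_word_mem_barCot sgn_bicolinear sgn_bicolinear hy) hy2,
    R.split_cons_pos (htop _), barWord_cons]
  simp only [map_map_eq, hs]
  have h1 : barWord A A.sgn ∘ₗ barSplit A = barSplit A ∘ₗ barWord A A.sgn :=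
    LinearMap.ext barSplit_sgn
  have h2 : map A.pos (barWord A A.pos) y =
      map LinearMap.id (barWord A A.pos) y :=
    map_eq_on_subTensor (fun a ha => R.pos_of_mem ha) (fun _ _ => rfl) hy1
  have h3 : map LinearMap.id (barTail ε ∘ₗ barSplit A) y +
      map LinearMap.id ((barIns A ∘ₗ barHead ε +
        barSplit A ∘ₗ barWord A A.sgn ∘ₗ barHead ε) ∘ₗ barWord A A.sgn) y +
      map LinearMap.id (barSplit A ∘ₗ barTail ε) y =
      y - map LinearMap.id (barWord A A.pos) y := by
    refine eq_on_subTensor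
      (F := map LinearMap.id (barTail ε ∘ₗ barSplit A) +
        map LinearMap.id ((barIns A ∘ₗ barHead ε +
        barSplit A ∘ₗ barWord A A.sgn ∘ₗ barHead ε) ∘ₗ barWord A A.sgn) +
        map LinearMap.id (barSplit A ∘ₗ barTail ε))
      (G := LinearMap.id - map LinearMap.id (barWord A A.pos))
      (fun a _ c hc => ?_) hy'
    simp only [LinearMap.add_apply, map_tmul, LinearMap.id_apply,
      comp_apply, LinearMap.sub_apply]
    rw [← tmul_add, ← tmul_add, ← TensorProduct.tmul_sub,
      ← hK c hc.1, barHead_sgn, barWord_sgn_sgn, R.head_split hc.2]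
    congr 1
    abel
  rw [h2, h1]
  rw [← map_sub, ← h3, map_add, map_add, map_zero]
  abel

theorem split_homotopy_aux {x : BarTot A} (hx : x ∈ R.sub) :
    barTail ε (barSplit A x) + barHead ε (barSplit A x) +
      barSplit A (barTail ε x) + barSplit A (barHead ε x) = x - barWord A A.pos x := by
  let K : Submodule k (BarTot A) := LinearMap.ker (barTail ε ∘ₗ barSplit A +
    barHead ε ∘ₗ barSplit A + barSplit A ∘ₗ barTail ε + barSplit A ∘ₗ barHead ε -
    (LinearMap.id - barWord A A.pos))
  have hK : ∀ c, c ∈ K ↔ barTail ε (barSplit A c) + barHead ε (barSplit A c) +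
      barSplit A (barTail ε c) + barSplit A (barHead ε c) = c - barWord A A.pos c :=
    fun c => LinearMap.mem_ker.trans sub_eq_zero
  refine (hK x).1 (R.sub_induction K (fun f => ?_) (fun x hx hx' => ?_) hx)
  · rw [hK, barSplit_zero, barTail_zero, barHead_zero, barWord_zero]
    simp
  · have h1 := R.rTensor_proj (ε := ε) hx (subTensor_mono le_rfl le_top hx')
    -- the parts with first letter of degree zero and of positive degree
    have h2 : x = rTensor (BarTot A) (A.proj 0) x +
        rTensor (BarTot A) A.pos x := by
      rw [← LinearMap.add_apply, ← LinearMap.rTensor_add, pos, add_sub_cancel]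
      simp
    rw [h2, map_add, h1]
    refine add_mem ((hK _).2 (split_homotopy_ins (R.sub_le ?_)))
      ((hK _).2 (R.split_homotopy_cons (K := K) ?_ (fun c hc => (hK c).1 hc) ?_))
    · exact sliceL_mem (subTensor_mono le_rfl inf_le_right hx') _
    · exact map_mem_cotensor pos_bicolinear.right (f := LinearMap.id) (Q := ⊤)
        (fun y _ => by simp) hx (mem_subTensor_top _)
    · exact subTensor_map (g := LinearMap.id) (fun a ha => R.pos_mem ha) (fun _ h => h) hx'

/-- `barSplit` contracts the bar complex of the rigid subalgebra onto the words with letters of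
positive degree. -/
theorem split_homotopy {x : BarTot A} (hx : x ∈ R.sub) :
    barD A ε (barSplit A x) + barSplit A (barD A ε x) = x - barWord A A.pos x := by
  rw [← R.split_homotopy_aux (ε := ε) hx, barD_eq, barD_eq, map_add, map_add]
  have := R.der_split hx
  rw [← sub_eq_zero, ← this]
  abel

end RelDGA.Retract

end Splitting

/-! ### The coalgebra of cohomology classes of degree zero -/

section InducedCoalgebra

variable {k X Q : Type u} [Field k] [AddCommGroup X] [Module k X] [AddCommGroup Q] [Module k Q]

theorem subTensor_inf_left {M N : Type u} [AddCommGroup M] [Module k M] [AddCommGroup N]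
    [Module k N] {P P' : Submodule k M} {t : M ⊗[k] N} (h : t ∈ subTensor P ⊤)
    (h' : t ∈ subTensor P' ⊤) : t ∈ subTensor (P ⊓ P') ⊤ :=
  mem_subTensor_of_slice fun φ => ⟨slice_mem h φ, slice_mem h' φ⟩

theorem subTensor_inf_right {M N : Type u} [AddCommGroup M] [Module k M] [AddCommGroup N]
    [Module k N] {P P' : Submodule k N} {t : M ⊗[k] N} (h : t ∈ subTensor ⊤ P)
    (h' : t ∈ subTensor ⊤ P') : t ∈ subTensor ⊤ (P ⊓ P') :=
  mem_subTensor_of_sliceL fun φ => ⟨sliceL_mem h φ, sliceL_mem h' φ⟩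

/-- The coalgebra structure on a subspace that is stable under a coassociative and counitary
comultiplication. -/
theorem exists_coalgebra_of_injective (ι : Q →ₗ[k] X) (hι : Function.Injective ι)
    (Δ : X →ₗ[k] X ⊗[k] X) (η : X →ₗ[k] k)
    (hco : ∀ x, coactLeft Δ X (Δ x) = lTensor X Δ (Δ x))
    (hl : ∀ x, sliceL X η (Δ x) = x) (hr : ∀ x, slice X η (Δ x) = x)
    (hΔ : ∀ q, Δ (ι q) ∈ subTensor (LinearMap.range ι) (LinearMap.range ι)) :
    ∃ C : Coalgebra k Q, (∀ q, map ι ι (C.comul q) = Δ (ι q)) ∧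
      ∀ q, C.counit q = η (ι q) := by
  obtain ⟨r, hr'⟩ := ι.exists_leftInverse_of_injective (LinearMap.ker_eq_bot.2 hι)
  let c : Q →ₗ[k] Q ⊗[k] Q := map r r ∘ₗ Δ ∘ₗ ι
  have hc : ∀ q, map ι ι (c q) = Δ (ι q) := by
    intro q
    have h : ∀ x ∈ LinearMap.range ι, (ι ∘ₗ r) x = x := by
      rintro _ ⟨y, rfl⟩
      exact congrArg ι (LinearMap.congr_fun hr' y)
    have h2 := map_eq_on_subTensor (f' := LinearMap.id) (g' := LinearMap.id) h h (hΔ q)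
    rw [TensorProduct.map_id, LinearMap.id_apply, ← map_map_eq] at h2
    exact h2
  have h1 : (TensorProduct.assoc k Q Q Q).toLinearMap ∘ₗ rTensor Q c ∘ₗ c =
      lTensor Q c ∘ₗ c := by
    refine LinearMap.ext fun q => ?_
    apply map_injective hι (map_injective hι hι)
    have h1 := hco (ι q)
    rw [← hc] at h1
    refine Eq.trans ?_ (h1.trans ?_)
    · exact (coactLeft_map₂ (lam := c) (fun x => (hc x).symm) ι (c q)).symm
    · have h2 : map ι ι ∘ₗ c = Δ ∘ₗ ι := LinearMap.ext hc
      have h3 : map ι (map ι ι) (lTensor Q c (c q)) =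
          map ι (map ι ι ∘ₗ c) (c q) := map_map_eq _ _ _ _ _
      refine Eq.trans ?_ h3.symm
      rw [h2, lTensor, map_map_eq]
      rfl
  have h2 : rTensor Q (η ∘ₗ ι) ∘ₗ c = TensorProduct.mk k k Q 1 := by
    refine LinearMap.ext fun q => ?_
    apply (TensorProduct.lid k Q).injective
    apply hι
    have h1 := hl (ι q)
    rw [← hc, sliceL_map] at h1
    refine h1.trans ?_
    simp
  have h3 : lTensor Q (η ∘ₗ ι) ∘ₗ c = (TensorProduct.mk k Q k).flip 1 := by
    refine LinearMap.ext fun q => ?_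
    apply (TensorProduct.rid k Q).injective
    apply hι
    have h1 := hr (ι q)
    rw [← hc, slice_map] at h1
    refine h1.trans ?_
    simp
  let C : Coalgebra k Q :=
    { comul := c
      counit := η ∘ₗ ι
      coassoc := h1
      rTensor_counit_comp_comul := h2
      lTensor_counit_comp_comul := h3 }
  exact ⟨C, hc, fun q => rfl⟩

end InducedCoalgebra

section Core

variable {k O : Type u} [Field k] [AddCommGroup O] [Module k O] [Coalgebra k O] {A : RelDGA k O}

theorem barCounit_barD (ε : A.Augmentation) (y : BarTot A) : barCounit A (barD A ε y) = 0 := by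
  obtain ⟨f, x, rfl⟩ := bar_cases y
  rw [barD_eq, map_add, map_add, barCounit_der, map_add, map_add, map_add (barHead ε),
    barTail_zero, barHead_zero, barTail_cons, barHead_cons, map_zero, zero_add, zero_add, zero_add,
    barCounit_word, map_sub, map_neg,
    barCounit_cons, barCounit_act, sub_zero]
  have h : ε.char ∘ₗ slice A (barCounit A) ∘ₗ map A.sgn (barWord A A.sgn) =
      barCounit A ∘ₗ sliceL (BarTot A) ε.char := by
    refine TensorProduct.ext' fun a t => ?_
    simp only [comp_apply, map_tmul, slice_tmul, sliceL_tmul, map_smul,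
      barCounit_word, ε.char_sgn, smul_eq_mul]
    ring
  rw [neg_add_eq_zero]
  exact LinearMap.congr_fun h x

/-- The comultiplication of a coboundary is a coboundary of the tensor square. The degree of the
components of the comultiplication is read off from eigenvalues. -/
theorem comul_mem_barBB [CharZero k] {ε : A.Augmentation} {y : BarTot A}
    (hy : y ∈ barPart A (-1)) : barComul A (barD A ε y) ∈ barBB A ε := by
  have hy' := mem_barPart.1 hy
  have h1 : barComul A y ∈ ⨆ i : ℤ, ⨆ j : ℤ, subTensor (barPart A i) (barPart A j) := by
    have h2 := subTensor_mono barTotSub_le_iSup barTotSub_le_iSup (barComul_mem hy'.1)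
    refine subTensor_induction _ (fun a ha b hb => ?_) h2
    have h3 : ⨆ i, barPart A i ≤ (⨆ i : ℤ, ⨆ j : ℤ, subTensor (barPart A i) (barPart A j)).comap
        ((TensorProduct.mk k (BarTot A) (BarTot A)).flip b) := by
      refine iSup_le fun i a ha => ?_
      have h4 : ⨆ i, barPart A i ≤ (⨆ i : ℤ, ⨆ j : ℤ,
          subTensor (barPart A i) (barPart A j)).comap
          (TensorProduct.mk k (BarTot A) (BarTot A) a) :=
        iSup_le fun j b hb => mem_iSup_of_mem i (mem_iSup_of_mem j
          (tmul_mem_subTensor ha hb))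
      exact h4 hb
    exact h3 ha
  -- the elements of total degree `n`
  let V : ℤ → Submodule k (BarTot A ⊗[k] BarTot A) := fun n =>
    ⨆ i : ℤ, subTensor (barPart A i) (barPart A (n - i))
  have h2 : barComul A y ∈ V (-1) := by
    refine mem_of_eigenvector (map (barWt A 2) (barWt A 2)) V
      (fun n => (2 : k) ^ n) two_zpow_injective ?_ ?_ ?_
    · intro n x hx
      have : V n ≤ LinearMap.ker (map (barWt A 2) (barWt A 2) -
          (2 : k) ^ n • LinearMap.id) := by
        refine iSup_le fun i => Submodule.map₂_le.2 fun a ha b hb => ?_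
        rw [mem_ker, LinearMap.sub_apply, TensorProduct.mk_apply,
          map_tmul, (mem_barPart.1 ha).2, (mem_barPart.1 hb).2,
          TensorProduct.smul_tmul_smul, ← zpow_add₀ two_ne_zero, add_sub_cancel]
        exact sub_self _
      exact sub_eq_zero.1 (this hx)
    · refine (iSup_le fun i => iSup_le fun j => ?_ :
        ⨆ i : ℤ, ⨆ j : ℤ, subTensor (barPart A i) (barPart A j) ≤ ⨆ n, V n) h1
      refine le_trans ?_ (le_iSup V (i + j))
      refine le_trans ?_ (le_iSup _ i)
      rw [add_sub_cancel_left]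
    · have h := barComul_word (smul_wt_bicolinear (A := A) (2 : k)) (fun x => by
        rw [LinearMap.smul_apply, LinearMap.smul_apply, RelDGA.wt_sgn, map_smul]) y
      refine h.symm.trans ?_
      change barComul A (barWt A 2 y) = _
      rw [hy'.2, map_smul]
  rw [barComul_barD hy'.1]
  have h3 : V (-1) ≤ (barBB A ε).comap (rTensor (BarTot A) (barD A ε) +
      map (barTotSgn A) (barD A ε)) := by
    refine iSup_le fun i => Submodule.map₂_le.2 fun a ha b hb => ?_
    refine Submodule.subset_span ⟨i, a, ha, b, hb, ?_⟩
    have h4 : barTotSgn A a = ((i.negOnePow : ℤˣ) : ℤ) • a := by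
      have h5 := barWt_of_mem_barPart (A := A) (c := (-1 : k)) (by simp) ha
      have h6 : (-1 : k)⁻¹ • A.wt (-1) = -A.sgn := by
        rw [RelDGA.sgn_eq_wt, inv_neg, inv_one, neg_smul, one_smul]
      rw [barWt, h6] at h5
      refine h5.trans ?_
      rcases Int.even_or_odd i with h | h
      · rw [h.neg_one_zpow, Int.negOnePow_even _ h]
        simp
      · rw [h.neg_one_zpow, Int.negOnePow_odd _ h]
        simp
    rw [LinearMap.add_apply, TensorProduct.mk_apply, rTensor_tmul,
      map_tmul, h4, smul_tmul']
  exact h3 h2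

namespace RelDGA.Retract

variable (R : A.Retract)

/-- The projection of `A` to the part of degree one of the rigid subalgebra. -/
def lin : A →ₗ[k] A := R.p ∘ₗ A.proj 1

theorem lin_mem_deg (x : A) : R.lin x ∈ A.deg 1 := R.p_deg 1 _ (proj_mem 1 x)

theorem lin_mem (x : A) : R.lin x ∈ R.B := R.p_mem _

theorem lin_bicolinear : A.Bicolinear R.lin := R.p_bicolinear.comp (proj_bicolinear 1)

theorem lin_comp_lin : R.lin ∘ₗ R.lin = R.lin := by
  refine LinearMap.ext fun x => ?_
  change R.p (A.proj 1 (R.lin x)) = R.lin x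
  rw [proj_of_mem (R.lin_mem_deg x), R.p_eq _ (R.lin_mem x)]

theorem barWt_lin {c : k} (hc : c ≠ 0) (x : BarTot A) :
    barWt A c (barWord A R.lin x) = barWord A R.lin x := by
  rw [barWt, barWord_comp]
  congr 2
  refine LinearMap.ext fun x => ?_
  rw [comp_apply, LinearMap.smul_apply, A.wt_apply c (R.lin_mem_deg x), zpow_one,
    smul_smul, inv_mul_cancel₀ hc, one_smul]

/-- A space of elements of degree `j` which contains the words of that degree with letters of
positive degree in the rigid subalgebra: for `j = 0` the words with all letters of degree one, for
`j < 0` nothing but zero, and for `j > 0`, where no sharper bound is needed, everything. -/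
def posPart (j : ℤ) : Submodule k (BarTot A) :=
  if j = 0 then LinearMap.range (barWord A R.lin) else
    if j < 0 then ⊥ else LinearMap.ker (barWt A (2 : k) - (2 : k) ^ j • LinearMap.id)

theorem barWt_posPart [CharZero k] {j : ℤ} {x : BarTot A} (hx : x ∈ R.posPart j) :
    barWt A 2 x = (2 : k) ^ j • x := by
  unfold posPart at hx
  split_ifs at hx with h1 h2
  · obtain ⟨y, rfl⟩ := hx
    rw [R.barWt_lin two_ne_zero, h1, zpow_zero, one_smul]
  · rw [(mem_bot k).1 hx, map_zero, smul_zero]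
  · exact sub_eq_zero.1 hx

theorem mem_posPart {j : ℤ} (hj : 0 < j) {x : BarTot A} (hx : barWt A 2 x = (2 : k) ^ j • x) :
    x ∈ R.posPart j := by
  unfold posPart
  rw [if_neg hj.ne', if_neg hj.le.not_gt]
  exact sub_eq_zero.2 hx

/-- Letters of positive degree contribute nonnegatively to the degree of a bar word, and the
degree is zero only if all letters have degree one. -/
theorem word_pos_mem [CharZero k] (x : BarTot A) :
    barWord A (R.p ∘ₗ A.pos) x ∈ ⨆ j, R.posPart j := by
  refine barTot_induction ((⨆ j, R.posPart j).comap (barWord A (R.p ∘ₗ A.pos))) (fun f => ?_)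
    (fun a t ht => ?_) x
  · rw [mem_comap, barWord_zero]
    refine mem_iSup_of_mem 0 ?_
    rw [posPart, if_pos rfl]
    exact ⟨barZero A f, barWord_zero _ _⟩
  · rw [mem_comap, barWord_cons, map_tmul]
    rw [mem_comap] at ht
    generalize barWord A (R.p ∘ₗ A.pos) t = t' at ht
    have h1 : ⨆ j, R.posPart j ≤ (⨆ j, R.posPart j).comap
        (barCons A ∘ₗ TensorProduct.mk k A (BarTot A) ((R.p ∘ₗ A.pos) a)) := by
      refine iSup_le fun j t ht => ?_
      refine graded_induction A.internal ((⨆ j, R.posPart j).comap (barCons A ∘ₗ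
        (TensorProduct.mk k A (BarTot A)).flip t ∘ₗ R.p ∘ₗ A.pos)) (fun q a ha => ?_) a
      change barCons A (R.p (A.pos a) ⊗ₜ t) ∈ ⨆ j, R.posPart j
      by_cases hq0 : q = 0
      · subst hq0
        rw [pos_apply, proj_of_mem ha, sub_self, map_zero, zero_tmul, map_zero]
        exact zero_mem _
      have hpa : A.pos a = a := by rw [pos_apply, proj_of_ne hq0 ha, sub_zero]
      rw [hpa]
      have hpd := R.p_deg q a ha
      rcases lt_or_gt_of_ne hq0 with hq | hq
      · rw [R.eq_zero q hq _ (R.p_mem a) hpd, zero_tmul, map_zero]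
        exact zero_mem _
      by_cases hj : j < 0
      · have : t = 0 := by
          rw [posPart, if_neg hj.ne, if_pos hj] at ht
          exact ht
        rw [this, tmul_zero, map_zero]
        exact zero_mem _
      by_cases hjq : j = 0 ∧ q = 1
      · obtain ⟨rfl, rfl⟩ := hjq
        rw [posPart, if_pos rfl] at ht
        obtain ⟨s, rfl⟩ := ht
        refine mem_iSup_of_mem 0 ?_
        rw [posPart, if_pos rfl]
        refine ⟨barCons A (a ⊗ₜ s), ?_⟩
        rw [barWord_cons, map_tmul, lin, comp_apply, proj_of_mem ha]
      · refine mem_iSup_of_mem (j + q - 1) (R.mem_posPart (by omega) ?_)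
        rw [barWt_cons, map_tmul, R.barWt_posPart ht, LinearMap.smul_apply,
          A.wt_apply 2 hpd, TensorProduct.tmul_smul, smul_smul, smul_tmul',
          smul_smul, ← smul_tmul', map_smul]
        congr 1
        rw [← zpow_neg_one, ← zpow_add₀ two_ne_zero, ← zpow_add₀ two_ne_zero]
        congr 1
        ring
    exact h1 ht

theorem word_pos_eq {x : BarTot A} (hx : x ∈ R.sub) :
    barWord A (R.p ∘ₗ A.pos) x = barWord A A.pos x := by
  have h : R.p ∘ₗ A.pos = A.pos ∘ₗ R.p := LinearMap.ext fun a => by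
    rw [comp_apply, comp_apply, pos_apply, pos_apply, map_sub, proj, R.p_dOp]
  rw [h, ← barWord_comp, (R.mem_sub.1 hx).2]

theorem word_pos_mem_posPart [CharZero k] {x : BarTot A} (hx : x ∈ R.sub) {i : ℤ}
    (hi : x ∈ barPart A i) : barWord A A.pos x ∈ R.posPart i := by
  refine mem_of_eigenvector (barWt A 2) R.posPart (fun n => (2 : k) ^ n) two_zpow_injective
    (fun j y hy => R.barWt_posPart hy) ?_ ?_
  · rw [← R.word_pos_eq hx]
    exact R.word_pos_mem x
  · rw [barWt, barWord_comm, ← barWt, (mem_barPart.1 hi).2, map_smul]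
    intro x
    rw [LinearMap.smul_apply, LinearMap.smul_apply, map_smul]
    exact congrArg _ (dOp_pos _ x)

variable (ε : A.Augmentation)

/-- The closed bar words with letters of degree one in the rigid subalgebra.  They represent
`H^0` of the bar complex. -/
def core : Submodule k (BarTot A) :=
  barTotSub A ⊓ (LinearMap.ker (barWord A R.lin - LinearMap.id) ⊓ LinearMap.ker (barD A ε))

variable {ε}

theorem mem_core {x : BarTot A} : x ∈ R.core ε ↔
    x ∈ barTotSub A ∧ barWord A R.lin x = x ∧ barD A ε x = 0 :=
  and_congr Iff.rfl (and_congr (LinearMap.mem_ker.trans sub_eq_zero) Iff.rfl)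

theorem core_le_barZ [CharZero k] : R.core ε ≤ barZ A ε 0 := by
  intro x hx
  obtain ⟨h1, h2, h3⟩ := R.mem_core.1 hx
  refine ⟨mem_barPart.2 ⟨h1, ?_⟩, h3⟩
  rw [← h2, R.barWt_lin two_ne_zero, zpow_zero, one_smul]

theorem core_le_sub : R.core ε ≤ R.sub := by
  intro x hx
  obtain ⟨h1, h2, h3⟩ := R.mem_core.1 hx
  refine R.mem_sub.2 ⟨h1, ?_⟩
  rw [← h2, barWord_comp, lin, ← comp_assoc, p_comp_p]

theorem split_lin (x : BarTot A) : barSplit A (barWord A R.lin x) = 0 := by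
  suffices h : barSplit A ∘ₗ barWord A R.lin = 0 from LinearMap.congr_fun h x
  refine barTot_ext (fun f => ?_) (fun a t ih => ?_)
  · simp [barSplit_zero, barWord_zero]
  · rw [comp_apply, LinearMap.zero_apply] at ih ⊢
    rw [barWord_cons, barSplit_cons, map_tmul, map_tmul,
      map_tmul, ih, proj_of_ne one_ne_zero (R.lin_mem_deg a)]
    simp

/-- Every cocycle of degree zero is cohomologous to a closed word with letters of degree one in the
rigid subalgebra. -/
theorem exists_core [CharZero k] {z : BarTot A} (hz : z ∈ barZ A ε 0) :
    ∃ y ∈ barPart A (0 - 1), z - barD A ε y ∈ R.core ε := by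
  obtain ⟨y, hy, hy'⟩ := R.exists_reduction hz.1 (by
    have h : barD A ε z = 0 := hz.2
    rw [h]
    exact zero_mem _)
  have hDy := barD_mem_barPart (ε := ε) hy
  rw [sub_add_cancel] at hDy
  have hb := sub_mem hz.1 hDy
  set b := z - barD A ε y with hbdef
  have hDb : barD A ε b = 0 := by
    have h : barD A ε z = 0 := hz.2
    rw [hbdef, map_sub, h, barD_barD (mem_barPart.1 hy).1, sub_zero]
  have h1 := R.split_homotopy (ε := ε) hy'
  rw [hDb, map_zero, add_zero] at h1
  refine ⟨y + barSplit A b, add_mem hy (barSplit_mem_barPart hb), ?_⟩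
  have h2 : z - barD A ε (y + barSplit A b) = barWord A A.pos b := by
    rw [map_add, h1, hbdef]
    abel
  rw [h2, R.mem_core]
  refine ⟨barWord_mem pos_bicolinear (R.sub_le hy'), ?_, ?_⟩
  · have h3 := R.word_pos_mem_posPart hy' hb
    rw [posPart, if_pos rfl] at h3
    obtain ⟨s, hs⟩ := h3
    rw [← hs, barWord_comp, lin_comp_lin]
  · rw [← h2, map_add, map_sub, map_add, barD_barD (mem_barPart.1 hy).1,
      barD_barD (barSplit_mem (R.sub_le hy'))]
    have h : barD A ε z = 0 := hz.2
    rw [h]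
    simp

/-- No coboundary but zero is a word with letters of degree one in the rigid subalgebra: after
reduction a primitive would be a word of degree `-1` in letters of positive degree. -/
theorem core_eq_zero [CharZero k] {y : BarTot A} (hy : y ∈ barPart A (0 - 1))
    (h : barD A ε y ∈ R.core ε) : barD A ε y = 0 := by
  obtain ⟨z, hz, hb⟩ := R.exists_reduction hy (R.core_le_sub h)
  have hDz := barD_mem_barPart (ε := ε) hz
  rw [sub_add_cancel] at hDz
  have hbd := sub_mem hy hDz
  have hDb : barD A ε (y - barD A ε z) = barD A ε y := by
    rw [map_sub, barD_barD (mem_barPart.1 hz).1, sub_zero]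
  have h1 := R.split_homotopy (ε := ε) hb
  have h2 := R.word_pos_mem_posPart hb hbd
  rw [posPart, if_neg (by norm_num), if_pos (by norm_num)] at h2
  have h3 : barSplit A (barD A ε y) = 0 := by
    rw [← (R.mem_core.1 h).2.1, R.split_lin]
  rw [hDb, h3, add_zero, (mem_bot k).1 h2, sub_zero] at h1
  rw [← hDb, ← h1, barD_barD (barSplit_mem (R.sub_le hb))]

theorem totSgn_lin (x : BarTot A) : barTotSgn A (barWord A R.lin x) = barWord A R.lin x := by
  rw [barTotSgn, barWord_comp]
  congr 2
  refine LinearMap.ext fun x => ?_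
  rw [comp_apply, LinearMap.neg_apply, sgn_apply (R.lin_mem_deg x), zpow_one, neg_smul,
    one_smul, neg_neg]

/-- The closed words with letters of degree one form a subcoalgebra. -/
theorem comul_core [CharZero k] {x : BarTot A} (hx : x ∈ R.core ε) :
    barComul A x ∈ subTensor (R.core ε) (R.core ε) := by
  obtain ⟨h1, h2, h3⟩ := R.mem_core.1 hx
  have hX := barComul_mem h1
  have hs : ∀ x, R.lin (A.sgn x) = A.sgn (R.lin x) := fun x => by
    rw [lin, comp_apply, comp_apply, proj_sgn, R.p_sgn]
  have hw : map (barWord A R.lin) (barWord A R.lin) (barComul A x) = barComul A x := by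
    rw [← barComul_word R.lin_bicolinear hs, h2]
  have hw2 : barWord A R.lin ∘ₗ barWord A R.lin = barWord A R.lin :=
    LinearMap.ext fun y => (barWord_comp _ _ _).trans (by rw [lin_comp_lin])
  have hr : barComul A x ∈ subTensor (LinearMap.ker (barWord A R.lin - LinearMap.id))
      (LinearMap.ker (barWord A R.lin - LinearMap.id)) := by
    have hm : ∀ y, barWord A R.lin y ∈ LinearMap.ker (barWord A R.lin - LinearMap.id) :=
      fun y => sub_eq_zero.2 (LinearMap.congr_fun hw2 y)
    rw [← hw]
    exact subTensor_map (P := ⊤) (Q := ⊤) (fun y _ => hm y) (fun y _ => hm y)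
      (mem_subTensor_top _)
  have hD := barComul_barD (ε := ε) h1
  rw [h3, map_zero] at hD
  have ht : map (barTotSgn A) (barD A ε) (barComul A x) =
      lTensor (BarTot A) (barD A ε) (barComul A x) := by
    have h : barTotSgn A ∘ₗ barWord A R.lin = barWord A R.lin := LinearMap.ext R.totSgn_lin
    conv_lhs => rw [← hw, map_map_eq, h]
    conv_rhs => rw [← hw, lTensor, map_map_eq, LinearMap.id_comp]
  rw [ht] at hD
  have hW : ∀ y ∈ barTotSub A ⊓ LinearMap.ker (barWord A R.lin - LinearMap.id),
      barWt A 2 y = y := by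
    intro y hy
    have h := sub_eq_zero.1 (LinearMap.mem_ker.1 hy.2)
    have h' : barWord A R.lin y = y := h
    rw [← h', R.barWt_lin two_ne_zero]
  have hP : barComul A x ∈ subTensor
      (barTotSub A ⊓ LinearMap.ker (barWord A R.lin - LinearMap.id))
      (barTotSub A ⊓ LinearMap.ker (barWord A R.lin - LinearMap.id)) :=
    subTensor_inf (subTensor_inf_left (subTensor_mono le_rfl le_top hX)
      (subTensor_mono le_rfl le_top hr)) (subTensor_inf_right (subTensor_mono le_top le_rfl hX)
      (subTensor_mono le_top le_rfl hr))
  -- The two terms of `(D ⊗ 1 ± 1 ⊗ D) (Δ x) = 0` have different degrees in the first factor, one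
  -- and zero, so that both of them vanish.
  have e1 : rTensor (BarTot A) (barWt A (2 : k))
      (rTensor (BarTot A) (barD A ε) (barComul A x)) =
      (2 : k) • rTensor (BarTot A) (barD A ε) (barComul A x) := by
    refine eq_on_subTensor (F := rTensor (BarTot A) (barWt A (2 : k)) ∘ₗ
      rTensor (BarTot A) (barD A ε))
      (G := (2 : k) • rTensor (BarTot A) (barD A ε)) (fun a ha b _ => ?_) hP
    rw [comp_apply, rTensor_tmul, rTensor_tmul,
      LinearMap.smul_apply, rTensor_tmul, barWt_barD two_ne_zero ha.1, hW a ha,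
      smul_tmul']
  have e2 : rTensor (BarTot A) (barWt A (2 : k))
      (lTensor (BarTot A) (barD A ε) (barComul A x)) =
      lTensor (BarTot A) (barD A ε) (barComul A x) := by
    refine eq_on_subTensor (F := rTensor (BarTot A) (barWt A (2 : k)) ∘ₗ
      lTensor (BarTot A) (barD A ε))
      (G := lTensor (BarTot A) (barD A ε)) (fun a ha b _ => ?_) hP
    rw [comp_apply, lTensor_tmul, rTensor_tmul, hW a ha]
  have e3 := eq_neg_of_add_eq_zero_right hD.symm
  rw [e3, map_neg, e1] at e2
  have e4 : rTensor (BarTot A) (barD A ε) (barComul A x) = 0 := by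
    have := neg_injective e2
    rw [two_smul] at this
    exact left_eq_add.1 this.symm
  rw [e4, neg_zero] at e3
  have h5 := subTensor_inf_left (subTensor_mono (le_refl _) le_top hr)
    (mem_subTensor_ker_left e4)
  have h6 := subTensor_inf_right (subTensor_mono le_top (le_refl _) hr)
    (mem_subTensor_ker_right e3)
  exact subTensor_inf (subTensor_inf_left (subTensor_mono le_rfl le_top hX) h5)
    (subTensor_inf_right (subTensor_mono le_top le_rfl hX) h6)

/-- The coalgebra `H^0` of the bar complex is the one of the closed bar words with letters of
degree one in the rigid subalgebra. -/
theorem exists_coalgebra [CharZero k] : ∃ (C : Coalgebra k (barH0 A ε))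
    (ι : barH0 A ε →ₗ[k] BarTot A), IsInducedCoalgebra A ε C ∧ Function.Injective ι ∧
      LinearMap.range ι = R.core ε ∧ (∀ q, map ι ι (C.comul q) = barComul A (ι q)) ∧
      ∀ q, C.counit q = barCounit A (ι q) := by
  let e₀ : R.core ε →ₗ[k] barH0 A ε :=
    Submodule.mkQ _ ∘ₗ Submodule.inclusion R.core_le_barZ
  have he : Function.Bijective e₀ := by
    constructor
    · refine (injective_iff_map_eq_zero e₀).2 fun x hx => ?_
      obtain ⟨y, hy, hyx⟩ := (Submodule.Quotient.mk_eq_zero _).1 hx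
      have hyx' : barD A ε y = x := hyx
      have h := R.core_eq_zero (ε := ε) hy (hyx' ▸ x.2)
      exact Subtype.ext (hyx'.symm.trans h)
    · intro q
      obtain ⟨z, rfl⟩ := Submodule.Quotient.mk_surjective _ q
      obtain ⟨y, hy, hzy⟩ := R.exists_core z.2
      refine ⟨⟨_, hzy⟩, ?_⟩
      refine (Submodule.Quotient.eq _).2 ⟨-y, neg_mem hy, ?_⟩
      change barD A ε (-y) = (z.1 - barD A ε y) - z.1
      rw [map_neg]
      abel
  let e := LinearEquiv.ofBijective e₀ he
  let ι : barH0 A ε →ₗ[k] BarTot A := (R.core ε).subtype ∘ₗ e.symm.toLinearMap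
  have hι : Function.Injective ι := Subtype.val_injective.comp e.symm.injective
  have hrange : LinearMap.range ι = R.core ε := by
    rw [LinearMap.range_comp, LinearEquiv.range, Submodule.map_top, Submodule.range_subtype]
  have hιe : ∀ x : R.core ε, ι (e₀ x) = x := fun x =>
    congrArg Subtype.val (e.symm_apply_apply x)
  obtain ⟨C, hC, hC'⟩ := exists_coalgebra_of_injective ι hι (barComul A) (barCounit A)
    barComul_coassoc sliceL_barCounit_comul slice_barCounit_comul (fun q => by
      rw [hrange]
      exact R.comul_core (e.symm q).2)
  refine ⟨C, ι, fun z => ?_, hι, hrange, hC, hC'⟩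
  obtain ⟨y, hy, hx⟩ := R.exists_core z.2
  have hzx : (Submodule.Quotient.mk z : barH0 A ε) = e₀ ⟨_, hx⟩ := by
    refine (Submodule.Quotient.eq _).2 ⟨y, hy, ?_⟩
    change barD A ε y = z.1 - (z.1 - barD A ε y)
    abel
  have hιz : ι (Submodule.Quotient.mk z) = z.1 - barD A ε y := by rw [hzx, hιe]
  constructor
  · obtain ⟨w', hw'⟩ := exists_map_subtype (R.comul_core hx)
    let inc : R.core ε →ₗ[k] barZ A ε 0 := Submodule.inclusion R.core_le_barZ
    refine ⟨map inc inc w', ?_, ?_⟩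
    · apply map_injective hι hι
      rw [hC, hιz, map_map_eq, map_map_eq, ← hw']
      have h : (R.core ε).subtype = (ι ∘ₗ Submodule.mkQ _) ∘ₗ inc :=
        LinearMap.ext fun x => (hιe x).symm
      rw [h]
    · rw [map_map_eq]
      have h1 : map ((barZ A ε 0).subtype ∘ₗ inc) ((barZ A ε 0).subtype ∘ₗ inc) w' =
          barComul A (z.1 - barD A ε y) := hw'
      rw [h1, ← map_sub, sub_sub_cancel]
      refine Submodule.mem_sup_left (comul_mem_barBB ?_)
      rwa [zero_sub] at hy
  · rw [hC', hιz, map_sub]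
    rw [barCounit_barD, sub_zero]

end RelDGA.Retract

end Core

/-! ### Coactions of the bar complex -/

section Letter

variable {k O : Type u} [Field k] [AddCommGroup O] [Module k O] [Coalgebra k O] {A : RelDGA k O}

theorem map_neg_left {M M' N N' : Type u} [AddCommGroup M] [Module k M] [AddCommGroup M']
    [Module k M'] [AddCommGroup N] [Module k N] [AddCommGroup N'] [Module k N'] (f : M →ₗ[k] M')
    (g : N →ₗ[k] N') (t : M ⊗[k] N) :
    map (-f) g t = -map f g t := by
  rw [← neg_one_smul k f, TensorProduct.map_smul_left]
  simp

theorem map_neg_right {M M' N N' : Type u} [AddCommGroup M] [Module k M] [AddCommGroup M']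
    [Module k M'] [AddCommGroup N] [Module k N] [AddCommGroup N'] [Module k N'] (f : M →ₗ[k] M')
    (g : N →ₗ[k] N') (t : M ⊗[k] N) :
    map f (-g) t = -map f g t := by
  rw [← neg_one_smul k g, TensorProduct.map_smul_right]
  simp

variable (A) in
/-- The component in `Bar_1 = A` of an element of the bar complex. -/
def barLetter : BarTot A →ₗ[k] A := slice A (barCounit A) ∘ₗ barUncons A

theorem barLetter_zero (f : O) : barLetter A (barZero A f) = 0 := by simp [barLetter]

theorem barLetter_cons (x : A ⊗[k] BarTot A) :
    barLetter A (barCons A x) = slice A (barCounit A) x := by simp [barLetter]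

theorem barPrZero_comp_zero : barPrZero A ∘ₗ barZero A = (LinearMap.id : O →ₗ[k] O) :=
  LinearMap.ext fun f => barPrZero_zero (A := A) f

theorem barPrZero_comp_cons : barPrZero A ∘ₗ barCons A = 0 :=
  LinearMap.ext fun x => barPrZero_cons x

theorem map_barPrZero_join {Y : Type u} [AddCommGroup Y] [Module k Y] (f : BarTot A →ₗ[k] Y)
    (w : A ⊗[k] (BarTot A ⊗[k] BarTot A)) :
    map (barPrZero A) f (barJoin A w) = 0 := by
  refine ext_threefold (F := map (barPrZero A) f ∘ₗ barJoin A) (G := 0)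
    (fun a p q => ?_) w
  rw [comp_apply, barJoin_tmul, map_tmul, barPrZero_cons,
    zero_tmul]
  rfl

theorem barPrZero_comul_left (x : BarTot A) :
    rTensor (BarTot A) (barPrZero A) (barComul A x) = barLam A x := by
  obtain ⟨f, y, rfl⟩ := bar_cases x
  rw [map_add, map_add, barComul_zero, barComul_cons, map_add, map_add, barLam_zero, barLam_cons,
    rTensor, map_barPrZero_join, map_map_eq, map_map_eq, barPrZero_comp_zero, add_zero]
  rfl

theorem barPrZero_lam (x : BarTot A) : lTensor O (barPrZero A) (barLam A x) =
    Coalgebra.comul (R := k) (barPrZero A x) := by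
  obtain ⟨f, y, rfl⟩ := bar_cases x
  rw [map_add, map_add, map_add, barLam_zero, barLam_cons, ← lTensor_comp_apply,
    ← lTensor_comp_apply, barPrZero_comp_zero, barPrZero_comp_cons, barPrZero_zero,
    barPrZero_cons]
  simp

theorem barPrZero_comul (x : BarTot A) : map (barPrZero A) (barPrZero A)
    (barComul A x) = Coalgebra.comul (R := k) (barPrZero A x) := by
  rw [← barPrZero_lam, ← barPrZero_comul_left, lTensor, rTensor, map_map_eq]
  rfl

/-- Deconcatenation after the first letter. -/
theorem barLetter_comul_left (x : BarTot A) :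
    rTensor (BarTot A) (barLetter A) (barComul A x) =
      lTensor A (barWord A A.sgn) (barUncons A x) := by
  have h1 : barLetter A ∘ₗ barZero A = 0 := LinearMap.ext fun f => barLetter_zero f
  have h3 (w : A ⊗[k] (BarTot A ⊗[k] BarTot A)) :
      rTensor (BarTot A) (barLetter A) (barJoin A w) =
      lTensor A (barWord A A.sgn ∘ₗ sliceL (BarTot A) (barCounit A)) w := by
    refine ext_threefold (F := rTensor (BarTot A) (barLetter A) ∘ₗ barJoin A)
      (fun a p q => ?_) w
    rw [comp_apply, barJoin_tmul, rTensor_tmul, barLetter_cons, slice_tmul,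
      lTensor_tmul, comp_apply, sliceL_tmul, map_smul,
      TensorProduct.smul_tmul]
  have h4 : sliceL (BarTot A) (barCounit A) ∘ₗ barComul A = LinearMap.id :=
    LinearMap.ext fun x => sliceL_barCounit_comul x
  obtain ⟨f, y, rfl⟩ := bar_cases x
  rw [map_add, map_add, barComul_zero, barComul_cons, map_add, h3, rTensor, map_map_eq,
    map_map_eq, h1, ← lTensor_comp_apply, comp_assoc, h4]
  simp

theorem barLetter_colinear (x : BarTot A) :
    A.coactL (barLetter A x) = lTensor O (barLetter A) (barLam A x) := by
  rw [barLetter, lTensor_comp_apply, ← barUncons_colinear, comp_apply,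
    slice_coactLeft]

theorem barLetter_coactL (x : BarTot A) : A.coactL (barLetter A x) =
    map (barPrZero A) (barLetter A) (barComul A x) := by
  rw [barLetter_colinear, ← barPrZero_comul_left, lTensor, rTensor, map_map_eq]
  rfl

theorem slice_counit_lam (x : BarTot A) : slice O (barCounit A) (barLam A x) = barPrZero A x := by
  rw [← barPrZero_comul_left, slice_rTensor, slice_barCounit_comul]

theorem barPrZero_word (α : A →ₗ[k] A) (x : BarTot A) :
    barPrZero A (barWord A α x) = barPrZero A x := by
  obtain ⟨f, y, rfl⟩ := bar_cases x
  simp [barWord_zero, barWord_cons, barPrZero_zero, barPrZero_cons]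

theorem barLetter_coactR {x : BarTot A} (hx : x ∈ barTotSub A) : A.coactR (barLetter A x) =
    map (barLetter A) (barPrZero A) (barComul A x) := by
  have h1 : map (barLetter A) (barPrZero A) (barComul A x) =
      lTensor A (barPrZero A)
        (rTensor (BarTot A) (barLetter A) (barComul A x)) := by
    rw [lTensor, rTensor, map_map_eq]
    rfl
  have h2 : barPrZero A ∘ₗ barWord A A.sgn = slice O (barCounit A) ∘ₗ barLam A :=
    LinearMap.ext fun y => (barPrZero_word _ y).trans (slice_counit_lam y).symm
  rw [h1, barLetter_comul_left, ← lTensor_comp_apply, h2, lTensor_comp_apply,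
    ← mem_cotensor.1 (barUncons_mem hx).1, slice_coactMid]
  rfl

theorem barLetter_der (x : BarTot A) :
    barLetter A (barDer A A.d A.sgn x) = A.d (barLetter A x) := by
  have h : barCounit A ∘ₗ barDer A A.d A.sgn = 0 := LinearMap.ext (barCounit_der _ _)
  rw [barLetter, comp_apply, barUncons_der, map_add, slice_map, h, slice_rTensor]
  simp [slice]

theorem barLetter_word (α : A →ₗ[k] A) (x : BarTot A) :
    barLetter A (barWord A α x) = α (barLetter A x) := by
  have h : barCounit A ∘ₗ barWord A α = barCounit A := LinearMap.ext (barCounit_word _)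
  rw [barLetter, comp_apply, barUncons_word, slice_map, h]
  rfl

theorem barLetter_act (ε : A.Augmentation) (y : A ⊗[k] BarTot A) :
    barLetter A (barAct ε y) = A.m (lTensor A (barLetter A) y) := by
  rw [barLetter, comp_apply, barUncons_act, slice_mulTensor,
    ← lTensor_comp_apply]

theorem barCounit_tail (ε : A.Augmentation) (x : BarTot A) :
    barCounit A (barTail ε x) = -ε.char (barLetter A x) := by
  have h := barCounit_barD ε x
  have h2 (y : A ⊗[k] BarTot A) : barCounit A (sliceL (BarTot A) ε.char y) =
      ε.char (slice A (barCounit A) y) := by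
    induction y with
    | zero => simp
    | add x y hx hy => rw [map_add, map_add, map_add, map_add, hx, hy]
    | tmul a t => simp [slice_tmul, sliceL_tmul, mul_comm]
  have h3 : barCounit A (barHead ε x) = ε.char (barLetter A x) := by
    rw [barHead, comp_apply, comp_apply, barCounit_word, h2]
    rfl
  rw [barD_eq, map_add, map_add, barCounit_der, h3, zero_add] at h
  exact eq_neg_of_add_eq_zero_left h

namespace RelDGA.Retract

variable (R : A.Retract) {ε : A.Augmentation}

theorem letter_core {x : BarTot A} (hx : x ∈ R.core ε) :
    barLetter A x ∈ R.B ∧ barLetter A x ∈ A.deg 1 := by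
  have h := (R.mem_core.1 hx).2.1
  rw [← h, barLetter_word]
  exact ⟨R.lin_mem _, R.lin_mem_deg _⟩

theorem sgn_lin : A.sgn ∘ₗ R.lin = -R.lin := by
  refine LinearMap.ext fun a => ?_
  rw [comp_apply, sgn_apply (R.lin_mem_deg a)]
  simp

theorem char_lin : ε.char ∘ₗ R.lin = 0 := by
  refine LinearMap.ext fun a => ?_
  rw [comp_apply, ← ε.char_proj, proj_of_ne one_ne_zero (R.lin_mem_deg a), map_zero]
  rfl

/-- The Maurer–Cartan equation: the component of length one of the differential of a closed bar
word vanishes. -/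
theorem letter_maurerCartan {x : BarTot A} (hx : x ∈ R.core ε) : A.d (barLetter A x) +
    A.m (map (barLetter A) (barLetter A) (barComul A x)) = 0 := by
  obtain ⟨h1, h2, h3⟩ := R.mem_core.1 hx
  have hu : map R.lin (barWord A R.lin) (barUncons A x) = barUncons A x := by
    rw [← barUncons_word, h2]
  have hl : barLetter A ∘ₗ barWord A A.sgn ∘ₗ barWord A R.lin =
      -(barLetter A ∘ₗ barWord A R.lin) := by
    refine LinearMap.ext fun y => ?_
    simp only [comp_apply, LinearMap.neg_apply, barLetter_word]
    exact LinearMap.congr_fun R.sgn_lin _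
  have e1 : map (barLetter A) (barLetter A) (barComul A x) =
      -lTensor A (barLetter A) (barUncons A x) := by
    have h : map (barLetter A) (barLetter A) (barComul A x) =
        lTensor A (barLetter A)
          (rTensor (BarTot A) (barLetter A) (barComul A x)) := by
      rw [lTensor, rTensor, map_map_eq]
      rfl
    rw [h, barLetter_comul_left, ← lTensor_comp_apply, ← hu, lTensor,
      map_map_eq, comp_assoc, hl, lTensor, map_map_eq, map_neg_right]
  have e2 : barLetter A (barTail ε x) =
      -A.m (lTensor A (barLetter A) (barUncons A x)) := by
    have hT : (barCounit A ∘ₗ barTail ε) ∘ₗ barWord A R.lin = 0 := by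
      refine LinearMap.ext fun y => ?_
      rw [comp_apply, comp_apply, barCounit_tail, barLetter_word]
      exact neg_eq_zero.2 (LinearMap.congr_fun R.char_lin _)
    have ht : barLetter A (barCons A (map A.sgn (barTail ε) (barUncons A x))) =
        0 := by
      rw [barLetter_cons, slice_map, ← hu, slice_map, hT]
      simp [slice]
    have ha : map A.sgn (barLetter A ∘ₗ barWord A A.sgn) (barUncons A x) =
        lTensor A (barLetter A) (barUncons A x) := by
      rw [← hu, map_map_eq, comp_assoc, hl, R.sgn_lin, lTensor, map_map_eq,
        map_neg_right, map_neg_left, neg_neg]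
      rfl
    conv_lhs => rw [← bar_decomp x]
    rw [map_add, barTail_zero, zero_add, barTail_cons, map_sub, map_neg, barLetter_act, ht,
      sub_zero, lTensor, map_map_eq]
    exact congrArg (fun y => -A.m y) ha
  have e3 : barLetter A (barHead ε x) = 0 := by
    rw [barHead, comp_apply, comp_apply, barLetter_word, ← hu, sliceL_map,
      R.char_lin]
    simp [sliceL]
  have h4 := congrArg (barLetter A) h3
  rw [barD_eq, map_add, map_add, barLetter_der, e2, e3, map_zero, add_zero] at h4
  rw [e1, map_neg, h4]

end RelDGA.Retract

end Letter

section BarComodule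

variable {k O : Type u} [Field k] [AddCommGroup O] [Module k O] [Coalgebra k O] {A : RelDGA k O}
  {U : Type u} [AddCommGroup U] [Module k U]

variable (A) in
/-- The map `a ⊗ (x ⊗ y) ↦ (-1)^|x| [a | x] ⊗ y`, which prepends a letter to a bar word. -/
def barStep (Y : Type u) [AddCommGroup Y] [Module k Y] :
    A ⊗[k] (BarTot A ⊗[k] Y) →ₗ[k] BarTot A ⊗[k] Y :=
  rTensor Y (barCons A) ∘ₗ (TensorProduct.assoc k A (BarTot A) Y).symm.toLinearMap ∘ₗ
    lTensor A (rTensor Y (barWord A A.sgn))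

variable {Y Z : Type u} [AddCommGroup Y] [Module k Y] [AddCommGroup Z] [Module k Z]

theorem barStep_tmul (a : A) (x : BarTot A) (y : Y) : barStep A Y (a ⊗ₜ (x ⊗ₜ y)) =
    barCons A (a ⊗ₜ barWord A A.sgn x) ⊗ₜ y := by
  simp [barStep]

theorem lTensor_barStep (f : Y →ₗ[k] Z) (w : A ⊗[k] (BarTot A ⊗[k] Y)) :
    lTensor (BarTot A) f (barStep A Y w) =
      barStep A Z (lTensor A (lTensor (BarTot A) f) w) := by
  refine ext_threefold (F := lTensor (BarTot A) f ∘ₗ barStep A Y)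
    (G := barStep A Z ∘ₗ lTensor A (lTensor (BarTot A) f))
    (fun a x y => ?_) w
  simp [barStep_tmul]

/-- A comodule over the coalgebra of the closed bar words with letters of degree one in the rigid
subalgebra. -/
structure IsBarCoaction (R : A.Retract) (ε : A.Augmentation) (ρ : U →ₗ[k] BarTot A ⊗[k] U) :
    Prop where
  coassoc : ∀ u, coactLeft (barComul A) U (ρ u) = lTensor (BarTot A) ρ (ρ u)
  counit : ∀ u, sliceL U (barCounit A) (ρ u) = u
  mem : ∀ u, ρ u ∈ subTensor (R.core ε) ⊤

/-- The coaction of `O` underlying a coaction of the bar complex. -/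
def zeroPart (ρ : U →ₗ[k] BarTot A ⊗[k] U) : U →ₗ[k] O ⊗[k] U :=
  rTensor U (barPrZero A) ∘ₗ ρ

/-- The component in `A` of a coaction of the bar complex. -/
def letterPart (ρ : U →ₗ[k] BarTot A ⊗[k] U) : U →ₗ[k] A ⊗[k] U :=
  rTensor U (barLetter A) ∘ₗ ρ

namespace IsBarCoaction

variable {R : A.Retract} {ε : A.Augmentation} {ρ : U →ₗ[k] BarTot A ⊗[k] U}

theorem map_map (hρ : IsBarCoaction R ε ρ) {Y Z : Type u} [AddCommGroup Y] [Module k Y]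
    [AddCommGroup Z] [Module k Z] (P : BarTot A →ₗ[k] Y) (P' : BarTot A →ₗ[k] Z) (u : U) :
    lTensor Y (rTensor U P' ∘ₗ ρ) (rTensor U P (ρ u)) =
      TensorProduct.assoc k Y Z U (rTensor U (map P P' ∘ₗ barComul A)
        (ρ u)) := by
  have h1 : lTensor Y (rTensor U P' ∘ₗ ρ) (rTensor U P (ρ u)) =
      map P (map P' LinearMap.id)
        (lTensor (BarTot A) ρ (ρ u)) := by
    refine (map_map_eq _ _ _ _ _).trans (Eq.symm ((map_map_eq _ _ _ _ _).trans ?_))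
    rfl
  rw [h1, ← hρ.coassoc, rTensor_comp_apply]
  exact (assoc_map_apply P P' LinearMap.id _).symm

theorem zeroPart_isCoaction (hρ : IsBarCoaction R ε ρ) : IsLeftCoaction (zeroPart ρ) where
  coassoc := by
    refine LinearMap.ext fun u => ?_
    have h := hρ.map_map (barPrZero A) (barPrZero A) u
    refine Eq.trans ?_ h.symm
    have h2 : map (barPrZero A) (barPrZero A) ∘ₗ barComul A =
        Coalgebra.comul ∘ₗ barPrZero A := LinearMap.ext barPrZero_comul
    rw [h2, rTensor_comp_apply]
    rfl
  counit := by
    refine LinearMap.ext fun u => ?_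
    refine Eq.trans ?_ (hρ.counit u)
    change sliceL U Coalgebra.counit (rTensor U (barPrZero A) (ρ u)) = _
    exact sliceL_map _ LinearMap.id _ _

theorem letterPart_coactLeft (hρ : IsBarCoaction R ε ρ) (u : U) :
    coactLeft A.coactL U (letterPart ρ u) = lTensor O (letterPart ρ) (zeroPart ρ u) := by
  have h := hρ.map_map (barPrZero A) (barLetter A) u
  refine Eq.trans ?_ h.symm
  have h2 : map (barPrZero A) (barLetter A) ∘ₗ barComul A =
      A.coactL ∘ₗ barLetter A := LinearMap.ext fun x => (barLetter_coactL x).symm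
  rw [h2, rTensor_comp_apply]
  rfl

theorem letterPart_mem_cotensor (hρ : IsBarCoaction R ε ρ) (u : U) :
    letterPart ρ u ∈ cotensor A.coactR (zeroPart ρ) := by
  have h := hρ.map_map (barLetter A) (barPrZero A) u
  refine mem_cotensor.2 (Eq.trans ?_ h.symm)
  refine congrArg (TensorProduct.assoc k A O U) ?_
  change rTensor U A.coactR (rTensor U (barLetter A) (ρ u)) = _
  rw [← rTensor_comp_apply]
  exact map_eq_on_subTensor (fun x hx => barLetter_coactR (R.mem_core.1 hx).1) (fun _ _ => rfl)
    (hρ.mem u)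

theorem letterPart_mem (hρ : IsBarCoaction R ε ρ) (u : U) :
    letterPart ρ u ∈ subTensor R.B ⊤ ∧ letterPart ρ u ∈ subTensor (A.deg 1) ⊤ :=
  ⟨subTensor_map (g := LinearMap.id) (fun _ hx => (R.letter_core hx).1) (fun _ h => h) (hρ.mem u),
    subTensor_map (g := LinearMap.id) (fun _ hx => (R.letter_core hx).2) (fun _ h => h) (hρ.mem u)⟩

theorem letterPart_maurerCartan (hρ : IsBarCoaction R ε ρ) (u : U) :
    rTensor U A.d (letterPart ρ u) +
      mulTensor A.m U (lTensor A (letterPart ρ) (letterPart ρ u)) = 0 := by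
  have h := hρ.map_map (barLetter A) (barLetter A) u
  have h2 : mulTensor A.m U (lTensor A (letterPart ρ) (letterPart ρ u)) =
      rTensor U (A.m ∘ₗ map (barLetter A) (barLetter A) ∘ₗ barComul A)
        (ρ u) := by
    refine (congrArg (mulTensor A.m U) h).trans ?_
    rw [rTensor_comp_apply U A.m]
    exact congrArg (rTensor U A.m) ((TensorProduct.assoc k A A U).symm_apply_apply _)
  rw [h2, letterPart, comp_apply, ← rTensor_comp_apply, ← LinearMap.add_apply,
    ← LinearMap.rTensor_add]
  exact (map_eq_on_subTensor (f' := 0) (g' := LinearMap.id)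
    (fun x hx => R.letter_maurerCartan hx) (fun _ _ => rfl) (hρ.mem u)).trans (by simp)

/-- Coassociativity of the coaction, with the first component restricted to words of length one. -/
theorem uncons_eq (hρ : IsBarCoaction R ε ρ) (u : U) :
    lTensor A (rTensor U (barWord A A.sgn) ∘ₗ ρ) (letterPart ρ u) =
      TensorProduct.assoc k A (BarTot A) U (rTensor U (barUncons A) (ρ u)) := by
  have h := hρ.map_map (barLetter A) (barWord A A.sgn) u
  have h2 : map (barLetter A) (barWord A A.sgn) ∘ₗ barComul A = barUncons A := by
    refine LinearMap.ext fun x => ?_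
    have h3 : map (barLetter A) (barWord A A.sgn) (barComul A x) =
        lTensor A (barWord A A.sgn)
          (rTensor (BarTot A) (barLetter A) (barComul A x)) := by
      rw [lTensor, rTensor, map_map_eq]
      rfl
    rw [comp_apply, h3, barLetter_comul_left, ← lTensor_comp_apply]
    have h4 : barWord A A.sgn ∘ₗ barWord A A.sgn = LinearMap.id := LinearMap.ext barWord_sgn_sgn
    rw [h4]
    simp
  rw [h2] at h
  exact h

/-- A coaction of the bar complex is determined by its components of length zero and one. -/
theorem recursion (hρ : IsBarCoaction R ε ρ) (u : U) :
    ρ u = rTensor U (barZero A) (zeroPart ρ u) +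
      barStep A U (lTensor A ρ (letterPart ρ u)) := by
  rw [barStep, comp_apply, comp_apply, ← lTensor_comp_apply,
    hρ.uncons_eq, LinearEquiv.coe_coe, LinearEquiv.symm_apply_apply, zeroPart, comp_apply,
    ← rTensor_comp_apply, ← rTensor_comp_apply, ← LinearMap.add_apply,
    ← LinearMap.rTensor_add]
  have h6 : barZero A ∘ₗ barPrZero A + barCons A ∘ₗ barUncons A = LinearMap.id :=
    LinearMap.ext bar_decomp
  rw [h6]
  simp

end IsBarCoaction

end BarComodule

/-! ### The filtration of a connection, and homological reduction -/

section Filtration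

variable {k O : Type u} [Field k] [AddCommGroup O] [Module k O] [Coalgebra k O] {A : RelDGA k O}

section general

variable {V W : FDComod k O}

theorem op_mem_homC {α : A →ₗ[k] A} (hα : A.Bicolinear α) {n n' : ℤ}
    (hd : ∀ x ∈ A.deg n, α x ∈ A.deg n') {f : V →ₗ[k] A ⊗[k] W} (hf : f ∈ homC A n V W) :
    rTensor W α ∘ₗ f ∈ homC A n' V W := by
  refine ⟨LinearMap.ext fun v => ?_, fun v => ⟨?_, ?_⟩⟩
  · have h : coactLeft A.coactL W (f v) = lTensor O f (V.coact v) :=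
      LinearMap.congr_fun hf.1 v
    refine (coactLeft_map hα.left LinearMap.id (f v)).trans ?_
    rw [h, ← lTensor_comp_apply]
    rfl
  · exact map_mem_cotensor hα.right (f := LinearMap.id) (Q := ⊤) (fun y _ => by simp)
      (hf.2 v).1 (mem_subTensor_top _)
  · exact subTensor_map (g := LinearMap.id) hd (fun _ h => h) (hf.2 v).2

theorem dC_mem {n : ℤ} {f : V →ₗ[k] A ⊗[k] W} (hf : f ∈ homC A n V W) :
    dC f ∈ homC A (n + 1) V W :=
  op_mem_homC RelDGA.Bicolinear.d (A.d_deg n) hf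

theorem dC_dC (f : V →ₗ[k] A ⊗[k] W) : dC (dC f) = 0 := by
  have h : A.d ∘ₗ A.d = 0 := A.d_d
  refine LinearMap.ext fun v => ?_
  change rTensor W A.d (rTensor W A.d (f v)) = 0
  rw [← rTensor_comp_apply, h]
  simp

theorem op_add (α : A →ₗ[k] A) (f g : V →ₗ[k] A ⊗[k] W) :
    rTensor W α ∘ₗ (f + g) = rTensor W α ∘ₗ f + rTensor W α ∘ₗ g :=
  LinearMap.comp_add _ _ _

theorem star_zsmul_left {X : FDComod k O} (c : ℤ) (g : W →ₗ[k] A ⊗[k] X) (f : V →ₗ[k] A ⊗[k] W) :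
    star (c • g) f = c • star g f := by
  ext v
  simp only [star, comp_apply, LinearMap.smul_apply]
  rw [← Int.cast_smul_eq_zsmul k c g, ← Int.cast_smul_eq_zsmul k c, LinearMap.lTensor_smul]
  simp

theorem star_zsmul_right {X : FDComod k O} (c : ℤ) (g : W →ₗ[k] A ⊗[k] X) (f : V →ₗ[k] A ⊗[k] W) :
    star g (c • f) = c • star g f := by
  ext v
  simp [star]

/-- The homomorphisms with values in the subspace of a retract. -/
def RelDGA.Retract.valued (R : A.Retract) (V W : FDComod k O) :
    Submodule k (V →ₗ[k] A ⊗[k] W) where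
  carrier := {f | ∀ v, f v ∈ subTensor R.B ⊤}
  add_mem' hf hg v := add_mem (hf v) (hg v)
  zero_mem' _ := zero_mem _
  smul_mem' c _ hf v := Submodule.smul_mem _ c (hf v)

namespace RelDGA.Retract

variable (R : A.Retract)

theorem valued_star {X : FDComod k O} {p q : ℤ} {g : W →ₗ[k] A ⊗[k] X} {f : V →ₗ[k] A ⊗[k] W}
    (hg : g ∈ homC A p W X) (hf : f ∈ homC A q V W) (hg' : g ∈ R.valued W X)
    (hf' : f ∈ R.valued V W) : star g f ∈ R.valued V X := by
  intro v
  refine mem_subTensor_of_slice fun φ => ?_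
  have h : slice A φ (star g f v) = A.m (lTensor A (slice A φ)
    (lTensor A g (f v))) := slice_mulTensor _ _ _
  rw [h]
  refine R.mul_mem _ (slice_mem_cot A X (lTensor_mem_cotensor hg hf v) φ) ?_
  rw [← lTensor_comp_apply]
  exact subTensor_map (f := LinearMap.id) (fun _ h => h) (fun w _ => slice_mem (hg' w) φ) (hf' v)

theorem valued_d {f : V →ₗ[k] A ⊗[k] W} (hf : f ∈ R.valued V W) : dC f ∈ R.valued V W :=
  fun v => subTensor_map (g := LinearMap.id) R.d_mem (fun _ h => h) (hf v)

theorem valued_p (f : V →ₗ[k] A ⊗[k] W) : rTensor W R.p ∘ₗ f ∈ R.valued V W :=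
  fun v => subTensor_map (P := ⊤) (Q := ⊤) (g := LinearMap.id) (fun x _ => R.p_mem x)
    (fun _ h => h) (mem_subTensor_top (f v))

theorem p_valued {f : V →ₗ[k] A ⊗[k] W} (hf : f ∈ R.valued V W) :
    rTensor W R.p ∘ₗ f = f := by
  refine LinearMap.ext fun v => ?_
  exact (map_eq_on_subTensor (f' := LinearMap.id) (g' := LinearMap.id) R.p_eq (fun _ _ => rfl)
    (hf v)).trans (by simp)

theorem h_valued {f : V →ₗ[k] A ⊗[k] W} (hf : f ∈ R.valued V W) :
    rTensor W R.h ∘ₗ f = 0 := by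
  refine LinearMap.ext fun v => ?_
  exact (map_eq_on_subTensor (f' := 0) (g' := LinearMap.id) R.h_eq (fun _ _ => rfl)
    (hf v)).trans (by simp)

theorem h_mem_homC {n : ℤ} {f : V →ₗ[k] A ⊗[k] W} (hf : f ∈ homC A n V W) :
    rTensor W R.h ∘ₗ f ∈ homC A (n + -1) V W :=
  op_mem_homC R.h_bicolinear (R.h_deg n) hf

theorem p_mem_homC {n : ℤ} {f : V →ₗ[k] A ⊗[k] W} (hf : f ∈ homC A n V W) :
    rTensor W R.p ∘ₗ f ∈ homC A n V W :=
  op_mem_homC R.p_bicolinear (R.p_deg n) hf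

theorem homotopy_homC (f : V →ₗ[k] A ⊗[k] W) :
    dC (rTensor W R.h ∘ₗ f) + rTensor W R.h ∘ₗ dC f =
      f - rTensor W R.p ∘ₗ f := by
  have h : A.d ∘ₗ R.h + R.h ∘ₗ A.d = LinearMap.id - R.p := LinearMap.ext R.homotopy
  refine LinearMap.ext fun v => ?_
  change rTensor W A.d (rTensor W R.h (f v)) +
    rTensor W R.h (rTensor W A.d (f v)) = f v - rTensor W R.p (f v)
  rw [← rTensor_comp_apply, ← rTensor_comp_apply, ← LinearMap.add_apply,
    ← LinearMap.rTensor_add, h, LinearMap.rTensor_sub]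
  simp

end RelDGA.Retract

end general

namespace Connection

variable (V W X : Connection A)

/-- The filtration `⨁ (j ≥ c) V^j` of a connection. -/
def fil (c : ℤ) : Submodule k V.V := ⨆ j : {j : ℤ // c ≤ j}, V.piece j

theorem piece_le_fil {c j : ℤ} (h : c ≤ j) : V.piece j ≤ V.fil c :=
  le_iSup (fun j : {j : ℤ // c ≤ j} => V.piece j) ⟨j, h⟩

theorem fil_le {c : ℤ} {K : Submodule k V.V} (h : ∀ j, c ≤ j → V.piece j ≤ K) : V.fil c ≤ K :=
  iSup_le fun j => h j.1 j.2

theorem fil_antitone {c c' : ℤ} (h : c ≤ c') : V.fil c' ≤ V.fil c :=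
  V.fil_le fun _ hj => V.piece_le_fil (h.trans hj)

theorem exists_fil : ∃ N : ℕ, (∀ c : ℤ, c ≤ -N → V.fil c = ⊤) ∧ ∀ c : ℤ, N ≤ c → V.fil c = ⊥ := by
  have hfin := WellFoundedGT.finite_ne_bot_of_iSupIndep V.internal.submodule_iSupIndep
  obtain ⟨a, ha⟩ := hfin.bddBelow
  obtain ⟨b, hb⟩ := hfin.bddAbove
  refine ⟨a.natAbs + b.natAbs + 1, fun c hc => ?_, fun c hc => ?_⟩
  · refine top_unique (V.internal.submodule_iSup_eq_top ▸ iSup_le fun j => ?_)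
    by_cases hj : V.piece j = ⊥
    · rw [hj]
      exact bot_le
    · have := ha hj
      exact V.piece_le_fil (by omega)
  · refine bot_unique (V.fil_le fun j hj => ?_)
    by_contra h
    have := hb (show V.piece j ≠ ⊥ from fun h' => h h'.le)
    omega

theorem nabla_fil {c : ℤ} {v : V.V} (hv : v ∈ V.fil c) :
    V.nabla v ∈ subTensor ⊤ (V.fil (c + 1)) := by
  refine V.fil_le (K := (subTensor ⊤ (V.fil (c + 1))).comap V.nabla) (fun j hj x hx => ?_) hv
  exact subTensor_mono le_rfl (iSup_le fun i => V.piece_le_fil (by have := i.2; omega))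
    (V.nabla_strict j x hx)

/-- Induction along the filtration. -/
theorem fil_induction (K : Submodule k V.V) (hK : ∀ v, V.nabla v ∈ subTensor ⊤ K → v ∈ K)
    (v : V.V) : v ∈ K := by
  obtain ⟨N, h1, h2⟩ := V.exists_fil
  have h : ∀ i : ℕ, V.fil (N - i) ≤ K := by
    intro i
    induction i with
    | zero => rw [h2 _ (by simp)]; exact bot_le
    | succ i ih =>
      intro x hx
      refine hK x (subTensor_mono le_rfl ih ?_)
      have := V.nabla_fil hx
      rwa [show (N : ℤ) - (i + 1 : ℕ) + 1 = N - i by push_cast; ring] at this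
  refine h (2 * N) ?_
  rw [h1 _ (by push_cast; linarith)]
  trivial

/-- The homomorphisms that raise the filtration by `m`. -/
def homFil (m : ℤ) : Submodule k (V.V →ₗ[k] A ⊗[k] W.V) where
  carrier := {f | ∀ c, ∀ v ∈ V.fil c, f v ∈ subTensor ⊤ (W.fil (c + m))}
  add_mem' hf hg c v hv := add_mem (hf c v hv) (hg c v hv)
  zero_mem' _ _ _ := zero_mem _
  smul_mem' a _ hf c v hv := Submodule.smul_mem _ a (hf c v hv)

variable {V W X}

theorem homFil_mono {m n : ℤ} (h : m ≤ n) : homFil V W n ≤ homFil V W m :=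
  fun _ hf c v hv => subTensor_mono le_rfl (W.fil_antitone (by omega)) (hf c v hv)

theorem star_mem_homFil {m n : ℤ} {g : W.V →ₗ[k] A ⊗[k] X.V} {f : V.V →ₗ[k] A ⊗[k] W.V}
    (hg : g ∈ homFil W X m) (hf : f ∈ homFil V W n) : star g f ∈ homFil V X (n + m) := by
  intro c v hv
  refine mulTensor_mem_top (subTensor_map (P := ⊤) (f := LinearMap.id) (g := g) (fun _ h => h)
    (fun w hw => ?_) (hf c v hv))
  rw [← add_assoc]
  exact hg _ w hw

theorem op_mem_homFil (α : A →ₗ[k] A) {m : ℤ} {f : V.V →ₗ[k] A ⊗[k] W.V}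
    (hf : f ∈ homFil V W m) : rTensor W.V α ∘ₗ f ∈ homFil V W m :=
  fun c v hv => subTensor_map (P' := ⊤) (g := LinearMap.id) (fun _ _ => trivial) (fun _ h => h)
    (hf c v hv)

theorem nabla_mem_homFil : V.nabla ∈ homFil V V 1 := fun _ _ hv => V.nabla_fil hv

theorem star_mem_homFil_left {m n m' : ℤ} (h : m' ≤ n + m) {g : W.V →ₗ[k] A ⊗[k] X.V}
    {f : V.V →ₗ[k] A ⊗[k] W.V} (hg : g ∈ homFil W X m) (hf : f ∈ homFil V W n) :
    star g f ∈ homFil V X m' := homFil_mono h (star_mem_homFil hg hf)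

variable (V W) in
theorem exists_homFil : ∃ N : ℕ, homFil V W (-N) = ⊤ ∧ homFil V W N = ⊥ := by
  obtain ⟨M, hM, hM'⟩ := V.exists_fil
  obtain ⟨N, hN, hN'⟩ := W.exists_fil
  refine ⟨M + N, top_unique fun f _ c v hv => ?_, bot_unique fun f hf => ?_⟩
  · rcases le_or_gt (M : ℤ) c with h | h
    · rw [hM' c h, mem_bot] at hv
      rw [hv, map_zero]
      exact zero_mem _
    · rw [hN _ (by push_cast; omega)]
      exact mem_subTensor_top _
  · refine LinearMap.ext fun v => ?_
    have h := hf (-M) v (by rw [hM _ le_rfl]; trivial)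
    rw [hN' _ (by push_cast; omega)] at h
    refine subTensor_induction ⊥ (fun x _ y hy => ?_) h
    rw [(mem_bot k).1 hy, tmul_zero]
    exact zero_mem _

theorem flat' (V : Connection A) : dC V.nabla = star V.nabla V.nabla := by
  have h := V.flat
  simp only [compC, mul_one, Int.negOnePow_one, Units.val_neg, Units.val_one, neg_smul,
    one_smul] at h
  exact add_neg_eq_zero.1 h

theorem homD_apply (n : ℤ) (f : V.V →ₗ[k] A ⊗[k] W.V) : homD V W n f =
    dC f + ((n.negOnePow : ℤˣ) : ℤ) • star W.nabla f - star f V.nabla := by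
  have h : ((n.negOnePow : ℤˣ) : ℤ) * ((n.negOnePow : ℤˣ) : ℤ) = 1 := by
    rw [← Units.val_mul, ← Int.negOnePow_add, Int.negOnePow_even _ (Even.add_self n), Units.val_one]
  simp only [homD, compC, LinearMap.coe_mk, AddHom.coe_mk, one_mul, mul_one, smul_smul, h, one_smul]

theorem homD_mem {n : ℤ} {f : V.V →ₗ[k] A ⊗[k] W.V} (hf : f ∈ homC A n V.V W.V) :
    homD V W n f ∈ homC A (n + 1) V.V W.V := by
  rw [homD_apply]
  refine sub_mem (add_mem (dC_mem hf) (zsmul_mem (star_mem W.nabla_mem hf) _)) ?_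
  rw [add_comm]
  exact star_mem hf V.nabla_mem

theorem dC_zsmul {V W : FDComod k O} (c : ℤ) (f : V →ₗ[k] A ⊗[k] W) : dC (c • f) = c • dC f := by
  ext v
  simp [dC]

theorem dC_add {V W : FDComod k O} (f g : V →ₗ[k] A ⊗[k] W) : dC (f + g) = dC f + dC g :=
  op_add _ _ _

theorem dC_sub {V W : FDComod k O} (f g : V →ₗ[k] A ⊗[k] W) : dC (f - g) = dC f - dC g :=
  LinearMap.comp_sub _ _ _

theorem homD_homD {n n' : ℤ} (hn : n' = n + 1) {f : V.V →ₗ[k] A ⊗[k] W.V}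
    (hf : f ∈ homC A n V.V W.V) : homD V W n' (homD V W n f) = 0 := by
  subst hn
  have hs : ((n + 1).negOnePow : ℤˣ) = -n.negOnePow := Int.negOnePow_succ n
  have h : ((n.negOnePow : ℤˣ) : ℤ) * ((n.negOnePow : ℤˣ) : ℤ) = 1 := by
    rw [← Units.val_mul, ← Int.negOnePow_add, Int.negOnePow_even _ (Even.add_self n), Units.val_one]
  rw [homD_apply, homD_apply, hs, dC_sub, dC_add, dC_zsmul, dC_dC, dC_star W.nabla_mem hf,
    dC_star hf V.nabla_mem, flat', flat']
  simp only [star_add_left, star_add_right, star_sub_left, star_sub_right, star_zsmul_left,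
    star_zsmul_right, star_assoc W.nabla_mem W.nabla_mem hf, star_assoc W.nabla_mem hf V.nabla_mem,
    star_assoc hf V.nabla_mem V.nabla_mem, Units.val_neg, neg_smul, smul_add, smul_sub, smul_smul, h,
    one_smul, Int.negOnePow_one, Units.val_one, neg_mul]
  abel

/-- Homological reduction to the subspace of a retract: a homomorphism with differential in the
subspace is, up to a boundary, in the subspace. The homotopy is corrected along the filtration. -/
theorem exists_reduction (R : A.Retract) (hV : V.nabla ∈ R.valued V.V V.V)
    (hW : W.nabla ∈ R.valued W.V W.V) {n : ℤ} {f : V.V →ₗ[k] A ⊗[k] W.V}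
    (hf : f ∈ homC A n V.V W.V) (hD : homD V W n f ∈ R.valued V.V W.V) :
    ∃ y ∈ homC A (n + -1) V.V W.V, f - homD V W (n + -1) y ∈ R.valued V.V W.V := by
  obtain ⟨N, hN, hN'⟩ := exists_homFil V W
  have hn : n = n + -1 + 1 := by ring
  -- successive approximation: the error `r` is replaced by terms which contain a connection form,
  -- and these raise the filtration
  have key : ∀ i : ℕ, ∃ y ∈ homC A (n + -1) V.V W.V, ∃ g ∈ homC A n V.V W.V,
      g ∈ R.valued V.V W.V ∧ f - homD V W (n + -1) y - g ∈ homFil V W (-N + i) := by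
    intro i
    induction i with
    | zero => exact ⟨0, zero_mem _, 0, zero_mem _, zero_mem _, by simp [hN]⟩
    | succ i ih =>
      obtain ⟨y, hy, g, hg, hgR, hr⟩ := ih
      set r := f - homD V W (n + -1) y - g with hrdef
      have hrC : r ∈ homC A n V.V W.V := by
        refine sub_mem (sub_mem hf ?_) hg
        have := homD_mem hy
        rwa [← hn] at this
      have hgD : homD V W n g ∈ R.valued V.V W.V := by
        rw [homD_apply]
        exact sub_mem (add_mem (R.valued_d hgR) (zsmul_mem (R.valued_star W.nabla_mem hg hW hgR) _))
          (R.valued_star hg V.nabla_mem hgR hV)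
      have hrD : homD V W n r ∈ R.valued V.V W.V := by
        rw [hrdef, map_sub, map_sub, homD_homD hn hy, sub_zero]
        exact sub_mem hD hgD
      have hyh := R.h_mem_homC hrC
      refine ⟨y + rTensor W.V R.h ∘ₗ r, add_mem hy hyh,
        g + rTensor W.V R.p ∘ₗ r, add_mem hg (R.p_mem_homC hrC),
        add_mem hgR (R.valued_p r), ?_⟩
      have h1 := R.h_valued hrD
      rw [homD_apply, LinearMap.comp_sub, LinearMap.comp_add] at h1
      have h2 := R.homotopy_homC r
      have h3 : f - homD V W (n + -1) (y + rTensor W.V R.h ∘ₗ r) -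
          (g + rTensor W.V R.p ∘ₗ r) =
          -(((n.negOnePow : ℤˣ) : ℤ) • (rTensor W.V R.h ∘ₗ star W.nabla r)) +
          rTensor W.V R.h ∘ₗ star r V.nabla -
          (((n + -1).negOnePow : ℤˣ) : ℤ) • star W.nabla (rTensor W.V R.h ∘ₗ r) +
          star (rTensor W.V R.h ∘ₗ r) V.nabla := by
        have h4 : rTensor W.V R.h ∘ₗ (((n.negOnePow : ℤˣ) : ℤ) • star W.nabla r) =
            ((n.negOnePow : ℤˣ) : ℤ) • (rTensor W.V R.h ∘ₗ star W.nabla r) := by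
          ext v
          simp
        rw [h4] at h1
        rw [map_add, homD_apply (n + -1) (rTensor W.V R.h ∘ₗ r),
          show f = r + g + homD V W (n + -1) y by rw [hrdef]; abel]
        linear_combination (norm := abel) h1 - h2
      rw [h3]
      have e : (-N + (i + 1 : ℕ) : ℤ) = -N + i + 1 := by push_cast; ring
      have e' : (-N + (i + 1 : ℕ) : ℤ) = 1 + (-N + i) := by push_cast; ring
      have hs1 : star W.nabla r ∈ homFil V W (-N + (i + 1 : ℕ)) :=
        e ▸ star_mem_homFil nabla_mem_homFil hr
      have hs2 : star r V.nabla ∈ homFil V W (-N + (i + 1 : ℕ)) :=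
        e' ▸ star_mem_homFil hr nabla_mem_homFil
      have hh := op_mem_homFil R.h hr
      have hs3 : star W.nabla (rTensor W.V R.h ∘ₗ r) ∈ homFil V W (-N + (i + 1 : ℕ)) :=
        e ▸ star_mem_homFil nabla_mem_homFil hh
      have hs4 : star (rTensor W.V R.h ∘ₗ r) V.nabla ∈
          homFil V W (-N + (i + 1 : ℕ)) := e' ▸ star_mem_homFil hh nabla_mem_homFil
      exact add_mem (sub_mem (add_mem (neg_mem (zsmul_mem (op_mem_homFil R.h hs1) _))
        (op_mem_homFil R.h hs2)) (zsmul_mem hs3 _)) hs4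
  obtain ⟨y, hy, g, -, hgR, hr⟩ := key (2 * N)
  refine ⟨y, hy, ?_⟩
  rw [show (-N + (2 * N : ℕ) : ℤ) = N by push_cast; ring, hN', mem_bot, sub_eq_zero] at hr
  rw [hr]
  exact hgR

end Connection

end Filtration

/-! ### Gauge transformations, and the coaction of a flat connection -/

section Gauge

variable {k O : Type u} [Field k] [AddCommGroup O] [Module k O] [Coalgebra k O] {A : RelDGA k O}

theorem star_mem_of {V W X : FDComod k O} {p q n : ℤ} (h : q + p = n) {g : W →ₗ[k] A ⊗[k] X}
    {f : V →ₗ[k] A ⊗[k] W} (hg : g ∈ homC A p W X) (hf : f ∈ homC A q V W) :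
    star g f ∈ homC A n V X := h ▸ star_mem hg hf

theorem dC_mem_of {V W : FDComod k O} {q n : ℤ} (h : q + 1 = n) {f : V →ₗ[k] A ⊗[k] W}
    (hf : f ∈ homC A q V W) : dC f ∈ homC A n V W := h ▸ dC_mem hf

namespace Connection

variable {V : Connection A}

/-- A homomorphism which is unipotent for the filtration is invertible, by successive approximation
from both sides. -/
theorem exists_inverse {g : V.V →ₗ[k] A ⊗[k] V.V} (hg : g ∈ homC A 0 V.V V.V)
    (hg1 : g - idC A V.V ∈ homFil V V 1) :
    ∃ y ∈ homC A 0 V.V V.V, star g y = idC A V.V ∧ star y g = idC A V.V := by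
  obtain ⟨N, hN, hN'⟩ := exists_homFil V V
  have e (i : ℕ) : (-N + (i + 1 : ℕ) : ℤ) = -N + i + 1 := by push_cast; ring
  have hone := idC_mem (A := A) V.V
  have right : ∀ i : ℕ, ∃ y ∈ homC A 0 V.V V.V, idC A V.V - star g y ∈ homFil V V (-N + i) := by
    intro i
    induction i with
    | zero => exact ⟨0, zero_mem _, by simp [hN]⟩
    | succ i ih =>
      obtain ⟨y, hy, hr⟩ := ih
      have hrC : idC A V.V - star g y ∈ homC A 0 V.V V.V := sub_mem hone (star_mem_of (zero_add 0) hg hy)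
      refine ⟨y + (idC A V.V - star g y), add_mem hy hrC, ?_⟩
      have h := neg_mem (star_mem_homFil hg1 hr)
      rw [star_sub_left, idC_star hrC] at h
      rw [e, star_add_right]
      convert h using 1
      abel
  have left : ∀ i : ℕ, ∃ y ∈ homC A 0 V.V V.V, idC A V.V - star y g ∈ homFil V V (-N + i) := by
    intro i
    induction i with
    | zero => exact ⟨0, zero_mem _, by simp [hN]⟩
    | succ i ih =>
      obtain ⟨y, hy, hr⟩ := ih
      have hrC : idC A V.V - star y g ∈ homC A 0 V.V V.V := sub_mem hone (star_mem_of (zero_add 0) hy hg)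
      refine ⟨y + (idC A V.V - star y g), add_mem hy hrC, ?_⟩
      have h := neg_mem (star_mem_homFil hr hg1)
      rw [star_sub_right, star_idC hrC, add_comm] at h
      rw [e, star_add_left]
      convert h using 1
      abel
  have hN2 : (-N + (2 * N : ℕ) : ℤ) = N := by push_cast; ring
  obtain ⟨y, hy, h1⟩ := right (2 * N)
  obtain ⟨z, hz, h2⟩ := left (2 * N)
  rw [hN2, hN', mem_bot, sub_eq_zero] at h1 h2
  have h : z = y := by
    rw [← star_idC hz, h1, ← star_assoc hz hg hy, ← h2, idC_star hy]
  exact ⟨y, hy, h1.symm, h ▸ h2.symm⟩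

theorem p_dC {V W : FDComod k O} (R : A.Retract) (f : V →ₗ[k] A ⊗[k] W) :
    rTensor W R.p ∘ₗ dC f = dC (rTensor W R.p ∘ₗ f) := by
  have h : R.p ∘ₗ A.d = A.d ∘ₗ R.p := LinearMap.ext R.p_d
  rw [dC, dC, ← comp_assoc, ← comp_assoc, ← LinearMap.rTensor_comp,
    ← LinearMap.rTensor_comp, h]

/-- Every connection is gauge equivalent to one with values in the subspace of a retract. The gauge
transformation and the new connection are corrected along the filtration. -/
theorem exists_gauge (R : A.Retract) (V : Connection A) :
    ∃ g ∈ homC A 0 V.V V.V, ∃ b ∈ homC A 1 V.V V.V, g - idC A V.V ∈ homFil V V 1 ∧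
      b ∈ homFil V V 1 ∧ b ∈ R.valued V.V V.V ∧ dC b = star b b ∧
      dC g + star b g - star g V.nabla = 0 := by
  obtain ⟨N, -, hN⟩ := exists_homFil V V
  have hone := idC_mem (A := A) V.V
  -- successive approximation: `e` is the error of the gauge transformation, which is corrected by
  -- subtracting `h e` from `g` and `p e` from `b`
  have key : ∀ m : ℕ, ∃ g ∈ homC A 0 V.V V.V, ∃ b ∈ homC A 1 V.V V.V,
      g - idC A V.V ∈ homFil V V 1 ∧ b ∈ homFil V V 1 ∧ b ∈ R.valued V.V V.V ∧
      dC b - star b b ∈ homFil V V (1 + m) ∧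
      dC g + star b g - star g V.nabla ∈ homFil V V (1 + m) := by
    intro m
    induction m with
    | zero =>
      refine ⟨idC A V.V, hone, 0, zero_mem _, by simp, zero_mem _, zero_mem _, ?_, ?_⟩
      · simp [dC, star_zero_left]
      · rw [dC_idC, star_zero_left, idC_star V.nabla_mem]
        simpa using nabla_mem_homFil
    | succ m ih =>
      obtain ⟨g, hg, b, hb, hg1, hb1, hbR, hc, he⟩ := ih
      obtain ⟨e, hedef⟩ : ∃ e, e = dC g + star b g - star g V.nabla := ⟨_, rfl⟩
      obtain ⟨c, hcdef⟩ : ∃ c, c = dC b - star b b := ⟨_, rfl⟩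
      rw [← hedef] at he
      rw [← hcdef] at hc
      have heC : e ∈ homC A 1 V.V V.V := by
        rw [hedef]
        exact sub_mem (add_mem (dC_mem_of (zero_add 1) hg) (star_mem_of (zero_add 1) hb hg))
          (star_mem_of (add_zero 1) hg V.nabla_mem)
      have hcC : c ∈ homC A 2 V.V V.V := by
        rw [hcdef]
        exact sub_mem (dC_mem_of one_add_one_eq_two hb) (star_mem_of one_add_one_eq_two hb hb)
      have hcR : c ∈ R.valued V.V V.V := by
        rw [hcdef]
        exact sub_mem (R.valued_d hbR) (R.valued_star hb hb hbR hbR)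
      -- the Bianchi identity for the deviation from a closed homomorphism
      have hde : dC e = star b e + star e V.nabla + (star c (g - idC A V.V) + c) := by
        rw [star_sub_right c, star_idC hcC, sub_add_cancel, hedef, dC_sub, dC_add, dC_dC,
          dC_star hb hg, dC_star hg V.nabla_mem, flat', hcdef]
        simp only [star_add_left, star_add_right, star_sub_left, star_sub_right,
          star_assoc hb hb hg, star_assoc hb hg V.nabla_mem,
          star_assoc hg V.nabla_mem V.nabla_mem, Int.negOnePow_zero, Int.negOnePow_one,
          Units.val_neg, Units.val_one, neg_smul, one_smul]
        abel
      have hhC : rTensor V.V R.h ∘ₗ e ∈ homC A 0 V.V V.V  := by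
        have := R.h_mem_homC heC
        rwa [add_neg_cancel] at this
      have hpC := R.p_mem_homC heC
      have hhF := op_mem_homFil R.h he
      have hpF := op_mem_homFil R.p he
      have hot := R.homotopy_homC e
      have e2 : (1 + (m + 1 : ℕ) : ℤ) = 1 + m + 1 := by push_cast; ring
      have hF1 : star b e ∈ homFil V V (1 + (m + 1 : ℕ)) :=
        star_mem_homFil_left (by omega) hb1 he
      have hF2 : star e V.nabla ∈ homFil V V (1 + (m + 1 : ℕ)) :=
        star_mem_homFil_left (by omega) he nabla_mem_homFil
      have hF3 : star c (g - idC A V.V) ∈ homFil V V (1 + (m + 1 : ℕ)) :=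
        star_mem_homFil_left (by omega) hc hg1
      refine ⟨g - rTensor V.V R.h ∘ₗ e, sub_mem hg hhC,
        b - rTensor V.V R.p ∘ₗ e, sub_mem hb hpC, ?_, ?_, sub_mem hbR (R.valued_p e),
        ?_, ?_⟩
      · rw [sub_right_comm]
        exact sub_mem hg1 (homFil_mono (by omega) hhF)
      · exact sub_mem hb1 (homFil_mono (by omega) hpF)
      · have h1 := p_dC R e
        rw [hde, op_add, op_add, op_add, R.p_valued hcR] at h1
        have h2 : dC (b - rTensor V.V R.p ∘ₗ e) -
            star (b - rTensor V.V R.p ∘ₗ e) (b - rTensor V.V R.p ∘ₗ e) =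
            star b (rTensor V.V R.p ∘ₗ e) + star (rTensor V.V R.p ∘ₗ e) b -
            star (rTensor V.V R.p ∘ₗ e) (rTensor V.V R.p ∘ₗ e) -
            (rTensor V.V R.p ∘ₗ star b e + rTensor V.V R.p ∘ₗ star e V.nabla +
              rTensor V.V R.p ∘ₗ star c (g - idC A V.V)) := by
          rw [dC_sub, ← h1, star_sub_left, star_sub_right b,
            star_sub_right (rTensor V.V R.p ∘ₗ e)]
          linear_combination (norm := abel) -hcdef
        rw [h2]
        refine sub_mem (sub_mem (add_mem ?_ ?_) ?_) (add_mem (add_mem (op_mem_homFil _ hF1)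
          (op_mem_homFil _ hF2)) (op_mem_homFil _ hF3))
        · exact star_mem_homFil_left (by omega) hb1 hpF
        · exact star_mem_homFil_left (by omega) hpF hb1
        · exact star_mem_homFil_left (by omega) hpF hpF
      · rw [hde, op_add, op_add, op_add, R.h_valued hcR, add_zero] at hot
        have h2 : dC (g - rTensor V.V R.h ∘ₗ e) +
            star (b - rTensor V.V R.p ∘ₗ e) (g - rTensor V.V R.h ∘ₗ e) -
            star (g - rTensor V.V R.h ∘ₗ e) V.nabla =
            rTensor V.V R.h ∘ₗ star b e + rTensor V.V R.h ∘ₗ star e V.nabla +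
            rTensor V.V R.h ∘ₗ star c (g - idC A V.V) -
            star b (rTensor V.V R.h ∘ₗ e) -
            star (rTensor V.V R.p ∘ₗ e) (g - idC A V.V) +
            star (rTensor V.V R.p ∘ₗ e) (rTensor V.V R.h ∘ₗ e) +
            star (rTensor V.V R.h ∘ₗ e) V.nabla := by
          have h3 := star_sub_right (rTensor V.V R.p ∘ₗ e) g (idC A V.V)
          rw [star_idC hpC] at h3
          rw [dC_sub, star_sub_left, star_sub_right, star_sub_right, star_sub_left, h3]
          linear_combination (norm := abel) -hot - hedef
        rw [h2]
        refine add_mem (add_mem (sub_mem (sub_mem (add_mem (add_mem (op_mem_homFil _ hF1)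
          (op_mem_homFil _ hF2)) (op_mem_homFil _ hF3)) ?_) ?_) ?_) ?_
        · exact star_mem_homFil_left (by omega) hb1 hhF
        · exact star_mem_homFil_left (by omega) hpF hg1
        · exact star_mem_homFil_left (by omega) hpF hhF
        · exact star_mem_homFil_left (by omega) hhF nabla_mem_homFil
  obtain ⟨g, hg, b, hb, hg1, hb1, hbR, hc, he⟩ := key N
  have h := homFil_mono (V := V) (W := V) (show (N : ℤ) ≤ 1 + N by omega)
  rw [hN] at h
  exact ⟨g, hg, b, hb, hg1, hb1, hbR, sub_eq_zero.1 ((mem_bot k).1 (h hc)),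
    (mem_bot k).1 (h he)⟩

end Connection

end Gauge

section FlatBar

variable {k O : Type u} [Field k] [AddCommGroup O] [Module k O] [Coalgebra k O] {A : RelDGA k O}

variable {Y Z : Type u} [AddCommGroup Y] [Module k Y] [AddCommGroup Z] [Module k Z]

theorem slice_barStep (φ : Y →ₗ[k] k) (w : A ⊗[k] (BarTot A ⊗[k] Y)) :
    slice (BarTot A) φ (barStep A Y w) =
      barCons A (lTensor A (barWord A A.sgn ∘ₗ slice (BarTot A) φ) w) := by
  refine ext_threefold (F := slice (BarTot A) φ ∘ₗ barStep A Y)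
    (G := barCons A ∘ₗ lTensor A (barWord A A.sgn ∘ₗ slice (BarTot A) φ))
    (fun a x y => ?_) w
  simp [barStep_tmul, slice_tmul]

theorem rTensor_barLetter_step (w : A ⊗[k] (BarTot A ⊗[k] Y)) :
    rTensor Y (barLetter A) (barStep A Y w) =
      lTensor A (sliceL Y (barCounit A)) w := by
  refine ext_threefold (F := rTensor Y (barLetter A) ∘ₗ barStep A Y)
    (G := lTensor A (sliceL Y (barCounit A))) (fun a x y => ?_) w
  rw [comp_apply, barStep_tmul, rTensor_tmul, barLetter_cons, slice_tmul,
    barCounit_word, lTensor_tmul, sliceL_tmul, TensorProduct.smul_tmul]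

theorem rTensor_step_eq_zero {F : BarTot A →ₗ[k] Z} (hF : ∀ x, F (barCons A x) = 0)
    (w : A ⊗[k] (BarTot A ⊗[k] Y)) : rTensor Y F (barStep A Y w) = 0 := by
  refine ext_threefold (F := rTensor Y F ∘ₗ barStep A Y) (G := 0) (fun a x y => ?_) w
  rw [comp_apply, barStep_tmul, rTensor_tmul, hF, zero_tmul]
  rfl

/-- The comultiplication of a bar word with a prepended letter. -/
theorem coactLeft_barComul_step (w : A ⊗[k] (BarTot A ⊗[k] Y)) :
    coactLeft (barComul A) Y (barStep A Y w) =
      map (barZero A) (barStep A Y) (coactLeft A.coactL (BarTot A ⊗[k] Y) w) +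
        barStep A (BarTot A ⊗[k] Y) (lTensor A (coactLeft (barComul A) Y) w) := by
  refine ext_threefold (F := coactLeft (barComul A) Y ∘ₗ barStep A Y)
    (G := map (barZero A) (barStep A Y) ∘ₗ coactLeft A.coactL (BarTot A ⊗[k] Y) +
      barStep A (BarTot A ⊗[k] Y) ∘ₗ lTensor A (coactLeft (barComul A) Y))
    (fun a x y => ?_) w
  rw [comp_apply, LinearMap.add_apply, comp_apply, comp_apply,
    barStep_tmul, lTensor_tmul]
  simp only [coactLeft, comp_apply, rTensor_tmul, LinearEquiv.coe_coe]
  rw [barComul_cons, add_tmul, map_add, lTensor_tmul,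
    barComul_word RelDGA.sgn_bicolinear (fun _ => rfl)]
  congr 1
  · rw [coactLeft, comp_apply, rTensor_tmul]
    generalize A.coactL a = t
    induction t with
    | zero => simp
    | add t t' h h' => simp only [add_tmul, map_add, h, h']
    | tmul f a => simp [barStep_tmul]
  · generalize barComul A x = t
    induction t with
    | zero => simp
    | add t t' h h' =>
      simp only [add_tmul, tmul_add, map_add, h, h']
    | tmul p q => simp [barStep_tmul, barJoin_tmul, barWord_sgn_sgn]

namespace Connection

/-- The fixed point equation for the coaction of the bar complex attached to a connection: a bar
word starts with the coaction of `O`, or with a letter of `-∇`. -/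
theorem exists_fixedPoint (V : Connection A) : ∃ ρ : V.V →ₗ[k] BarTot A ⊗[k] V.V, ∀ v,
    ρ v = rTensor V.V (barZero A) (V.V.coact v) -
      barStep A V.V (lTensor A ρ (V.nabla v)) := by
  obtain ⟨N, h1, h2⟩ := V.exists_fil
  -- the connection raises the filtration, so that the equation can be solved from the top
  have key : ∀ i : ℕ, ∃ ρ : V.V →ₗ[k] BarTot A ⊗[k] V.V, ∀ v ∈ V.fil (N - i),
      ρ v = rTensor V.V (barZero A) (V.V.coact v) -
        barStep A V.V (lTensor A ρ (V.nabla v)) := by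
    intro i
    induction i with
    | zero =>
      refine ⟨0, fun v hv => ?_⟩
      rw [h2 _ (by simp), mem_bot] at hv
      simp [hv]
    | succ i ih =>
      obtain ⟨ρ, hρ⟩ := ih
      refine ⟨rTensor V.V (barZero A) ∘ₗ V.V.coact -
        barStep A V.V ∘ₗ lTensor A ρ ∘ₗ V.nabla, fun v hv => ?_⟩
      have h := V.nabla_fil hv
      rw [show (N : ℤ) - (i + 1 : ℕ) + 1 = N - i by push_cast; ring] at h
      refine congrArg (fun t => rTensor V.V (barZero A) (V.V.coact v) -
        barStep A V.V t) ?_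
      exact map_eq_on_subTensor (f := LinearMap.id) (f' := LinearMap.id) (fun _ _ => rfl)
        (fun w hw => hρ w hw) h
  obtain ⟨ρ, hρ⟩ := key (2 * N)
  exact ⟨ρ, fun v => hρ v (by rw [h1 _ (by push_cast; linarith)]; trivial)⟩

variable {V : Connection A} {R : A.Retract} (ε : A.Augmentation)

/-- The coefficients of the coaction attached to a flat connection with values in the subspace of a
retract are closed bar words with letters of degree one. The terms of their differential in which a
letter is differentiated or two letters are multiplied cancel by flatness. -/
theorem coefficient_mem_core (hV : V.nabla ∈ R.valued V.V V.V) {X : V.V →ₗ[k] BarTot A}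
    {x : V.V →ₗ[k] O} (hx : ∀ v, comul (R := k) (x v) = lTensor O x (V.V.coact v))
    (hX : ∀ v, X v = barZero A (x v) -
      barCons A (lTensor A (barWord A A.sgn ∘ₗ X) (V.nabla v))) (v : V.V) :
    X v ∈ R.core ε := by
  have hs : ∀ y, barLam A (barWord A A.sgn y) = lTensor O (barWord A A.sgn) (barLam A y) :=
    barLam_word RelDGA.sgn_bicolinear
  have hcol : ∀ v, barLam A (X v) = lTensor O X (V.V.coact v) := by
    intro v
    have hXe : X = barZero A ∘ₗ x -
        barCons A ∘ₗ lTensor A (barWord A A.sgn ∘ₗ X) ∘ₗ V.nabla := LinearMap.ext hX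
    have hn : coactLeft A.coactL V.V (V.nabla v) = lTensor O V.nabla (V.V.coact v) :=
      LinearMap.congr_fun V.nabla_mem.1 v
    have hl : ∀ t, barLam A (barWord A A.sgn t) = lTensor O (barWord A A.sgn)
      (barLam A t) := hs
    conv_rhs => rw [hXe, LinearMap.lTensor_sub]
    rw [hX v, map_sub, barLam_zero, barLam_cons, hx, coactLeft_lTensor, hn, LinearMap.sub_apply]
    simp only [← lTensor_comp_apply]
  have hun : ∀ v, barUncons A (X v) =
      -lTensor A (barWord A A.sgn ∘ₗ X) (V.nabla v) := by
    intro v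
    rw [hX, map_sub]
    simp
  have hdeg := fun v => (V.nabla_mem.2 v).2
  have h1 : ∀ v, X v ∈ barTotSub A := by
    refine fun v => V.fil_induction ((barTotSub A).comap X) (fun v hv => ?_) v
    rw [mem_comap, hX]
    refine sub_mem (barZero_mem _) (barCons_mem_iff.2 ⟨?_, ?_⟩)
    · refine map_mem_cotensor (α := LinearMap.id) (fun x => by simp)
        (Q := ⊤) (fun y _ => ?_) (V.nabla_mem.2 v).1 (mem_subTensor_top _)
      rw [comp_apply, hs, hcol, ← lTensor_comp_apply]
    · exact subTensor_map (P' := ⊤) (Q' := barTotSub A) (f := LinearMap.id) (fun _ h => h)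
        (fun y hy => barWord_mem RelDGA.sgn_bicolinear (x := X y) hy) hv
  have h2 : barWord A R.lin (X v) = X v := by
    refine V.fil_induction (eqLocus (barWord A R.lin ∘ₗ X) X) (fun v hv => ?_) v
    have hB := subTensor_inf (subTensor_inf_left (hV v) (hdeg v)) hv
    rw [LinearMap.mem_eqLocus, comp_apply, hX, map_sub, barWord_zero, barWord_cons,
      map_lTensor_eq]
    refine congrArg (fun t => barZero A (x v) - barCons A t)
      (map_eq_on_subTensor (f' := LinearMap.id) (fun a ha => ?_) (fun y hy => ?_) hB)
    · have ha' := Submodule.mem_inf.1 ha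
      exact (congrArg R.p (RelDGA.proj_of_mem ha'.2)).trans (R.p_eq a ha'.1)
    · have hc : ∀ a, R.lin (A.sgn a) = A.sgn (R.lin a) := fun a =>
        (congrArg R.p (RelDGA.proj_sgn 1 a)).trans (R.p_sgn _).symm
      rw [comp_apply, comp_apply, barWord_comm hc]
      exact congrArg (barWord A A.sgn) hy
  refine R.mem_core.2 ⟨h1 v, h2, ?_⟩
  have hχ : ∀ v, sliceL V.V ε.char (V.nabla v) = 0 := fun v =>
    eq_on_subTensor (F := sliceL V.V ε.char) (G := 0) (fun a ha w _ => by
      rw [sliceL_tmul, ← ε.char_proj, RelDGA.proj_of_ne one_ne_zero ha, map_zero, zero_smul]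
      rfl) (hdeg v)
  have hhead : ∀ v, barHead ε (X v) = 0 := fun v => by
    rw [barHead, comp_apply, comp_apply, hun, map_neg, sliceL_lTensor, hχ]
    simp
  refine V.fil_induction (LinearMap.ker (barD A ε ∘ₗ X)) (fun v hv => ?_) v
  rw [mem_ker, comp_apply, barD_eq, hhead, add_zero]
  have e1 : rTensor (BarTot A) A.d
      (lTensor A (barWord A A.sgn ∘ₗ X) (V.nabla v)) =
      lTensor A (barWord A A.sgn ∘ₗ X) (star V.nabla V.nabla v) := by
    rw [rTensor_lTensor]
    exact congrArg _ (LinearMap.congr_fun V.flat' v)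
  have e2 : map A.sgn (barDer A A.d A.sgn)
      (lTensor A (barWord A A.sgn ∘ₗ X) (V.nabla v)) =
      map A.sgn (barTail ε)
      (lTensor A (barWord A A.sgn ∘ₗ X) (V.nabla v)) := by
    rw [map_lTensor_eq, map_lTensor_eq]
    refine map_eq_on_subTensor (fun _ _ => rfl) (fun y hy => ?_) hv
    have hy' : barD A ε (X y) = 0 := hy
    rw [barD_eq, hhead, add_zero] at hy'
    have h3 := barSgn_der (X y)
    change barDer A A.d A.sgn (barWord A A.sgn (X y)) = barTail ε (barWord A A.sgn (X y))
    rw [barTail_sgn (h1 y), ← neg_eq_iff_eq_neg.2 h3, ← map_neg]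
    exact congrArg (barWord A A.sgn) (neg_eq_of_add_eq_zero_right hy')
  have e3 : map A.sgn (barWord A A.sgn)
      (lTensor A (barWord A A.sgn ∘ₗ X) (V.nabla v)) =
      -lTensor A X (V.nabla v) := by
    rw [map_lTensor_eq, lTensor, ← map_neg_left]
    refine map_eq_on_subTensor (fun a ha => ?_) (fun y _ => barWord_sgn_sgn _) (hdeg v)
    rw [RelDGA.sgn_apply ha]
    simp
  have e4 : barAct ε (lTensor A X (V.nabla v)) =
      -barCons A (lTensor A (barWord A A.sgn ∘ₗ X) (star V.nabla V.nabla v)) := by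
    have hd : slice A (barCounit A) (lTensor A X (V.nabla v)) ∈ A.deg 1 :=
      slice_mem (Q := ⊤) (subTensor_map (Q' := ⊤) (f := LinearMap.id) (fun _ h => h) (fun _ _ => trivial)
        (hdeg v)) _
    have hu : barUncons A ∘ₗ X =
        -(lTensor A (barWord A A.sgn ∘ₗ X) ∘ₗ V.nabla) := LinearMap.ext hun
    rw [barAct_apply, ← ε.left_proj, RelDGA.proj_of_ne one_ne_zero hd, map_zero, map_zero, zero_add,
      ← lTensor_comp_apply, hu, LinearMap.lTensor_neg, LinearMap.neg_apply, map_neg,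
      map_neg, lTensor_comp_apply, mulTensor_lTensor]
    rfl
  rw [hX, map_sub, map_sub, barDer_zero, barTail_zero, barDer_cons, barTail_cons, e1, e2, e3,
    map_neg, e4]
  abel

/-- A connection with values in the subspace of a retract is the connection of a coaction of the
coalgebra of closed bar words. -/
theorem exists_barCoaction (hV : V.nabla ∈ R.valued V.V V.V) :
    ∃ ρ : V.V →ₗ[k] BarTot A ⊗[k] V.V, IsBarCoaction R ε ρ ∧ zeroPart ρ = V.V.coact ∧
      letterPart ρ = -V.nabla := by
  obtain ⟨ρ, hρ⟩ := V.exists_fixedPoint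
  have hz : zeroPart ρ = V.V.coact := by
    refine LinearMap.ext fun v => ?_
    rw [zeroPart, comp_apply, hρ, map_sub, rTensor_step_eq_zero barPrZero_cons,
      ← rTensor_comp_apply, barPrZero_comp_zero]
    simp
  have hc : ∀ v, sliceL V.V (barCounit A) (ρ v) = v := by
    intro v
    have h1 : sliceL V.V (barCounit A) (barStep A V.V (lTensor A ρ (V.nabla v))) = 0 := by
      rw [sliceL, comp_apply, rTensor_step_eq_zero barCounit_cons, map_zero]
    have h2 : barCounit A ∘ₗ barZero A = counit := LinearMap.ext barCounit_zero
    rw [hρ, map_sub, h1, sub_zero, rTensor, sliceL_map, h2]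
    exact V.V.isCoaction.counit_apply v
  have hco : ∀ v, coactLeft comul V.V (V.V.coact v) =
      lTensor O V.V.coact (V.V.coact v) := V.V.isCoaction.coassoc_apply
  refine ⟨ρ, ⟨fun v => ?_, hc, fun v => mem_subTensor_of_slice fun φ => ?_⟩, hz,
    LinearMap.ext fun v => ?_⟩
  · refine V.fil_induction (eqLocus (coactLeft (barComul A) V.V ∘ₗ ρ)
      (lTensor (BarTot A) ρ ∘ₗ ρ)) (fun v hv => ?_) v
    have hn : coactLeft A.coactL V.V (V.nabla v) = lTensor O V.nabla (V.V.coact v) :=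
      LinearMap.congr_fun V.nabla_mem.1 v
    have h1 : lTensor A (coactLeft (barComul A) V.V) (lTensor A ρ (V.nabla v)) =
        lTensor A (lTensor (BarTot A) ρ) (lTensor A ρ (V.nabla v)) := by
      rw [← lTensor_comp_apply, ← lTensor_comp_apply]
      exact map_eq_on_subTensor (fun _ _ => rfl) (fun y hy => hy) hv
    have h2 : coactLeft (barComul A) V.V (rTensor V.V (barZero A) (V.V.coact v)) =
        map (barZero A) (rTensor V.V (barZero A) ∘ₗ V.V.coact)
          (V.V.coact v) := by
      refine (coactLeft_map₂ (γ := barZero A) barComul_zero LinearMap.id _).trans ?_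
      rw [hco, map_lTensor_eq]
      rfl
    have hρe : ρ = rTensor V.V (barZero A) ∘ₗ V.V.coact +
        -(barStep A V.V ∘ₗ lTensor A ρ ∘ₗ V.nabla) :=
      LinearMap.ext fun v => (hρ v).trans (sub_eq_add_neg _ _)
    have h3 : lTensor (BarTot A) ρ (rTensor V.V (barZero A) (V.V.coact v)) =
        map (barZero A) (rTensor V.V (barZero A) ∘ₗ V.V.coact)
          (V.V.coact v) - map (barZero A) (barStep A V.V ∘ₗ lTensor A ρ ∘ₗ
            V.nabla) (V.V.coact v) := by
      have h4 : lTensor (BarTot A) ρ (rTensor V.V (barZero A) (V.V.coact v)) =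
          map (barZero A) ρ (V.V.coact v) := by
        refine (map_map_eq _ _ _ _ _).trans ?_
        rfl
      rw [h4]
      conv_lhs => rw [hρe]
      rw [TensorProduct.map_add_right, LinearMap.add_apply, map_neg_right,
        ← sub_eq_add_neg]
    rw [LinearMap.mem_eqLocus, comp_apply, comp_apply, hρ v, map_sub, map_sub,
      h2, h3, coactLeft_barComul_step, lTensor_barStep, h1, coactLeft_lTensor, hn,
      ← lTensor_comp_apply, map_lTensor_eq]
    abel
  · refine coefficient_mem_core ε hV (X := slice (BarTot A) φ ∘ₗ ρ) (x := slice O φ ∘ₗ V.V.coact)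
      (fun v => ?_) (fun v => ?_) v
    · rw [comp_apply, ← slice_coactLeft, hco, ← lTensor_comp_apply]
    · rw [comp_apply, hρ, map_sub, slice_rTensor, slice_barStep,
        ← lTensor_comp_apply]
      rfl
  · have h1 : barLetter A ∘ₗ barZero A = 0 := LinearMap.ext fun f => barLetter_zero f
    have h2 : sliceL V.V (barCounit A) ∘ₗ ρ = LinearMap.id := LinearMap.ext hc
    rw [letterPart, comp_apply, hρ, map_sub, rTensor_barLetter_step,
      ← rTensor_comp_apply, h1, ← lTensor_comp_apply, h2]
    simp

end Connection

end FlatBar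

/-! ### Comodules over the cohomology coalgebra -/

section Pieces

variable {k O : Type u} [Field k] [AddCommGroup O] [Module k O] [Coalgebra k O] {A : RelDGA k O}

theorem coactLeft_mem {C M N : Type u} [AddCommGroup C] [Module k C] [AddCommGroup M] [Module k M]
    [AddCommGroup N] [Module k N] (lam : M →ₗ[k] C ⊗[k] M) {P : Submodule k N} {t : M ⊗[k] N}
    (ht : t ∈ subTensor ⊤ P) : coactLeft lam N t ∈ subTensor ⊤ (subTensor ⊤ P) := by
  refine subTensor_induction ((subTensor ⊤ (subTensor ⊤ P)).comap (coactLeft lam N))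
    (fun x _ y hy => ?_) ht
  rw [mem_comap, coactLeft_tmul]
  exact subTensor_map (P := ⊤) (Q := ⊤) (P' := ⊤) (Q' := subTensor ⊤ P) (f := LinearMap.id)
    (fun _ h => h) (fun m _ => tmul_mem_subTensor Submodule.mem_top hy) (mem_subTensor_top _)

theorem assoc_mem {L M N : Type u} [AddCommGroup L] [Module k L] [AddCommGroup M] [Module k M]
    [AddCommGroup N] [Module k N] {P : Submodule k M} {t : (L ⊗[k] M) ⊗[k] N}
    (ht : t ∈ subTensor (subTensor ⊤ P) ⊤) :
    TensorProduct.assoc k L M N t ∈ subTensor ⊤ (subTensor P ⊤) := by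
  refine subTensor_induction ((subTensor ⊤ (subTensor P ⊤)).comap
    (TensorProduct.assoc k L M N).toLinearMap) (fun w hw y _ => ?_) ht
  refine subTensor_induction ((subTensor ⊤ (subTensor P ⊤)).comap
    ((TensorProduct.assoc k L M N).toLinearMap ∘ₗ (TensorProduct.mk k (L ⊗[k] M) N).flip y))
    (fun a _ b hb => ?_) hw
  exact tmul_mem_subTensor trivial (tmul_mem_subTensor hb trivial)

section socle

variable {V : FDComod k O} (n : V →ₗ[k] A ⊗[k] V)

/-- The ascending filtration whose first step is the kernel of `n`, and whose further steps are
obtained in the same way from the quotients. -/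
def socle : ℕ → Submodule k V
  | 0 => ⊥
  | i + 1 => (subTensor ⊤ (socle i)).comap n

theorem mem_socle_succ {i : ℕ} {v : V} :
    v ∈ socle n (i + 1) ↔ n v ∈ subTensor ⊤ (socle n i) := Iff.rfl

theorem socle_mono : Monotone (socle n) := by
  refine monotone_nat_of_le_succ fun i => ?_
  induction i with
  | zero => exact bot_le
  | succ i ih => exact fun v hv => subTensor_mono le_rfl ih hv

variable {n}

theorem socle_isSubcomodule (hn : n ∈ homC A 1 V V) (i : ℕ) : V.IsSubcomodule (socle n i) := by
  intro v hv
  cases i with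
  | zero =>
    rw [(mem_bot k).1 hv, map_zero]
    exact zero_mem _
  | succ i =>
    have h : coactLeft A.coactL V (n v) = lTensor O n (V.coact v) :=
      LinearMap.congr_fun hn.1 v
    refine mem_subTensor_of_sliceL fun ψ => ?_
    rw [mem_socle_succ, ← sliceL_lTensor, ← h]
    exact sliceL_mem (coactLeft_mem _ hv) ψ

/-- If the comodules over `O` are completely reducible, the filtration by socles splits, and a
nilpotent connection form is strictly triangular for a direct sum decomposition. -/
theorem exists_pieces (hcr : ∀ (V : FDComod k O) (U : Submodule k V), V.IsSubcomodule U →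
    ∃ U' : Submodule k V, V.IsSubcomodule U' ∧ IsCompl U U') (hn : n ∈ homC A 1 V V)
    (hN : ∃ N, socle n N = ⊤) :
    ∃ piece : ℤ → Submodule k V, DirectSum.IsInternal piece ∧ (∀ i, V.IsSubcomodule (piece i)) ∧
      ∀ i, ∀ v ∈ piece i, n v ∈ subTensor ⊤ (⨆ j : {j : ℤ // i < j}, piece j) := by
  classical
  choose C hC hC' using fun i => hcr V (socle n i) (socle_isSubcomodule hn i)
  -- The piece of index `-i` is a complement of the `i`-th socle in the next one; the negative
  -- indices make the form raise the index.
  obtain ⟨piece, hp⟩ : ∃ piece : ℤ → Submodule k V, ∀ j, piece j =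
      if j ≤ 0 then socle n ((-j).toNat + 1) ⊓ C (-j).toNat else ⊥ := ⟨_, fun _ => rfl⟩
  have hle : ∀ i : ℕ, ∀ m : ℤ, m + i ≤ 0 → socle n i ≤ ⨆ j : {j : ℤ // m < j}, piece j := by
    intro i
    induction i with
    | zero => exact fun m _ => bot_le
    | succ i ih =>
      intro m hm v hv
      obtain ⟨a, ha, b, hb, rfl⟩ := Submodule.mem_sup.1
        (((hC' i).sup_eq_top ▸ trivial : v ∈ socle n i ⊔ C i))
      refine add_mem (ih m (by push_cast at hm; omega) ha) ?_
      refine mem_iSup_of_mem ⟨-(i : ℤ), by push_cast at hm; omega⟩ ?_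
      rw [hp, if_pos (by simp), neg_neg, Int.toNat_natCast]
      refine ⟨?_, hb⟩
      have := sub_mem hv (socle_mono n (Nat.le_succ i) ha)
      rwa [add_sub_cancel_left] at this
  have hsoc : ∀ j, piece j ≤ socle n ((-j).toNat + 1) := by
    intro j
    rw [hp]
    split_ifs
    · exact inf_le_left
    · exact bot_le
  have hpos : ∀ j, 0 < j → piece j = ⊥ := fun j hj => by rw [hp, if_neg (by omega)]
  refine ⟨piece, ?_, fun j v hv => ?_, fun j v hv => ?_⟩
  · refine DirectSum.isInternal_submodule_of_iSupIndep_of_iSup_eq_top ?_ ?_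
    · rw [iSupIndep_iff_finsetSum_eq_zero_imp_eq_zero]
      intro s v hv hsum
      by_contra! hne
      obtain ⟨i₀, hi₀, hi₀'⟩ := hne
      -- the nonzero component of lowest index lies both in a socle and in its complement
      obtain ⟨j, hj, hmin⟩ := Finset.exists_min_image (s.filter fun i => v i ≠ 0) id
        ⟨i₀, Finset.mem_filter.2 ⟨hi₀, hi₀'⟩⟩
      rw [Finset.mem_filter] at hj
      have hj0 : j ≤ 0 := by
        by_contra h
        have := hv j hj.1
        rw [hpos j (by omega)] at this
        exact hj.2 ((mem_bot k).1 this)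
      have h1 : v j ∈ socle n (-j).toNat := by
        rw [← Finset.add_sum_erase s v hj.1] at hsum
        rw [eq_neg_of_add_eq_zero_left hsum]
        refine neg_mem (Submodule.sum_mem _ fun i hi => ?_)
        rw [Finset.mem_erase] at hi
        by_cases h0 : v i = 0
        · rw [h0]
          exact zero_mem _
        · have h2 : j ≤ i := hmin i (Finset.mem_filter.2 ⟨hi.2, h0⟩)
          have h3 : i ≤ 0 := by
            by_contra h
            have := hv i hi.2
            rw [hpos i (by omega)] at this
            exact h0 ((mem_bot k).1 this)
          have h4 := hi.1
          exact socle_mono n (by omega) (hsoc i (hv i hi.2))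
      have h2 : v j ∈ C (-j).toNat := by
        have := hv j hj.1
        rw [hp, if_pos hj0] at this
        exact this.2
      have h3 : v j ∈ (⊥ : Submodule k V) := (hC' _).inf_eq_bot ▸ ⟨h1, h2⟩
      exact hj.2 ((mem_bot k).1 h3)
    · obtain ⟨N, hN⟩ := hN
      refine top_unique (hN ▸ (hle N (-N) (by simp)).trans (iSup_le fun j => le_iSup piece j.1))
  · rw [hp] at hv ⊢
    split_ifs with h
    · rw [if_pos h] at hv
      exact Submodule.mem_inf.2 ⟨hv.1, hv.2⟩ |> fun h' => subTensor_inf_right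
        (socle_isSubcomodule hn _ v h'.1) (hC _ v h'.2)
    · rw [if_neg h] at hv
      rw [(mem_bot k).1 hv, map_zero]
      exact zero_mem _
  · by_cases h : j ≤ 0
    · refine subTensor_mono le_rfl (hle (-j).toNat j (by omega)) ?_
      exact (mem_socle_succ n).1 (hsoc j hv)
    · rw [hpos j (by omega)] at hv
      rw [(mem_bot k).1 hv, map_zero]
      exact zero_mem _

end socle

theorem barUncons_mem_barLen {i : ℕ} {x : BarTot A} (hx : x ∈ barLen A (i + 1)) :
    barUncons A x ∈ subTensor ⊤ (barLen A i) := by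
  refine barLen_succ_le (K := (subTensor ⊤ (barLen A i)).comap (barUncons A)) (fun f => ?_)
    (fun y hy => ?_) hx
  · simp
  · simpa using hy

theorem exists_barLen_tensor {U : Type u} [AddCommGroup U] [Module k U] (t : BarTot A ⊗[k] U) :
    ∃ i, t ∈ subTensor (barLen A i) ⊤ := by
  have hm : Monotone (barLen A) := monotone_nat_of_le_succ barLen_mono_succ
  induction t with
  | zero => exact ⟨0, zero_mem _⟩
  | tmul x u =>
    obtain ⟨i, hi⟩ := exists_mem_barLen x
    exact ⟨i, tmul_mem_subTensor hi trivial⟩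
  | add s t hs ht =>
    obtain ⟨i, hi⟩ := hs
    obtain ⟨j, hj⟩ := ht
    exact ⟨max i j, add_mem (subTensor_mono (hm (le_max_left i j)) le_rfl hi)
      (subTensor_mono (hm (le_max_right i j)) le_rfl hj)⟩

namespace IsBarCoaction

variable {R : A.Retract} {ε : A.Augmentation} {V : FDComod k O} {ρ : V →ₗ[k] BarTot A ⊗[k] V}

/-- The filtration by the length of the bar words in the coaction is finer than the one by socles,
so that the latter is exhaustive. -/
theorem mem_socle (hρ : IsBarCoaction R ε ρ) {i : ℕ} {v : V}
    (hv : ρ v ∈ subTensor (barLen A i) ⊤) : v ∈ socle (-letterPart ρ) i := by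
  induction i generalizing v with
  | zero =>
    have h : ρ v = 0 := by
      refine subTensor_induction (LinearMap.ker LinearMap.id) (fun x hx y _ => ?_) hv
      rw [(mem_bot k).1 hx, zero_tmul]
      exact zero_mem _
    have h2 := hρ.counit v
    rw [h, map_zero] at h2
    rw [← h2]
    exact zero_mem _
  | succ i ih =>
    refine (mem_socle_succ _).2 (neg_mem (mem_subTensor_of_sliceL fun ψ => ih ?_))
    have h1 : rTensor V (barUncons A) (ρ v) ∈
        subTensor (subTensor ⊤ (barLen A i)) ⊤ :=
      subTensor_map (g := LinearMap.id) (fun x hx => barUncons_mem_barLen hx) (fun _ h => h) hv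
    have h2 := sliceL_mem (assoc_mem h1) ψ
    rw [← hρ.uncons_eq, sliceL_lTensor] at h2
    have h3 : rTensor V (barWord A A.sgn) (rTensor V (barWord A A.sgn)
        (ρ (sliceL V ψ (letterPart ρ v)))) = ρ (sliceL V ψ (letterPart ρ v)) := by
      have h4 : barWord A A.sgn ∘ₗ barWord A A.sgn = LinearMap.id := LinearMap.ext barWord_sgn_sgn
      rw [← rTensor_comp_apply, h4]
      simp
    rw [← h3]
    exact subTensor_map (g := LinearMap.id) (fun x hx => barWord_mem_barLen _ hx) (fun _ h => h) h2

theorem exists_socle_eq_top (hρ : IsBarCoaction R ε ρ) : ∃ N, socle (-letterPart ρ) N = ⊤ := by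
  obtain ⟨N, hN⟩ := monotone_stabilizes_iff_noetherian.2 (inferInstance : IsNoetherian k V)
    ⟨socle (-letterPart ρ), socle_mono _⟩
  refine ⟨N, top_unique fun v _ => ?_⟩
  obtain ⟨i, hi⟩ := exists_barLen_tensor (ρ v)
  have h := socle_mono _ (le_max_right N i) (hρ.mem_socle hi)
  have h2 := hN (max N i) (le_max_left N i)
  exact (show socle (-letterPart ρ) N = socle (-letterPart ρ) (max N i) from h2) ▸ h

end IsBarCoaction

end Pieces

section CoreComodules

variable {k O : Type u} [Field k] [AddCommGroup O] [Module k O] [Coalgebra k O] {A : RelDGA k O}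
  {Q : Type u} [AddCommGroup Q] [Module k Q] [Coalgebra k Q]

/-- The embedding `ι` identifies the coalgebra `Q` with the coalgebra of closed bar words with
letters of degree one in the subspace of a retract. -/
structure IsCoreEmbedding (R : A.Retract) (ε : A.Augmentation) (ι : Q →ₗ[k] BarTot A) : Prop where
  injective : Function.Injective ι
  range_eq : LinearMap.range ι = R.core ε
  comul : ∀ q, map ι ι (Coalgebra.comul (R := k) q) = barComul A (ι q)
  counit : ∀ q, Coalgebra.counit (R := k) q = barCounit A (ι q)

namespace IsCoreEmbedding

variable {R : A.Retract} {ε : A.Augmentation} {ι : Q →ₗ[k] BarTot A}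

variable {U : Type u} [AddCommGroup U] [Module k U]

theorem coactLeft_rTensor (h : IsCoreEmbedding R ε ι) (t : Q ⊗[k] U) :
    coactLeft (barComul A) U (rTensor U ι t) =
      map ι (rTensor U ι) (coactLeft Coalgebra.comul U t) := by
  have e : rTensor U ι = map ι LinearMap.id := rfl
  rw [e]
  exact coactLeft_map₂ (lam := Coalgebra.comul) (lam' := barComul A) (γ := ι) (α := ι)
    (fun x => (h.comul x).symm) LinearMap.id t

theorem lTensor_rTensor_comp (σ : U →ₗ[k] Q ⊗[k] U) (t : Q ⊗[k] U) :
    lTensor (BarTot A) (rTensor U ι ∘ₗ σ) (rTensor U ι t) =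
      map ι (rTensor U ι) (lTensor Q σ t) := by
  induction t with
  | zero => simp only [map_zero]
  | tmul x y =>
    rw [rTensor_tmul, lTensor_tmul, lTensor_tmul,
      map_tmul, comp_apply]
  | add s t hs ht => rw [map_add, map_add, map_add, map_add, hs, ht]

theorem sliceL_barCounit (h : IsCoreEmbedding R ε ι) (t : Q ⊗[k] U) :
    sliceL U (barCounit A) (rTensor U ι t) = sliceL U Coalgebra.counit t := by
  have hη : barCounit A ∘ₗ ι = Coalgebra.counit := LinearMap.ext fun q => (h.counit q).symm
  rw [← hη]
  exact sliceL_map ι LinearMap.id (barCounit A) t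

/-- Comodules over `Q` are coactions of the bar complex with values in the closed words with letters
of degree one in the rigid subalgebra. -/
theorem isBarCoaction (h : IsCoreEmbedding R ε ι) {σ : U →ₗ[k] Q ⊗[k] U} (hσ : IsLeftCoaction σ) :
    IsBarCoaction R ε (rTensor U ι ∘ₗ σ) where
  coassoc u := by
    have hco : coactLeft Coalgebra.comul U (σ u) = lTensor Q σ (σ u) :=
      hσ.coassoc_apply u
    rw [comp_apply, h.coactLeft_rTensor, hco, lTensor_rTensor_comp]
  counit u := by
    rw [comp_apply, h.sliceL_barCounit]
    exact hσ.counit_apply u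
  mem u := by
    rw [← h.range_eq]
    exact map_mem_subTensor ι LinearMap.id (σ u) |> subTensor_mono le_rfl le_top

/-- The converse of `isBarCoaction`. -/
theorem isLeftCoaction (h : IsCoreEmbedding R ε ι) {σ : U →ₗ[k] Q ⊗[k] U}
    (hρ : IsBarCoaction R ε (rTensor U ι ∘ₗ σ)) : IsLeftCoaction σ where
  coassoc := by
    refine LinearMap.ext fun u => map_injective h.injective (rTensor_injective h.injective) ?_
    have h1 := hρ.coassoc u
    rw [comp_apply, h.coactLeft_rTensor, lTensor_rTensor_comp] at h1
    exact h1
  counit := by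
    refine LinearMap.ext fun u => ?_
    have h1 := hρ.counit u
    rw [comp_apply, h.sliceL_barCounit] at h1
    exact h1

/-- A coaction of the bar complex factors through `Q`. -/
theorem exists_coaction (h : IsCoreEmbedding R ε ι) {ρ : U →ₗ[k] BarTot A ⊗[k] U}
    (hρ : IsBarCoaction R ε ρ) :
    ∃ σ : U →ₗ[k] Q ⊗[k] U, IsLeftCoaction σ ∧ rTensor U ι ∘ₗ σ = ρ := by
  obtain ⟨l, hl⟩ := LinearMap.exists_leftInverse_of_injective ι (LinearMap.ker_eq_bot.2 h.injective)
  have hσ : rTensor U ι ∘ₗ (rTensor U l ∘ₗ ρ) = ρ := by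
    refine LinearMap.ext fun u => ?_
    rw [comp_apply, comp_apply, ← rTensor_comp_apply]
    refine (map_eq_on_subTensor (f' := LinearMap.id) (g' := LinearMap.id) (fun x hx => ?_)
      (fun _ _ => rfl) (hρ.mem u)).trans (by simp)
    rw [← h.range_eq] at hx
    obtain ⟨q, rfl⟩ := hx
    exact congrArg ι (LinearMap.congr_fun hl q)
  exact ⟨rTensor U l ∘ₗ ρ, h.isLeftCoaction (hσ.symm ▸ hρ), hσ⟩

end IsCoreEmbedding

end CoreComodules

/-! ### Strict homomorphisms of connections -/

section Strict

variable {k O : Type u} [Field k] [AddCommGroup O] [Module k O] [Coalgebra k O] {A : RelDGA k O}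

section comodules

variable {V W X : FDComod k O}

theorem idC_comp {e : V →ₗ[k] W} (he : ∀ v, W.coact (e v) = lTensor O e (V.coact v)) :
    idC A W ∘ₗ e = lTensor A e ∘ₗ idC A V := by
  refine LinearMap.ext fun v => ?_
  change rTensor W A.unit (W.coact (e v)) =
    lTensor A e (rTensor V A.unit (V.coact v))
  rw [he, rTensor_lTensor]

theorem comp_mem_homC {p : ℤ} {e : V →ₗ[k] W}
    (he : ∀ v, W.coact (e v) = lTensor O e (V.coact v)) {g : W →ₗ[k] A ⊗[k] X}
    (hg : g ∈ homC A p W X) : g ∘ₗ e ∈ homC A p V X := by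
  refine ⟨LinearMap.ext fun v => ?_, fun v => hg.2 (e v)⟩
  have h : coactLeft A.coactL X (g (e v)) = lTensor O g (W.coact (e v)) :=
    LinearMap.congr_fun hg.1 (e v)
  rw [he, ← lTensor_comp_apply] at h
  exact h

theorem lTensor_comp_mem_homC {p : ℤ} {e : W →ₗ[k] X}
    (he : ∀ v, X.coact (e v) = lTensor O e (W.coact v)) {f : V →ₗ[k] A ⊗[k] W}
    (hf : f ∈ homC A p V W) : lTensor A e ∘ₗ f ∈ homC A p V X := by
  refine ⟨LinearMap.ext fun v => ?_, fun v => ⟨?_, ?_⟩⟩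
  · have h : coactLeft A.coactL W (f v) = lTensor O f (V.coact v) :=
      LinearMap.congr_fun hf.1 v
    change coactLeft A.coactL X (lTensor A e (f v)) =
      lTensor O (lTensor A e ∘ₗ f) (V.coact v)
    rw [coactLeft_lTensor, h, ← lTensor_comp_apply]
  · exact mem_cotensor_map he (hf.2 v).1
  · exact subTensor_map (P' := A.deg p) (Q' := ⊤) (f := LinearMap.id) (fun _ h => h)
      (fun _ _ => Submodule.mem_top) (hf.2 v).2

theorem star_idC_comp {p : ℤ} {e : V →ₗ[k] W}
    (he : ∀ v, W.coact (e v) = lTensor O e (V.coact v)) {g : W →ₗ[k] A ⊗[k] X}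
    (hg : g ∈ homC A p W X) : star g (idC A W ∘ₗ e) = g ∘ₗ e := by
  refine Eq.trans (LinearMap.ext fun v => ?_) (star_idC (comp_mem_homC he hg))
  rw [idC_comp he]
  change mulTensor A.m X (lTensor A g (lTensor A e (idC A V v))) =
    mulTensor A.m X (lTensor A (g ∘ₗ e) (idC A V v))
  rw [lTensor_comp_apply]

theorem idC_comp_star {p : ℤ} {e : W →ₗ[k] X}
    (he : ∀ v, X.coact (e v) = lTensor O e (W.coact v)) {f : V →ₗ[k] A ⊗[k] W}
    (hf : f ∈ homC A p V W) : star (idC A X ∘ₗ e) f = lTensor A e ∘ₗ f := by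
  refine Eq.trans (LinearMap.ext fun v => ?_) (idC_star (lTensor_comp_mem_homC he hf))
  change mulTensor A.m X (lTensor A (idC A X ∘ₗ e) (f v)) =
    mulTensor A.m X (lTensor A (idC A X) (lTensor A e (f v)))
  rw [lTensor_comp_apply]

theorem sliceL_idC (ε : A.Augmentation) (v : V) : sliceL V ε.char (idC A V v) = v := by
  have h : ε.char ∘ₗ A.unit = counit := LinearMap.ext ε.char_unit
  refine (sliceL_map A.unit LinearMap.id ε.char (V.coact v)).trans ?_
  rw [h]
  exact V.isCoaction.counit_apply v

theorem idC_injective (ε : A.Augmentation) : Function.Injective (idC A V) := fun v w h => by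
  rw [← sliceL_idC ε v, h, sliceL_idC]

/-- A homomorphism of degree zero with values in the rigid part is a homomorphism of comodules. -/
theorem exists_eq_idC_comp (R : A.Retract) (ε : A.Augmentation) {g : V →ₗ[k] A ⊗[k] W}
    (hg : g ∈ homC A 0 V W) (hg' : g ∈ R.valued V W) : ∃ e : V →ₗ[k] W,
    (∀ v, W.coact (e v) = lTensor O e (V.coact v)) ∧ g = idC A W ∘ₗ e := by
  have h1 : ∀ v, idC A W (sliceL W ε.char (g v)) = g v := by
    intro v
    have h2 : g v ∈ subTensor (LinearMap.range A.unit) ⊤ := by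
      refine subTensor_mono (P := R.B ⊓ A.deg 0) (fun x hx => ?_) le_rfl
        (subTensor_inf_left (hg' v) (hg.2 v).2)
      exact R.exists_unit x (Submodule.mem_inf.1 hx).1 (Submodule.mem_inf.1 hx).2
    obtain ⟨z, hz⟩ : ∃ z : O ⊗[k] W, rTensor W A.unit z = g v := by
      refine subTensor_induction (LinearMap.range (rTensor W A.unit)) ?_ h2
      rintro _ ⟨x, rfl⟩ y _
      exact ⟨x ⊗ₜ y, by simp⟩
    have h3 : coactLeft comul W z = lTensor O W.coact z := by
      apply rTensor_injective R.unit_injective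
      rw [← rTensor_unit_coactMid, hz, mem_cotensor.1 (hg.2 v).1, ← hz, rTensor_lTensor]
    have h4 := sliceL_coactLeft (comul_isLeftCoaction k O) z
    rw [h3, sliceL_lTensor] at h4
    have h5 : sliceL W ε.char (g v) = sliceL W counit z := by
      have h : ε.char ∘ₗ A.unit = counit := LinearMap.ext ε.char_unit
      rw [← hz, ← h]
      exact sliceL_map A.unit LinearMap.id ε.char z
    rw [h5, ← hz]
    change rTensor W A.unit (W.coact (sliceL W counit z)) = _
    rw [h4]
  have h2 : g = idC A W ∘ₗ (sliceL W ε.char ∘ₗ g) := LinearMap.ext fun v => (h1 v).symm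
  refine ⟨sliceL W ε.char ∘ₗ g, fun v => ?_, h2⟩
  apply lTensor_injective (idC_injective (A := A) (V := W) ε)
  have h3 : coactLeft A.coactL W (g v) = lTensor O g (V.coact v) :=
    LinearMap.congr_fun hg.1 v
  have h4 : coactLeft A.coactL W (idC A W (sliceL W ε.char (g v))) =
      lTensor O (idC A W) (W.coact (sliceL W ε.char (g v))) :=
    LinearMap.congr_fun (idC_mem (A := A) W).1 _
  rw [h1 v, h3] at h4
  rw [← lTensor_comp_apply, ← h2]
  exact h4.symm

end comodules

namespace Connection

variable {V W X : Connection A}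

/-- A homomorphism of comodules which commutes with the connection forms. -/
structure IsStrict (V W : Connection A) (e : V.V →ₗ[k] W.V) : Prop where
  coact : ∀ v, W.V.coact (e v) = lTensor O e (V.V.coact v)
  nabla : ∀ v, W.nabla (e v) = lTensor A e (V.nabla v)

theorem isStrict_id : IsStrict V V LinearMap.id := ⟨fun v => by simp, fun v => by simp⟩

theorem IsStrict.comp {e : V.V →ₗ[k] W.V} {e' : W.V →ₗ[k] X.V} (he' : IsStrict W X e')
    (he : IsStrict V W e) : IsStrict V X (e' ∘ₗ e) :=
  ⟨fun v => by rw [comp_apply, he'.coact, he.coact, lTensor_comp_apply],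
    fun v => by rw [comp_apply, he'.nabla, he.nabla, lTensor_comp_apply]⟩

theorem dC_idC_comp {V W : FDComod k O} (e : V →ₗ[k] W) : dC (idC A W ∘ₗ e) = 0 := by
  have h : dC (idC A W ∘ₗ e) = dC (idC A W) ∘ₗ e := rfl
  rw [h, dC_idC, LinearMap.zero_comp]

theorem IsStrict.mem_homZ {e : V.V →ₗ[k] W.V} (he : IsStrict V W e) :
    idC A W.V ∘ₗ e ∈ homZ V W := by
  refine RelativeDGA.mem_homZ.2 ⟨comp_mem_homC he.coact (idC_mem W.V), ?_⟩
  rw [dC_idC_comp, star_idC_comp he.coact W.nabla_mem, idC_comp_star he.coact V.nabla_mem,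
    LinearMap.ext (f := W.nabla ∘ₗ e) (g := lTensor A e ∘ₗ V.nabla) he.nabla]
  simp

/-- The homotopy class of a strict homomorphism. -/
def IsStrict.hom {e : V.V →ₗ[k] W.V} (he : IsStrict V W e) : V ⟶ W :=
  Quotient.mk (homotopic V W) ⟨idC A W.V ∘ₗ e, he.mem_homZ⟩

theorem isStrict_id_hom : (isStrict_id (V := V)).hom = CategoryTheory.CategoryStruct.id V := rfl

theorem IsStrict.hom_comp {e : V.V →ₗ[k] W.V} {e' : W.V →ₗ[k] X.V} (he' : IsStrict W X e')
    (he : IsStrict V W e) :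
    CategoryTheory.CategoryStruct.comp he.hom he'.hom = (he'.comp he).hom := by
  refine congrArg (Quotient.mk (homotopic V X)) (Subtype.ext ?_)
  refine (compC_zero_zero _ _).trans ?_
  exact star_idC_comp he.coact (comp_mem_homC he'.coact (idC_mem X.V))

/-- Mutually inverse strict homomorphisms give an isomorphism. -/
def strictIso {e : V.V →ₗ[k] W.V} {e' : W.V →ₗ[k] V.V} (he : IsStrict V W e)
    (he' : IsStrict W V e') (h : e' ∘ₗ e = LinearMap.id) (h' : e ∘ₗ e' = LinearMap.id) :
    V ≅ W where
  hom := he.hom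
  inv := he'.hom
  hom_inv_id := by
    rw [IsStrict.hom_comp]
    simp only [h]
    exact isStrict_id_hom
  inv_hom_id := by
    rw [IsStrict.hom_comp]
    simp only [h']
    exact isStrict_id_hom

section valued

variable {R : A.Retract}

/-- An exact homomorphism of degree zero with values in the rigid part vanishes, since a primitive
can be chosen in the rigid part, which is zero in degree `-1`. -/
theorem eq_zero_of_mem_homB (hV : V.nabla ∈ R.valued V.V V.V) (hW : W.nabla ∈ R.valued W.V W.V)
    {f : V.V →ₗ[k] A ⊗[k] W.V} (hf : f ∈ homB V W) (hf' : f ∈ R.valued V.V W.V) : f = 0 := by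
  obtain ⟨y, hy, rfl⟩ := hf
  obtain ⟨z, hz, hz'⟩ := exists_reduction R hV hW hy hf'
  have h1 : homD V W (-1 + -1) z ∈ homC A (-1) V.V W.V := by
    have := homD_mem hz
    rwa [show (-1 + -1 + 1 : ℤ) = -1 by norm_num] at this
  have h2 : y - homD V W (-1 + -1) z = 0 := by
    refine LinearMap.ext fun v => ?_
    have h3 := subTensor_inf_left (hz' v) ((sub_mem hy h1).2 v).2
    have h4 : R.B ⊓ A.deg (-1) = ⊥ := eq_bot_iff.2 fun x hx =>
      R.eq_zero (-1) (by norm_num) x (Submodule.mem_inf.1 hx).1 (Submodule.mem_inf.1 hx).2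
    rw [h4] at h3
    refine subTensor_induction (LinearMap.ker LinearMap.id) (fun x hx w _ => ?_) h3
    rw [(mem_bot k).1 hx, zero_tmul]
    exact zero_mem _
  rw [sub_eq_zero.1 h2]
  exact homD_homD (by norm_num) hz

theorem IsStrict.eq_of_hom_eq (ε : A.Augmentation) (hV : V.nabla ∈ R.valued V.V V.V)
    (hW : W.nabla ∈ R.valued W.V W.V) {e e' : V.V →ₗ[k] W.V} (he : IsStrict V W e)
    (he' : IsStrict V W e') (h : he.hom = he'.hom) : e = e' := by
  have h1 : idC A W.V ∘ₗ e - idC A W.V ∘ₗ e' ∈ homB V W := Quotient.exact h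
  have hval : ∀ f : V.V →ₗ[k] W.V, idC A W.V ∘ₗ f ∈ R.valued V.V W.V := fun f v =>
    subTensor_map (P := ⊤) (Q := ⊤) (g := LinearMap.id) (fun x _ => R.unit_mem x)
      (fun _ h => h) (mem_subTensor_top _)
  have h2 := eq_zero_of_mem_homB hV hW h1 (sub_mem (hval e) (hval e'))
  exact LinearMap.ext fun v => idC_injective ε (LinearMap.congr_fun (sub_eq_zero.1 h2) v)

/-- Between connections with values in the rigid part every closed homomorphism of degree zero is
homotopic to a strict one. -/
theorem exists_strict (ε : A.Augmentation) (hV : V.nabla ∈ R.valued V.V V.V)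
    (hW : W.nabla ∈ R.valued W.V W.V) (f : V ⟶ W) :
    ∃ (e : V.V →ₗ[k] W.V) (he : IsStrict V W e), he.hom = f := by
  obtain ⟨⟨t, ht⟩, rfl⟩ := Quotient.exists_rep f
  have ht0 : homD V W 0 t = 0 := LinearMap.mem_ker.1 ht.2
  obtain ⟨y, hy, hy'⟩ := exists_reduction R hV hW ht.1 (by rw [ht0]; exact zero_mem _)
  rw [zero_add] at hy hy'
  have h1 : homD V W (-1) y ∈ homC A 0 V.V W.V := by
    have := homD_mem hy
    rwa [show (-1 + 1 : ℤ) = 0 by norm_num] at this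
  obtain ⟨e, he, hge⟩ := exists_eq_idC_comp R ε (sub_mem ht.1 h1) hy'
  have h2 : homD V W 0 (t - homD V W (-1) y) = 0 := by
    rw [map_sub, ht0, homD_homD (by norm_num) hy, sub_zero]
  rw [homD_zero_apply, hge, dC_idC_comp, star_idC_comp he W.nabla_mem,
    idC_comp_star he V.nabla_mem, zero_add] at h2
  refine ⟨e, ⟨he, LinearMap.congr_fun (sub_eq_zero.1 h2)⟩, Quotient.sound ?_⟩
  change idC A W.V ∘ₗ e - t ∈ homB V W
  rw [← hge, sub_sub_cancel_left]
  exact neg_mem ⟨y, hy, rfl⟩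

/-- A strict homomorphism is compatible with the coactions of the bar complex, which are determined
by the connection forms. -/
theorem IsStrict.barCoaction {ε : A.Augmentation} {ρ : V.V →ₗ[k] BarTot A ⊗[k] V.V}
    {ρ' : W.V →ₗ[k] BarTot A ⊗[k] W.V} (hρ : IsBarCoaction R ε ρ) (hρ' : IsBarCoaction R ε ρ')
    (h0 : zeroPart ρ = V.V.coact) (h0' : zeroPart ρ' = W.V.coact)
    (h1 : letterPart ρ = -V.nabla) (h1' : letterPart ρ' = -W.nabla)
    {e : V.V →ₗ[k] W.V} (he : IsStrict V W e) (v : V.V) :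
    ρ' (e v) = lTensor (BarTot A) e (ρ v) := by
  refine V.fil_induction (eqLocus (ρ' ∘ₗ e) (lTensor (BarTot A) e ∘ₗ ρ))
    (fun v hv => ?_) v
  have h2 : lTensor A (ρ' ∘ₗ e) (V.nabla v) =
      lTensor A (lTensor (BarTot A) e ∘ₗ ρ) (V.nabla v) :=
    map_eq_on_subTensor (fun _ _ => rfl) (fun y hy => hy) hv
  change ρ' (e v) = lTensor (BarTot A) e (ρ v)
  rw [hρ.recursion v, hρ'.recursion (e v), h0, h0', h1, h1', map_add, lTensor_barStep, he.coact,
    LinearMap.neg_apply, LinearMap.neg_apply, he.nabla]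
  simp only [map_neg]
  rw [← lTensor_comp_apply, ← lTensor_comp_apply, h2, rTensor_lTensor]

end valued

/-- Every connection is isomorphic to a connection with values in the rigid part. -/
theorem exists_iso_valued (R : A.Retract) (V : Connection A) :
    ∃ W : Connection A, W.nabla ∈ R.valued W.V W.V ∧ Nonempty (W ≅ V) := by
  obtain ⟨g, hg, b, hb, hg1, hb1, hbR, hbb, hgb⟩ := exists_gauge R V
  let W : Connection A :=
    { V := V.V
      piece := V.piece
      internal := V.internal
      piece_subcomodule := V.piece_subcomodule
      nabla := b
      nabla_mem := hb
      nabla_strict := fun i v hv => by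
        refine subTensor_mono le_rfl (V.fil_le fun j hj => ?_) (hb1 i v (V.piece_le_fil le_rfl hv))
        exact le_iSup (fun j : {j : ℤ // i < j} => V.piece j) ⟨j, by omega⟩
      flat := by
        rw [hbb]
        simp [compC] }
  obtain ⟨y, hy, hgy, hyg⟩ := exists_inverse hg hg1
  have hgZ : g ∈ homZ V W := mem_homZ.2 ⟨hg, hgb⟩
  -- `g * Dy = D(g * y) = 0` because `g` is closed, and `g` is invertible
  have hyZ : y ∈ homZ W V := by
    refine mem_homZ.2 ⟨hy, ?_⟩
    change dC y + star V.nabla y - star y b = 0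
    have hz : dC y + star V.nabla y - star y b ∈ homC A 1 V.V V.V :=
      sub_mem (add_mem (dC_mem_of (by norm_num) hy) (star_mem_of (by norm_num) V.nabla_mem hy))
        (star_mem_of (by norm_num) hy hb)
    have h1 : star g (dC y + star V.nabla y - star y b) = 0 := by
      have h2 := dC_star hg hy
      rw [hgy, dC_idC, Int.negOnePow_zero, Units.val_one, one_smul] at h2
      have h3 := congrArg (fun x => star x y) hgb
      simp only [star_sub_left, star_add_left, star_zero_left] at h3
      rw [star_assoc hb hg hy, hgy, star_idC hb, star_assoc hg V.nabla_mem hy] at h3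
      rw [star_sub_right, star_add_right, ← star_assoc hg hy hb, hgy, idC_star hb]
      linear_combination (norm := abel) -h2 - h3
    have h4 := star_assoc hy hg hz
    rw [hyg, idC_star hz, h1, star_zero_right] at h4
    exact h4
  refine ⟨W, hbR, ⟨⟨Quotient.mk (homotopic W V) ⟨y, hyZ⟩, Quotient.mk (homotopic V W) ⟨g, hgZ⟩,
    ?_, ?_⟩⟩⟩
  · exact congrArg (Quotient.mk (homotopic W W))
      (Subtype.ext ((compC_zero_zero g y).trans hgy))
  · exact congrArg (Quotient.mk (homotopic V V))
      (Subtype.ext ((compC_zero_zero y g).trans hyg))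

end Connection

end Strict

/-! ### The equivalence of categories -/

section Functor

variable {k O : Type u} [Field k] [AddCommGroup O] [Module k O] [Coalgebra k O] {A : RelDGA k O}
  {R : A.Retract} {ε : A.Augmentation}

/-- The connection of a coaction of the bar complex: its connection form is the negative of the
component in `A`, and its pieces split the filtration by socles. -/
def IsBarCoaction.connection (hcr : ∀ (V : FDComod k O) (U : Submodule k V), V.IsSubcomodule U →
    ∃ U' : Submodule k V, V.IsSubcomodule U' ∧ IsCompl U U') {V : FDComod k O}
    {ρ : V →ₗ[k] BarTot A ⊗[k] V} (hρ : IsBarCoaction R ε ρ) (hV : zeroPart ρ = V.coact) :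
    Connection A :=
  have hmem : -letterPart ρ ∈ homC A 1 V V := by
    refine neg_mem ⟨LinearMap.ext fun v => ?_, fun v => ⟨?_, (hρ.letterPart_mem v).2⟩⟩
    · rw [← hV]
      exact hρ.letterPart_coactLeft v
    · rw [← hV]
      exact hρ.letterPart_mem_cotensor v
  have hp := exists_pieces hcr hmem hρ.exists_socle_eq_top
  { V := V
    piece := hp.choose
    internal := hp.choose_spec.1
    piece_subcomodule := hp.choose_spec.2.1
    nabla := -letterPart ρ
    nabla_mem := hmem
    nabla_strict := hp.choose_spec.2.2
    flat := by
      refine LinearMap.ext fun v => ?_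
      have h := hρ.letterPart_maurerCartan v
      have h1 : dC (-letterPart ρ) v = -rTensor V A.d (letterPart ρ v) :=
        map_neg (rTensor V A.d) _
      have h2 : star (-letterPart ρ) (-letterPart ρ) v =
          mulTensor A.m V (lTensor A (letterPart ρ) (letterPart ρ v)) := by
        change mulTensor A.m V (map LinearMap.id (-letterPart ρ)
          (-letterPart ρ v)) = _
        rw [map_neg_right, map_neg, map_neg, map_neg, neg_neg]
        rfl
      have h3 : compC 1 1 (-letterPart ρ) (-letterPart ρ) v =
          -mulTensor A.m V (lTensor A (letterPart ρ) (letterPart ρ v)) := by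
        rw [← h2]
        simp [compC]
      rw [LinearMap.add_apply, h1, h3, ← neg_add, h, neg_zero]
      rfl }

variable {Q : Type u} [AddCommGroup Q] [Module k Q] [Coalgebra k Q] {ι : Q →ₗ[k] BarTot A}

namespace IsCoreEmbedding

/-- The `O`-comodule underlying a comodule over `Q`. -/
abbrev restrict (h : IsCoreEmbedding R ε ι) (M : FDComod k Q) : FDComod k O where
  carrier := M
  coact := zeroPart (rTensor M ι ∘ₗ M.coact)
  isCoaction := (h.isBarCoaction M.isCoaction).zeroPart_isCoaction

variable (hcr : ∀ (V : FDComod k O) (U : Submodule k V), V.IsSubcomodule U →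
    ∃ U' : Submodule k V, V.IsSubcomodule U' ∧ IsCompl U U')

/-- The connection of a comodule over `Q`. -/
def connection (h : IsCoreEmbedding R ε ι) (M : FDComod k Q) : Connection A :=
  IsBarCoaction.connection hcr (V := h.restrict M) (h.isBarCoaction M.isCoaction) rfl

variable {hcr}

theorem connection_valued (h : IsCoreEmbedding R ε ι) (M : FDComod k Q) :
    (h.connection hcr M).nabla ∈ R.valued (h.connection hcr M).V (h.connection hcr M).V :=
  fun v => neg_mem ((h.isBarCoaction M.isCoaction).letterPart_mem v).1

theorem isStrict (h : IsCoreEmbedding R ε ι) {M N : FDComod k Q} (f : FDComod.Hom M N) :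
    Connection.IsStrict (h.connection hcr M) (h.connection hcr N) f.toLin := by
  have hf : ∀ v, N.coact (f.toLin v) = lTensor Q f.toLin (M.coact v) :=
    LinearMap.congr_fun f.colinear
  have key : ∀ {Y : Type u} [AddCommGroup Y] [Module k Y] (P : BarTot A →ₗ[k] Y) (v : M),
      rTensor N P (rTensor N ι (N.coact (f.toLin v))) =
        lTensor Y f.toLin (rTensor M P (rTensor M ι (M.coact v))) := by
    intro Y _ _ P v
    rw [hf, rTensor_lTensor, rTensor_lTensor]
  refine ⟨key (barPrZero A), fun v => ?_⟩
  refine (congrArg Neg.neg (key (barLetter A) v)).trans ?_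
  exact (map_neg (lTensor A f.toLin) _).symm

/-- By the recursion a coaction of the bar complex is determined by the connection, so that a strict
homomorphism is colinear. -/
theorem isStrict_colinear (h : IsCoreEmbedding R ε ι) {M N : FDComod k Q} {e : M →ₗ[k] N}
    (he : Connection.IsStrict (h.connection hcr M) (h.connection hcr N) e) :
    N.coact ∘ₗ e = lTensor Q e ∘ₗ M.coact := by
  refine LinearMap.ext fun v => rTensor_injective h.injective ?_
  have h1 : rTensor N ι (N.coact (e v)) =
      lTensor (BarTot A) e (rTensor M ι (M.coact v)) :=
    he.barCoaction (h.isBarCoaction M.isCoaction) (h.isBarCoaction N.isCoaction) rfl rfl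
      (neg_neg _).symm (neg_neg _).symm v
  change rTensor N ι (N.coact (e v)) =
    rTensor N ι (lTensor Q e (M.coact v))
  rw [h1, rTensor_lTensor]

variable (hcr) in
/-- The functor from comodules to connections. -/
def functor (h : IsCoreEmbedding R ε ι) : CategoryTheory.Functor (FDComod k Q) (Connection A) where
  obj M := h.connection hcr M
  map {_ _} f := (h.isStrict (hcr := hcr) f).hom
  map_id _ := Connection.isStrict_id_hom
  map_comp {_ _ _} f g := (Connection.IsStrict.hom_comp (h.isStrict g) (h.isStrict f)).symm

theorem functor_faithful (h : IsCoreEmbedding R ε ι) : (h.functor hcr).Faithful where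
  map_injective {M N f g} hfg := FDComod.Hom.ext
    (Connection.IsStrict.eq_of_hom_eq ε (h.connection_valued M) (h.connection_valued N)
      (h.isStrict f) (h.isStrict g) hfg)

theorem functor_full (h : IsCoreEmbedding R ε ι) : (h.functor hcr).Full where
  map_surjective {M N} f := by
    obtain ⟨e, he, hf⟩ := Connection.exists_strict ε (h.connection_valued M)
      (h.connection_valued N) f
    exact ⟨⟨e, h.isStrict_colinear he⟩, hf⟩

/-- After a gauge transformation a connection has values in the rigid part, and is then the
connection of a coaction of the bar complex. -/
theorem functor_essSurj (h : IsCoreEmbedding R ε ι) : (h.functor hcr).EssSurj where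
  mem_essImage V := by
    obtain ⟨W, hW, ⟨i⟩⟩ := Connection.exists_iso_valued R V
    obtain ⟨ρ, hρ, h0, h1⟩ := Connection.exists_barCoaction ε hW
    obtain ⟨σ, hσ, hσρ⟩ := h.exists_coaction hρ
    let M : FDComod k Q := { carrier := W.V, coact := σ, isCoaction := hσ }
    have e0 : (h.connection hcr M).V.coact = W.V.coact := by
      rw [← h0, ← hσρ]
      rfl
    have e1 : (h.connection hcr M).nabla = W.nabla := by
      rw [← neg_neg W.nabla, ← h1, ← hσρ]
      rfl
    have id' : ∀ {Y : Type u} [AddCommGroup Y] [Module k Y] (t : Y ⊗[k] W.V),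
        lTensor Y LinearMap.id t = t := fun t =>
      LinearMap.congr_fun (LinearMap.lTensor_id _ _) t
    have s1 : Connection.IsStrict (h.connection hcr M) W LinearMap.id :=
      ⟨fun v => ((id' _).trans (LinearMap.congr_fun e0 v)).symm,
        fun v => ((id' _).trans (LinearMap.congr_fun e1 v)).symm⟩
    have s2 : Connection.IsStrict W (h.connection hcr M) LinearMap.id :=
      ⟨fun v => (LinearMap.congr_fun e0 v).trans (id' _).symm,
        fun v => (LinearMap.congr_fun e1 v).trans (id' _).symm⟩
    exact ⟨M, ⟨(Connection.strictIso s1 s2 rfl rfl).trans i⟩⟩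

theorem nonempty_equivalence (hcr : ∀ (V : FDComod k O) (U : Submodule k V), V.IsSubcomodule U →
    ∃ U' : Submodule k V, V.IsSubcomodule U' ∧ IsCompl U U') (h : IsCoreEmbedding R ε ι) :
    Nonempty (Connection A ≌ FDComod k Q) := by
  have := h.functor_faithful (hcr := hcr)
  have := h.functor_full (hcr := hcr)
  have := h.functor_essSurj (hcr := hcr)
  have : (h.functor hcr).IsEquivalence := {}
  exact ⟨(h.functor hcr).asEquivalence.symm⟩

end IsCoreEmbedding

end Functor

end RelativeDGA

end

theorem mainTheorem10 {k O : Type u} [Field k] [CharZero k] [CommRing O] [HopfAlgebra k O]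
    [Algebra.FiniteType k O] (hred : RelativeDGA.IsReductive k O) (hsplit : RelativeDGA.IsSplit k O)
    (A : RelativeDGA.RelDGA k O) (ε : A.Augmentation)
    (hrig : ∃ (R : RelativeDGA.RelDGA k O) (j : RelativeDGA.RelDGA.Hom R A),
      Function.Injective j.toLin ∧ R.IsRigid ∧ j.IsQuasiIso) :
    ∃ C : Coalgebra k (RelativeDGA.barH0 A ε), RelativeDGA.IsInducedCoalgebra A ε C ∧
      Nonempty (RelativeDGA.Connection A ≌ RelativeDGA.FDComod k (RelativeDGA.barH0 A ε)) := by
  obtain ⟨S, j, hj, hS, hq⟩ := hrig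
  obtain ⟨β, hβ⟩ := RelativeDGA.exists_coseparating hred
  obtain ⟨R⟩ := RelativeDGA.RelDGA.exists_retract hβ j hj hS hq
  obtain ⟨C, ι, hC, hι, hrange, hcomul, hcounit⟩ := R.exists_coalgebra (ε := ε)
  exact ⟨C, hC, RelativeDGA.IsCoreEmbedding.nonempty_equivalence hred ⟨hι, hrange, hcomul, hcounit⟩⟩
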